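/- Let $(Y_i)_{i\in\mathbb Z}$ be a strictly stationary sequence of real random variables on a probability space $(\Omega,\mathcal A,\mathbb P)$ which also carries a sequence $(\delta_i)_{i\in\mathbb Z}$ of independent random variables, uniform on $[0,1]$, independent of $(Y_i)_{i\in\mathbb Z}$. Let $\mathcal F_i=\sigma((Y_k,\delta_k):k\le i)$, and write $X^{(0)}=X-\mathbb E(X)$. For a nonnegative random variable $X$ let $Q_X(u)=\inf\{t\ge 0:\mathbb P(X>t)\le u\}$, $u\in[0,1]$; a quantile function is a function of this form. Let $Q$ be a quantile function that is integrable over $(0,1)$. For a probability measure $\mu$ on $\mathbb R$ and $X$ with law $\mu$, let $\widetilde{\mathrm{Mon}}(Q,\mu)$ be the set of functions $g:\mathbb R\to\mathbb R$ which are monotonic on some open interval and null elsewhere and satisfy $Q_{|g(X)|}\le Q$. Let $\widetilde{\mathcal F}(Q,\mu)$ be the closure in $\mathbb L^1(\mu)$ of the set of finite sums $\sum_{\ell=1}^L a_\ell f_\ell$ with $\sum_{\ell}|a_\ell|\le 1$ and $f_\ell\in\widetilde{\mathrm{Mon}}(Q,\mu)$. Let $\alpha(0)=1$ and, for $n\ge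 1$, $$\alpha(n)=\max_{l\in\{1,2\}}\ \sup_{n\le i_1\le\dots\le i_l}\ \sup_{x\in\mathbb R^l}\Big\|\mathbb E\Big(\prod_{j=1}^l(\mathbf 1_{Y_{i_j}\le x_j})^{(0)}\,\Big|\,\mathcal F_0\Big)^{(0)}\Big\|_1 .$$ Put $\alpha^{-1}(u)=\min\{q\in\mathbb N:\alpha(q)\le u\}$ (with $\min\emptyset=\infty$ and $0\cdot\infty=0$), $R(u)=\alpha^{-1}(u)\,(Q(u)\vee 1)$, and $$M_{2,\alpha}(Q)=\int_0^1R(u)Q(u)\,du,\qquad M_{3,\alpha}(Q,\lambda)=\int_0^1Q(u)R(u)(R(u)\wedge\lambda)\,du .$$ Let $f\in\widetilde{\mathcal F}(Q,P_{Y_0})$, where $P_{Y_0}$ is the law of $Y_0$, let $X_i=f(Y_i)-\mathbb E(f(Y_i))$ and $S_n=X_1+\dots+X_n$, and assume $M_{2,\alpha}(Q)<\infty$. Then the products $X_0X_k$, $k\ge 0$, are integrable and the series $\mathbb E(X_0^2)+2\sum_{k\ge1}\mathbb E(X_0X_k)$ converges to some nonnegative real $\sigma^2$. If $\sigma^2>0$,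 there is a positive constant $C$, depending only on $\sigma^2$, such that for every integer $n>0$ $$\mathbb E\big(W_2^2(P_{S_n|\mathcal F_0},G_{n\sigma^2})\big)\le C\,n^{1/2}\,M_{3,\alpha}(Q,n^{1/2}).$$ Here $P_{S_n|\mathcal F_0}$ is the (regular) conditional law of $S_n$ given $\mathcal F_0$, $G_{n\sigma^2}$ is the normal law $N(0,n\sigma^2)$, and $W_2$ is the Wasserstein distance of order 2 on $\mathbb R$: $W_2^2(\mu,\nu)=\int_0^1(F_\mu^{-1}(u)-F_\nu^{-1}(u))^2du$, with $F_\mu^{-1}(u)=\inf\{x:F_\mu(x)\ge u\}$ for the distribution function $F_\mu$ of $\mu$. -/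

import Mathlib

open MeasureTheory ProbabilityTheory Filter Topology Set
open scoped ENNReal NNReal

noncomputable section

namespace WeakDep

/-- The upper tail quantile function `Q_X(u) = inf {t ≥ 0 : P (X > t) ≤ u}` of a nonnegative
random variable `X`, with `inf ∅ = ∞` (this can only occur at `u = 0`). -/
def upperQuantile {Ω : Type*} {mΩ : MeasurableSpace Ω} (P : Measure Ω) (X : Ω → ℝ) (u : ℝ) :
    ℝ≥0∞ :=
  ⨅ (t : ℝ≥0) (_ : P {ω | (t : ℝ) < X ω} ≤ ENNReal.ofReal u), (t : ℝ≥0∞)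

/-- `Q` is (on `[0,1]`) the upper tail quantile function of some nonnegative random variable, with
law `ν`, and it is integrable over `(0,1)`. -/
def IsIntegrableQuantile (Q : ℝ → ℝ≥0∞) : Prop :=
  (∃ ν : Measure ℝ, IsProbabilityMeasure ν ∧ ν (Iio 0) = 0 ∧
    ∀ u ∈ Icc (0 : ℝ) 1, Q u = upperQuantile ν id u) ∧
  ∫⁻ u in Ioo (0 : ℝ) 1, Q u < ∞

/-- Functions `g : ℝ → ℝ` monotonic (in either direction) on an open interval and null elsewhere,
with `Q_{|g(X)|} ≤ Q` for `X` of law `μ`. -/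
def MonClass (Q : ℝ → ℝ≥0∞) (μ : Measure ℝ) : Set (ℝ → ℝ) :=
  {g | (∃ I : Set ℝ, IsOpen I ∧ I.OrdConnected ∧ (MonotoneOn g I ∨ AntitoneOn g I) ∧
      ∀ x ∉ I, g x = 0) ∧
    ∀ u ∈ Icc (0 : ℝ) 1, upperQuantile μ (fun x => |g x|) u ≤ Q u}

/-- Finite sums `∑ a_ℓ f_ℓ` with `∑ |a_ℓ| ≤ 1` and all `f_ℓ` in `MonClass Q μ`. -/
def MonCombinations (Q : ℝ → ℝ≥0∞) (μ : Measure ℝ) : Set (ℝ → ℝ) :=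
  {h | ∃ (L : ℕ) (a : Fin L → ℝ) (g : Fin L → ℝ → ℝ),
    ∑ l, |a l| ≤ 1 ∧ (∀ l, g l ∈ MonClass Q μ) ∧ h = fun x => ∑ l, a l * g l x}

/-- The closure of `MonCombinations Q μ` in `L¹(μ)`. -/
def FClass (Q : ℝ → ℝ≥0∞) (μ : Measure ℝ) : Set (ℝ → ℝ) :=
  {f | Integrable f μ ∧
    ∀ ε : ℝ≥0∞, 0 < ε → ∃ h ∈ MonCombinations Q μ, ∫⁻ x, ‖f x - h x‖ₑ ∂μ < ε}

section Dependence

variable {Ω : Type*} {mΩ : MeasurableSpace Ω}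

/-- `X⁽⁰⁾ = X - E(X)`. -/
def centered (P : Measure Ω) (X : Ω → ℝ) (ω : Ω) : ℝ := X ω - ∫ ω', X ω' ∂P

/-- The coefficient
`α(F, (Y₁, …, Y_k)) = sup_x ‖ (E (∏ⱼ (1_{Yⱼ ≤ xⱼ})⁽⁰⁾ | F))⁽⁰⁾ ‖₁`. -/
def alphaCoef (P : Measure Ω) (F : MeasurableSpace Ω) {k : ℕ} (Y : Fin k → Ω → ℝ) : ℝ≥0∞ :=
  ⨆ x : Fin k → ℝ, eLpNorm (centered P (condExp F P (fun ω =>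
    ∏ j, centered P ({ω' | Y j ω' ≤ x j}.indicator fun _ => (1 : ℝ)) ω))) 1 P

/-- `F_i = σ ((Y_k, δ_k) : k ≤ i)`. -/
@[reducible] def past (Y δ : ℤ → Ω → ℝ) (i : ℤ) : MeasurableSpace Ω :=
  ⨆ k ∈ Iic i, MeasurableSpace.comap (fun ω => (Y k ω, δ k ω)) inferInstance

/-- The dependence coefficients `α_{k,Y}(n)` of the sequence `Y`, relative to `F_0`:
`α_{k,Y}(0) = 1` and, for `n > 0`, the maximum over `1 ≤ l ≤ k` of the supremum over
`n ≤ i₁ ≤ … ≤ i_l` of `α(F_0, (Y_{i₁}, …, Y_{i_l}))`. -/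
def alphaSeq (P : Measure Ω) (Y δ : ℤ → Ω → ℝ) (k n : ℕ) : ℝ≥0∞ :=
  if n = 0 then 1 else
    ⨆ (l : ℕ) (_ : 1 ≤ l ∧ l ≤ k) (i : Fin l → ℤ) (_ : Monotone i ∧ ∀ j, (n : ℤ) ≤ i j),
      alphaCoef P (past Y δ 0) (fun j => Y (i j))

/-- `α_{2,Y}⁻¹(u) = min {q ∈ ℕ : α_{2,Y}(q) ≤ u}`, with `min ∅ = ∞`. -/
def alphaInv (P : Measure Ω) (Y δ : ℤ → Ω → ℝ) (u : ℝ) : ℝ≥0∞ :=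
  ⨅ (q : ℕ) (_ : alphaSeq P Y δ 2 q ≤ ENNReal.ofReal u), (q : ℝ≥0∞)

/-- `R(u) = α_{2,Y}⁻¹(u) (Q(u) ∨ 1)`. -/
def Rfun (P : Measure Ω) (Y δ : ℤ → Ω → ℝ) (Q : ℝ → ℝ≥0∞) (u : ℝ) : ℝ≥0∞ :=
  alphaInv P Y δ u * max (Q u) 1

/-- `M_{p,α}(Q) = ∫₀¹ R(u)^{p-1} Q(u) du`. -/
def Mmoment (P : Measure Ω) (Y δ : ℤ → Ω → ℝ) (Q : ℝ → ℝ≥0∞) (p : ℝ) : ℝ≥0∞ :=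
  ∫⁻ u in Ioo (0 : ℝ) 1, Rfun P Y δ Q u ^ (p - 1) * Q u

/-- `M_{3,α}(Q, lam) = ∫₀¹ Q(u) R(u) (R(u) ∧ lam) du`. -/
def Mtrunc (P : Measure Ω) (Y δ : ℤ → Ω → ℝ) (Q : ℝ → ℝ≥0∞) (lam : ℝ) : ℝ≥0∞ :=
  ∫⁻ u in Ioo (0 : ℝ) 1, Q u * Rfun P Y δ Q u * min (Rfun P Y δ Q u) (ENNReal.ofReal lam)

/-- `Y` is a strictly stationary sequence of real random variables on `(Ω, P)`, and `δ` is a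
sequence of independent uniform variables on `[0,1]` that is independent of `Y`. -/
structure StationarySetup (P : Measure Ω) (Y δ : ℤ → Ω → ℝ) : Prop where
  measurable_Y : ∀ i, Measurable (Y i)
  measurable_δ : ∀ i, Measurable (δ i)
  stationary : ∀ k : ℤ, P.map (fun ω (i : ℤ) => Y (i + k) ω) = P.map (fun ω (i : ℤ) => Y i ω)
  indep_δ : iIndepFun δ P
  uniform_δ : ∀ i, P.map (δ i) = volume.restrict (Icc (0 : ℝ) 1)
  indep_Y_δ : IndepFun (fun ω (i : ℤ) => Y i ω) (fun ω (i : ℤ) => δ i ω) P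

/-- `X_i = f(Y_i) - E(f(Y_i))`. -/
def Xseq (P : Measure Ω) (Y : ℤ → Ω → ℝ) (f : ℝ → ℝ) (i : ℤ) : Ω → ℝ :=
  centered P (fun ω => f (Y i ω))

/-- `S_n = X_1 + ⋯ + X_n`. -/
def partialSum (P : Measure Ω) (Y : ℤ → Ω → ℝ) (f : ℝ → ℝ) (n : ℕ) (ω : Ω) : ℝ :=
  ∑ i ∈ Finset.Icc 1 n, Xseq P Y f (i : ℤ) ω

/-- The partial sums of the series `E(X_0²) + 2 ∑_{k ≥ 1} E(X_0 X_k)`. -/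
def covPartialSum (P : Measure Ω) (Y : ℤ → Ω → ℝ) (f : ℝ → ℝ) (N : ℕ) : ℝ :=
  ∫ ω, Xseq P Y f 0 ω ^ 2 ∂P
    + 2 * ∑ k ∈ Finset.Icc 1 N, ∫ ω, Xseq P Y f 0 ω * Xseq P Y f (k : ℤ) ω ∂P

/-- A regular version of the conditional law `P_{U | F}`: the conditional distribution of `U` given
the identity map from `Ω` to `(Ω, F)`. -/
def condLaw (P : Measure Ω) [IsFiniteMeasure P] (F : MeasurableSpace Ω) (U : Ω → ℝ) (ω : Ω) :
    Measure ℝ :=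
  @condDistrib Ω Ω ℝ _ _ _ mΩ F U id P _ ω

end Dependence

/-- The quantile function `F⁻¹(u) = inf {x : u ≤ F(x)}` of a probability measure on `ℝ` with
distribution function `F`. -/
def quantileFun (μ : Measure ℝ) (u : ℝ) : ℝ := sInf {x : ℝ | u ≤ cdf μ x}

/-- The squared Wasserstein distance of order 2 between probability measures on `ℝ`:
`W₂²(μ, ν) = ∫₀¹ (F_μ⁻¹(u) - F_ν⁻¹(u))² du`. -/
def W2sq (μ ν : Measure ℝ) : ℝ≥0∞ :=
  ∫⁻ u in Ioo (0 : ℝ) 1, ENNReal.ofReal ((quantileFun μ u - quantileFun ν u) ^ 2)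

end WeakDep

end

open MeasureTheory ProbabilityTheory Filter Topology Set
open scoped ENNReal NNReal

noncomputable section

namespace WeakDep

/-! ### Optimal transport on the line -/

/-! On the line the quadratic cost is governed by stop-loss transforms: `W2sq_le_stopLoss` bounds
W₂²(μ, ν) by eight times the L¹ distance between x ↦ ∫ (t - x)⁺ dμ(t) and x ↦ ∫ (t - x)⁺ dν(t). For
laws with equal means and finite second moments, `integral_prim_prim_sub` identifies this distance
with ∫ f dμ - ∫ f dν for a single f, the second antiderivative of the sign ε of the difference.
Given F₀, the sign ε depends measurably on the past. The expected conditional cost is thus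
controlled by the error made by one random test function with |f''| ≤ 1 and F₀-measurable
randomness, and no supremum over test functions is ever taken under a conditional expectation.

Since f'' is merely bounded, an independent Gaussian of variance s = σ² is first added to the sum,
at a cost of order σ². The Lindeberg method then trades summands for Gaussian steps one at a time.
At step k the test function has been smoothed with variance (n - k)s, so its second derivative is
Lipschitz with constant ((n - k)s)^(-1/2) (`isTest_smooth`). These constants add up to at most
2(n/s)^(1/2), which is the source of the factor n^(1/2). In `lindeberg_step` the first order term
f'(S_k) X_{k+1} is telescoped along the past; with the second order term it produces E f''(S_k)
times half the covariance series, which cancels against the Gaussian step. What is left is a double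
sum over lags i, j of third partial moments ∫ Q³ up to α(max(i, j)), some terms from long lags and
early times, and the conditional mean of S_n, which is not zero and is estimated in L¹ and L².

The dependence coefficients speak only of half-lines. Layer-cake decompositions carry them to
bounded monotonic pieces (`abs_integral_monComb_le`), and splitting at a level q carries them to
larger observables. Taking for q the value of Q at α(p) turns every bound into a partial moment up
to α(p) (`Model.level`).

The sums over lags are finally compared with the truncated moment. `exists_isThreshold` finds the
probability v at which R crosses n^(1/2), with a lag m + 1 and a level M satisfying (m + 1)M ≤
n^(1/2). The observable is truncated at M, and lags beyond m are treated by sup-norm bounds.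
Exchanging the sum over lags with the integral in u, the number of lags whose coefficient exceeds u
is at most α⁻¹(u). The double sum is therefore at most ∫ Q R (R ∧ n^(1/2)), while the truncation
errors live on {u < v}, where R ∧ n^(1/2) = n^(1/2). Terms of order σ² are absorbed through σ² ≤ 96
M₃ (`StationarySetup.limitVariance_le`), which makes the constant depend on σ² alone. -/

lemma two_mul_volume_lt_prod (A : Set ℝ) (hA : MeasurableSet A) :
    2 * (volume.prod volume) {p : ℝ × ℝ | p.1 ∈ A ∧ p.2 ∈ A ∧ p.2 < p.1} = volume A ^ 2 := by
  set U := {p : ℝ × ℝ | p.1 ∈ A ∧ p.2 ∈ A ∧ p.2 < p.1}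
  set V := {p : ℝ × ℝ | p.1 ∈ A ∧ p.2 ∈ A ∧ p.1 < p.2}
  set D := {p : ℝ × ℝ | p.1 = p.2}
  have hU : MeasurableSet U :=
    (measurable_fst hA).inter ((measurable_snd hA).inter
      (measurableSet_lt measurable_snd measurable_fst))
  have hV : MeasurableSet V :=
    (measurable_fst hA).inter ((measurable_snd hA).inter
      (measurableSet_lt measurable_fst measurable_snd))
  have hUV : (volume.prod volume) V = (volume.prod volume) U := by
    rw [Measure.prod_apply_symm hV, Measure.prod_apply hU]
    refine lintegral_congr fun x => ?_
    congr 1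
    ext y; simp [U, V]; tauto
  have hD : (volume.prod volume) D = 0 := by
    rw [Measure.prod_apply (measurableSet_eq_fun measurable_fst measurable_snd)]
    have : ∀ x : ℝ, Prod.mk x ⁻¹' D = {x} := by
      intro x; ext y; simp [D, eq_comm]
    simp
  have hsub : A ×ˢ A ⊆ (U ∪ V) ∪ D := by
    rintro ⟨x, y⟩ ⟨hx, hy⟩
    rcases lt_trichotomy x y with h | h | h
    · exact Or.inl (Or.inr ⟨hx, hy, h⟩)
    · exact Or.inr h
    · exact Or.inl (Or.inl ⟨hx, hy, h⟩)
  have hdisj : Disjoint U V := by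
    rw [Set.disjoint_left]
    rintro ⟨x, y⟩ ⟨_, _, h⟩ ⟨_, _, h'⟩
    exact absurd h (not_lt.2 h'.le)
  have h2 : (volume.prod volume) (U ∪ V) = 2 * (volume.prod volume) U := by
    rw [measure_union hdisj hV, hUV, two_mul]
  have h3 : (volume.prod volume) (A ×ˢ A) = volume A ^ 2 := by
    rw [Measure.prod_prod, sq]
  rw [← h2, ← h3]
  apply le_antisymm
  · apply measure_mono
    rintro ⟨x, y⟩ (⟨hx, hy, _⟩ | ⟨hx, hy, _⟩) <;> exact ⟨hx, hy⟩
  · calc _ ≤ _ := measure_mono hsub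
      _ ≤ _ := measure_union_le _ _
      _ = _ := by rw [hD, add_zero]

/-- A squared length is twice the area of the ordered pairs s < t inside the set. Such a pair lies
in the interval [a, b) exactly when a ≤ s and t < b, so Tonelli turns the cost into an integral of
crossing probabilities. -/
lemma lintegral_volume_Ico_inter_sq {T : Type*} [MeasurableSpace T] (π : Measure T) [SFinite π]
    {a b : T → ℝ} (ha : Measurable a) (hb : Measurable b) {E : Set ℝ} (hE : MeasurableSet E) :
    ∫⁻ x, volume (Ico (a x) (b x) ∩ E) ^ 2 ∂π =
      2 * ∫⁻ p in {p : ℝ × ℝ | p.1 ∈ E ∧ p.2 ∈ E ∧ p.2 < p.1},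
        π {x | a x ≤ p.2 ∧ p.1 < b x} ∂(volume.prod volume) := by
  set U := {p : ℝ × ℝ | p.1 ∈ E ∧ p.2 ∈ E ∧ p.2 < p.1}
  have hU : MeasurableSet U :=
    (measurable_fst hE).inter ((measurable_snd hE).inter
      (measurableSet_lt measurable_snd measurable_fst))
  set W := {q : T × (ℝ × ℝ) | q.2 ∈ U ∧ a q.1 ≤ q.2.2 ∧ q.2.1 < b q.1}
  have hW : MeasurableSet W := by
    change MeasurableSet (Prod.snd ⁻¹' U ∩
      ({q : T × (ℝ × ℝ) | a q.1 ≤ q.2.2} ∩ {q : T × (ℝ × ℝ) | q.2.1 < b q.1}))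
    exact (measurable_snd hU).inter ((measurableSet_le (by fun_prop) (by fun_prop)).inter
      (measurableSet_lt (by fun_prop) (by fun_prop)))
  have e1 : ∀ x, volume (Ico (a x) (b x) ∩ E) ^ 2 =
      2 * (volume.prod volume) (Prod.mk x ⁻¹' W) := by
    intro x
    rw [← two_mul_volume_lt_prod _ (measurableSet_Ico.inter hE)]
    congr 2
    ext ⟨t, s⟩
    simp only [mem_inter_iff, mem_Ico, mem_ofPred_eq, mem_preimage, W, U]
    constructor
    · rintro ⟨⟨⟨h1, h2⟩, h3⟩, ⟨⟨h4, h5⟩, h6⟩, h7⟩; exact ⟨⟨h3, h6, h7⟩, h4, h2⟩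
    · rintro ⟨⟨h3, h6, h7⟩, h4, h2⟩
      exact ⟨⟨⟨h4.trans h7.le, h2⟩, h3⟩, ⟨⟨h4, h7.trans h2⟩, h6⟩, h7⟩
  simp_rw [e1]
  rw [lintegral_const_mul _ (measurable_measure_prodMk_left hW), ← Measure.prod_apply hW,
    Measure.prod_apply_symm hW, ← lintegral_indicator hU]
  congr 1
  refine lintegral_congr fun p => ?_
  by_cases hp : p ∈ U
  · rw [indicator_of_mem hp]; congr 1; ext x; simp [W, hp]
  · rw [indicator_of_notMem hp]
    convert measure_empty (μ := π)
    ext x; simp [W, hp]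

lemma ofReal_sq_eq_volume_Ico_add (l r : ℝ) :
    ENNReal.ofReal ((l - r) ^ 2) = volume (Ico l r ∩ univ) ^ 2 + volume (Ico r l ∩ univ) ^ 2 := by
  simp only [inter_univ, Real.volume_Ico]
  rcases le_total l r with h | h
  · rw [ENNReal.ofReal_of_nonpos (p := l - r) (by linarith),
      ← ENNReal.ofReal_pow (by linarith)]
    simp only [ne_eq, OfNat.ofNat_ne_zero, not_false_eq_true, zero_pow, add_zero]
    congr 1; ring
  · rw [ENNReal.ofReal_of_nonpos (p := r - l) (by linarith),
      ← ENNReal.ofReal_pow (by linarith)]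
    simp

/-- The Galois connection between quantile and distribution function. Right continuity gives the
forward direction; the restriction to 0 < u < 1 makes the defining set nonempty and bounded below,
so that `sInf` is a genuine infimum. -/
lemma quantileFun_le_iff (μ : Measure ℝ) {u : ℝ} (hu : u ∈ Ioo (0 : ℝ) 1) (x : ℝ) :
    quantileFun μ u ≤ x ↔ u ≤ cdf μ x := by
  have hne : {x : ℝ | u ≤ cdf μ x}.Nonempty := by
    obtain ⟨x, hx⟩ := ((tendsto_cdf_atTop μ).eventually (lt_mem_nhds hu.2)).exists
    exact ⟨x, le_of_lt hx⟩
  have hbdd : BddBelow {x : ℝ | u ≤ cdf μ x} := by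
    obtain ⟨x, hx⟩ := ((tendsto_cdf_atBot μ).eventually (gt_mem_nhds hu.1)).exists
    refine ⟨x, fun y hy => ?_⟩
    by_contra h
    exact absurd (lt_of_le_of_lt (le_trans hy (monotone_cdf μ (not_le.1 h).le)) hx) (lt_irrefl _)
  constructor
  · intro h
    have hr : Tendsto (cdf μ) (𝓝[>] x) (𝓝 (cdf μ x)) :=
      ((cdf μ).right_continuous x).mono_left (nhdsWithin_mono _ Ioi_subset_Ici_self)
    refine ge_of_tendsto hr ?_
    filter_upwards [self_mem_nhdsWithin] with y hy
    obtain ⟨z, hz, hzy⟩ := exists_lt_of_csInf_lt hne (lt_of_le_of_lt h hy)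
    exact le_trans hz (monotone_cdf μ hzy.le)
  · intro h
    exact csInf_le hbdd h

/-- Outside (0,1) the infimum may be a default value, so measurability is stated for a modification
that agrees with the quantile function where it matters. -/
lemma measurable_quantileFun_restrict (μ : Measure ℝ) :
    ∃ l : ℝ → ℝ, Measurable l ∧ ∀ u ∈ Ioo (0 : ℝ) 1, quantileFun μ u = l u := by
  refine ⟨(Ioo (0 : ℝ) 1).indicator (quantileFun μ), ?_, fun u hu => by simp [hu]⟩
  refine measurable_of_Iic fun x => ?_
  have : (Ioo (0 : ℝ) 1).indicator (quantileFun μ) ⁻¹' Iic x =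
      (Ioo (0 : ℝ) 1 ∩ Iic (cdf μ x)) ∪ ((Ioo (0 : ℝ) 1)ᶜ ∩ {_u | (0 : ℝ) ≤ x}) := by
    ext u
    by_cases hu : u ∈ Ioo (0 : ℝ) 1
    · have := quantileFun_le_iff μ hu x
      simp only [mem_preimage, indicator_of_mem hu, mem_Iic, this, mem_union, mem_inter_iff, hu,
        true_and, mem_compl_iff, not_true, false_and, or_false]
    · simp only [mem_preimage, indicator_of_notMem hu, mem_Iic, mem_union, mem_inter_iff, hu,
        false_and, mem_compl_iff, not_false_eq_true, true_and, false_or, mem_ofPred_eq]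
  rw [this]
  exact (measurableSet_Ioo.inter measurableSet_Iic).union
    (measurableSet_Ioo.compl.inter (MeasurableSet.const _))

/-- By the Galois connection the relevant u are those with G(t) < u ≤ F(s). The quantile coupling
thus attains the least crossing probability any coupling can have. -/
lemma volume_quantile_cross (μ ν : Measure ℝ) (s t : ℝ) :
    (volume.restrict (Ioo (0 : ℝ) 1)) {u | quantileFun μ u ≤ s ∧ t < quantileFun ν u} =
      ENNReal.ofReal (cdf μ s - cdf ν t) := by
  have h1 := cdf_le_one μ s
  have h0 := cdf_nonneg ν t
  rw [Measure.restrict_apply' measurableSet_Ioo]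
  have : {u | quantileFun μ u ≤ s ∧ t < quantileFun ν u} ∩ Ioo 0 1
      = Ioc (cdf ν t) (cdf μ s) ∩ Ioo 0 1 := by
    ext u
    constructor
    · rintro ⟨⟨h, h'⟩, hu⟩
      refine ⟨⟨?_, (quantileFun_le_iff μ hu s).1 h⟩, hu⟩
      by_contra hc
      exact absurd ((quantileFun_le_iff ν hu t).2 (not_lt.1 hc)) (not_le.2 h')
    · rintro ⟨⟨h, h'⟩, hu⟩
      refine ⟨⟨(quantileFun_le_iff μ hu s).2 h', ?_⟩, hu⟩
      by_contra hc
      exact absurd ((quantileFun_le_iff ν hu t).1 (not_lt.1 hc)) (not_le.2 h)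
  rw [this]
  apply le_antisymm
  · refine (measure_mono inter_subset_left).trans ?_
    rw [Real.volume_Ioc]
  · have : Ioo (cdf ν t) (cdf μ s) ⊆ Ioc (cdf ν t) (cdf μ s) ∩ Ioo 0 1 := fun u hu =>
      ⟨⟨hu.1, hu.2.le⟩, lt_of_le_of_lt h0 hu.1, lt_of_lt_of_le hu.2 h1⟩
    calc _ = volume (Ioo (cdf ν t) (cdf μ s)) := by rw [Real.volume_Ioo]
      _ ≤ _ := measure_mono this

/-- One half of the quadratic cost of the quantile coupling, restricted to a set of heights. -/
lemma lintegral_volume_quantile_Ico (μ ν : Measure ℝ) {E : Set ℝ} (hE : MeasurableSet E) :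
    ∫⁻ u in Ioo (0 : ℝ) 1, volume (Ico (quantileFun μ u) (quantileFun ν u) ∩ E) ^ 2 =
      2 * ∫⁻ p in {p : ℝ × ℝ | p.1 ∈ E ∧ p.2 ∈ E ∧ p.2 < p.1},
        ENNReal.ofReal (cdf μ p.2 - cdf ν p.1) ∂(volume.prod volume) := by
  obtain ⟨l, hl, hl'⟩ := measurable_quantileFun_restrict μ
  obtain ⟨r, hr, hr'⟩ := measurable_quantileFun_restrict ν
  have := lintegral_volume_Ico_inter_sq (volume.restrict (Ioo (0 : ℝ) 1)) hl hr hE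
  calc _ = ∫⁻ u in Ioo (0 : ℝ) 1, volume (Ico (l u) (r u) ∩ E) ^ 2 :=
        setLIntegral_congr_fun measurableSet_Ioo fun u hu => by simp only [hl' u hu, hr' u hu]
    _ = _ := this
    _ = _ := by
      congr 1
      refine lintegral_congr fun p => ?_
      rw [← volume_quantile_cross]
      rw [Measure.restrict_apply' measurableSet_Ioo, Measure.restrict_apply' measurableSet_Ioo]
      congr 1
      ext u
      simp only [mem_inter_iff, mem_ofPred_eq, and_congr_left_iff]
      intro hu
      rw [hl' u hu, hr' u hu]

lemma measurable_volume_quantile_Ico (μ ν : Measure ℝ) {E : Set ℝ} (hE : MeasurableSet E) :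
    AEMeasurable (fun u => volume (Ico (quantileFun μ u) (quantileFun ν u) ∩ E) ^ 2)
      (volume.restrict (Ioo (0 : ℝ) 1)) := by
  obtain ⟨l, hl, hl'⟩ := measurable_quantileFun_restrict μ
  obtain ⟨r, hr, hr'⟩ := measurable_quantileFun_restrict ν
  refine ⟨fun u => volume (Ico (l u) (r u) ∩ E) ^ 2, ?_, ?_⟩
  · have : MeasurableSet {q : ℝ × ℝ | q.2 ∈ Ico (l q.1) (r q.1) ∩ E} := by
      change MeasurableSet (({q : ℝ × ℝ | l q.1 ≤ q.2} ∩ {q : ℝ × ℝ | q.2 < r q.1}) ∩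
        Prod.snd ⁻¹' E)
      exact ((measurableSet_le (by fun_prop) (by fun_prop)).inter
        (measurableSet_lt (by fun_prop) (by fun_prop))).inter (measurable_snd hE)
    exact (measurable_measure_prodMk_left this).pow_const 2
  · filter_upwards [ae_restrict_mem measurableSet_Ioo] with u hu
    simp only [hl' u hu, hr' u hu]

lemma W2sq_eq_add (μ ν : Measure ℝ) :
    W2sq μ ν =
      (∫⁻ u in Ioo (0 : ℝ) 1, volume (Ico (quantileFun μ u) (quantileFun ν u) ∩ univ) ^ 2) +
      ∫⁻ u in Ioo (0 : ℝ) 1, volume (Ico (quantileFun ν u) (quantileFun μ u) ∩ univ) ^ 2 := by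
  rw [W2sq, ← lintegral_add_left' (measurable_volume_quantile_Ico _ _ MeasurableSet.univ)]
  exact lintegral_congr fun u => ofReal_sq_eq_volume_Ico_add _ _

/-- The quantile coupling is optimal for the quadratic cost. -/
lemma W2sq_map_le {T : Type*} [MeasurableSpace T] (π : Measure T) [IsProbabilityMeasure π]
    {A B : T → ℝ} (hA : Measurable A) (hB : Measurable B) :
    W2sq (π.map A) (π.map B) ≤ ∫⁻ x, ENNReal.ofReal ((A x - B x) ^ 2) ∂π := by
  have key : ∀ A B : T → ℝ, Measurable A → Measurable B →
      ∫⁻ u in Ioo (0 : ℝ) 1,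
        volume (Ico (quantileFun (π.map A) u) (quantileFun (π.map B) u) ∩ univ) ^ 2 ≤
      ∫⁻ x, volume (Ico (A x) (B x) ∩ univ) ^ 2 ∂π := by
    intro A B hA hB
    have := Measure.isProbabilityMeasure_map (μ := π) hA.aemeasurable
    have := Measure.isProbabilityMeasure_map (μ := π) hB.aemeasurable
    rw [lintegral_volume_quantile_Ico _ _ MeasurableSet.univ,
      lintegral_volume_Ico_inter_sq π hA hB MeasurableSet.univ]
    gcongr with p
    rw [cdf_eq_real, cdf_eq_real, map_measureReal_apply hA measurableSet_Iic,
      map_measureReal_apply hB measurableSet_Iic]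
    apply ENNReal.ofReal_le_of_le_toReal
    -- For any coupling, P(A ≤ s) - P(B ≤ t) ≤ P(A ≤ s, t < B). The quantile coupling attains the
    -- positive part of the left side, so optimality holds pair by pair.
    have h1 : A ⁻¹' Iic p.2 ⊆ (B ⁻¹' Iic p.1) ∪ {x | A x ≤ p.2 ∧ p.1 < B x} := by
      intro x hx
      by_cases h : B x ≤ p.1
      · exact Or.inl h
      · exact Or.inr ⟨hx, not_le.1 h⟩
    have h2 := (measureReal_mono (μ := π) h1).trans (measureReal_union_le _ _)
    change _ ≤ π.real _
    linarith
  have hm : Measurable fun x => volume (Ico (A x) (B x) ∩ univ) ^ 2 := by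
    simp only [inter_univ, Real.volume_Ico]; fun_prop
  rw [W2sq_eq_add]
  refine (add_le_add (key A B hA hB) (key B A hB hA)).trans ?_
  rw [← lintegral_add_left hm]
  exact (lintegral_congr fun x => (ofReal_sq_eq_volume_Ico_add _ _).symm).le

lemma ennreal_add_sq_le (a b : ℝ≥0∞) : (a + b) ^ 2 ≤ 2 * (a ^ 2 + b ^ 2) := by
  have := ENNReal.rpow_add_le_mul_rpow_add_rpow a b (p := 2) (by norm_num)
  norm_num at this
  exact this

/-- If `H` is a primitive of `F - G` with `F`, `G` nondecreasing, the horizontal excess of `F` over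
`G(t)` to the left of `t` inside `{H ≥ 0}` is at most `H(t)`. -/
lemma setLIntegral_excess_le {F G H : ℝ → ℝ} (hF : Monotone F) (hG : Monotone G)
    (hH : ∀ s t, s ≤ t → H t - H s = ∫ x in s..t, (F x - G x)) (t : ℝ) :
    ∫⁻ s in {s | 0 ≤ H s ∧ s < t}, ENNReal.ofReal (F s - G t) ≤ ENNReal.ofReal (H t) := by
  -- The part of the domain where the integrand is positive.
  set S := {s | (0 ≤ H s ∧ s < t) ∧ G t < F s} with hS
  -- To the right of a point of `S` and before t one has F ≥ F(c) > G(t) ≥ G, so H increases and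
  -- stays nonnegative: `S` is an interval ending at t.
  have hup : ∀ c ∈ S, ∀ s, c ≤ s → s < t → s ∈ S := by
    rintro c ⟨⟨hc0, hct⟩, hcG⟩ s hcs hst
    refine ⟨⟨?_, hst⟩, hcG.trans_le (hF hcs)⟩
    have h1 := hH c s hcs
    have h2 : 0 ≤ ∫ x in c..s, (F x - G x) := by
      apply intervalIntegral.integral_nonneg hcs
      intro x hx
      have := hF hx.1
      have := hG (hx.2.trans hst.le)
      linarith
    linarith
  have hSm : MeasurableSet S := by
    apply Set.OrdConnected.measurableSet
    rw [ordConnected_iff]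
    intro a ha b hb _ x hx
    exact hup a ha x hx.1 (lt_of_le_of_lt hx.2 hb.1.2)
  have hle : ∫⁻ s in {s | 0 ≤ H s ∧ s < t}, ENNReal.ofReal (F s - G t) ≤
      ∫⁻ s in S, ENNReal.ofReal (F s - G t) := by
    rw [← lintegral_indicator hSm]
    refine (lintegral_mono_ae ?_).trans (setLIntegral_le_lintegral {s | 0 ≤ H s ∧ s < t} _)
    have hHm : MeasurableSet {s | 0 ≤ H s ∧ s < t} := by
      apply MeasurableSet.inter _ measurableSet_Iio
      have : Continuous H := by
        have h0 : H = fun x => H 0 + ∫ y in (0:ℝ)..x, (F y - G y) := by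
          ext x
          rcases le_total 0 x with h | h
          · rw [← hH _ _ h]; ring
          · rw [intervalIntegral.integral_symm, ← hH _ _ h]; ring
        rw [h0]
        exact continuous_const.add (intervalIntegral.continuous_primitive
          (fun a b => hF.intervalIntegrable.sub hG.intervalIntegrable) 0)
      exact measurableSet_le measurable_const this.measurable
    filter_upwards [ae_restrict_mem hHm] with s hs
    by_cases h : s ∈ S
    · rw [indicator_of_mem h]
    · rw [indicator_of_notMem h, ENNReal.ofReal_of_nonpos]
      by_contra hc
      exact h ⟨hs, by linarith⟩
  -- From a point c of `S` on, G(t) may be replaced by the smaller G(s); the integral of F - G over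
  -- [c, t] is H(t) - H(c) ≤ H(t).
  have hcut : ∀ c ∈ S, ∫⁻ s in S ∩ Ici c, ENNReal.ofReal (F s - G t) ≤ ENNReal.ofReal (H t) := by
    intro c hc
    have hct := hc.1.2
    have hint : IntervalIntegrable (fun x => F x - G x) volume c t :=
      hF.intervalIntegrable.sub hG.intervalIntegrable
    calc ∫⁻ s in S ∩ Ici c, ENNReal.ofReal (F s - G t)
        ≤ ∫⁻ s in Icc c t, ENNReal.ofReal (F s - G t) :=
          lintegral_mono_set fun s hs => ⟨hs.2, hs.1.1.2.le⟩
      _ ≤ ∫⁻ s in Icc c t, ENNReal.ofReal (F s - G s) := by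
          refine setLIntegral_mono' measurableSet_Icc fun s hs => ?_
          have := hG hs.2
          exact ENNReal.ofReal_le_ofReal (by linarith)
      _ = ∫⁻ s in Ioc c t, ENNReal.ofReal (F s - G s) := by
          rw [Measure.restrict_congr_set Ioc_ae_eq_Icc.symm]
      _ = ENNReal.ofReal (∫ s in c..t, (F s - G s)) := by
          rw [intervalIntegral.integral_of_le hct.le, ofReal_integral_eq_lintegral_ofReal]
          · exact (intervalIntegrable_iff_integrableOn_Ioc_of_le hct.le).1 hint
          · filter_upwards [ae_restrict_mem measurableSet_Ioc] with s hs
            have h1 := hF hs.1.le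
            have h2 := hG hs.2
            have h3 := hc.2
            simp only [Pi.zero_apply]; linarith
      _ ≤ _ := by
          apply ENNReal.ofReal_le_ofReal
          rw [← hH c t hct.le]
          linarith [hc.1.1]
  refine hle.trans ?_
  -- The left end of `S` may be infinite or not attained. Cutting at rational points of `S` exhausts
  -- it up to at most one point, and monotone convergence along the directed family concludes.
  set S' := ⋃ q : {q : ℚ // (q : ℝ) ∈ S}, S ∩ Ici ((q : ℚ) : ℝ) with hS'
  have hSS' : S =ᵐ[volume] S' := by
    have hsub : S' ⊆ S := iUnion_subset fun q => inter_subset_left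
    have hdiff : (S \ S').Subsingleton := by
      have : ∀ x ∈ S \ S', ∀ y ∈ S \ S', ¬ x < y := by
        intro x hx y hy hxy
        obtain ⟨q, hq1, hq2⟩ := exists_rat_btwn hxy
        have hqS : (q : ℝ) ∈ S := hup x hx.1 _ hq1.le (hq2.trans hy.1.1.2)
        exact hy.2 (mem_iUnion.2 ⟨⟨q, hqS⟩, hy.1, hq2.le⟩)
      intro x hx y hy
      exact le_antisymm (not_lt.1 (this y hy x hx)) (not_lt.1 (this x hx y hy))
    refine Filter.EventuallyEq.symm ?_
    refine hsub.eventuallyLE.antisymm ?_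
    rw [ae_le_set]
    exact hdiff.measure_zero volume
  rw [Measure.restrict_congr_set hSS', setLIntegral_iUnion_of_directed]
  · exact iSup_le fun q => hcut _ q.2
  · intro p q
    rcases le_total (p : ℚ) (q : ℚ) with h | h
    · refine ⟨p, subset_rfl, inter_subset_inter_right _ (Ici_subset_Ici.2 (by exact_mod_cast h))⟩
    · refine ⟨q, inter_subset_inter_right _ (Ici_subset_Ici.2 (by exact_mod_cast h)), subset_rfl⟩

/-- The reflection x ↦ -x exchanges the roles of F and G: the functions -G(-x), -F(-x) and -H(-x)
satisfy the same hypotheses. -/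
lemma setLIntegral_excess_le' {F G H : ℝ → ℝ} (hF : Monotone F) (hG : Monotone G)
    (hH : ∀ s t, s ≤ t → H t - H s = ∫ x in s..t, (F x - G x)) (s : ℝ) :
    ∫⁻ t in {t | H t < 0 ∧ s < t}, ENNReal.ofReal (F s - G t) ≤ ENNReal.ofReal (- H s) := by
  have h := setLIntegral_excess_le (F := fun x => - G (-x)) (G := fun x => - F (-x))
    (H := fun x => - H (-x)) (fun x y h => neg_le_neg (hG (neg_le_neg h)))
    (fun x y h => neg_le_neg (hF (neg_le_neg h))) (fun a b hab => by
      have h1 := hH (-b) (-a) (neg_le_neg hab)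
      have h2 := intervalIntegral.integral_comp_neg (a := a) (b := b) (fun x => F x - G x)
      simp only [neg_sub_neg] at *
      rw [h2, ← h1]) (-s)
  simp only [neg_neg] at h
  refine le_trans ?_ h
  have hmp := (Measure.measurePreserving_neg (volume : Measure ℝ))
  have := hmp.setLIntegral_comp_preimage_emb (MeasurableEquiv.neg ℝ).measurableEmbedding
    (fun t => ENNReal.ofReal (F s - G t)) {t | H t < 0 ∧ s < t}
  rw [← this]
  refine (lintegral_mono_set ?_).trans (lintegral_mono fun x => ?_)
  · rintro x ⟨h1, h2⟩
    exact ⟨by linarith, by linarith⟩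
  · apply ENNReal.ofReal_le_ofReal; linarith

/-- The stop-loss transform `x ↦ ∫ (t - x)⁺ dμ(t)`. -/
def stopLoss (μ : Measure ℝ) (x : ℝ) : ℝ := ∫ t, max (t - x) 0 ∂μ

/-- For fixed y the map x ↦ (y - x)⁺ has derivative -1 on x < y and 0 beyond. Integrating this in x
and applying Fubini gives the tail of the law. -/
lemma stopLoss_sub (μ : Measure ℝ) [IsProbabilityMeasure μ] (hμ : Integrable (fun t => t) μ)
    {s t : ℝ} (hst : s ≤ t) :
    stopLoss μ t - stopLoss μ s = - ∫ x in s..t, (1 - cdf μ x) := by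
  have hi : ∀ x, Integrable (fun t => max (t - x) 0) μ := fun x =>
    (hμ.sub (integrable_const x)).pos_part
  have h1 : ∀ y : ℝ, max (y - t) 0 - max (y - s) 0 =
      - ∫ x in Ioc s t, (Ioi x).indicator (fun _ => (1 : ℝ)) y := by
    intro y
    have : (fun x => (Ioi x).indicator (fun _ => (1 : ℝ)) y) =
        (Iio y).indicator (fun _ => (1 : ℝ)) := by
      ext x; by_cases h : x < y <;> simp [h]
    rw [this, setIntegral_indicator measurableSet_Iio, setIntegral_const, smul_eq_mul, mul_one]
    rcases le_or_gt y s with h | h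
    · have : Ioc s t ∩ Iio y = ∅ := by
        ext x; simp only [mem_inter_iff, mem_Ioc, mem_Iio, mem_empty_iff_false, iff_false]
        rintro ⟨⟨h1, h2⟩, h3⟩; linarith
      rw [this, measureReal_empty, max_eq_right (by linarith), max_eq_right (by linarith)]; simp
    · rcases le_or_gt y t with h' | h'
      · have : Ioc s t ∩ Iio y = Ioo s y := by
          ext x; simp only [mem_inter_iff, mem_Ioc, mem_Iio, mem_Ioo]
          constructor
          · rintro ⟨⟨h1, h2⟩, h3⟩; exact ⟨h1, h3⟩
          · rintro ⟨h1, h3⟩; exact ⟨⟨h1, by linarith⟩, h3⟩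
        rw [this, Real.volume_real_Ioo_of_le h.le, max_eq_right (by linarith),
          max_eq_left (by linarith)]; ring
      · have : Ioc s t ∩ Iio y = Ioc s t := by
          ext x; simp only [mem_inter_iff, mem_Ioc, mem_Iio, and_iff_left_iff_imp]
          rintro ⟨h1, h2⟩; linarith
        rw [this, Real.volume_real_Ioc_of_le hst, max_eq_left (by linarith),
          max_eq_left (by linarith)]; ring
  have hm : Measurable (Function.uncurry fun (y x : ℝ) =>
      (Ioi x).indicator (fun _ => (1 : ℝ)) y) := by
    have : (Function.uncurry fun (y x : ℝ) => (Ioi x).indicator (fun _ => (1 : ℝ)) y) =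
        {p : ℝ × ℝ | p.2 < p.1}.indicator fun _ => (1 : ℝ) := by
      ext ⟨y, x⟩; simp [indicator]
    rw [this]
    exact measurable_const.indicator (measurableSet_lt measurable_snd measurable_fst)
  rw [stopLoss, stopLoss, ← integral_sub (hi t) (hi s)]
  simp_rw [h1]
  rw [integral_neg, integral_integral_swap, intervalIntegral.integral_of_le hst]
  · congr 2
    ext x
    rw [integral_indicator_const _ measurableSet_Ioi, smul_eq_mul, mul_one, cdf_eq_real,
      ← probReal_compl_eq_one_sub measurableSet_Iic, compl_Iic]
  · refine Integrable.of_bound hm.aestronglyMeasurable 1 (ae_of_all _ fun p => ?_)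
    rcases p with ⟨y, x⟩
    simp only [Function.uncurry_apply_pair]
    by_cases h : x < y <;> simp [h]

lemma antitone_stopLoss (μ : Measure ℝ) [IsProbabilityMeasure μ]
    (hμ : Integrable (fun t => t) μ) : Antitone (stopLoss μ) := by
  intro x y hxy
  refine integral_mono (hμ.sub (integrable_const y)).pos_part
    (hμ.sub (integrable_const x)).pos_part fun t => ?_
  exact max_le_max (by linarith) le_rfl

/-- Heights are separated by the sign of H. The inequality (a + b)² ≤ 2(a² + b²) removes the pairs
of heights with opposite signs. Among pairs in {H ≥ 0} the lower height is integrated first, with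
the upper one t fixed, and gives at most H(t); among pairs in {H < 0} the upper height is integrated
first and gives at most -H(s). -/
lemma lintegral_quantile_Ico_le {F G : Measure ℝ} {H : ℝ → ℝ} (hHm : Measurable H)
    (hH : ∀ s t, s ≤ t → H t - H s = ∫ x in s..t, (cdf F x - cdf G x)) :
    ∫⁻ u in Ioo (0 : ℝ) 1, volume (Ico (quantileFun F u) (quantileFun G u) ∩ univ) ^ 2 ≤
      4 * ∫⁻ x, ENNReal.ofReal |H x| := by
  set E := {x | 0 ≤ H x} with hEdef
  have hE : MeasurableSet E := measurableSet_le measurable_const hHm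
  have hmF : Measurable (cdf F) := (monotone_cdf F).measurable
  have hmG : Measurable (cdf G) := (monotone_cdf G).measurable
  have hmd : Measurable fun p : ℝ × ℝ => ENNReal.ofReal (cdf F p.2 - cdf G p.1) := by fun_prop
  have hset : ∀ E : Set ℝ, MeasurableSet E →
      MeasurableSet {p : ℝ × ℝ | p.1 ∈ E ∧ p.2 ∈ E ∧ p.2 < p.1} := fun E hE =>
    (measurable_fst hE).inter ((measurable_snd hE).inter
      (measurableSet_lt measurable_snd measurable_fst))
  have h1 : ∫⁻ p in {p : ℝ × ℝ | p.1 ∈ E ∧ p.2 ∈ E ∧ p.2 < p.1},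
      ENNReal.ofReal (cdf F p.2 - cdf G p.1) ∂(volume.prod volume) ≤
      ∫⁻ x in E, ENNReal.ofReal |H x| := by
    rw [← lintegral_indicator (hset E hE), lintegral_prod _ ((hmd.indicator (hset E hE)).aemeasurable),
      ← lintegral_indicator hE]
    refine lintegral_mono fun t => ?_
    by_cases ht : t ∈ E
    · rw [indicator_of_mem ht, abs_of_nonneg ht]
      refine le_trans ?_ (setLIntegral_excess_le (monotone_cdf F) (monotone_cdf G) hH t)
      rw [← lintegral_indicator (show MeasurableSet {s | 0 ≤ H s ∧ s < t} from
        hE.inter measurableSet_Iio)]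
      refine lintegral_mono fun s => ?_
      by_cases hs : s ∈ E ∧ s < t
      · rw [indicator_of_mem (show (t, s) ∈ {p : ℝ × ℝ | p.1 ∈ E ∧ p.2 ∈ E ∧ p.2 < p.1} from
          ⟨ht, hs⟩), indicator_of_mem (show s ∈ {s | 0 ≤ H s ∧ s < t} from hs)]
      · rw [indicator_of_notMem (fun h => hs h.2)]; exact zero_le
    · rw [indicator_of_notMem ht, nonpos_iff_eq_zero]
      rw [lintegral_eq_zero_iff' (by
        exact ((hmd.indicator (hset E hE)).comp measurable_prodMk_left).aemeasurable)]
      refine ae_of_all _ fun s => ?_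
      exact indicator_of_notMem (fun h => ht h.1) _
  have h2 : ∫⁻ p in {p : ℝ × ℝ | p.1 ∈ Eᶜ ∧ p.2 ∈ Eᶜ ∧ p.2 < p.1},
      ENNReal.ofReal (cdf F p.2 - cdf G p.1) ∂(volume.prod volume) ≤
      ∫⁻ x in Eᶜ, ENNReal.ofReal |H x| := by
    rw [← lintegral_indicator (hset _ hE.compl),
      lintegral_prod_symm _ ((hmd.indicator (hset _ hE.compl)).aemeasurable),
      ← lintegral_indicator hE.compl]
    refine lintegral_mono fun s => ?_
    by_cases hs : s ∈ Eᶜ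
    · have hs' : H s < 0 := not_le.1 hs
      rw [indicator_of_mem hs, abs_of_neg hs']
      refine le_trans ?_ (setLIntegral_excess_le' (monotone_cdf F) (monotone_cdf G) hH s)
      have hm : MeasurableSet {t | H t < 0 ∧ s < t} :=
        (measurableSet_lt hHm measurable_const).inter measurableSet_Ioi
      rw [← lintegral_indicator hm]
      refine lintegral_mono fun t => ?_
      by_cases ht : H t < 0 ∧ s < t
      · rw [indicator_of_mem (show (t, s) ∈ {p : ℝ × ℝ | p.1 ∈ Eᶜ ∧ p.2 ∈ Eᶜ ∧ p.2 < p.1} from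
          ⟨not_le.2 ht.1, hs, ht.2⟩), indicator_of_mem (show t ∈ {t | H t < 0 ∧ s < t} from ht)]
      · rw [indicator_of_notMem (fun h => ht ⟨not_le.1 h.1, h.2.2⟩)]; exact zero_le
    · rw [indicator_of_notMem hs, nonpos_iff_eq_zero]
      rw [lintegral_eq_zero_iff' (by
        exact ((hmd.indicator (hset _ hE.compl)).comp measurable_prodMk_right).aemeasurable)]
      refine ae_of_all _ fun t => ?_
      exact indicator_of_notMem (fun h => hs h.2.1) _
  calc ∫⁻ u in Ioo (0 : ℝ) 1, volume (Ico (quantileFun F u) (quantileFun G u) ∩ univ) ^ 2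
      ≤ ∫⁻ u in Ioo (0 : ℝ) 1, 2 * (volume (Ico (quantileFun F u) (quantileFun G u) ∩ E) ^ 2 +
          volume (Ico (quantileFun F u) (quantileFun G u) ∩ Eᶜ) ^ 2) := by
        refine lintegral_mono fun u => ?_
        refine le_trans ?_ (ennreal_add_sq_le _ _)
        refine pow_le_pow_left' ?_ 2
        rw [← union_compl_self E, inter_union_distrib_left]
        exact measure_union_le _ _
    _ = 2 * ((∫⁻ u in Ioo (0 : ℝ) 1, volume (Ico (quantileFun F u) (quantileFun G u) ∩ E) ^ 2) +
        ∫⁻ u in Ioo (0 : ℝ) 1, volume (Ico (quantileFun F u) (quantileFun G u) ∩ Eᶜ) ^ 2) := by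
        rw [lintegral_const_mul' _ _ (by norm_num), lintegral_add_left' (measurable_volume_quantile_Ico F G hE)]
    _ ≤ 2 * (2 * (∫⁻ x in E, ENNReal.ofReal |H x|) + 2 * ∫⁻ x in Eᶜ, ENNReal.ofReal |H x|) := by
        rw [lintegral_volume_quantile_Ico F G hE, lintegral_volume_quantile_Ico F G hE.compl]
        gcongr
    _ = _ := by
        rw [← mul_add, lintegral_add_compl _ hE, ← mul_assoc]; norm_num

/-- The quadratic transportation cost is controlled by the `L¹` distance of stop-loss transforms. -/
theorem W2sq_le_stopLoss (μ ν : Measure ℝ) [IsProbabilityMeasure μ] [IsProbabilityMeasure ν]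
    (hμ : Integrable (fun t => t) μ) (hν : Integrable (fun t => t) ν) :
    W2sq μ ν ≤ 8 * ∫⁻ x, ENNReal.ofReal |stopLoss μ x - stopLoss ν x| := by
  have key : ∀ (μ ν : Measure ℝ) [IsProbabilityMeasure μ] [IsProbabilityMeasure ν],
      Integrable (fun t => t) μ → Integrable (fun t => t) ν →
      ∫⁻ u in Ioo (0 : ℝ) 1, volume (Ico (quantileFun μ u) (quantileFun ν u) ∩ univ) ^ 2 ≤
      4 * ∫⁻ x, ENNReal.ofReal |stopLoss μ x - stopLoss ν x| := by
    intro μ ν _ _ hμ hν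
    refine lintegral_quantile_Ico_le
      ((antitone_stopLoss μ hμ).measurable.sub (antitone_stopLoss ν hν).measurable) ?_
    -- The constant 1 in the derivatives of both stop-loss transforms cancels, so their difference
    -- is a primitive of the difference of the distribution functions.
    intro s t hst
    have h1 := stopLoss_sub μ hμ hst
    have h2 := stopLoss_sub ν hν hst
    have i1 : IntervalIntegrable (cdf μ) volume s t := (monotone_cdf μ).intervalIntegrable
    have i2 : IntervalIntegrable (cdf ν) volume s t := (monotone_cdf ν).intervalIntegrable
    rw [intervalIntegral.integral_sub intervalIntegrable_const i1] at h1
    rw [intervalIntegral.integral_sub intervalIntegrable_const i2] at h2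
    rw [intervalIntegral.integral_sub i1 i2]
    linarith
  rw [W2sq_eq_add]
  refine (add_le_add (key μ ν hμ hν) (key ν μ hν hμ)).trans ?_
  simp_rw [fun x => abs_sub_comm (stopLoss ν x) (stopLoss μ x)]
  rw [← add_mul]; norm_num

/-! ### Second antiderivatives of bounded functions -/

/-- The antiderivative of `ε` vanishing at `0`. -/
def prim (ε : ℝ → ℝ) (y : ℝ) : ℝ := ∫ x in (0 : ℝ)..y, ε x

/-- The kernel of the second antiderivative vanishing to second order at `0`. -/
def primKer (x y : ℝ) : ℝ :=
  (Ico 0 y).indicator (fun x => y - x) x + (Ico y 0).indicator (fun x => x - y) x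

lemma intervalIntegrable_of_abs_le_one {ε : ℝ → ℝ} (hm : Measurable ε) (hb : ∀ x, |ε x| ≤ 1)
    (a b : ℝ) : IntervalIntegrable ε volume a b := by
  exact (intervalIntegrable_const (c := (1 : ℝ))).mono_fun' hm.aestronglyMeasurable
    (ae_of_all _ hb)

lemma prim_sub {ε : ℝ → ℝ} (hm : Measurable ε) (hb : ∀ x, |ε x| ≤ 1) (a b : ℝ) :
    prim ε b - prim ε a = ∫ x in a..b, ε x :=
  intervalIntegral.integral_interval_sub_left (intervalIntegrable_of_abs_le_one hm hb _ _)
    (intervalIntegrable_of_abs_le_one hm hb _ _)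

lemma abs_prim_sub_le {ε : ℝ → ℝ} (hm : Measurable ε) (hb : ∀ x, |ε x| ≤ 1) (a b : ℝ) :
    |prim ε b - prim ε a| ≤ |b - a| := by
  rw [prim_sub hm hb]
  have := intervalIntegral.norm_integral_le_of_norm_le_const (a := a) (b := b) (f := ε) (C := 1)
    fun x _ => hb x
  simpa using this

lemma abs_prim_le {ε : ℝ → ℝ} (hm : Measurable ε) (hb : ∀ x, |ε x| ≤ 1) (y : ℝ) :
    |prim ε y| ≤ |y| := by
  have := abs_prim_sub_le hm hb 0 y
  simpa [prim] using this

lemma continuous_prim {ε : ℝ → ℝ} (hm : Measurable ε) (hb : ∀ x, |ε x| ≤ 1) :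
    Continuous (prim ε) :=
  intervalIntegral.continuous_primitive (intervalIntegrable_of_abs_le_one hm hb) 0

lemma prim_prim_sub {ε : ℝ → ℝ} (hm : Measurable ε) (hb : ∀ x, |ε x| ≤ 1) (a b : ℝ) :
    prim (prim ε) b - prim (prim ε) a = ∫ x in a..b, prim ε x :=
  intervalIntegral.integral_interval_sub_left
    ((continuous_prim hm hb).intervalIntegrable _ _)
    ((continuous_prim hm hb).intervalIntegrable _ _)

lemma continuous_prim_prim {ε : ℝ → ℝ} (hm : Measurable ε) (hb : ∀ x, |ε x| ≤ 1) :
    Continuous (prim (prim ε)) :=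
  intervalIntegral.continuous_primitive
    (fun _ _ => (continuous_prim hm hb).intervalIntegrable _ _) 0

lemma abs_prim_prim_le {ε : ℝ → ℝ} (hm : Measurable ε) (hb : ∀ x, |ε x| ≤ 1) (y : ℝ) :
    |prim (prim ε) y| ≤ y ^ 2 := by
  have := intervalIntegral.norm_integral_le_of_norm_le_const (a := 0) (b := y) (f := prim ε)
    (C := |y|) fun x hx => (abs_prim_le hm hb x).trans (by
      have := abs_sub_left_of_mem_uIcc (uIoc_subset_uIcc hx)
      simpa using this)
  simpa [prim, ← sq] using this

/-- Cauchy's formula for repeated integration, by Fubini on the triangle 0 < x ≤ s ≤ y. -/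
lemma prim_prim_eq_of_nonneg {ε : ℝ → ℝ} (hm : Measurable ε) (hb : ∀ x, |ε x| ≤ 1) {y : ℝ}
    (hy : 0 ≤ y) : prim (prim ε) y = ∫ x in Ioc 0 y, ε x * (y - x) := by
  have h1 : prim (prim ε) y = ∫ s in Ioc 0 y, ∫ x in Ioc 0 y, (Iic s).indicator ε x := by
    rw [prim, intervalIntegral.integral_of_le hy]
    refine setIntegral_congr_fun measurableSet_Ioc fun s hs => ?_
    rw [prim, intervalIntegral.integral_of_le hs.1.le, setIntegral_indicator measurableSet_Iic]
    congr 2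
    ext x; simp only [mem_Ioc, mem_inter_iff, mem_Iic]
    constructor
    · rintro ⟨h1, h2⟩; exact ⟨⟨h1, h2.trans hs.2⟩, h2⟩
    · rintro ⟨⟨h1, _⟩, h2⟩; exact ⟨h1, h2⟩
  have hmeas : Measurable (Function.uncurry fun s x : ℝ => (Iic s).indicator ε x) := by
    have : (Function.uncurry fun s x : ℝ => (Iic s).indicator ε x) =
        {p : ℝ × ℝ | p.2 ≤ p.1}.indicator fun p => ε p.2 := by
      ext ⟨s, x⟩; simp [indicator]
    rw [this]
    exact (hm.comp measurable_snd).indicator (measurableSet_le measurable_snd measurable_fst)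
  rw [h1, integral_integral_swap]
  · refine setIntegral_congr_fun measurableSet_Ioc fun x hx => ?_
    have : (fun s => (Iic s).indicator ε x) = (Ici x).indicator fun _ => ε x := by
      ext s; by_cases h : x ≤ s <;> simp [h]
    rw [this, setIntegral_indicator measurableSet_Ici, setIntegral_const]
    have : Ioc 0 y ∩ Ici x = Icc x y := by
      ext s; simp only [mem_inter_iff, mem_Ioc, mem_Ici, mem_Icc]
      constructor
      · rintro ⟨⟨_, h1⟩, h2⟩; exact ⟨h2, h1⟩
      · rintro ⟨h2, h1⟩; exact ⟨⟨hx.1.trans_le h2, h1⟩, h2⟩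
    rw [this, Real.volume_real_Icc_of_le hx.2, smul_eq_mul, mul_comm]
  · refine Integrable.of_bound hmeas.aestronglyMeasurable 1 (ae_of_all _ fun p => ?_)
    rcases p with ⟨s, x⟩
    simp only [Function.uncurry_apply_pair]
    by_cases h : x ≤ s
    · simpa [h] using hb x
    · simp [h]

lemma prim_prim_eq {ε : ℝ → ℝ} (hm : Measurable ε) (hb : ∀ x, |ε x| ≤ 1) (y : ℝ) :
    prim (prim ε) y = ∫ x, ε x * primKer x y := by
  rcases le_total 0 y with hy | hy
  · have : (fun x => ε x * primKer x y) = (Ico 0 y).indicator fun x => ε x * (y - x) := by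
      ext x
      have : x ∉ Ico y 0 := fun h => by linarith [h.1, h.2]
      by_cases h : x ∈ Ico 0 y
      · simp only [primKer, indicator_of_mem h, indicator_of_notMem this, add_zero]
      · simp only [primKer, indicator_of_notMem h, indicator_of_notMem this, add_zero, mul_zero]
    rw [this, integral_indicator measurableSet_Ico, prim_prim_eq_of_nonneg hm hb hy,
      integral_Ioc_eq_integral_Ioo, ← integral_Ico_eq_integral_Ioo]
  · have h1 : prim (prim ε) y = prim (prim fun x => ε (-x)) (-y) := by
      have e1 : (prim fun x => ε (-x)) = fun s => - prim ε (-s) := by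
        ext s
        rw [prim, intervalIntegral.integral_comp_neg, neg_zero, intervalIntegral.integral_symm]
        rfl
      rw [e1, prim, prim, intervalIntegral.integral_neg,
        intervalIntegral.integral_comp_neg (prim ε), neg_neg, neg_zero,
        intervalIntegral.integral_symm]
    have : (fun x => ε x * primKer x y) = (Ico y 0).indicator fun x => ε x * (x - y) := by
      ext x
      have : x ∉ Ico 0 y := fun h => by linarith [h.1, h.2]
      by_cases h : x ∈ Ico y 0
      · simp only [primKer, indicator_of_mem h, indicator_of_notMem this, zero_add]
      · simp only [primKer, indicator_of_notMem h, indicator_of_notMem this, zero_add, mul_zero]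
    rw [h1, prim_prim_eq_of_nonneg (ε := fun x => ε (-x)) (hm.comp measurable_neg)
      (fun x => hb _) (by linarith), this,
      integral_indicator measurableSet_Ico, ← intervalIntegral.integral_of_le (by linarith)]
    have := intervalIntegral.integral_comp_neg (a := 0) (b := -y) fun x => ε x * (x - y)
    rw [neg_neg, neg_zero] at this
    rw [integral_Ico_eq_integral_Ioo, ← integral_Ioc_eq_integral_Ioo,
      ← intervalIntegral.integral_of_le hy, ← this]
    congr 1; ext x; ring

lemma primKer_nonneg (x y : ℝ) : 0 ≤ primKer x y := by
  apply add_nonneg <;> apply indicator_nonneg <;> intro z hz <;> linarith [hz.1, hz.2]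

/-- The kernel is the stop-loss payoff minus an affine function of y, present for x < 0 only. The
affine part sees a law only through its mean, which is why equal means suffice later on. -/
lemma primKer_eq (x y : ℝ) :
    primKer x y = max (y - x) 0 - (Iio (0 : ℝ)).indicator (fun x => y - x) x := by
  rcases lt_or_ge x 0 with hx | hx
  · have h1 : x ∉ Ico 0 y := fun h => by linarith [h.1]
    rw [primKer, indicator_of_notMem h1, indicator_of_mem (show x ∈ Iio (0 : ℝ) from hx), zero_add]
    rcases le_or_gt y x with h | h
    · rw [indicator_of_mem (show x ∈ Ico y 0 from ⟨h, hx⟩), max_eq_right (by linarith)]; ring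
    · rw [indicator_of_notMem (fun h' : x ∈ Ico y 0 => by linarith [h'.1]),
        max_eq_left (by linarith)]; ring
  · rw [primKer, indicator_of_notMem (show x ∉ Iio (0 : ℝ) from not_lt.2 hx),
      indicator_of_notMem (fun h' : x ∈ Ico y 0 => by linarith [h'.2])]
    rcases le_or_gt y x with h | h
    · rw [indicator_of_notMem (fun h' : x ∈ Ico 0 y => by linarith [h'.2]),
        max_eq_right (by linarith)]; ring
    · rw [indicator_of_mem (show x ∈ Ico 0 y from ⟨hx, h⟩), max_eq_left (by linarith)]; ring

lemma measurable_primKer : Measurable (Function.uncurry primKer) := by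
  have : Function.uncurry primKer = fun p : ℝ × ℝ => max (p.2 - p.1) 0 -
      {p : ℝ × ℝ | p.1 < 0}.indicator (fun p => p.2 - p.1) p := by
    ext ⟨x, y⟩
    simp only [Function.uncurry_apply_pair, primKer_eq, indicator, mem_Iio, mem_ofPred_eq]
  rw [this]
  refine Measurable.sub (by fun_prop) (Measurable.indicator (by fun_prop) ?_)
  exact measurableSet_lt measurable_fst measurable_const

lemma integrable_primKer (y : ℝ) : Integrable (fun x => primKer x y) := by
  unfold primKer
  refine Integrable.add ?_ ?_
  · exact (Continuous.integrableOn_Icc (by fun_prop)).mono_set Ico_subset_Icc_self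
      |>.integrable_indicator measurableSet_Ico
  · exact (Continuous.integrableOn_Icc (by fun_prop)).mono_set Ico_subset_Icc_self
      |>.integrable_indicator measurableSet_Ico

/-- The kernel is nonnegative and its integral in x is the second antiderivative of the constant 1,
at most y². A second moment is all that Fubini needs. -/
lemma integrable_mul_primKer {ε : ℝ → ℝ} (hm : Measurable ε) (hb : ∀ x, |ε x| ≤ 1)
    (μ : Measure ℝ) [IsProbabilityMeasure μ] (h2 : Integrable (fun y => y ^ 2) μ) :
    Integrable (Function.uncurry fun y x => ε x * primKer x y) (μ.prod volume) := by
  have hmeas : Measurable (Function.uncurry fun y x => ε x * primKer x y) :=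
    (hm.comp measurable_snd).mul (measurable_primKer.comp measurable_swap)
  rw [integrable_prod_iff hmeas.aestronglyMeasurable]
  have hle : ∀ y x, ‖ε x * primKer x y‖ ≤ primKer x y := fun y x => by
    rw [norm_mul, Real.norm_of_nonneg (primKer_nonneg x y)]
    exact mul_le_of_le_one_left (primKer_nonneg x y) (hb x)
  have hi : ∀ y, Integrable (fun x => ε x * primKer x y) := fun y =>
    (integrable_primKer y).mono' (hmeas.comp measurable_prodMk_left).aestronglyMeasurable
      (ae_of_all _ (hle y))
  refine ⟨ae_of_all _ hi, ?_⟩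
  refine h2.mono' hmeas.norm.stronglyMeasurable.integral_prod_right.aestronglyMeasurable
    (ae_of_all _ fun y => ?_)
  rw [Real.norm_of_nonneg (integral_nonneg fun _ => norm_nonneg _)]
  calc ∫ x, ‖ε x * primKer x y‖ ≤ ∫ x, (fun _ => (1 : ℝ)) x * primKer x y :=
        integral_mono (hi y).norm (by simpa using integrable_primKer y)
          (fun x => by simpa using hle y x)
    _ = prim (prim fun _ => 1) y := (prim_prim_eq measurable_const (by simp) y).symm
    _ ≤ |prim (prim fun _ => 1) y| := le_abs_self _
    _ ≤ y ^ 2 := abs_prim_prim_le measurable_const (by simp) y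

lemma integral_primKer (μ : Measure ℝ) [IsProbabilityMeasure μ]
    (h1 : Integrable (fun y => y) μ) (x : ℝ) :
    ∫ y, primKer x y ∂μ =
      stopLoss μ x - (Iio (0 : ℝ)).indicator (fun x => (∫ y, y ∂μ) - x) x := by
  simp_rw [primKer_eq]
  have i1 : Integrable (fun y => max (y - x) 0) μ := (h1.sub (integrable_const x)).pos_part
  rw [integral_sub i1]
  · congr 1
    by_cases h : x ∈ Iio (0 : ℝ)
    · simp only [indicator_of_mem h]
      rw [integral_sub h1 (integrable_const x)]; simp
    · simp [indicator_of_notMem h]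
  · by_cases h : x ∈ Iio (0 : ℝ)
    · simp only [indicator_of_mem h]; exact h1.sub (integrable_const x)
    · simp [indicator_of_notMem h]

/-- For two laws with equal means, second antiderivatives integrate to a pairing with the
difference of the stop-loss transforms. -/
lemma integral_prim_prim_sub {ε : ℝ → ℝ} (hm : Measurable ε) (hb : ∀ x, |ε x| ≤ 1)
    (μ ν : Measure ℝ) [IsProbabilityMeasure μ] [IsProbabilityMeasure ν]
    (hμ1 : Integrable (fun y => y) μ) (hν1 : Integrable (fun y => y) ν)
    (hμ : Integrable (fun y => y ^ 2) μ) (hν : Integrable (fun y => y ^ 2) ν)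
    (hmean : ∫ y, y ∂μ = ∫ y, y ∂ν) :
    Integrable (fun x => ε x * (stopLoss μ x - stopLoss ν x)) ∧
    ∫ y, prim (prim ε) y ∂μ - ∫ y, prim (prim ε) y ∂ν =
      ∫ x, ε x * (stopLoss μ x - stopLoss ν x) := by
  have hI : ∀ (μ : Measure ℝ) [IsProbabilityMeasure μ], Integrable (fun y => y ^ 2) μ →
      Integrable (fun x => ε x * ∫ y, primKer x y ∂μ) ∧
      ∫ y, prim (prim ε) y ∂μ = ∫ x, ε x * ∫ y, primKer x y ∂μ := by
    intro μ _ h2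
    have hint := integrable_mul_primKer hm hb μ h2
    simp_rw [prim_prim_eq hm hb, ← integral_const_mul]
    exact ⟨hint.integral_prod_right, integral_integral_swap hint⟩
  obtain ⟨i1, e1⟩ := hI μ hμ
  obtain ⟨i2, e2⟩ := hI ν hν
  have he : ∀ x, ε x * (∫ y, primKer x y ∂μ) - ε x * (∫ y, primKer x y ∂ν) =
      ε x * (stopLoss μ x - stopLoss ν x) := fun x => by
    rw [integral_primKer μ hμ1, integral_primKer ν hν1, hmean]; ring
  have hi := i1.sub i2
  refine ⟨hi.congr (ae_of_all _ he), ?_⟩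
  rw [e1, e2, ← integral_sub i1 i2]
  exact integral_congr_ae (ae_of_all _ he)

/-- A smooth test function with its first two derivatives: second derivative bounded by `1` and
`L`-Lipschitz, first derivative at the origin bounded by `b`. -/
structure IsTest (L b : ℝ) (φ φ₁ φ₂ : ℝ → ℝ) : Prop where
  taylor : ∀ x h, |φ (x + h) - φ x - φ₁ x * h - φ₂ x * h ^ 2 / 2| ≤ L * |h| ^ 3
  taylor_deriv : ∀ x h, |φ₁ (x + h) - φ₁ x - φ₂ x * h| ≤ L * |h| ^ 2
  lip : ∀ x h, |φ₂ (x + h) - φ₂ x| ≤ L * |h|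
  lip_deriv : ∀ x h, |φ₁ (x + h) - φ₁ x| ≤ |h|
  bound : ∀ x, |φ₂ x| ≤ 1
  deriv_zero : |φ₁ 0| ≤ b

/-- Only integral identities between the three functions are required, as Gaussian smoothing
preserves those. The Taylor constants are the crude ones obtained as interval length times supremum
of the integrand. -/
lemma isTest_of_integral {L b : ℝ} {φ φ₁ φ₂ : ℝ → ℝ} (hL : 0 ≤ L)
    (h0 : ∀ x y, φ y - φ x = ∫ s in x..y, φ₁ s) (h1 : ∀ x y, φ₁ y - φ₁ x = ∫ s in x..y, φ₂ s)
    (hlip : ∀ x h, |φ₂ (x + h) - φ₂ x| ≤ L * |h|) (hb : ∀ x, |φ₂ x| ≤ 1) (hz : |φ₁ 0| ≤ b) :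
    IsTest L b φ φ₁ φ₂ := by
  have c2 : Continuous φ₂ := by
    have : LipschitzWith L.toNNReal φ₂ := LipschitzWith.of_dist_le_mul fun x y => by
      have := hlip y (x - y)
      rw [add_sub_cancel] at this
      rw [Real.dist_eq, Real.dist_eq, Real.coe_toNNReal _ hL]
      exact this
    exact this.continuous
  have hl1 : ∀ x h, |φ₁ (x + h) - φ₁ x| ≤ |h| := fun x h => by
    rw [h1]
    have := intervalIntegral.norm_integral_le_of_norm_le_const (a := x) (b := x + h) (f := φ₂)
      (C := 1) fun s _ => hb s
    simpa using this
  have c1 : Continuous φ₁ := by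
    have : LipschitzWith 1 φ₁ := LipschitzWith.of_dist_le_mul fun x y => by
      have := hl1 y (x - y)
      rw [add_sub_cancel] at this
      simpa [Real.dist_eq] using this
    exact this.continuous
  have hmem : ∀ x h s : ℝ, s ∈ uIoc x (x + h) → |s - x| ≤ |h| := fun x h s hs => by
    have := abs_sub_left_of_mem_uIcc (uIoc_subset_uIcc hs)
    simpa using this
  have ht1 : ∀ x h, |φ₁ (x + h) - φ₁ x - φ₂ x * h| ≤ L * |h| ^ 2 := fun x h => by
    have e : φ₁ (x + h) - φ₁ x - φ₂ x * h = ∫ s in x..(x + h), (φ₂ s - φ₂ x) := by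
      rw [intervalIntegral.integral_sub (c2.intervalIntegrable _ _) (by simp), h1]
      simp [mul_comm]
    rw [e]
    have := intervalIntegral.norm_integral_le_of_norm_le_const (a := x) (b := x + h)
      (f := fun s => φ₂ s - φ₂ x) (C := L * |h|) fun s hs => by
        have h3 := hlip x (s - x)
        rw [add_sub_cancel] at h3
        exact h3.trans (mul_le_mul_of_nonneg_left (hmem x h s hs) hL)
    rw [add_sub_cancel_left, Real.norm_eq_abs] at this
    linarith
  refine ⟨fun x h => ?_, ht1, hlip, hl1, hb, hz⟩
  have e : φ (x + h) - φ x - φ₁ x * h - φ₂ x * h ^ 2 / 2 =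
      ∫ s in x..(x + h), (φ₁ s - φ₁ x - φ₂ x * (s - x)) := by
    rw [intervalIntegral.integral_sub ((c1.intervalIntegrable _ _).sub (by simp))
      ((by fun_prop : Continuous fun s => φ₂ x * (s - x)).intervalIntegrable _ _),
      intervalIntegral.integral_sub (c1.intervalIntegrable _ _) (by simp), ← h0,
      intervalIntegral.integral_const_mul, intervalIntegral.integral_sub (by simp) (by simp)]
    simp
    ring
  rw [e]
  have := intervalIntegral.norm_integral_le_of_norm_le_const (a := x) (b := x + h)
    (f := fun s => φ₁ s - φ₁ x - φ₂ x * (s - x)) (C := L * |h| ^ 2) fun s hs => by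
      have h3 := ht1 x (s - x)
      rw [add_sub_cancel] at h3
      refine h3.trans (mul_le_mul_of_nonneg_left ?_ hL)
      exact pow_le_pow_left₀ (abs_nonneg _) (hmem x h s hs) 2
  rw [add_sub_cancel_left, Real.norm_eq_abs] at this
  linarith

/-! ### Gaussian smoothing -/

/-- Convolution with the centered Gaussian law of variance `v`. -/
def smooth (v : ℝ≥0) (g : ℝ → ℝ) (y : ℝ) : ℝ := ∫ z, g (y + z) ∂gaussianReal 0 v

lemma integrable_id_gaussianReal (c : ℝ) (v : ℝ≥0) :
    Integrable (fun z => z) (gaussianReal c v) :=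
  (memLp_id_gaussianReal (μ := c) (v := v) 1).integrable (by simp)

lemma integrable_sq_gaussianReal (c : ℝ) (v : ℝ≥0) :
    Integrable (fun z => z ^ 2) (gaussianReal c v) := by
  have := (memLp_id_gaussianReal (μ := c) (v := v) 2).integrable_norm_pow (by norm_num)
  simpa using this

lemma integrable_abs_cube_gaussianReal (c : ℝ) (v : ℝ≥0) :
    Integrable (fun z => |z| ^ 3) (gaussianReal c v) := by
  have := (memLp_id_gaussianReal (μ := c) (v := v) 3).integrable_norm_pow (by norm_num)
  simpa using this

lemma integral_sq_gaussianReal (v : ℝ≥0) : ∫ z, z ^ 2 ∂gaussianReal 0 v = v := by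
  have h := variance_id_gaussianReal (μ := 0) (v := v)
  rw [variance_eq_sub (memLp_id_gaussianReal 2)] at h
  simpa using h

lemma integral_abs_gaussianReal_le (v : ℝ≥0) : ∫ z, |z| ∂gaussianReal 0 v ≤ √v := by
  have h1 := ConvexOn.map_integral_le (μ := gaussianReal 0 v) (f := fun z => |z|)
    (g := fun x : ℝ => x ^ 2) (s := univ) (even_two.convexOn_pow)
    (by fun_prop) isClosed_univ (by simp) (integrable_id_gaussianReal 0 v).abs
    (by simpa [Function.comp_def] using integrable_sq_gaussianReal 0 v)
  simp only [sq_abs, integral_sq_gaussianReal] at h1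
  exact Real.le_sqrt_of_sq_le h1

lemma integrable_shift_gaussianReal {g : ℝ → ℝ} (hg : Measurable g) {C : ℝ}
    (hb : ∀ x, |g x| ≤ C * (1 + x ^ 2)) (c : ℝ) (v : ℝ≥0) (y : ℝ) :
    Integrable (fun z => g (y + z)) (gaussianReal c v) := by
  have hC : 0 ≤ C := by have := (abs_nonneg _).trans (hb 0); simpa using this
  refine Integrable.mono' (g := fun z => C * (1 + 2 * y ^ 2 + 2 * z ^ 2)) ?_
    (hg.comp (measurable_const.add measurable_id)).aestronglyMeasurable
    (ae_of_all _ fun z => (hb _).trans ?_)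
  · exact ((integrable_const _).add ((integrable_sq_gaussianReal c v).const_mul 2)).const_mul C
  · apply mul_le_mul_of_nonneg_left _ hC
    nlinarith [sq_nonneg (y - z)]

lemma smooth_sub_eq_integral {g G : ℝ → ℝ} (hg : Measurable g) (hGm : Measurable G) {C : ℝ}
    (hgb : ∀ x, |g x| ≤ C * (1 + x ^ 2)) (hGb : ∀ x, |G x| ≤ C * (1 + x ^ 2))
    (hG : ∀ x y, G y - G x = ∫ s in x..y, g s) (v : ℝ≥0) (x y : ℝ) :
    smooth v G y - smooth v G x = ∫ s in x..y, smooth v g s := by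
  have hC : 0 ≤ C := by have := (abs_nonneg _).trans (hgb 0); simpa using this
  unfold smooth
  rw [intervalIntegral_integral_swap, ← integral_sub (integrable_shift_gaussianReal hGm hGb _ _ _)
    (integrable_shift_gaussianReal hGm hGb _ _ _)]
  · congr 1; ext z
    rw [hG, intervalIntegral.integral_comp_add_right]
  · have hfin : IsFiniteMeasure (volume.restrict (uIoc x y)) :=
      ⟨by rw [Measure.restrict_apply_univ, uIoc, Real.volume_Ioc]; exact ENNReal.ofReal_lt_top⟩
    have hint : Integrable (fun p : ℝ × ℝ => C * (1 + 2 * (|x| + |y|) ^ 2 + 2 * p.2 ^ 2))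
        ((volume.restrict (uIoc x y)).prod (gaussianReal 0 v)) := by
      refine ((integrable_const _).add (Integrable.const_mul ?_ 2)).const_mul C
      exact (integrable_sq_gaussianReal 0 v).comp_snd (volume.restrict (uIoc x y))
    have hmeas : Measurable (Function.uncurry fun s z : ℝ => g (s + z)) :=
      hg.comp (measurable_fst.add measurable_snd)
    refine hint.mono' hmeas.aestronglyMeasurable ?_
    have hae : ∀ᵐ p ∂((volume.restrict (uIoc x y)).prod (gaussianReal 0 v)), p.1 ∈ uIoc x y := by
      have := Measure.quasiMeasurePreserving_fst (μ := volume.restrict (uIoc x y))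
        (ν := gaussianReal 0 v)
      exact this.ae (ae_restrict_mem measurableSet_uIoc)
    filter_upwards [hae] with p hp
    refine (hgb _).trans (mul_le_mul_of_nonneg_left ?_ hC)
    have h1 : |p.1| ≤ |x| + |y| := by
      have h2 := abs_sub_left_of_mem_uIcc (uIoc_subset_uIcc hp)
      rcases le_total x y with h | h
      · rw [uIoc_of_le h] at hp
        rw [abs_le]; constructor <;> linarith [neg_abs_le x, le_abs_self y, hp.1, hp.2,
          abs_nonneg x, abs_nonneg y]
      · rw [uIoc_of_ge h] at hp
        rw [abs_le]; constructor <;> linarith [neg_abs_le y, le_abs_self x, hp.1, hp.2,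
          abs_nonneg x, abs_nonneg y]
    have h3 : p.1 ^ 2 ≤ (|x| + |y|) ^ 2 := by
      rw [← sq_abs p.1]; exact pow_le_pow_left₀ (abs_nonneg _) h1 2
    nlinarith [sq_nonneg (p.1 - p.2)]

lemma hasDerivAt_gaussianPDFReal (v : ℝ≥0) (x : ℝ) :
    HasDerivAt (gaussianPDFReal 0 v) (-(x / v) * gaussianPDFReal 0 v x) x := by
  rw [gaussianPDFReal_def]
  have h1 : HasDerivAt (fun x : ℝ => -(x - 0) ^ 2 / (2 * (v : ℝ))) (-(x / v)) x := by
    have := (((hasDerivAt_id x).sub_const 0).pow 2).neg.div_const (2 * (v : ℝ))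
    refine this.congr_deriv ?_
    simp only [id_eq, sub_zero]
    ring
  refine (h1.exp.const_mul (√(2 * Real.pi * ↑v))⁻¹).congr_deriv ?_
  ring

/-- The derivative is put on the Gaussian density, not on ε. The L¹ norm of the derivative of the
density is E|Z|/v ≤ v^(-1/2), uniformly over |ε| ≤ 1. -/
lemma abs_smooth_sub_le {v : ℝ≥0} (hv : v ≠ 0) {ε : ℝ → ℝ} (hm : Measurable ε)
    (hb : ∀ x, |ε x| ≤ 1) (y h : ℝ) :
    |smooth v ε (y + h) - smooth v ε y| ≤ (√v)⁻¹ * |h| := by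
  set p := gaussianPDFReal 0 v with hp
  have hv0 : (0 : ℝ) < v := by positivity
  have hpm : Measurable p := measurable_gaussianPDFReal 0 v
  have hp0 : ∀ x, 0 ≤ p x := gaussianPDFReal_nonneg 0 v
  set q : ℝ → ℝ := fun x => -(x / v) * p x with hq
  have hqm : Measurable q := by fun_prop
  have hqi : Integrable q := by
    have h1 := integrable_id_gaussianReal 0 v
    rw [gaussianReal_of_var_ne_zero _ hv, integrable_withDensity_iff_integrable_smul'
      (measurable_gaussianPDF 0 v) (ae_of_all _ fun x => gaussianPDF_lt_top)] at h1
    have := h1.const_mul (-(v : ℝ)⁻¹)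
    refine this.congr (ae_of_all _ fun x => ?_)
    simp only [toReal_gaussianPDF, smul_eq_mul, hq, hp]
    field_simp
  have hqa : ∫ x, |q x| ≤ (√v)⁻¹ := by
    have h1 : ∫ x, |q x| = (v : ℝ)⁻¹ * ∫ z, |z| ∂gaussianReal 0 v := by
      rw [integral_gaussianReal_eq_integral_smul hv, ← integral_const_mul]
      congr 1; ext x
      rw [hq]; simp only [abs_mul, abs_neg, abs_div, abs_of_pos hv0, abs_of_nonneg (hp0 x),
        smul_eq_mul]
      rw [← hp]; field_simp
    rw [h1]
    have h2 := integral_abs_gaussianReal_le v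
    calc _ ≤ (v : ℝ)⁻¹ * √v := by gcongr
      _ = (√v)⁻¹ := by
        rw [inv_mul_eq_div, Real.sqrt_div_self', one_div]
  have e1 : ∀ t, smooth v ε (y + t) = ∫ x, p (x - t) * ε (y + x) := by
    intro t
    rw [smooth, integral_gaussianReal_eq_integral_smul hv,
      ← integral_sub_right_eq_self (fun z => gaussianPDFReal 0 v z • ε (y + t + z)) t]
    congr 1; ext x
    rw [smul_eq_mul, show y + t + (x - t) = y + x by ring]
  have hpi : ∀ t, Integrable fun x => p (x - t) * ε (y + x) := fun t => by
    have : Integrable fun x => p (x - t) := (integrable_gaussianPDFReal 0 v).comp_sub_right t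
    refine this.mono' (by fun_prop) (ae_of_all _ fun x => ?_)
    rw [norm_mul, Real.norm_of_nonneg (hp0 _)]
    exact mul_le_of_le_one_right (hp0 _) (hb _)
  have hqt : ∀ s, Integrable fun x => q (x - s) * ε (y + x) := fun s => by
    refine (hqi.comp_sub_right s).norm.mono' (by fun_prop) (ae_of_all _ fun x => ?_)
    rw [norm_mul]
    exact mul_le_of_le_one_right (norm_nonneg _) (hb _)
  have hle : ∀ s, ∫ x, ‖q (x - s) * ε (y + x)‖ ≤ (√v)⁻¹ := fun s => by
    refine le_trans (integral_mono (hqt s).norm (hqi.comp_sub_right s).norm fun x => ?_) ?_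
    · simp only [norm_mul]
      exact mul_le_of_le_one_right (norm_nonneg _) (hb _)
    · rw [integral_sub_right_eq_self (fun x => ‖q x‖) s]; exact hqa
  have key : smooth v ε (y + h) - smooth v ε y =
      ∫ s in (0 : ℝ)..h, ∫ x, -(q (x - s) * ε (y + x)) := by
    have e0 := e1 0
    rw [add_zero] at e0
    rw [e1 h, e0, ← integral_sub (hpi h) (hpi 0), intervalIntegral_integral_swap]
    · congr 1; ext x
      have hd : ∀ s ∈ uIcc 0 h, HasDerivAt (fun s => p (x - s)) (-q (x - s)) s := by
        intro s _
        have := (hasDerivAt_gaussianPDFReal v (x - s)).comp s ((hasDerivAt_id s).const_sub x)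
        refine this.congr_deriv ?_
        simp only [hq, hp]; ring
      have hc : Continuous fun s => -q (x - s) := by
        have : Continuous p := continuous_iff_continuousAt.2 fun z =>
          (hasDerivAt_gaussianPDFReal v z).continuousAt
        fun_prop
      have := intervalIntegral.integral_eq_sub_of_hasDerivAt hd (hc.intervalIntegrable _ _)
      rw [← sub_mul, ← this, ← intervalIntegral.integral_mul_const]
      congr 1; ext s; ring
    · have hfin : IsFiniteMeasure (volume.restrict (uIoc 0 h)) :=
        ⟨by rw [Measure.restrict_apply_univ, uIoc, Real.volume_Ioc]; exact ENNReal.ofReal_lt_top⟩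
      have hmeas : Measurable (Function.uncurry fun s x : ℝ => -(q (x - s) * ε (y + x))) := by
        unfold Function.uncurry; fun_prop
      rw [integrable_prod_iff hmeas.aestronglyMeasurable]
      refine ⟨ae_of_all _ fun s => (hqt s).neg, ?_⟩
      refine Integrable.of_bound
        hmeas.norm.stronglyMeasurable.integral_prod_right.aestronglyMeasurable (√v)⁻¹
        (ae_of_all _ fun s => ?_)
      rw [Real.norm_of_nonneg (integral_nonneg fun _ => norm_nonneg _)]
      simpa using hle s
  rw [key]
  have := intervalIntegral.norm_integral_le_of_norm_le_const (a := 0) (b := h)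
    (f := fun s => ∫ x, -(q (x - s) * ε (y + x))) (C := (√v)⁻¹) fun s _ => by
      refine (norm_integral_le_integral_norm _).trans ?_
      simpa using hle s
  simpa using this

lemma abs_smooth_le {v : ℝ≥0} {ε : ℝ → ℝ} (hb : ∀ x, |ε x| ≤ 1) (y : ℝ) :
    |smooth v ε y| ≤ 1 := by
  have : ‖∫ z, ε (y + z) ∂gaussianReal 0 v‖ ≤ 1 * (gaussianReal 0 v).real univ :=
    norm_integral_le_of_norm_le_const (ae_of_all _ fun z => hb _)
  simpa [smooth] using this

/-- The semigroup property of Gaussian convolution: variance can be spent in successive steps. -/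
lemma smooth_smooth {g : ℝ → ℝ} (hg : Measurable g) {C : ℝ}
    (hb : ∀ x, |g x| ≤ C * (1 + x ^ 2)) (v w : ℝ≥0) (y : ℝ) :
    smooth v (smooth w g) y = smooth (v + w) g y := by
  unfold smooth
  have hi := integrable_shift_gaussianReal hg hb (0 + 0) (v + w) y
  rw [← gaussianReal_conv_gaussianReal] at hi
  have h := integral_conv hi
  rw [gaussianReal_conv_gaussianReal, zero_add] at h
  rw [h]
  simp_rw [add_assoc]

lemma abs_prim_le_quad {ε : ℝ → ℝ} (hm : Measurable ε) (hb : ∀ x, |ε x| ≤ 1) (y : ℝ) :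
    |prim ε y| ≤ 1 * (1 + y ^ 2) := by
  have := abs_prim_le hm hb y
  nlinarith [sq_nonneg (|y| - 1), sq_abs y]

lemma abs_prim_prim_le_quad {ε : ℝ → ℝ} (hm : Measurable ε) (hb : ∀ x, |ε x| ≤ 1) (y : ℝ) :
    |prim (prim ε) y| ≤ 1 * (1 + y ^ 2) := by
  have := abs_prim_prim_le hm hb y
  linarith

lemma abs_le_quad {ε : ℝ → ℝ} (hb : ∀ x, |ε x| ≤ 1) (y : ℝ) : |ε y| ≤ 1 * (1 + y ^ 2) := by
  nlinarith [hb y, sq_nonneg y]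

/-- Gaussian smoothings of second antiderivatives are test functions. -/
lemma isTest_smooth {v : ℝ≥0} (hv : v ≠ 0) {ε : ℝ → ℝ} (hm : Measurable ε)
    (hb : ∀ x, |ε x| ≤ 1) :
    IsTest (√v)⁻¹ (√v) (smooth v (prim (prim ε))) (smooth v (prim ε)) (smooth v ε) := by
  refine isTest_of_integral (by positivity)
    (smooth_sub_eq_integral (continuous_prim hm hb).measurable
      (continuous_prim_prim hm hb).measurable (abs_prim_le_quad hm hb)
      (abs_prim_prim_le_quad hm hb) (prim_prim_sub hm hb) v)
    (smooth_sub_eq_integral hm (continuous_prim hm hb).measurable (abs_le_quad hb)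
      (abs_prim_le_quad hm hb) (prim_sub hm hb) v)
    (abs_smooth_sub_le hv hm hb) (abs_smooth_le hb) ?_
  refine le_trans ?_ (integral_abs_gaussianReal_le v)
  rw [smooth, ← Real.norm_eq_abs]
  refine (norm_integral_le_integral_norm _).trans (integral_mono ?_
    (integrable_id_gaussianReal 0 v).abs fun z => ?_)
  · exact (integrable_shift_gaussianReal (continuous_prim hm hb).measurable
      (abs_prim_le_quad hm hb) 0 v 0).norm
  · simpa using abs_prim_le hm hb z

/-- Second order expansion of a Gaussian smoothing of a test function. -/
lemma abs_smooth_sub_sub_le {L b : ℝ} {φ φ₁ φ₂ : ℝ → ℝ} (hφ : IsTest L b φ φ₁ φ₂)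
    (v : ℝ≥0) {y : ℝ} (hi : Integrable (fun z => φ (y + z)) (gaussianReal 0 v)) :
    |smooth v φ y - φ y - v * φ₂ y / 2| ≤ L * ∫ z, |z| ^ 3 ∂gaussianReal 0 v := by
  have i1 := integrable_id_gaussianReal 0 v
  have i2 := integrable_sq_gaussianReal 0 v
  have e : smooth v φ y - φ y - v * φ₂ y / 2 =
      ∫ z, (φ (y + z) - φ y - φ₁ y * z - φ₂ y * z ^ 2 / 2) ∂gaussianReal 0 v := by
    have i3 : Integrable (fun z => φ (y + z) - φ y) (gaussianReal 0 v) :=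
      hi.sub (integrable_const _)
    have i4 : Integrable (fun z => φ (y + z) - φ y - φ₁ y * z) (gaussianReal 0 v) :=
      i3.sub (i1.const_mul _)
    rw [integral_sub i4 ((i2.const_mul _).div_const _), integral_sub i3 (i1.const_mul _),
      integral_sub hi (integrable_const _), integral_div, integral_const_mul, integral_const_mul,
      integral_sq_gaussianReal, integral_id_gaussianReal]
    simp [smooth]
    ring
  rw [e, ← integral_const_mul, ← Real.norm_eq_abs]
  refine norm_integral_le_of_norm_le ((integrable_abs_cube_gaussianReal 0 v).const_mul L)
    (ae_of_all _ fun z => by simpa only [Real.norm_eq_abs] using hφ.taylor y z)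

/-! ### Joint measurability -/

/-- Test functions will depend on the conditioning variable, hence measurability jointly in the
parameter. The oriented integral is written as a difference of two integrals over measurable
sections. -/
lemma measurable_uncurry_prim {α : Type*} [MeasurableSpace α] {ε : α → ℝ → ℝ}
    (h : Measurable (Function.uncurry ε)) :
    Measurable (Function.uncurry fun a y => prim (ε a) y) := by
  have key : ∀ U : Set ((α × ℝ) × ℝ), MeasurableSet U →
      Measurable fun p : α × ℝ => ∫ x, U.indicator (fun q => ε q.1.1 q.2) (p, x) := by
    intro U hU
    have hm : Measurable fun q : (α × ℝ) × ℝ => ε q.1.1 q.2 :=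
      h.comp ((measurable_fst.comp measurable_fst).prodMk measurable_snd)
    exact ((hm.indicator hU).stronglyMeasurable.integral_prod_right'
      (ν := (volume : Measure ℝ))).measurable
  have e : (Function.uncurry fun a y => prim (ε a) y) = fun p : α × ℝ =>
      (∫ x, {q : (α × ℝ) × ℝ | 0 < q.2 ∧ q.2 ≤ q.1.2}.indicator (fun q => ε q.1.1 q.2) (p, x)) -
      ∫ x, {q : (α × ℝ) × ℝ | q.1.2 < q.2 ∧ q.2 ≤ 0}.indicator (fun q => ε q.1.1 q.2) (p, x) := by
    ext ⟨a, y⟩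
    simp only [Function.uncurry_apply_pair, prim, intervalIntegral]
    rw [← integral_indicator measurableSet_Ioc, ← integral_indicator measurableSet_Ioc]
    rfl
  rw [e]
  refine (key _ ?_).sub (key _ ?_)
  · exact (measurableSet_lt measurable_const measurable_snd).inter
      (measurableSet_le measurable_snd (measurable_snd.comp measurable_fst))
  · exact (measurableSet_lt (measurable_snd.comp measurable_fst) measurable_snd).inter
      (measurableSet_le measurable_snd measurable_const)

lemma measurable_uncurry_smooth {α : Type*} [MeasurableSpace α] {g : α → ℝ → ℝ}
    (h : Measurable (Function.uncurry g)) (v : ℝ≥0) :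
    Measurable (Function.uncurry fun a y => smooth v (g a) y) := by
  have hm : Measurable fun q : (α × ℝ) × ℝ => g q.1.1 (q.1.2 + q.2) :=
    h.comp ((measurable_fst.comp measurable_fst).prodMk
      ((measurable_snd.comp measurable_fst).add measurable_snd))
  exact (hm.stronglyMeasurable.integral_prod_right' (ν := gaussianReal 0 v)).measurable

/-! ### Linear functionals controlled on half-lines -/

/-- Functions monotonic on some interval and null elsewhere. -/
def IsPieceMono (g : ℝ → ℝ) : Prop :=
  ∃ I : Set ℝ, I.OrdConnected ∧ (MonotoneOn g I ∨ AntitoneOn g I) ∧ ∀ x ∉ I, g x = 0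

/-- Subconvex combinations of monotonic pieces bounded by `q`. -/
def MonComb (q : ℝ) (g : ℝ → ℝ) : Prop :=
  ∃ (L : ℕ) (a : Fin L → ℝ) (f : Fin L → ℝ → ℝ), ∑ l, |a l| ≤ 1 ∧
    (∀ l, IsPieceMono (f l) ∧ ∀ x, |f l x| ≤ q) ∧ g = fun x => ∑ l, a l * f l x

/-- A positive level is reached only inside the interval of monotonicity, and there superlevel sets
are intervals whatever the direction. For t ≤ 0 this fails, since the function vanishes outside. -/
lemma IsPieceMono.ordConnected_ge {g : ℝ → ℝ} (hg : IsPieceMono g) {t : ℝ} (ht : 0 < t) :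
    {x | t ≤ g x}.OrdConnected := by
  obtain ⟨I, hI, hm, h0⟩ := hg
  have hmem : ∀ x, t ≤ g x → x ∈ I := fun x hx => by
    by_contra h; rw [h0 x h] at hx; linarith
  refine ⟨fun x hx y hy z hz => ?_⟩
  have hxI := hmem x hx
  have hyI := hmem y hy
  have hzI := hI.out hxI hyI hz
  rcases hm with hm | hm
  · exact le_trans hx (hm hxI hzI hz.1)
  · exact le_trans hy (hm hzI hyI hz.2)

lemma IsPieceMono.neg {g : ℝ → ℝ} (hg : IsPieceMono g) : IsPieceMono fun x => - g x := by
  obtain ⟨I, hI, hm, h0⟩ := hg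
  refine ⟨I, hI, ?_, fun x hx => by simp [h0 x hx]⟩
  rcases hm with hm | hm
  · exact Or.inr fun x hx y hy h => neg_le_neg (hm hx hy h)
  · exact Or.inl fun x hx y hy h => neg_le_neg (hm hx hy h)

lemma IsPieceMono.comp {g : ℝ → ℝ} (hg : IsPieceMono g) {ψ : ℝ → ℝ} (hψ : Monotone ψ)
    (h0 : ψ 0 = 0) : IsPieceMono fun x => ψ (g x) := by
  obtain ⟨I, hI, hm, h0'⟩ := hg
  refine ⟨I, hI, ?_, fun x hx => by simp [h0' x hx, h0]⟩
  rcases hm with hm | hm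
  · exact Or.inl fun x hx y hy h => hψ (hm hx hy h)
  · exact Or.inr fun x hx y hy h => hψ (hm hx hy h)

lemma IsPieceMono.measurable {g : ℝ → ℝ} (hg : IsPieceMono g) : Measurable g := by
  refine measurable_of_Ici fun t => ?_
  rcases lt_or_ge 0 t with ht | ht
  · exact (hg.ordConnected_ge ht).measurableSet
  · have : g ⁻¹' Ici t = ⋂ n : ℕ, {x | -t + 1 / ((n : ℝ) + 1) ≤ - g x}ᶜ := by
      ext x
      simp only [mem_preimage, mem_Ici, mem_iInter, mem_compl_iff, mem_ofPred_eq, not_le]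
      constructor
      · intro h n
        have : 0 < 1 / ((n : ℝ) + 1) := by positivity
        linarith
      · intro h
        by_contra hc
        push Not at hc
        obtain ⟨n, hn⟩ := exists_nat_one_div_lt (show 0 < t - g x by linarith)
        linarith [h n]
    rw [this]
    exact MeasurableSet.iInter fun n => (hg.neg.ordConnected_ge (by
      have : 0 < 1 / ((n : ℝ) + 1) := by positivity
      linarith)).measurableSet.compl

lemma MonComb.measurable {q : ℝ} {g : ℝ → ℝ} (h : MonComb q g) : Measurable g := by
  obtain ⟨L, a, f, _, hf, rfl⟩ := h
  exact Finset.measurable_sum _ fun l _ => measurable_const.mul (hf l).1.measurable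

lemma MonComb.abs_le {q : ℝ} {g : ℝ → ℝ} (h : MonComb q g) (hq : 0 ≤ q) (x : ℝ) : |g x| ≤ q := by
  obtain ⟨L, a, f, ha, hf, rfl⟩ := h
  calc |∑ l, a l * f l x| ≤ ∑ l, |a l| * q := by
        refine (Finset.abs_sum_le_sum_abs _ _).trans (Finset.sum_le_sum fun l _ => ?_)
        rw [abs_mul]
        exact mul_le_mul_of_nonneg_left ((hf l).2 x) (abs_nonneg _)
    _ = (∑ l, |a l|) * q := by rw [Finset.sum_mul]
    _ ≤ q := mul_le_of_le_one_left hq ha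

lemma abs_indicator_one_le {T : Type*} (s : Set T) (z : T) :
    |s.indicator (fun _ => (1 : ℝ)) z| ≤ 1 := by
  by_cases h : z ∈ s <;> simp [h]

section Functional

variable {Ω : Type*} {mΩ : MeasurableSpace Ω} {P : Measure Ω} [IsProbabilityMeasure P]
  {y V : Ω → ℝ} {K A : ℝ}

lemma integrable_indicator_mul (hy : Measurable y) (hV : Measurable V) (hVb : ∀ ω, |V ω| ≤ K)
    {s : Set ℝ} (hs : MeasurableSet s) :
    Integrable (fun ω => s.indicator (fun _ => (1 : ℝ)) (y ω) * V ω) P := by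
  refine Integrable.of_bound (((measurable_const.indicator hs).comp hy).mul hV).aestronglyMeasurable
    K (ae_of_all _ fun ω => ?_)
  rw [norm_mul]
  exact (mul_le_of_le_one_left (norm_nonneg _) (abs_indicator_one_le _ _)).trans (hVb ω)

/-- A lower set of the line is empty, a closed or open half-line, or everything. Open half-lines are
limits of closed ones by dominated convergence; for the whole line the integral is zero because V
has mean zero. -/
lemma abs_integral_lowerSet_le (hy : Measurable y) (hV : Measurable V) (hVb : ∀ ω, |V ω| ≤ K)
    (hV0 : ∫ ω, V ω ∂P = 0)
    (hA : ∀ x, |∫ ω, (Iic x).indicator (fun _ => (1 : ℝ)) (y ω) * V ω ∂P| ≤ A)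
    {D : Set ℝ} (hD : IsLowerSet D) :
    |∫ ω, D.indicator (fun _ => (1 : ℝ)) (y ω) * V ω ∂P| ≤ A := by
  have hA0 : 0 ≤ A := (abs_nonneg _).trans (hA 0)
  rcases D.eq_empty_or_nonempty with rfl | hne
  · simpa using hA0
  by_cases hbd : BddAbove D
  · have hlt : ∀ x, x < sSup D → x ∈ D := fun x hx => by
      obtain ⟨z, hz, hxz⟩ := exists_lt_of_lt_csSup hne hx
      exact hD hxz.le hz
    by_cases hs : sSup D ∈ D
    · have : D = Iic (sSup D) := by
        ext x; exact ⟨fun h => le_csSup hbd h, fun h => hD h hs⟩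
      rw [this]; exact hA _
    · have : D = Iio (sSup D) := by
        ext x
        refine ⟨fun h => lt_of_le_of_ne (le_csSup hbd h) ?_, fun h => hlt x h⟩
        rintro rfl; exact hs h
      rw [this]
      set s := sSup D
      have hlim : Tendsto (fun n : ℕ => ∫ ω, (Iic (s - 1 / ((n : ℝ) + 1))).indicator
          (fun _ => (1 : ℝ)) (y ω) * V ω ∂P) atTop
          (𝓝 (∫ ω, (Iio s).indicator (fun _ => (1 : ℝ)) (y ω) * V ω ∂P)) := by
        refine tendsto_integral_of_dominated_convergence (fun _ => K)
          (fun n => (integrable_indicator_mul hy hV hVb measurableSet_Iic).aestronglyMeasurable)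
          (integrable_const _) (fun n => ae_of_all _ fun ω => ?_) (ae_of_all _ fun ω => ?_)
        · rw [norm_mul]
          exact (mul_le_of_le_one_left (norm_nonneg _) (abs_indicator_one_le _ _)).trans (hVb ω)
        · refine Tendsto.mul_const _ ?_
          by_cases h : y ω < s
          · rw [indicator_of_mem (show y ω ∈ Iio s from h)]
            refine tendsto_const_nhds.congr' ?_
            obtain ⟨N, hN⟩ := exists_nat_one_div_lt (show 0 < s - y ω by linarith)
            filter_upwards [eventually_ge_atTop N] with n hn
            rw [indicator_of_mem]
            have : 1 / ((n : ℝ) + 1) ≤ 1 / ((N : ℝ) + 1) := by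
              apply one_div_le_one_div_of_le (by positivity)
              have : (N : ℝ) ≤ n := by exact_mod_cast hn
              linarith
            simp only [mem_Iic]; linarith
          · rw [indicator_of_notMem (show y ω ∉ Iio s from h)]
            refine tendsto_const_nhds.congr fun n => ?_
            rw [indicator_of_notMem]
            have : 0 < 1 / ((n : ℝ) + 1) := by positivity
            simp only [mem_Iic, not_le]; linarith
      exact le_of_tendsto hlim.abs (Eventually.of_forall fun n => hA _)
  · have : D = univ := by
      rw [eq_univ_iff_forall]
      intro x
      rw [not_bddAbove_iff] at hbd
      obtain ⟨z, hz, hxz⟩ := hbd x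
      exact hD hxz.le hz
    rw [this]
    simpa [hV0] using hA0

/-- An interval is the difference of two nested lower sets: the points below some element of it,
with and without the interval itself. -/
lemma abs_integral_ordConnected_le (hy : Measurable y) (hV : Measurable V)
    (hVb : ∀ ω, |V ω| ≤ K) (hV0 : ∫ ω, V ω ∂P = 0)
    (hA : ∀ x, |∫ ω, (Iic x).indicator (fun _ => (1 : ℝ)) (y ω) * V ω ∂P| ≤ A)
    {J : Set ℝ} (hJ : J.OrdConnected) :
    |∫ ω, J.indicator (fun _ => (1 : ℝ)) (y ω) * V ω ∂P| ≤ 2 * A := by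
  set D₂ := {x | ∃ j ∈ J, x ≤ j}
  set D₁ := D₂ \ J
  have h2 : IsLowerSet D₂ := fun x z hzx ⟨j, hj, hxj⟩ => ⟨j, hj, hzx.trans hxj⟩
  have h1 : IsLowerSet D₁ := by
    rintro x z hzx ⟨hx, hxJ⟩
    refine ⟨h2 hzx hx, fun hz => hxJ ?_⟩
    obtain ⟨j, hj, hxj⟩ := hx
    exact hJ.out hz hj ⟨hzx, hxj⟩
  have hsub : J ⊆ D₂ := fun x hx => ⟨x, hx, le_rfl⟩
  have e : ∀ ω, J.indicator (fun _ => (1 : ℝ)) (y ω) * V ω =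
      D₂.indicator (fun _ => (1 : ℝ)) (y ω) * V ω - D₁.indicator (fun _ => (1 : ℝ)) (y ω) * V ω := by
    intro ω
    rw [← sub_mul]; congr 1
    by_cases hJ' : y ω ∈ J
    · have a1 : y ω ∉ D₁ := fun h => h.2 hJ'
      rw [indicator_of_mem hJ', indicator_of_mem (hsub hJ'), indicator_of_notMem a1]; ring
    · by_cases hd : y ω ∈ D₂
      · have a1 : y ω ∈ D₁ := ⟨hd, hJ'⟩
        rw [indicator_of_notMem hJ', indicator_of_mem hd, indicator_of_mem a1]; ring
      · have a1 : y ω ∉ D₁ := fun h => hd h.1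
        rw [indicator_of_notMem hJ', indicator_of_notMem hd, indicator_of_notMem a1]; ring
  simp_rw [e]
  rw [integral_sub
    (integrable_indicator_mul hy hV hVb h2.ordConnected.measurableSet)
    (integrable_indicator_mul hy hV hVb h1.ordConnected.measurableSet)]
  have b2 := abs_integral_lowerSet_le hy hV hVb hV0 hA h2
  have b1 := abs_integral_lowerSet_le hy hV hVb hV0 hA h1
  exact (abs_sub _ _).trans (by linarith)

lemma eq_integral_layer {q z : ℝ} (hz : |z| ≤ q) :
    z = ∫ t in Ioc 0 q, ((Ici t).indicator (fun _ => (1 : ℝ)) z -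
      (Ici t).indicator (fun _ => (1 : ℝ)) (-z)) := by
  have key : ∀ z : ℝ, |z| ≤ q → IntegrableOn (fun t => (Ici t).indicator (fun _ => (1 : ℝ)) z)
      (Ioc 0 q) ∧ ∫ t in Ioc 0 q, (Ici t).indicator (fun _ => (1 : ℝ)) z = max z 0 := by
    intro z hz
    have e : (fun t => (Ici t).indicator (fun _ => (1 : ℝ)) z) =
        (Iic z).indicator fun _ => (1 : ℝ) := by
      ext t; by_cases h : t ≤ z <;> simp [h]
    rw [e]
    refine ⟨(integrable_indicator_iff measurableSet_Iic).2 ?_, ?_⟩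
    · refine IntegrableOn.mono_measure (μ := volume.restrict (Ioc 0 q)) ?_ le_rfl
      have : IsFiniteMeasure (volume.restrict (Ioc 0 q)) :=
        ⟨by rw [Measure.restrict_apply_univ, Real.volume_Ioc]; exact ENNReal.ofReal_lt_top⟩
      exact (integrable_const (1 : ℝ)).integrableOn
    · rw [setIntegral_indicator measurableSet_Iic, setIntegral_const, smul_eq_mul, mul_one]
      have : Ioc 0 q ∩ Iic z = Ioc 0 z := by
        ext t; simp only [mem_inter_iff, mem_Ioc, mem_Iic]
        exact ⟨fun h => ⟨h.1.1, h.2⟩, fun h => ⟨⟨h.1, h.2.trans ((le_abs_self z).trans hz)⟩, h.2⟩⟩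
      rw [this, measureReal_def, Real.volume_Ioc, sub_zero, ENNReal.toReal_ofReal']
  obtain ⟨i1, e1⟩ := key z hz
  obtain ⟨i2, e2⟩ := key (-z) (by rwa [abs_neg])
  rw [integral_sub i1 i2, e1, e2]
  rcases le_total 0 z with h | h
  · rw [max_eq_left h, max_eq_right (by linarith)]; ring
  · rw [max_eq_right h, max_eq_left (by linarith)]; ring

/-- The function is integrated over its levels in (0, q]. At each level the superlevel sets of f and
of -f are intervals, each costing twice A. -/
lemma abs_integral_isPieceMono_le (hy : Measurable y) (hV : Measurable V)
    (hVb : ∀ ω, |V ω| ≤ K) (hV0 : ∫ ω, V ω ∂P = 0)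
    (hA : ∀ x, |∫ ω, (Iic x).indicator (fun _ => (1 : ℝ)) (y ω) * V ω ∂P| ≤ A)
    {q : ℝ} (hq : 0 ≤ q) {f : ℝ → ℝ} (hf : IsPieceMono f) (hfq : ∀ x, |f x| ≤ q) :
    |∫ ω, f (y ω) * V ω ∂P| ≤ 4 * q * A := by
  have hfm := hf.measurable
  set F : Ω → ℝ → ℝ := fun ω t => (Ici t).indicator (fun _ => (1 : ℝ)) (f (y ω)) * V ω -
      (Ici t).indicator (fun _ => (1 : ℝ)) (-f (y ω)) * V ω with hF
  have e1 : ∀ ω, f (y ω) * V ω = ∫ t in Ioc 0 q, F ω t := by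
    intro ω
    conv_lhs => rw [eq_integral_layer (hfq (y ω))]
    rw [← integral_mul_const]
    congr 1; ext t; simp only [hF]; ring
  have hfin : IsFiniteMeasure (volume.restrict (Ioc 0 q)) :=
    ⟨by rw [Measure.restrict_apply_univ, Real.volume_Ioc]; exact ENNReal.ofReal_lt_top⟩
  have hFm : Measurable (Function.uncurry F) := by
    have h1 : Measurable fun p : Ω × ℝ => (Ici p.2).indicator (fun _ => (1 : ℝ)) (f (y p.1)) := by
      have : (fun p : Ω × ℝ => (Ici p.2).indicator (fun _ => (1 : ℝ)) (f (y p.1))) =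
          {p : Ω × ℝ | p.2 ≤ f (y p.1)}.indicator fun _ => 1 := by
        ext p; simp [indicator]
      rw [this]
      exact measurable_const.indicator (measurableSet_le measurable_snd (by fun_prop))
    have h2 : Measurable fun p : Ω × ℝ =>
        (Ici p.2).indicator (fun _ => (1 : ℝ)) (- f (y p.1)) := by
      have : (fun p : Ω × ℝ => (Ici p.2).indicator (fun _ => (1 : ℝ)) (- f (y p.1))) =
          {p : Ω × ℝ | p.2 ≤ - f (y p.1)}.indicator fun _ => 1 := by
        ext p; simp [indicator]
      rw [this]
      exact measurable_const.indicator (measurableSet_le measurable_snd (by fun_prop))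
    exact (h1.mul (hV.comp measurable_fst)).sub (h2.mul (hV.comp measurable_fst))
  have hFi : Integrable (Function.uncurry F) (P.prod (volume.restrict (Ioc 0 q))) := by
    refine Integrable.of_bound hFm.aestronglyMeasurable (2 * K) (ae_of_all _ fun p => ?_)
    simp only [Function.uncurry, hF, Real.norm_eq_abs]
    have hK := hVb p.1
    refine (abs_sub _ _).trans ?_
    rw [abs_mul, abs_mul]
    have h1 := mul_le_of_le_one_left (abs_nonneg (V p.1)) (abs_indicator_one_le (Ici p.2) (f (y p.1)))
    have h2 := mul_le_of_le_one_left (abs_nonneg (V p.1)) (abs_indicator_one_le (Ici p.2) (-f (y p.1)))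
    linarith
  simp_rw [e1]
  rw [integral_integral_swap hFi]
  have hb : ∀ t ∈ Ioc 0 q, ‖∫ ω, F ω t ∂P‖ ≤ 4 * A := by
    intro t ht
    have s1 := hf.ordConnected_ge ht.1
    have s2 := hf.neg.ordConnected_ge ht.1
    have b1 := abs_integral_ordConnected_le hy hV hVb hV0 hA s1
    have b2 := abs_integral_ordConnected_le hy hV hVb hV0 hA s2
    have e : ∀ ω, F ω t = {x | t ≤ f x}.indicator (fun _ => (1 : ℝ)) (y ω) * V ω -
        {x | t ≤ - f x}.indicator (fun _ => (1 : ℝ)) (y ω) * V ω := fun ω => rfl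
    simp_rw [e]
    rw [integral_sub (integrable_indicator_mul hy hV hVb s1.measurableSet)
      (integrable_indicator_mul hy hV hVb s2.measurableSet)]
    rw [Real.norm_eq_abs]
    exact (abs_sub _ _).trans (by linarith)
  have := norm_setIntegral_le_of_norm_le_const (μ := volume) (s := Ioc 0 q)
    (by rw [Real.volume_Ioc]; exact ENNReal.ofReal_lt_top) hb
  rw [Real.volume_real_Ioc_of_le hq, sub_zero] at this
  calc _ ≤ _ := this
    _ = _ := by ring

lemma abs_integral_monComb_le (hy : Measurable y) (hV : Measurable V)
    (hVb : ∀ ω, |V ω| ≤ K) (hV0 : ∫ ω, V ω ∂P = 0)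
    (hA : ∀ x, |∫ ω, (Iic x).indicator (fun _ => (1 : ℝ)) (y ω) * V ω ∂P| ≤ A)
    {q : ℝ} (hq : 0 ≤ q) {g : ℝ → ℝ} (hg : MonComb q g) :
    |∫ ω, g (y ω) * V ω ∂P| ≤ 4 * q * A := by
  have hA0 : 0 ≤ A := (abs_nonneg _).trans (hA 0)
  obtain ⟨L, a, f, ha, hf, rfl⟩ := hg
  have hi : ∀ l, Integrable (fun ω => a l * (f l (y ω) * V ω)) P := fun l => by
    refine Integrable.const_mul (Integrable.of_bound
      (((hf l).1.measurable.comp hy).mul hV).aestronglyMeasurable (q * K)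
      (ae_of_all _ fun ω => ?_)) _
    rw [Pi.mul_apply, norm_mul]
    exact mul_le_mul ((hf l).2 _) (hVb ω) (norm_nonneg _) hq
  have e : ∀ ω, (∑ l, a l * f l (y ω)) * V ω = ∑ l, a l * (f l (y ω) * V ω) := fun ω => by
    rw [Finset.sum_mul]; exact Finset.sum_congr rfl fun l _ => by ring
  simp_rw [e]
  rw [integral_finsetSum _ fun l _ => hi l]
  calc |∑ l, ∫ ω, a l * (f l (y ω) * V ω) ∂P| ≤ ∑ l, |a l| * (4 * q * A) := by
        refine (Finset.abs_sum_le_sum_abs _ _).trans (Finset.sum_le_sum fun l _ => ?_)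
        rw [integral_const_mul, abs_mul]
        exact mul_le_mul_of_nonneg_left
          (abs_integral_isPieceMono_le hy hV hVb hV0 hA hq (hf l).1 (hf l).2) (abs_nonneg _)
    _ = (∑ l, |a l|) * (4 * q * A) := by rw [Finset.sum_mul]
    _ ≤ _ := mul_le_of_le_one_left (by positivity) ha

end Functional

/-! ### Bounded random variables -/

/-- Bounded measurable functions. -/
def BddMeas {T : Type*} [MeasurableSpace T] (X : T → ℝ) : Prop :=
  Measurable X ∧ ∃ K, ∀ x, |X x| ≤ K

section Bdd

variable {Ω : Type*} {mΩ : MeasurableSpace Ω} {P : Measure Ω} [IsProbabilityMeasure P]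
  {X Z W : Ω → ℝ}

lemma BddMeas.integrable (hX : BddMeas X) : Integrable X P := by
  obtain ⟨hm, K, hK⟩ := hX
  exact Integrable.of_bound hm.aestronglyMeasurable K (ae_of_all _ hK)

lemma BddMeas.const (c : ℝ) : BddMeas fun _ : Ω => c := ⟨measurable_const, |c|, fun _ => le_rfl⟩

lemma BddMeas.add (hX : BddMeas X) (hZ : BddMeas Z) : BddMeas fun ω => X ω + Z ω := by
  obtain ⟨hm, K, hK⟩ := hX
  obtain ⟨hm', K', hK'⟩ := hZ
  exact ⟨hm.add hm', K + K', fun x => (abs_add_le _ _).trans (add_le_add (hK x) (hK' x))⟩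

lemma BddMeas.sub (hX : BddMeas X) (hZ : BddMeas Z) : BddMeas fun ω => X ω - Z ω := by
  obtain ⟨hm, K, hK⟩ := hX
  obtain ⟨hm', K', hK'⟩ := hZ
  exact ⟨hm.sub hm', K + K', fun x => (abs_sub _ _).trans (add_le_add (hK x) (hK' x))⟩

lemma BddMeas.mul (hX : BddMeas X) (hZ : BddMeas Z) : BddMeas fun ω => X ω * Z ω := by
  obtain ⟨hm, K, hK⟩ := hX
  obtain ⟨hm', K', hK'⟩ := hZ
  refine ⟨hm.mul hm', K * K', fun x => ?_⟩
  rw [abs_mul]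
  exact mul_le_mul (hK x) (hK' x) (abs_nonneg _) ((abs_nonneg _).trans (hK x))

lemma BddMeas.pow (hX : BddMeas X) (n : ℕ) : BddMeas fun ω => X ω ^ n := by
  obtain ⟨hm, K, hK⟩ := hX
  exact ⟨hm.pow_const n, K ^ n, fun x => by
    rw [abs_pow]; exact pow_le_pow_left₀ (abs_nonneg _) (hK x) n⟩

lemma BddMeas.abs (hX : BddMeas X) : BddMeas fun ω => |X ω| := by
  obtain ⟨hm, K, hK⟩ := hX
  exact ⟨hm.abs, K, fun x => by rw [abs_abs]; exact hK x⟩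

lemma BddMeas.centered (hX : BddMeas X) : BddMeas (WeakDep.centered P X) :=
  hX.sub (BddMeas.const _)

lemma BddMeas.comp {T : Type*} [MeasurableSpace T] {g : T → ℝ} (hg : BddMeas g) {y : Ω → T}
    (hy : Measurable y) : BddMeas fun ω => g (y ω) := by
  obtain ⟨hm, K, hK⟩ := hg
  exact ⟨hm.comp hy, K, fun x => hK _⟩

lemma bddMeas_indicator {s : Set ℝ} (hs : MeasurableSet s) :
    BddMeas (s.indicator fun _ => (1 : ℝ)) :=
  ⟨measurable_const.indicator hs, 1, fun _ => abs_indicator_one_le _ _⟩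

lemma MonComb.bddMeas {q : ℝ} {g : ℝ → ℝ} (h : MonComb q g) (hq : 0 ≤ q) : BddMeas g :=
  ⟨h.measurable, q, h.abs_le hq⟩

lemma integral_centered (hX : Integrable X P) : ∫ ω, centered P X ω ∂P = 0 := by
  unfold centered
  rw [integral_sub hX (integrable_const _)]; simp

lemma integral_mul_centered_comm (hX : BddMeas X) (hW : BddMeas W) :
    ∫ ω, W ω * centered P X ω ∂P = ∫ ω, X ω * centered P W ω ∂P := by
  unfold centered
  simp_rw [mul_sub]
  rw [integral_sub (hW.mul hX).integrable (hW.mul (BddMeas.const _)).integrable,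
    integral_sub (hX.mul hW).integrable (hX.mul (BddMeas.const _)).integrable,
    integral_mul_const, integral_mul_const, mul_comm (∫ ω, W ω ∂P)]
  congr 2; ext ω; ring

/-- Centring is self-adjoint, so a doubly centred expression can be read as a linear functional of X
alone, paired with a variable of mean zero. In this form the functional bounds for monotonic pieces
apply to one factor at a time. -/
lemma integral_mul_centered_mul (hX : BddMeas X) (hZ : BddMeas Z) (hW : BddMeas W) :
    ∫ ω, W ω * centered P (fun ω => centered P X ω * Z ω) ω ∂P =
      ∫ ω, X ω * centered P (fun ω => Z ω * centered P W ω) ω ∂P := by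
  have hX' : BddMeas (centered P X) := hX.centered
  have hW' : BddMeas (centered P W) := hW.centered
  rw [integral_mul_centered_comm (hX'.mul hZ) hW,
    ← integral_mul_centered_comm hX (hZ.mul hW')]
  congr 1; ext ω; ring

end Bdd

/-! ### The mixing hypothesis -/

/-- A process adapted to a filtration, pairwise stationary, whose dependence on the past is
controlled by the rate `a` for single and pairs of half-lines. -/
structure MixSetting {Ω : Type*} [mΩ : MeasurableSpace Ω] (P : Measure Ω) (Y : ℕ → Ω → ℝ)
    (ℱ : ℕ → MeasurableSpace Ω) (a : ℕ → ℝ) : Prop where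
  le : ∀ i, ℱ i ≤ mΩ
  mono : Monotone ℱ
  meas : ∀ i, Measurable[ℱ i] (Y i)
  nonneg : ∀ p, 0 ≤ a p
  le_one : ∀ p, a p ≤ 1
  pair : ∀ i j k, P.map (fun ω => (Y (i + j) ω, Y (i + k) ω)) = P.map (fun ω => (Y j ω, Y k ω))
  mix1 : ∀ i p k, 1 ≤ p → i + p ≤ k → ∀ W : Ω → ℝ, Measurable[ℱ i] W → (∀ ω, |W ω| ≤ 1) → ∀ x,
    |∫ ω, W ω * centered P (fun ω => (Iic x).indicator (fun _ => (1 : ℝ)) (Y k ω)) ω ∂P| ≤ 2 * a p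
  mix2 : ∀ i p k l, 1 ≤ p → i + p ≤ k → i + p ≤ l → ∀ W : Ω → ℝ, Measurable[ℱ i] W →
    (∀ ω, |W ω| ≤ 1) → ∀ x z,
    |∫ ω, W ω * centered P (fun ω =>
        centered P (fun ω => (Iic x).indicator (fun _ => (1 : ℝ)) (Y k ω)) ω *
        centered P (fun ω => (Iic z).indicator (fun _ => (1 : ℝ)) (Y l ω)) ω) ω ∂P| ≤ 2 * a p

namespace MixSetting

variable {Ω : Type*} {mΩ : MeasurableSpace Ω} {P : Measure Ω} [IsProbabilityMeasure P]
  {Y : ℕ → Ω → ℝ} {ℱ : ℕ → MeasurableSpace Ω} {a : ℕ → ℝ}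

lemma measurable (hS : MixSetting P Y ℱ a) (i : ℕ) : Measurable (Y i) :=
  (hS.meas i).mono (hS.le i) le_rfl

lemma map_eq (hS : MixSetting P Y ℱ a) (k : ℕ) : P.map (Y k) = P.map (Y 0) := by
  have h := congrArg (fun ν => ν.map Prod.fst) (hS.pair k 0 0)
  simp only [add_zero] at h
  rwa [Measure.map_map measurable_fst ((hS.measurable _).prodMk (hS.measurable _)),
    Measure.map_map measurable_fst ((hS.measurable _).prodMk (hS.measurable _))] at h

lemma abs_integral_le_of_scale {F : MeasurableSpace Ω} {Φ : (Ω → ℝ) → ℝ} {A b : ℝ} (hb : 0 ≤ b)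
    (hΦ : ∀ (c : ℝ) (W : Ω → ℝ), Φ (fun ω => c * W ω) = c * Φ W)
    (h1 : ∀ W, Measurable[F] W → (∀ ω, |W ω| ≤ 1) → |Φ W| ≤ A) {W : Ω → ℝ}
    (hW : Measurable[F] W) (hWb : ∀ ω, |W ω| ≤ b) : |Φ W| ≤ b * A := by
  rcases hb.eq_or_lt with rfl | hb'
  · have : W = fun ω => 0 * W ω := by
      ext ω; simpa using abs_nonpos_iff.1 (hWb ω)
    rw [this, hΦ]; simp
  · have : W = fun ω => b * (b⁻¹ * W ω) := by
      ext ω; field_simp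
    rw [this, hΦ, abs_mul, abs_of_nonneg hb]
    refine mul_le_mul_of_nonneg_left (h1 _ (hW.const_mul _) fun ω => ?_) hb
    rw [abs_mul, abs_inv, abs_of_nonneg hb, inv_mul_le_one₀ hb']
    exact hWb ω

/-- Here 8 = 4 · 2: the factor 4 passes from half-lines to monotonic pieces and the 2 is in the
mixing hypothesis. -/
lemma abs_integral_mul_le (hS : MixSetting P Y ℱ a) {i p k : ℕ} (hp : 1 ≤ p) (hk : i + p ≤ k)
    {W : Ω → ℝ} (hW : Measurable[ℱ i] W) {b : ℝ} (hb : 0 ≤ b) (hWb : ∀ ω, |W ω| ≤ b)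
    {q : ℝ} (hq : 0 ≤ q) {g : ℝ → ℝ} (hg : MonComb q g) :
    |∫ ω, W ω * centered P (fun ω => g (Y k ω)) ω ∂P| ≤ 8 * (b * q * a p) := by
  have hWm : BddMeas W := ⟨hW.mono (hS.le i) le_rfl, b, hWb⟩
  have hyk := hS.measurable k
  rw [integral_mul_centered_comm ((hg.bddMeas hq).comp hyk) hWm]
  obtain ⟨hVm, K, hK⟩ := hWm.centered (P := P)
  have := abs_integral_monComb_le (P := P) (A := b * (2 * a p)) hyk hVm hK
    (integral_centered hWm.integrable) (fun x => by
      rw [← integral_mul_centered_comm ((bddMeas_indicator measurableSet_Iic).comp hyk) hWm]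
      refine abs_integral_le_of_scale (F := ℱ i) (Φ := fun W => ∫ ω, W ω * centered P
        (fun ω => (Iic x).indicator (fun _ => (1 : ℝ)) (Y k ω)) ω ∂P) hb (fun c W => ?_)
        (fun W h h' => hS.mix1 i p k hp hk W h h' x) hW hWb
      rw [← integral_const_mul]; congr 1; ext ω; ring) hq hg
  linarith

/-- Two passes of the functional bound: with a half-line kept at time l the half-line at time k is
replaced by g, then the one at time l. Each pass multiplies the bound by 4q. -/
lemma abs_integral_mul_mul_le (hS : MixSetting P Y ℱ a) {i p k l : ℕ} (hp : 1 ≤ p)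
    (hk : i + p ≤ k) (hl : i + p ≤ l)
    {W : Ω → ℝ} (hW : Measurable[ℱ i] W) {b : ℝ} (hb : 0 ≤ b) (hWb : ∀ ω, |W ω| ≤ b)
    {q : ℝ} (hq : 0 ≤ q) {g : ℝ → ℝ} (hg : MonComb q g) :
    |∫ ω, W ω * centered P (fun ω => centered P (fun ω => g (Y k ω)) ω *
      centered P (fun ω => g (Y l ω)) ω) ω ∂P| ≤ 32 * (b * q ^ 2 * a p) := by
  have hWm : BddMeas W := ⟨hW.mono (hS.le i) le_rfl, b, hWb⟩
  have hyk := hS.measurable k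
  have hyl := hS.measurable l
  have hgk := (hg.bddMeas hq).comp hyk
  have hgl := (hg.bddMeas hq).comp hyl
  have ik : ∀ x, BddMeas fun ω => (Iic x).indicator (fun _ => (1 : ℝ)) (Y k ω) := fun x =>
    (bddMeas_indicator measurableSet_Iic).comp hyk
  have il : ∀ x, BddMeas fun ω => (Iic x).indicator (fun _ => (1 : ℝ)) (Y l ω) := fun x =>
    (bddMeas_indicator measurableSet_Iic).comp hyl
  have step1 : ∀ z, |∫ ω, W ω * centered P (fun ω => centered P (fun ω => g (Y k ω)) ω *
      centered P (fun ω => (Iic z).indicator (fun _ => (1 : ℝ)) (Y l ω)) ω) ω ∂P| ≤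
      4 * q * (b * (2 * a p)) := by
    intro z
    rw [integral_mul_centered_mul hgk (il z).centered hWm]
    obtain ⟨hVm, K, hK⟩ :=
      (((il z).centered (P := P)).mul (hWm.centered (P := P))).centered (P := P)
    refine abs_integral_monComb_le (P := P) hyk hVm hK (integral_centered
      (((il z).centered (P := P)).mul (hWm.centered (P := P))).integrable) (fun x => ?_) hq hg
    rw [← integral_mul_centered_mul (ik x) (il z).centered hWm]
    refine abs_integral_le_of_scale (F := ℱ i) (Φ := fun W => ∫ ω, W ω * centered P (fun ω =>
        centered P (fun ω => (Iic x).indicator (fun _ => (1 : ℝ)) (Y k ω)) ω *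
        centered P (fun ω => (Iic z).indicator (fun _ => (1 : ℝ)) (Y l ω)) ω) ω ∂P) hb
        (fun c W => ?_) (fun W h h' => hS.mix2 i p k l hp hk hl W h h' x z) hW hWb
    rw [← integral_const_mul]; congr 1; ext ω; ring
  have hcomm : ∀ g' : Ω → ℝ, ∀ g'' : Ω → ℝ,
      (fun ω => centered P g' ω * centered P g'' ω) = fun ω => centered P g'' ω * centered P g' ω :=
    fun g' g'' => by ext ω; ring
  rw [hcomm, integral_mul_centered_mul hgl hgk.centered hWm]
  obtain ⟨hVm, K, hK⟩ :=
      ((hgk.centered (P := P)).mul (hWm.centered (P := P))).centered (P := P)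
  have := abs_integral_monComb_le (P := P) (A := 4 * q * (b * (2 * a p))) hyl hVm hK
    (integral_centered ((hgk.centered (P := P)).mul (hWm.centered (P := P))).integrable)
    (fun x => by
      rw [← integral_mul_centered_mul (il x) hgk.centered hWm, hcomm]; exact step1 x) hq hg
  linarith

end MixSetting

/-! ### Truncation -/

/-- The truncated moments `∫₀¹ (B(u) - q)₊^j du`. -/
def tailMoment (B : ℝ → ℝ) (q : ℝ) (j : ℕ) : ℝ := ∫ u in Ioo (0 : ℝ) 1, max (B u - q) 0 ^ j

lemma tailMoment_nonneg (B : ℝ → ℝ) (q : ℝ) (j : ℕ) : 0 ≤ tailMoment B q j :=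
  integral_nonneg fun _ => pow_nonneg (le_max_right _ _) _

/-- Functions that are, at each level `q`, subconvex combinations of monotonic pieces bounded by `q`
up to a remainder with the moments of `(B - q)₊`. -/
structure Ctrl (μ : Measure ℝ) (B h : ℝ → ℝ) : Prop where
  bdd : BddMeas h
  split : ∀ q, 0 ≤ q → ∃ g ρ : ℝ → ℝ, MonComb q g ∧ BddMeas ρ ∧ (∀ x, 0 ≤ ρ x) ∧
    (∀ x, |h x - g x| ≤ ρ x) ∧ ∀ j ∈ Finset.Icc 1 3, ∫ x, ρ x ^ j ∂μ ≤ tailMoment B q j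

section Remainder

variable {Ω : Type*} {mΩ : MeasurableSpace Ω} {P : Measure Ω} [IsProbabilityMeasure P]
  {B : ℝ → ℝ} {q : ℝ}

/-- Nonnegative bounded variables with moments controlled by those of `2 (B - q)₊`. -/
structure IsRem (P : Measure Ω) (B : ℝ → ℝ) (q : ℝ) (ρ : Ω → ℝ) : Prop where
  bdd : BddMeas ρ
  nonneg : ∀ ω, 0 ≤ ρ ω
  moment : ∀ j ∈ Finset.Icc 1 3, ∫ ω, ρ ω ^ j ∂P ≤ 2 ^ j * tailMoment B q j

lemma integral_pow_le_integral_pow {ρ : Ω → ℝ} (hρ : BddMeas ρ) (h0 : ∀ ω, 0 ≤ ρ ω) (j : ℕ) :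
    (∫ ω, ρ ω ∂P) ^ j ≤ ∫ ω, ρ ω ^ j ∂P :=
  ConvexOn.map_integral_le (μ := P) (f := ρ) (g := fun x : ℝ => x ^ j) (s := Ici 0)
    (convexOn_pow j) (by fun_prop) isClosed_Ici (ae_of_all _ h0) hρ.integrable (hρ.pow j).integrable

lemma IsRem.const {ρ : Ω → ℝ} (h : IsRem P B q ρ) : IsRem P B q fun _ => ∫ ω, ρ ω ∂P where
  bdd := BddMeas.const _
  nonneg _ := integral_nonneg h.nonneg
  moment j hj := by
    rw [integral_const]
    simpa using (integral_pow_le_integral_pow h.bdd h.nonneg j).trans (h.moment j hj)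

/-- The leading term 4q² is displayed separately because the covariance estimates subtract it:
replacing variables by their parts below the level q costs only the terms carrying a tail moment. -/
lemma integral_quad_le {ρ : Ω → ℝ} (h : IsRem P B q ρ) (hq : 0 ≤ q) :
    ∫ ω, (2 * q + ρ ω) ^ 2 ∂P ≤ 4 * q ^ 2 + 8 * q * tailMoment B q 1 + 4 * tailMoment B q 2 := by
  have m1 := h.moment 1 (by simp)
  have m2 := h.moment 2 (by simp)
  simp only [pow_one] at m1
  have e : ∀ ω, (2 * q + ρ ω) ^ 2 = 4 * q ^ 2 + 4 * q * ρ ω + ρ ω ^ 2 := fun ω => by ring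
  simp_rw [e]
  rw [integral_add ((BddMeas.const _).add ((BddMeas.const _).mul h.bdd)).integrable
    (h.bdd.pow 2).integrable, integral_add (BddMeas.const _).integrable
    ((BddMeas.const _).mul h.bdd).integrable, integral_const_mul (4 * q) ρ]
  simp only [integral_const, probReal_univ, one_smul]
  nlinarith

lemma integral_cube_le {ρ : Ω → ℝ} (h : IsRem P B q ρ) (hq : 0 ≤ q) :
    ∫ ω, (2 * q + ρ ω) ^ 3 ∂P ≤ 8 * q ^ 3 +
      24 * (q ^ 2 * tailMoment B q 1 + q * tailMoment B q 2 + tailMoment B q 3) := by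
  have m1 := h.moment 1 (by simp)
  have m2 := h.moment 2 (by simp)
  have m3 := h.moment 3 (by simp)
  have t3 := tailMoment_nonneg B q 3
  simp only [pow_one] at m1
  have e : ∀ ω, (2 * q + ρ ω) ^ 3 = 8 * q ^ 3 + 12 * q ^ 2 * ρ ω + 6 * q * ρ ω ^ 2 + ρ ω ^ 3 :=
    fun ω => by ring
  simp_rw [e]
  have i1 := (BddMeas.const (Ω := Ω) (12 * q ^ 2)).mul h.bdd
  have i2 := (BddMeas.const (Ω := Ω) (6 * q)).mul (h.bdd.pow 2)
  rw [integral_add ((((BddMeas.const _).add i1).add i2).integrable) (h.bdd.pow 3).integrable,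
    integral_add ((BddMeas.const _).add i1).integrable i2.integrable,
    integral_add (BddMeas.const _).integrable i1.integrable, integral_const_mul (12 * q ^ 2) ρ,
    integral_const_mul (6 * q) fun ω => ρ ω ^ 2]
  simp only [integral_const, probReal_univ, one_smul]
  nlinarith [mul_le_mul_of_nonneg_left m1 (sq_nonneg q), mul_le_mul_of_nonneg_left m2 hq]

lemma integral_mul_le {ρ₁ ρ₂ : Ω → ℝ} (h₁ : IsRem P B q ρ₁) (h₂ : IsRem P B q ρ₂) (hq : 0 ≤ q) :
    ∫ ω, (2 * q + ρ₁ ω) * (2 * q + ρ₂ ω) ∂P ≤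
      4 * q ^ 2 + 8 * q * tailMoment B q 1 + 4 * tailMoment B q 2 := by
  have b := fun (ρ : Ω → ℝ) (h : IsRem P B q ρ) => (BddMeas.const (Ω := Ω) (2 * q)).add h.bdd
  have h3 : ∫ ω, (2 * q + ρ₁ ω) * (2 * q + ρ₂ ω) ∂P ≤
      ∫ ω, ((2 * q + ρ₁ ω) ^ 2 + (2 * q + ρ₂ ω) ^ 2) / 2 ∂P :=
    integral_mono ((b _ h₁).mul (b _ h₂)).integrable
      ((((b _ h₁).pow 2).add ((b _ h₂).pow 2)).integrable.div_const 2) fun ω => by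
        nlinarith [sq_nonneg (ρ₁ ω - ρ₂ ω)]
  rw [integral_div, integral_add ((b _ h₁).pow 2).integrable ((b _ h₂).pow 2).integrable] at h3
  linarith [integral_quad_le h₁ hq, integral_quad_le h₂ hq]

/-- The arithmetic-geometric mean inequality for three cubes, from the factorisation of x³ + y³ + z³
- 3xyz. -/
lemma mul_mul_le_cubes {x y z : ℝ} (hx : 0 ≤ x) (hy : 0 ≤ y) (hz : 0 ≤ z) :
    x * y * z ≤ (x ^ 3 + y ^ 3 + z ^ 3) / 3 := by
  nlinarith [mul_nonneg (add_nonneg (add_nonneg hx hy) hz)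
    (add_nonneg (add_nonneg (sq_nonneg (x - y)) (sq_nonneg (y - z))) (sq_nonneg (z - x)))]

lemma integral_mul_mul_le {ρ₁ ρ₂ ρ₃ : Ω → ℝ} (h₁ : IsRem P B q ρ₁) (h₂ : IsRem P B q ρ₂)
    (h₃ : IsRem P B q ρ₃) (hq : 0 ≤ q) :
    ∫ ω, (2 * q + ρ₁ ω) * (2 * q + ρ₂ ω) * (2 * q + ρ₃ ω) ∂P ≤ 8 * q ^ 3 +
      24 * (q ^ 2 * tailMoment B q 1 + q * tailMoment B q 2 + tailMoment B q 3) := by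
  have b := fun (ρ : Ω → ℝ) (h : IsRem P B q ρ) => (BddMeas.const (Ω := Ω) (2 * q)).add h.bdd
  have p := fun (ρ : Ω → ℝ) (h : IsRem P B q ρ) (ω : Ω) =>
    add_nonneg (mul_nonneg zero_le_two hq) (h.nonneg ω)
  have h4 : ∫ ω, (2 * q + ρ₁ ω) * (2 * q + ρ₂ ω) * (2 * q + ρ₃ ω) ∂P ≤
      ∫ ω, ((2 * q + ρ₁ ω) ^ 3 + (2 * q + ρ₂ ω) ^ 3 + (2 * q + ρ₃ ω) ^ 3) / 3 ∂P :=
    integral_mono (((b _ h₁).mul (b _ h₂)).mul (b _ h₃)).integrable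
      (((((b _ h₁).pow 3).add ((b _ h₂).pow 3)).add ((b _ h₃).pow 3)).integrable.div_const 3)
      fun ω => mul_mul_le_cubes (p _ h₁ ω) (p _ h₂ ω) (p _ h₃ ω)
  rw [integral_div, integral_add (((b _ h₁).pow 3).add ((b _ h₂).pow 3)).integrable
    ((b _ h₃).pow 3).integrable, integral_add ((b _ h₁).pow 3).integrable
    ((b _ h₂).pow 3).integrable] at h4
  linarith [integral_cube_le h₁ hq, integral_cube_le h₂ hq, integral_cube_le h₃ hq]

end Remainder

/-! ### Covariance inequalities -/

/-- Truncation at levels `±c`. -/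
def clip (c w : ℝ) : ℝ := max (-c) (min w c)

lemma abs_clip_le {c : ℝ} (hc : 0 ≤ c) (w : ℝ) : |clip c w| ≤ c :=
  abs_le.2 ⟨le_max_left _ _, max_le (by linarith) (min_le_right _ _)⟩

lemma abs_sub_clip_le {c w y : ℝ} (hy : 0 ≤ y) (h : |w| ≤ c + y) : |w - clip c w| ≤ y := by
  rw [abs_le] at *
  unfold clip
  constructor
  · rcases le_total w c with h' | h'
    · rw [min_eq_left h']; rcases max_cases (-c) w with ⟨e, _⟩ | ⟨e, _⟩ <;> rw [e] <;> linarith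
    · rw [min_eq_right h']; rcases max_cases (-c) c with ⟨e, _⟩ | ⟨e, _⟩ <;> rw [e] <;> linarith
  · rcases le_total w c with h' | h'
    · rw [min_eq_left h']; rcases max_cases (-c) w with ⟨e, _⟩ | ⟨e, _⟩ <;> rw [e] <;> linarith
    · rw [min_eq_right h']; rcases max_cases (-c) c with ⟨e, _⟩ | ⟨e, _⟩ <;> rw [e] <;> linarith

lemma abs_clip_le_abs {c : ℝ} (hc : 0 ≤ c) (w : ℝ) : |clip c w| ≤ |w| := by
  unfold clip
  rcases le_total w c with h' | h'
  · rw [min_eq_left h']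
    rcases max_cases (-c) w with ⟨e, h⟩ | ⟨e, h⟩ <;> rw [e]
    rw [abs_neg, abs_of_nonneg hc, abs_of_nonpos (by linarith)]; linarith
  · rw [min_eq_right h', max_eq_right (by linarith), abs_of_nonneg hc]
    exact h'.trans (le_abs_self w)

lemma monotone_clip (c : ℝ) : Monotone (clip c) := fun _ _ h =>
  max_le_max le_rfl (min_le_min h le_rfl)

lemma clip_zero {c : ℝ} (hc : 0 ≤ c) : clip c 0 = 0 := by
  simp [clip, hc]

lemma measurable_clip (c : ℝ) : Measurable (clip c) := (monotone_clip c).measurable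

lemma bddMeas_clip {Ω : Type*} {mΩ : MeasurableSpace Ω} {c : ℝ} (hc : 0 ≤ c) {W : Ω → ℝ}
    (hW : Measurable W) : BddMeas fun ω => clip c (W ω) :=
  ⟨(measurable_clip c).comp hW, c, fun _ => abs_clip_le hc _⟩

/-- Variables which, at each level `q`, are at most `2 q` up to a remainder. -/
def IsEnv {Ω : Type*} {mΩ : MeasurableSpace Ω} (P : Measure Ω) (B : ℝ → ℝ) (U : Ω → ℝ) : Prop :=
  ∀ q, 0 ≤ q → ∃ ρ, IsRem P B q ρ ∧ ∀ ω, |U ω| ≤ 2 * q + ρ ω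

section Mixing

variable {Ω : Type*} {mΩ : MeasurableSpace Ω} {P : Measure Ω} [IsProbabilityMeasure P]
  {Y : ℕ → Ω → ℝ} {ℱ : ℕ → MeasurableSpace Ω} {a : ℕ → ℝ} {B h : ℝ → ℝ}

lemma abs_integral_le_of_abs_le {X R : Ω → ℝ} (hR : Integrable R P) (h : ∀ ω, |X ω| ≤ R ω) :
    |∫ ω, X ω ∂P| ≤ ∫ ω, R ω ∂P := by
  rw [← Real.norm_eq_abs]; exact norm_integral_le_of_norm_le hR (ae_of_all _ h)

lemma abs_centered_le {X : Ω → ℝ} {q : ℝ} (hb : ∀ ω, |X ω| ≤ q) (ω : Ω) :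
    |centered P X ω| ≤ 2 * q := by
  have : |∫ ω, X ω ∂P| ≤ q := by
    have h0 : ‖∫ ω, X ω ∂P‖ ≤ q * P.real univ := norm_integral_le_of_norm_le_const (ae_of_all _ hb)
    simpa using h0
  unfold centered
  linarith [abs_sub (X ω) (∫ ω, X ω ∂P), hb ω]

/-- The mean of an enveloped variable is enveloped by the mean of the remainder, whose moments are
smaller by Jensen. This treats products of expectations like expectations of products. -/
lemma IsEnv.const {U : Ω → ℝ} (hU : IsEnv P B U) (hUb : BddMeas U) :
    IsEnv P B fun _ => ∫ ω, |U ω| ∂P := by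
  intro q hq
  obtain ⟨ρ, hρ, hle⟩ := hU q hq
  refine ⟨_, hρ.const, fun _ => ?_⟩
  rw [abs_of_nonneg (integral_nonneg fun _ => abs_nonneg _)]
  have := integral_mono hUb.abs.integrable ((BddMeas.const (2 * q)).add hρ.bdd).integrable
    (μ := P) hle
  rwa [integral_add (integrable_const _) hρ.bdd.integrable, integral_const, probReal_univ,
    one_smul] at this

/-- One bounded combination g serves at all times by stationarity. Centring adds the mean of the
remainder to the remainder; convexity of the power and Jensen produce the factor 2^j. -/
lemma Ctrl.split_centered (hS : MixSetting P Y ℱ a) (hC : Ctrl (P.map (Y 0)) B h) {q : ℝ}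
    (hq : 0 ≤ q) : ∃ g, MonComb q g ∧ ∃ r : ℕ → Ω → ℝ, ∀ k, IsRem P B q (r k) ∧
      ∀ ω, |centered P (fun ω => h (Y k ω)) ω - centered P (fun ω => g (Y k ω)) ω| ≤ r k ω := by
  obtain ⟨g, ρ, hg, hρ, h0, hle, hm⟩ := hC.split q hq
  refine ⟨g, hg, fun k ω => ρ (Y k ω) + ∫ ω', ρ (Y k ω') ∂P, fun k => ⟨⟨?_, ?_, ?_⟩, ?_⟩⟩
  · exact (hρ.comp (hS.measurable k)).add (BddMeas.const _)
  · exact fun ω => add_nonneg (h0 _) (integral_nonneg fun _ => h0 _)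
  · intro j hj
    have hj' : 1 ≤ j := (Finset.mem_Icc.1 hj).1
    have hρk := hρ.comp (hS.measurable k)
    have e : ∫ ω, ρ (Y k ω) ^ j ∂P = ∫ x, ρ x ^ j ∂(P.map (Y 0)) := by
      rw [← hS.map_eq k, integral_map (hS.measurable k).aemeasurable
        (hρ.pow j).1.aestronglyMeasurable]
    have h1 : ∫ ω, (ρ (Y k ω) + ∫ ω', ρ (Y k ω') ∂P) ^ j ∂P ≤
        ∫ ω, 2 ^ (j - 1) * (ρ (Y k ω) ^ j + (∫ ω', ρ (Y k ω') ∂P) ^ j) ∂P :=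
      integral_mono ((hρk.add (BddMeas.const _)).pow j).integrable
        ((BddMeas.const _).mul ((hρk.pow j).add (BddMeas.const _))).integrable fun ω =>
        add_pow_le (h0 _) (integral_nonneg fun _ => h0 _) j
    rw [integral_const_mul, integral_add (hρk.pow j).integrable (integrable_const _),
      integral_const, probReal_univ, one_smul] at h1
    have h2 := integral_pow_le_integral_pow (P := P) hρk (fun ω => h0 _) j
    have h3 := hm j hj
    calc _ ≤ _ := h1
      _ ≤ 2 ^ (j - 1) * (tailMoment B q j + tailMoment B q j) := by
        gcongr
        · rw [e]; exact h3
        · exact h2.trans (by rw [e]; exact h3)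
      _ = _ := by
        rw [← two_mul, ← mul_assoc, ← pow_succ, Nat.sub_add_cancel hj']
  · intro ω
    have i1 := (hC.bdd.comp (hS.measurable k)).integrable (P := P)
    have i2 := ((hg.bddMeas hq).comp (hS.measurable k)).integrable (P := P)
    have e : centered P (fun ω => h (Y k ω)) ω - centered P (fun ω => g (Y k ω)) ω =
        (h (Y k ω) - g (Y k ω)) - ∫ ω', (h (Y k ω') - g (Y k ω')) ∂P := by
      unfold centered; rw [integral_sub i1 i2]; ring
    rw [e]
    refine (abs_sub _ _).trans (add_le_add (hle _) ?_)
    exact abs_integral_le_of_abs_le (hρ.comp (hS.measurable k)).integrable fun ω => hle _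

lemma Ctrl.isEnv (hS : MixSetting P Y ℱ a) (hC : Ctrl (P.map (Y 0)) B h) (k : ℕ) :
    IsEnv P B (centered P fun ω => h (Y k ω)) := by
  intro q hq
  obtain ⟨g, hg, r, hr⟩ := hC.split_centered hS hq
  refine ⟨r k, (hr k).1, fun ω => ?_⟩
  have h1 := abs_centered_le (P := P) (X := fun ω => g (Y k ω))
    (fun ω => hg.abs_le hq _) ω
  have h2 := (hr k).2 ω
  have := abs_sub_abs_le_abs_sub (centered P (fun ω => h (Y k ω)) ω)
    (centered P (fun ω => g (Y k ω)) ω)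
  linarith

lemma abs_integral_sub_le {X Z R : Ω → ℝ} (hX : BddMeas X) (hZ : BddMeas Z) (hR : BddMeas R)
    (hle : ∀ ω, |X ω - Z ω| ≤ R ω) : |∫ ω, X ω ∂P - ∫ ω, Z ω ∂P| ≤ ∫ ω, R ω ∂P := by
  rw [← integral_sub hX.integrable hZ.integrable]
  exact abs_integral_le_of_abs_le hR.integrable hle

/-- Below the level q the observable is a combination of bounded monotonic pieces and mixing
applies; above it the first tail moment is paid. -/
lemma abs_cov_le_of_bdd (hS : MixSetting P Y ℱ a) (hC : Ctrl (P.map (Y 0)) B h)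
    {i p k : ℕ} (hp : 1 ≤ p) (hk : i + p ≤ k) {W : Ω → ℝ}
    (hW : Measurable[ℱ i] W) {b : ℝ} (hb : 0 ≤ b) (hWb : ∀ ω, |W ω| ≤ b) {q : ℝ} (hq : 0 ≤ q) :
    |∫ ω, W ω * centered P (fun ω => h (Y k ω)) ω ∂P| ≤ 8 * b * (q * a p + tailMoment B q 1) := by
  obtain ⟨g, hg, r, hr⟩ := hC.split_centered hS hq
  have hWm : BddMeas W := ⟨hW.mono (hS.le i) le_rfl, b, hWb⟩
  have hX := (hC.bdd.comp (hS.measurable k)).centered (P := P)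
  have hG := ((hg.bddMeas hq).comp (hS.measurable k)).centered (P := P)
  have h1 := hS.abs_integral_mul_le hp hk hW hb hWb hq hg
  have h2 := abs_integral_sub_le (P := P) (hWm.mul hX) (hWm.mul hG)
    ((BddMeas.const b).mul (hr k).1.bdd) fun ω => by
      rw [← mul_sub, abs_mul]
      exact mul_le_mul (hWb ω) ((hr k).2 ω) (abs_nonneg _) hb
  rw [integral_const_mul] at h2
  have h3 := (hr k).1.moment 1 (by simp)
  simp only [pow_one] at h3
  have h4 := abs_sub_abs_le_abs_sub (∫ ω, W ω * centered P (fun ω => h (Y k ω)) ω ∂P)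
    (∫ ω, W ω * centered P (fun ω => g (Y k ω)) ω ∂P)
  have h5 := mul_nonneg hb (tailMoment_nonneg B q 1)
  nlinarith [mul_le_mul_of_nonneg_left h3 hb]

/-- Both factors are cut, W at 2q and the observable at q. The error of replacing the product by the
product of cut parts is pointwise at most (2q + ρ)(2q + r) - 4q². -/
lemma abs_cov_le (hS : MixSetting P Y ℱ a) (hC : Ctrl (P.map (Y 0)) B h)
    {i p k : ℕ} (hp : 1 ≤ p) (hk : i + p ≤ k) {U W : Ω → ℝ} (hU : IsEnv P B U)
    (hWb : BddMeas W) (hW : Measurable[ℱ i] W) (hWU : ∀ ω, |W ω| ≤ |U ω|) {q : ℝ} (hq : 0 ≤ q) :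
    |∫ ω, W ω * centered P (fun ω => h (Y k ω)) ω ∂P| ≤
      16 * (q ^ 2 * a p + q * tailMoment B q 1 + tailMoment B q 2) := by
  obtain ⟨g, hg, r, hr⟩ := hC.split_centered hS hq
  obtain ⟨ρ, hρ, hUρ⟩ := hU q hq
  have hq2 : 0 ≤ 2 * q := by linarith
  have hX := (hC.bdd.comp (hS.measurable k)).centered (P := P)
  have hG := ((hg.bddMeas hq).comp (hS.measurable k)).centered (P := P)
  have hGb := fun ω => abs_centered_le (P := P) (X := fun ω => g (Y k ω))
    (fun ω => hg.abs_le hq _) ω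
  have hW0 : Measurable[ℱ i] fun ω => clip (2 * q) (W ω) := (measurable_clip _).comp hW
  have h1 := hS.abs_integral_mul_le hp hk hW0 hq2 (fun ω => abs_clip_le hq2 _) hq hg
  have hb := fun (ρ : Ω → ℝ) (h : IsRem P B q ρ) => (BddMeas.const (Ω := Ω) (2 * q)).add h.bdd
  have h2 := abs_integral_sub_le (P := P) (hWb.mul hX) ((bddMeas_clip hq2 hWb.1).mul hG)
    (((hb _ hρ).mul (hb _ (hr k).1)).sub (BddMeas.const (4 * q ^ 2))) fun ω => by
      have e : W ω * centered P (fun ω => h (Y k ω)) ω -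
          clip (2 * q) (W ω) * centered P (fun ω => g (Y k ω)) ω =
          (W ω - clip (2 * q) (W ω)) * centered P (fun ω => g (Y k ω)) ω +
          W ω * (centered P (fun ω => h (Y k ω)) ω - centered P (fun ω => g (Y k ω)) ω) := by ring
      rw [e]
      refine (abs_add_le _ _).trans ?_
      rw [abs_mul, abs_mul]
      have w1 := (hWU ω).trans (hUρ ω)
      have w2 := abs_sub_clip_le (hρ.nonneg ω) w1
      have a1 := mul_le_mul w2 (hGb ω) (abs_nonneg _) (hρ.nonneg ω)
      have a2 := mul_le_mul w1 ((hr k).2 ω) (abs_nonneg _) (add_nonneg hq2 (hρ.nonneg ω))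
      linarith
  rw [integral_sub ((hb _ hρ).mul (hb _ (hr k).1)).integrable (integrable_const _), integral_const,
    probReal_univ, one_smul] at h2
  have h3 := integral_mul_le hρ (hr k).1 hq
  have h4 := abs_sub_abs_le_abs_sub (∫ ω, W ω * centered P (fun ω => h (Y k ω)) ω ∂P)
    (∫ ω, clip (2 * q) (W ω) * centered P (fun ω => g (Y k ω)) ω ∂P)
  have h5 := mul_nonneg hq (tailMoment_nonneg B q 1)
  have h6 := tailMoment_nonneg B q 2
  nlinarith

/-- As for a single envelope, with W now clipped at 4q², the square of the level 2q. The pointwise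
error is (2q + ρ)(2q + ρ')(2q + r) - 8q³. -/
lemma abs_cov_le_of_mul (hS : MixSetting P Y ℱ a) (hC : Ctrl (P.map (Y 0)) B h)
    {i p k : ℕ} (hp : 1 ≤ p) (hk : i + p ≤ k) {U U' W : Ω → ℝ}
    (hU : IsEnv P B U) (hU' : IsEnv P B U') (hWb : BddMeas W) (hW : Measurable[ℱ i] W)
    (hWU : ∀ ω, |W ω| ≤ |U ω| * |U' ω|) {q : ℝ} (hq : 0 ≤ q) :
    |∫ ω, W ω * centered P (fun ω => h (Y k ω)) ω ∂P| ≤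
      32 * (q ^ 3 * a p + q ^ 2 * tailMoment B q 1 + q * tailMoment B q 2 + tailMoment B q 3) := by
  obtain ⟨g, hg, r, hr⟩ := hC.split_centered hS hq
  obtain ⟨ρ, hρ, hUρ⟩ := hU q hq
  obtain ⟨ρ', hρ', hUρ'⟩ := hU' q hq
  have hq2 : 0 ≤ 2 * q := by linarith
  have hq4 : 0 ≤ 4 * q ^ 2 := by positivity
  have hX := (hC.bdd.comp (hS.measurable k)).centered (P := P)
  have hG := ((hg.bddMeas hq).comp (hS.measurable k)).centered (P := P)
  have hGb := fun ω => abs_centered_le (P := P) (X := fun ω => g (Y k ω))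
    (fun ω => hg.abs_le hq _) ω
  have hW0 : Measurable[ℱ i] fun ω => clip (4 * q ^ 2) (W ω) := (measurable_clip _).comp hW
  have h1 := hS.abs_integral_mul_le hp hk hW0 hq4 (fun ω => abs_clip_le hq4 _) hq hg
  have hb := fun (ρ : Ω → ℝ) (h : IsRem P B q ρ) => (BddMeas.const (Ω := Ω) (2 * q)).add h.bdd
  have h2 := abs_integral_sub_le (P := P) (hWb.mul hX) ((bddMeas_clip hq4 hWb.1).mul hG)
    ((((hb _ hρ).mul (hb _ hρ')).mul (hb _ (hr k).1)).sub (BddMeas.const (8 * q ^ 3))) fun ω => by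
      have e : W ω * centered P (fun ω => h (Y k ω)) ω -
          clip (4 * q ^ 2) (W ω) * centered P (fun ω => g (Y k ω)) ω =
          (W ω - clip (4 * q ^ 2) (W ω)) * centered P (fun ω => g (Y k ω)) ω +
          W ω * (centered P (fun ω => h (Y k ω)) ω - centered P (fun ω => g (Y k ω)) ω) := by ring
      rw [e]
      refine (abs_add_le _ _).trans ?_
      rw [abs_mul, abs_mul]
      have n1 := hρ.nonneg ω
      have n2 := hρ'.nonneg ω
      have w1 : |W ω| ≤ (2 * q + ρ ω) * (2 * q + ρ' ω) :=
        (hWU ω).trans (mul_le_mul (hUρ ω) (hUρ' ω) (abs_nonneg _) (by linarith))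
      have n3 : 0 ≤ (2 * q + ρ ω) * (2 * q + ρ' ω) - 4 * q ^ 2 := by
        nlinarith [mul_nonneg hq n1, mul_nonneg hq n2, mul_nonneg n1 n2]
      have w2 := abs_sub_clip_le (c := 4 * q ^ 2) (w := W ω) n3 (by linarith)
      have a1 := mul_le_mul w2 (hGb ω) (abs_nonneg _) n3
      have a2 := mul_le_mul w1 ((hr k).2 ω) (abs_nonneg _) ((abs_nonneg _).trans w1)
      linarith
  rw [integral_sub (((hb _ hρ).mul (hb _ hρ')).mul (hb _ (hr k).1)).integrable
    (integrable_const _), integral_const, probReal_univ, one_smul] at h2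
  have h3 := integral_mul_mul_le hρ hρ' (hr k).1 hq
  have h4 := abs_sub_abs_le_abs_sub (∫ ω, W ω * centered P (fun ω => h (Y k ω)) ω ∂P)
    (∫ ω, clip (4 * q ^ 2) (W ω) * centered P (fun ω => g (Y k ω)) ω ∂P)
  have h5 := mul_nonneg (sq_nonneg q) (tailMoment_nonneg B q 1)
  have h6 := mul_nonneg hq (tailMoment_nonneg B q 2)
  have h7 := tailMoment_nonneg B q 3
  nlinarith

lemma abs_cov_pair_le_of_bdd (hS : MixSetting P Y ℱ a) (hC : Ctrl (P.map (Y 0)) B h)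
    {i p k l : ℕ} (hp : 1 ≤ p) (hk : i + p ≤ k) (hl : i + p ≤ l)
    {W : Ω → ℝ} (hW : Measurable[ℱ i] W) {b : ℝ} (hb : 0 ≤ b) (hWb : ∀ ω, |W ω| ≤ b) {q : ℝ}
    (hq : 0 ≤ q) :
    |∫ ω, W ω * centered P (fun ω => centered P (fun ω => h (Y k ω)) ω *
      centered P (fun ω => h (Y l ω)) ω) ω ∂P| ≤
      32 * b * (q ^ 2 * a p + q * tailMoment B q 1 + tailMoment B q 2) := by
  obtain ⟨g, hg, r, hr⟩ := hC.split_centered hS hq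
  have hWm : BddMeas W := ⟨hW.mono (hS.le i) le_rfl, b, hWb⟩
  have hq2 : 0 ≤ 2 * q := by linarith
  have hX := fun k => (hC.bdd.comp (hS.measurable k)).centered (P := P)
  have hG := fun k => ((hg.bddMeas hq).comp (hS.measurable k)).centered (P := P)
  have hGb := fun (k : ℕ) (ω : Ω) => abs_centered_le (P := P) (X := fun ω => g (Y k ω))
    (fun ω => hg.abs_le hq _) ω
  have h1 := hS.abs_integral_mul_mul_le hp hk hl hW hb hWb hq hg
  have hbd := fun (ρ : Ω → ℝ) (h : IsRem P B q ρ) => (BddMeas.const (Ω := Ω) (2 * q)).add h.bdd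
  have hR := ((hbd _ (hr k).1).mul (hbd _ (hr l).1)).sub (BddMeas.const (4 * q ^ 2))
  have hprod : ∀ ω, |centered P (fun ω => h (Y k ω)) ω * centered P (fun ω => h (Y l ω)) ω -
      centered P (fun ω => g (Y k ω)) ω * centered P (fun ω => g (Y l ω)) ω| ≤
      (2 * q + r k ω) * (2 * q + r l ω) - 4 * q ^ 2 := by
    intro ω
    have g1 := hGb k ω
    have g2 := hGb l ω
    have d1 := (hr k).2 ω
    have d2 := (hr l).2 ω
    set x := centered P (fun ω => h (Y k ω)) ω
    set y := centered P (fun ω => h (Y l ω)) ω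
    set u := centered P (fun ω => g (Y k ω)) ω
    set v := centered P (fun ω => g (Y l ω)) ω
    -- Expanding around the bounded parts makes the error exactly the product of enlarged bounds
    -- minus the product of the bounds.
    have e : x * y - u * v = (x - u) * (y - v) + (x - u) * v + u * (y - v) := by ring
    rw [e]
    refine (abs_add_three _ _ _).trans ?_
    rw [abs_mul, abs_mul, abs_mul]
    have m1 := mul_le_mul d1 d2 (abs_nonneg _) ((hr k).1.nonneg ω)
    have m2 := mul_le_mul d1 g2 (abs_nonneg _) ((hr k).1.nonneg ω)
    have m3 := mul_le_mul g1 d2 (abs_nonneg _) hq2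
    linarith
  set X := fun ω => centered P (fun ω => h (Y k ω)) ω * centered P (fun ω => h (Y l ω)) ω with hXd
  set G := fun ω => centered P (fun ω => g (Y k ω)) ω * centered P (fun ω => g (Y l ω)) ω with hGd
  have bX : BddMeas X := (hX k).mul (hX l)
  have bG : BddMeas G := (hG k).mul (hG l)
  set ER := ∫ ω, ((2 * q + r k ω) * (2 * q + r l ω) - 4 * q ^ 2) ∂P with hER
  have hdc : ∀ ω, |centered P X ω - centered P G ω| ≤
      ((2 * q + r k ω) * (2 * q + r l ω) - 4 * q ^ 2) + ER := by
    intro ω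
    have e : centered P X ω - centered P G ω =
        (X ω - G ω) - (∫ ω, X ω ∂P - ∫ ω, G ω ∂P) := by unfold centered; ring
    rw [e]
    refine (abs_sub _ _).trans (add_le_add (hprod ω) ?_)
    exact abs_integral_sub_le bX bG hR hprod
  have h2 := abs_integral_sub_le (P := P) (hWm.mul (bX.centered (P := P)))
    (hWm.mul (bG.centered (P := P))) ((BddMeas.const b).mul (hR.add (BddMeas.const ER)))
    fun ω => by
      rw [← mul_sub, abs_mul]
      exact mul_le_mul (hWb ω) (hdc ω) (abs_nonneg _) hb
  rw [integral_const_mul, integral_add hR.integrable (integrable_const _), ← hER, integral_const,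
    probReal_univ, one_smul] at h2
  have h3 := integral_mul_le (hr k).1 (hr l).1 hq
  have h3' : ER ≤ 8 * q * tailMoment B q 1 + 4 * tailMoment B q 2 := by
    rw [hER, integral_sub ((hbd _ (hr k).1).mul (hbd _ (hr l).1)).integrable (integrable_const _),
      integral_const, probReal_univ, one_smul]
    linarith
  have h4 := abs_sub_abs_le_abs_sub (∫ ω, W ω * centered P X ω ∂P)
    (∫ ω, W ω * centered P G ω ∂P)
  have h5 := mul_nonneg hb (mul_nonneg hq (tailMoment_nonneg B q 1))
  have h6 := mul_nonneg hb (tailMoment_nonneg B q 2)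
  nlinarith [mul_le_mul_of_nonneg_left h3' hb]

/-- The covariance is written as E(WX) - E(W)E(X), and W and the product X are cut separately in
each term. In the second term the remainder of W enters through its mean, which is again an
admissible remainder, so both errors obey the same third order bound. -/
lemma abs_cov_pair_le (hS : MixSetting P Y ℱ a) (hC : Ctrl (P.map (Y 0)) B h)
    {i p k l : ℕ} (hp : 1 ≤ p) (hk : i + p ≤ k) (hl : i + p ≤ l)
    {U W : Ω → ℝ} (hU : IsEnv P B U) (hWb : BddMeas W) (hW : Measurable[ℱ i] W)
    (hWU : ∀ ω, |W ω| ≤ |U ω|) {q : ℝ} (hq : 0 ≤ q) :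
    |∫ ω, W ω * centered P (fun ω => centered P (fun ω => h (Y k ω)) ω *
      centered P (fun ω => h (Y l ω)) ω) ω ∂P| ≤
      64 * (q ^ 3 * a p + q ^ 2 * tailMoment B q 1 + q * tailMoment B q 2 + tailMoment B q 3) := by
  obtain ⟨g, hg, r, hr⟩ := hC.split_centered hS hq
  obtain ⟨ρ, hρ, hUρ⟩ := hU q hq
  have hq2 : 0 ≤ 2 * q := by linarith
  have hX := fun k => (hC.bdd.comp (hS.measurable k)).centered (P := P)
  have hG := fun k => ((hg.bddMeas hq).comp (hS.measurable k)).centered (P := P)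
  have hGb := fun (k : ℕ) (ω : Ω) => abs_centered_le (P := P) (X := fun ω => g (Y k ω))
    (fun ω => hg.abs_le hq _) ω
  have hW0 : Measurable[ℱ i] fun ω => clip (2 * q) (W ω) := (measurable_clip _).comp hW
  have h1 := hS.abs_integral_mul_mul_le hp hk hl hW0 hq2 (fun ω => abs_clip_le hq2 _) hq hg
  have hbd := fun (ρ : Ω → ℝ) (h : IsRem P B q ρ) => (BddMeas.const (Ω := Ω) (2 * q)).add h.bdd
  set X := fun ω => centered P (fun ω => h (Y k ω)) ω * centered P (fun ω => h (Y l ω)) ω with hXd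
  set G := fun ω => centered P (fun ω => g (Y k ω)) ω * centered P (fun ω => g (Y l ω)) ω with hGd
  set W0 := fun ω => clip (2 * q) (W ω) with hW0d
  have bW0 : BddMeas W0 := bddMeas_clip hq2 hWb.1
  have bX : BddMeas X := (hX k).mul (hX l)
  have bG : BddMeas G := (hG k).mul (hG l)
  set T := fun ω => (2 * q + r k ω) * (2 * q + r l ω) with hT
  have bT : BddMeas T := (hbd _ (hr k).1).mul (hbd _ (hr l).1)
  have hT0 : ∀ ω, 4 * q ^ 2 ≤ T ω := fun ω => by
    have n1 := (hr k).1.nonneg ω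
    have n2 := (hr l).1.nonneg ω
    simp only [hT]
    nlinarith [mul_nonneg hq n1, mul_nonneg hq n2, mul_nonneg n1 n2]
  have hXT : ∀ ω, |X ω| ≤ T ω := fun ω => by
    simp only [hXd, hT, abs_mul]
    have hb : ∀ k, |centered P (fun ω => h (Y k ω)) ω| ≤ 2 * q + r k ω := fun k => by
      have := abs_sub_abs_le_abs_sub (centered P (fun ω => h (Y k ω)) ω)
        (centered P (fun ω => g (Y k ω)) ω)
      linarith [(hr k).2 ω, hGb k ω]
    exact mul_le_mul (hb k) (hb l) (abs_nonneg _) ((abs_nonneg _).trans (hb k))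
  have hprod : ∀ ω, |X ω - G ω| ≤ T ω - 4 * q ^ 2 := by
    intro ω
    have g1 := hGb k ω
    have g2 := hGb l ω
    have d1 := (hr k).2 ω
    have d2 := (hr l).2 ω
    simp only [hXd, hGd, hT]
    set x := centered P (fun ω => h (Y k ω)) ω
    set y := centered P (fun ω => h (Y l ω)) ω
    set u := centered P (fun ω => g (Y k ω)) ω
    set v := centered P (fun ω => g (Y l ω)) ω
    have e : x * y - u * v = (x - u) * (y - v) + (x - u) * v + u * (y - v) := by ring
    rw [e]
    refine (abs_add_three _ _ _).trans ?_
    rw [abs_mul, abs_mul, abs_mul]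
    have m1 := mul_le_mul d1 d2 (abs_nonneg _) ((hr k).1.nonneg ω)
    have m2 := mul_le_mul d1 g2 (abs_nonneg _) ((hr k).1.nonneg ω)
    have m3 := mul_le_mul g1 d2 (abs_nonneg _) hq2
    linarith
  have hWρ := fun ω => (hWU ω).trans (hUρ ω)
  have hdW := fun ω => abs_sub_clip_le (hρ.nonneg ω) (hWρ ω)
  have hexp : ∀ {W X : Ω → ℝ}, BddMeas W → BddMeas X →
      ∫ ω, W ω * centered P X ω ∂P = ∫ ω, W ω * X ω ∂P - (∫ ω, W ω ∂P) * ∫ ω, X ω ∂P := by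
    intro W X hW hX
    unfold centered
    simp_rw [mul_sub]
    rw [integral_sub (hW.mul hX).integrable (hW.mul (BddMeas.const _)).integrable,
      integral_mul_const]
  have hd1 : |∫ ω, W ω * X ω ∂P - ∫ ω, W0 ω * G ω ∂P| ≤
      ∫ ω, ((2 * q + ρ ω) * (2 * q + r k ω) * (2 * q + r l ω) - 8 * q ^ 3) ∂P := by
    refine abs_integral_sub_le (hWb.mul bX) (bW0.mul bG)
      ((((hbd _ hρ).mul (hbd _ (hr k).1)).mul (hbd _ (hr l).1)).sub (BddMeas.const _)) fun ω => ?_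
    have e : W ω * X ω - W0 ω * G ω = (W ω - W0 ω) * X ω + W0 ω * (X ω - G ω) := by ring
    rw [e]
    refine (abs_add_le _ _).trans ?_
    rw [abs_mul (W ω - W0 ω), abs_mul (W0 ω)]
    have m1 := mul_le_mul (hdW ω) (hXT ω) (abs_nonneg _) (hρ.nonneg ω)
    have m2 := mul_le_mul (abs_clip_le hq2 (W ω)) (hprod ω) (abs_nonneg _) hq2
    have e2 : (2 * q + ρ ω) * (2 * q + r k ω) * (2 * q + r l ω) - 8 * q ^ 3 =
      ρ ω * T ω + 2 * q * (T ω - 4 * q ^ 2) := by simp only [hT]; ring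
    rw [e2]
    exact add_le_add m1 m2
  have hd2 : |(∫ ω, W ω ∂P) * (∫ ω, X ω ∂P) - (∫ ω, W0 ω ∂P) * ∫ ω, G ω ∂P| ≤
      ∫ ω, ((2 * q + ∫ ω', ρ ω' ∂P) * (2 * q + r k ω) * (2 * q + r l ω) - 8 * q ^ 3) ∂P := by
    have e : (∫ ω, W ω ∂P) * (∫ ω, X ω ∂P) - (∫ ω, W0 ω ∂P) * ∫ ω, G ω ∂P =
        (∫ ω, W ω ∂P - ∫ ω, W0 ω ∂P) * (∫ ω, X ω ∂P) +
        (∫ ω, W0 ω ∂P) * (∫ ω, X ω ∂P - ∫ ω, G ω ∂P) := by ring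
    rw [e]
    refine (abs_add_le _ _).trans ?_
    rw [abs_mul, abs_mul]
    have b1 := abs_integral_sub_le (P := P) hWb bW0 hρ.bdd hdW
    have b2 : |∫ ω, X ω ∂P| ≤ ∫ ω, T ω ∂P :=
      abs_integral_le_of_abs_le bT.integrable hXT
    have b3 : |∫ ω, W0 ω ∂P| ≤ 2 * q := by
      have h0 : ‖∫ ω, W0 ω ∂P‖ ≤ 2 * q * P.real univ :=
        norm_integral_le_of_norm_le_const (ae_of_all _ fun ω => abs_clip_le hq2 (W ω))
      simpa using h0
    have b4 := abs_integral_sub_le (P := P) bX bG (bT.sub (BddMeas.const _)) hprod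
    have hρ0 : 0 ≤ ∫ ω, ρ ω ∂P := integral_nonneg hρ.nonneg
    have m1 := mul_le_mul b1 b2 (abs_nonneg _) hρ0
    have m2 := mul_le_mul b3 b4 (abs_nonneg _) hq2
    rw [integral_sub bT.integrable (integrable_const _), integral_const, probReal_univ,
      one_smul] at m2
    simp_rw [mul_assoc]
    rw [integral_sub ((BddMeas.const _).mul bT).integrable (integrable_const _),
      integral_const_mul, integral_const, probReal_univ, one_smul]
    linarith
  have hm1 := integral_mul_mul_le hρ (hr k).1 (hr l).1 hq
  have hm2 := integral_mul_mul_le hρ.const (hr k).1 (hr l).1 hq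
  rw [integral_sub (((hbd _ hρ).mul (hbd _ (hr k).1)).mul (hbd _ (hr l).1)).integrable
    (integrable_const _), integral_const, probReal_univ, one_smul] at hd1
  rw [integral_sub (((hbd _ hρ.const).mul (hbd _ (hr k).1)).mul (hbd _ (hr l).1)).integrable
    (integrable_const _), integral_const, probReal_univ, one_smul] at hd2
  rw [hexp bW0 bG] at h1
  rw [hexp hWb bX]
  have h5 := mul_nonneg (sq_nonneg q) (tailMoment_nonneg B q 1)
  have h6 := mul_nonneg hq (tailMoment_nonneg B q 2)
  have h7 := tailMoment_nonneg B q 3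
  rw [abs_le] at *
  constructor <;> nlinarith

end Mixing

/-! ### The choice of the truncation level -/

/-- The truncated moments `∫₀ᵗ B(u)^r du`. -/
def partMoment (B : ℝ → ℝ) (r : ℕ) (t : ℝ) : ℝ := ∫ u in Ioo (0 : ℝ) t, B u ^ r

/-- Bounded nonnegative functions that are nonincreasing on the unit interval. -/
structure IsRate (M : ℝ) (B : ℝ → ℝ) : Prop where
  anti : AntitoneOn B (Ioo 0 1)
  nonneg : ∀ u, 0 ≤ B u
  le : ∀ u, B u ≤ M

namespace IsRate

variable {M : ℝ} {B : ℝ → ℝ}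

lemma bound_nonneg (hB : IsRate M B) : 0 ≤ M := (hB.nonneg 0).trans (hB.le 0)

lemma integrableOn_pow (hB : IsRate M B) (r : ℕ) :
    IntegrableOn (fun u => B u ^ r) (Ioo (0 : ℝ) 1) := by
  have hm : AEMeasurable B (volume.restrict (Ioo (0 : ℝ) 1)) :=
    aemeasurable_restrict_of_antitoneOn measurableSet_Ioo hB.anti
  refine Integrable.of_bound (hm.pow_const r).aestronglyMeasurable (M ^ r) (ae_of_all _ fun u => ?_)
  rw [norm_pow, Real.norm_of_nonneg (hB.nonneg u)]
  exact pow_le_pow_left₀ (hB.nonneg u) (hB.le u) r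

lemma partMoment_nonneg (hB : IsRate M B) (r : ℕ) (t : ℝ) : 0 ≤ partMoment B r t :=
  integral_nonneg fun u => pow_nonneg (hB.nonneg u) r

lemma tailMoment_bound (hB : IsRate M B) {j : ℕ} (hj : 1 ≤ j) : tailMoment B M j = 0 := by
  unfold tailMoment
  have : ∀ u, max (B u - M) 0 ^ j = 0 := fun u => by
    rw [max_eq_right (by linarith [hB.le u]), zero_pow (by omega)]
  simp [this]

/-- The level is q = B(t). As B is nonincreasing, B ≥ q to the left of t, so q^i t is at most the
partial moment; and (B - q)⁺ vanishes to the right of t, so tail moments reduce to integrals over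
(0, t), where powers of q and of B - q are dominated by powers of B. -/
lemma exists_level (hB : IsRate M B) {t : ℝ} (h0 : 0 ≤ t) (h1 : t ≤ 1) : ∃ q, 0 ≤ q ∧
    (∀ i, q ^ i * t ≤ partMoment B i t) ∧
    ∀ i j, 1 ≤ j → q ^ i * tailMoment B q j ≤ partMoment B (i + j) t := by
  obtain ⟨q, hq, hl, hr⟩ : ∃ q, 0 ≤ q ∧ (∀ u ∈ Ioo (0 : ℝ) 1, u < t → q ≤ B u) ∧
      ∀ u ∈ Ioo (0 : ℝ) 1, t ≤ u → B u ≤ q := by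
    -- B is monotone only inside the open interval, so the end points get their own levels: the
    -- upper bound M at t = 0 and zero at t = 1.
    rcases h0.eq_or_lt with rfl | h0
    · exact ⟨M, hB.bound_nonneg, fun u hu h => absurd hu.1 h.not_gt, fun u _ _ => hB.le u⟩
    rcases h1.eq_or_lt with rfl | h1
    · exact ⟨0, le_rfl, fun u _ _ => hB.nonneg u, fun u hu h => absurd hu.2 h.not_gt⟩
    · exact ⟨B t, hB.nonneg t, fun u hu h => hB.anti hu ⟨h0, h1⟩ h.le,
        fun u hu h => hB.anti ⟨h0, h1⟩ hu h⟩
  have hsub : Ioo 0 t ⊆ Ioo (0 : ℝ) 1 := Ioo_subset_Ioo_right h1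
  have hin : ∀ r, IntegrableOn (fun u => B u ^ r) (Ioo (0 : ℝ) t) := fun r =>
    (hB.integrableOn_pow r).mono_set hsub
  refine ⟨q, hq, fun i => ?_, fun i j hj => ?_⟩
  · have : q ^ i * t = ∫ u in Ioo (0 : ℝ) t, q ^ i := by
      rw [setIntegral_const, Real.volume_real_Ioo_of_le h0, smul_eq_mul]; ring
    rw [this]
    refine setIntegral_mono_on (integrableOn_const (by simp)) (hin i) measurableSet_Ioo
      fun u hu => pow_le_pow_left₀ hq (hl u (hsub hu) hu.2) i
  · have e : tailMoment B q j = ∫ u in Ioo (0 : ℝ) t, max (B u - q) 0 ^ j := by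
      unfold tailMoment
      refine setIntegral_eq_of_subset_of_forall_sdiff_eq_zero measurableSet_Ioo hsub fun u hu => ?_
      have : t ≤ u := by
        by_contra h
        exact hu.2 ⟨hu.1.1, not_le.1 h⟩
      rw [max_eq_right (by linarith [hr u hu.1 this]), zero_pow (by omega)]
    rw [e, ← integral_const_mul]
    refine integral_mono_of_nonneg (ae_of_all _ fun u => mul_nonneg (pow_nonneg hq i)
      (pow_nonneg (le_max_right _ _) _)) (hin _) ?_
    filter_upwards [ae_restrict_mem measurableSet_Ioo] with u hu
    have h2 := hl u (hsub hu) hu.2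
    rw [max_eq_left (by linarith), pow_add]
    exact mul_le_mul (pow_le_pow_left₀ hq h2 i)
      (pow_le_pow_left₀ (by linarith) (by linarith) j) (pow_nonneg (by linarith) j)
      (pow_nonneg (hB.nonneg u) i)

end IsRate

/-! ### Covariance bounds for a bounded observable -/

/-- The centred observables `h(Y_k) - E h(Y_k)`. -/
def obs {Ω : Type*} {mΩ : MeasurableSpace Ω} (P : Measure Ω) (Y : ℕ → Ω → ℝ) (h : ℝ → ℝ) (k : ℕ) :
    Ω → ℝ := centered P fun ω => h (Y k ω)

/-- The partial sums of the centred observables. -/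
def psum {Ω : Type*} {mΩ : MeasurableSpace Ω} (P : Measure Ω) (Y : ℕ → Ω → ℝ) (h : ℝ → ℝ) (k : ℕ)
    (ω : Ω) : ℝ := ∑ i ∈ Finset.range k, obs P Y h (i + 1) ω

/-- The covariances of the observables. -/
def cov {Ω : Type*} {mΩ : MeasurableSpace Ω} (P : Measure Ω) (Y : ℕ → Ω → ℝ) (h : ℝ → ℝ) (j : ℕ) :
    ℝ := ∫ ω, obs P Y h 0 ω * obs P Y h j ω ∂P

lemma MixSetting.integral_comp {Ω : Type*} {mΩ : MeasurableSpace Ω} {P : Measure Ω}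
    [IsProbabilityMeasure P]
    {Y : ℕ → Ω → ℝ} {ℱ : ℕ → MeasurableSpace Ω} {a : ℕ → ℝ} (hS : MixSetting P Y ℱ a)
    {φ : ℝ → ℝ} (hφ : Measurable φ) (i : ℕ) :
    ∫ ω, φ (Y i ω) ∂P = ∫ x, φ x ∂(P.map (Y 0)) := by
  rw [← hS.map_eq i, integral_map (hS.measurable i).aemeasurable hφ.aestronglyMeasurable]

/-- Only the laws of pairs (Y_i, Y_{i+j}) enter, and these do not depend on i. -/
lemma MixSetting.integral_obs_mul {Ω : Type*} {mΩ : MeasurableSpace Ω} {P : Measure Ω}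
    [IsProbabilityMeasure P]
    {Y : ℕ → Ω → ℝ} {ℱ : ℕ → MeasurableSpace Ω} {a : ℕ → ℝ} (hS : MixSetting P Y ℱ a)
    {h : ℝ → ℝ} (hh : Measurable h) (k j : ℕ) :
    ∫ ω, obs P Y h k ω * obs P Y h (k + j) ω ∂P = cov P Y h j := by
  set c := ∫ x, h x ∂(P.map (Y 0)) with hc
  have key : ∀ i, ∫ ω, obs P Y h i ω * obs P Y h (i + j) ω ∂P =
      ∫ z : ℝ × ℝ, (h z.1 - c) * (h z.2 - c) ∂(P.map fun ω => (Y 0 ω, Y j ω)) := fun i => by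
    rw [← hS.pair i 0 j, integral_map ((hS.measurable _).prodMk
      (hS.measurable _)).aemeasurable]
    · simp only [obs, centered, hS.integral_comp hh, hc, add_zero]
    · exact (((hh.comp measurable_fst).sub_const c).mul
        ((hh.comp measurable_snd).sub_const c)).aestronglyMeasurable
  have h0 := key 0
  rw [zero_add] at h0
  rw [key k, ← h0]; rfl

/-- A mixing sequence with a bounded observable and its rate function. -/
structure Model {Ω : Type*} [mΩ : MeasurableSpace Ω] (P : Measure Ω) (Y : ℕ → Ω → ℝ)
    (ℱ : ℕ → MeasurableSpace Ω) (a : ℕ → ℝ) (M : ℝ) (B h : ℝ → ℝ) : Prop where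
  mix : MixSetting P Y ℱ a
  ctrl : Ctrl (P.map (Y 0)) B h
  rate : IsRate M B
  bound : ∀ x, |h x| ≤ M
  zero : a 0 = 1

namespace Model

variable {Ω : Type*} {mΩ : MeasurableSpace Ω} {P : Measure Ω} {Y : ℕ → Ω → ℝ}
  {ℱ : ℕ → MeasurableSpace Ω} {a : ℕ → ℝ} {M : ℝ} {B h : ℝ → ℝ}

lemma measurable_obs (H : Model P Y ℱ a M B h) {k i : ℕ} (hk : k ≤ i) :
    Measurable[ℱ i] (obs P Y h k) :=
  ((H.ctrl.bdd.1.comp (H.mix.meas k)).sub_const _).mono (H.mix.mono hk) le_rfl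

lemma psum_succ (k : ℕ) (ω : Ω) : psum P Y h (k + 1) ω = psum P Y h k ω + obs P Y h (k + 1) ω :=
  Finset.sum_range_succ _ _

lemma rate_mem (H : Model P Y ℱ a M B h) (p : ℕ) :
    0 ≤ a p ∧ a p ≤ 1 := ⟨H.mix.nonneg p, H.mix.le_one p⟩

lemma tailMoment_zero (H : Model P Y ℱ a M B h) (r : ℕ) :
    tailMoment B 0 r = partMoment B r (a 0) := by
  rw [H.zero]
  unfold tailMoment partMoment
  congr 1; ext u
  rw [sub_zero, max_eq_left (H.rate.nonneg u)]

lemma measurable_psum (H : Model P Y ℱ a M B h) {k i : ℕ} (hk : k ≤ i) :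
    Measurable[ℱ i] (psum P Y h k) :=
  Finset.measurable_sum (m := ℱ i) _ fun j hj => H.measurable_obs (by
    have := Finset.mem_range.1 hj; omega)

variable [IsProbabilityMeasure P]

lemma bddMeas_obs (H : Model P Y ℱ a M B h) (k : ℕ) : BddMeas (obs P Y h k) :=
  (H.ctrl.bdd.comp (H.mix.measurable k)).centered

lemma abs_obs_le (H : Model P Y ℱ a M B h) (k : ℕ) (ω : Ω) : |obs P Y h k ω| ≤ 2 * M :=
  abs_centered_le (P := P) (X := fun ω => h (Y k ω)) (fun _ => H.bound _) ω

lemma isEnv_obs (H : Model P Y ℱ a M B h) (k : ℕ) : IsEnv P B (obs P Y h k) :=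
  H.ctrl.isEnv H.mix k

lemma bddMeas_psum (H : Model P Y ℱ a M B h) (k : ℕ) : BddMeas (psum P Y h k) := by
  refine ⟨(H.measurable_psum le_rfl).mono (H.mix.le k) le_rfl, k * (2 * M), fun ω => ?_⟩
  refine (Finset.abs_sum_le_sum_abs _ _).trans ?_
  refine (Finset.sum_le_sum fun i _ => H.abs_obs_le (i + 1) ω).trans ?_
  simp

lemma integral_obs_mul (H : Model P Y ℱ a M B h) (k j : ℕ) :
    ∫ ω, obs P Y h k ω * obs P Y h (k + j) ω ∂P = cov P Y h j :=
  H.mix.integral_obs_mul H.ctrl.bdd.1 k j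

/-- At the level attached to t = a(p), each polynomial bound in q of the covariance inequalities
collapses to a single partial moment up to a(p). -/
lemma level (H : Model P Y ℱ a M B h) (p : ℕ) : ∃ q, 0 ≤ q ∧
    q * a p + tailMoment B q 1 ≤ 2 * partMoment B 1 (a p) ∧
    q ^ 2 * a p + q * tailMoment B q 1 + tailMoment B q 2 ≤ 3 * partMoment B 2 (a p) ∧
    q ^ 3 * a p + q ^ 2 * tailMoment B q 1 + q * tailMoment B q 2 + tailMoment B q 3 ≤
      4 * partMoment B 3 (a p) := by
  obtain ⟨q, hq, h1, h2⟩ := H.rate.exists_level (H.rate_mem p).1 (H.rate_mem p).2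
  have e1 := h1 1
  have e2 := h1 2
  have e3 := h1 3
  have f1 := h2 0 1 le_rfl
  have f2 := h2 1 1 le_rfl
  have f3 := h2 0 2 (by norm_num)
  have f4 := h2 2 1 le_rfl
  have f5 := h2 1 2 (by norm_num)
  have f6 := h2 0 3 (by norm_num)
  norm_num at e1 f1 f2 f3 f4 f5 f6
  exact ⟨q, hq, by linarith, by linarith, by linarith⟩

variable {i p k l : ℕ} {W : Ω → ℝ}

lemma cov_bdd (H : Model P Y ℱ a M B h) (hp : 1 ≤ p) (hk : i + p ≤ k) (hW : Measurable[ℱ i] W)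
    {b : ℝ} (hb : 0 ≤ b) (hWb : ∀ ω, |W ω| ≤ b) :
    |∫ ω, W ω * obs P Y h k ω ∂P| ≤ 16 * b * partMoment B 1 (a p) := by
  obtain ⟨q, hq, h1, -⟩ := H.level p
  have := abs_cov_le_of_bdd H.mix H.ctrl hp hk hW hb hWb hq
  exact this.trans (by nlinarith)

/-- Cutting at q = M leaves no tail. This crude bound serves for lags beyond the cut, where a
sup-norm factor times the sum of the rates is summable to the right order. -/
lemma cov_bdd_sup (H : Model P Y ℱ a M B h) (hp : 1 ≤ p) (hk : i + p ≤ k) (hW : Measurable[ℱ i] W)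
    {b : ℝ} (hb : 0 ≤ b) (hWb : ∀ ω, |W ω| ≤ b) :
    |∫ ω, W ω * obs P Y h k ω ∂P| ≤ 8 * b * (M * a p) := by
  have := abs_cov_le_of_bdd H.mix H.ctrl hp hk hW hb hWb H.rate.bound_nonneg
  rwa [H.rate.tailMoment_bound le_rfl, add_zero] at this

lemma cov_env (H : Model P Y ℱ a M B h) (hp : 1 ≤ p) (hk : i + p ≤ k) {U : Ω → ℝ}
    (hU : IsEnv P B U) (hWb : BddMeas W) (hW : Measurable[ℱ i] W) (hWU : ∀ ω, |W ω| ≤ |U ω|) :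
    |∫ ω, W ω * obs P Y h k ω ∂P| ≤ 48 * partMoment B 2 (a p) := by
  obtain ⟨q, hq, -, h2, -⟩ := H.level p
  exact (abs_cov_le H.mix H.ctrl hp hk hU hWb hW hWU hq).trans (by linarith)

lemma cov_env_mul (H : Model P Y ℱ a M B h) (hp : 1 ≤ p) (hk : i + p ≤ k) {U U' : Ω → ℝ}
    (hU : IsEnv P B U) (hU' : IsEnv P B U') (hWb : BddMeas W) (hW : Measurable[ℱ i] W)
    (hWU : ∀ ω, |W ω| ≤ |U ω| * |U' ω|) :
    |∫ ω, W ω * obs P Y h k ω ∂P| ≤ 128 * partMoment B 3 (a p) := by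
  obtain ⟨q, hq, -, -, h3⟩ := H.level p
  exact (abs_cov_le_of_mul H.mix H.ctrl hp hk hU hU' hWb hW hWU hq).trans (by linarith)

lemma cov_pair (H : Model P Y ℱ a M B h) (hp : 1 ≤ p) (hk : i + p ≤ k) (hl : i + p ≤ l)
    (hW : Measurable[ℱ i] W) (hWb : ∀ ω, |W ω| ≤ 1) :
    |∫ ω, W ω * centered P (fun ω => obs P Y h k ω * obs P Y h l ω) ω ∂P| ≤
      96 * partMoment B 2 (a p) := by
  obtain ⟨q, hq, -, h2, -⟩ := H.level p
  exact (abs_cov_pair_le_of_bdd H.mix H.ctrl hp hk hl hW zero_le_one hWb hq).trans (by linarith)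

lemma cov_pair_sup (H : Model P Y ℱ a M B h) (hp : 1 ≤ p) (hk : i + p ≤ k) (hl : i + p ≤ l)
    (hW : Measurable[ℱ i] W) (hWb : ∀ ω, |W ω| ≤ 1) :
    |∫ ω, W ω * centered P (fun ω => obs P Y h k ω * obs P Y h l ω) ω ∂P| ≤
      32 * (M ^ 2 * a p) := by
  have := abs_cov_pair_le_of_bdd H.mix H.ctrl hp hk hl hW zero_le_one hWb H.rate.bound_nonneg
  rw [H.rate.tailMoment_bound le_rfl, H.rate.tailMoment_bound one_le_two] at this
  exact this.trans (le_of_eq (by ring))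

lemma cov_pair_env (H : Model P Y ℱ a M B h) (hp : 1 ≤ p) (hk : i + p ≤ k) (hl : i + p ≤ l)
    {U : Ω → ℝ} (hU : IsEnv P B U) (hWb : BddMeas W) (hW : Measurable[ℱ i] W)
    (hWU : ∀ ω, |W ω| ≤ |U ω|) :
    |∫ ω, W ω * centered P (fun ω => obs P Y h k ω * obs P Y h l ω) ω ∂P| ≤
      256 * partMoment B 3 (a p) := by
  obtain ⟨q, hq, -, -, h3⟩ := H.level p
  exact (abs_cov_pair_le H.mix H.ctrl hp hk hl hU hWb hW hWU hq).trans (by linarith)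

/-- At the level q = 0 the remainder carries everything, and the partial moment runs over all of
(0,1) because the rate at lag zero is 1. -/
lemma integral_abs_obs_cube_le (H : Model P Y ℱ a M B h) (k : ℕ) :
    ∫ ω, |obs P Y h k ω| ^ 3 ∂P ≤ 24 * partMoment B 3 (a 0) := by
  obtain ⟨ρ, hρ, hle⟩ := H.isEnv_obs k 0 le_rfl
  have h1 := integral_cube_le hρ le_rfl
  norm_num at h1
  rw [H.tailMoment_zero] at h1
  refine le_trans (integral_mono ((H.bddMeas_obs k).abs.pow 3).integrable
    (hρ.bdd.pow 3).integrable fun ω => ?_) h1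
  exact pow_le_pow_left₀ (abs_nonneg _) (by simpa using hle ω) 3

lemma integral_obs_sq_le (H : Model P Y ℱ a M B h) (k : ℕ) :
    ∫ ω, obs P Y h k ω ^ 2 ∂P ≤ 4 * partMoment B 2 (a 0) := by
  obtain ⟨ρ, hρ, hle⟩ := H.isEnv_obs k 0 le_rfl
  have h1 := integral_quad_le hρ le_rfl
  norm_num at h1
  rw [H.tailMoment_zero] at h1
  refine le_trans (integral_mono ((H.bddMeas_obs k).pow 2).integrable
    (hρ.bdd.pow 2).integrable fun ω => ?_) h1
  exact sq_le_sq.2 (by rw [abs_of_nonneg (hρ.nonneg ω)]; simpa using hle ω)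

lemma abs_cov_le (H : Model P Y ℱ a M B h) (j : ℕ) :
    |cov P Y h j| ≤ 48 * partMoment B 2 (a j) := by
  rcases Nat.eq_zero_or_pos j with rfl | hj
  · have e : cov P Y h 0 = ∫ ω, obs P Y h 0 ω ^ 2 ∂P := by simp only [cov, sq]
    rw [e, abs_of_nonneg (integral_nonneg fun _ => sq_nonneg _)]
    have := H.rate.partMoment_nonneg 2 (a 0)
    linarith [H.integral_obs_sq_le 0]
  · exact H.cov_env hj (by omega) (H.isEnv_obs 0) (H.bddMeas_obs 0) (H.measurable_obs le_rfl)
      fun _ => le_rfl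

/-- The constant E|X_k| is an admissible second envelope, so the product of a covariance and a first
moment is of third order, with the decay of the covariance lag. -/
lemma abs_cov_mul_le (H : Model P Y ℱ a M B h) {j : ℕ} (hj : 1 ≤ j) (k : ℕ) :
    |cov P Y h j| * ∫ ω, |obs P Y h k ω| ∂P ≤ 128 * partMoment B 3 (a j) := by
  have h0 : 0 ≤ ∫ ω, |obs P Y h k ω| ∂P := integral_nonneg fun _ => abs_nonneg _
  have := H.cov_env_mul hj (i := 0) (k := j) (by omega) (H.isEnv_obs 0)
    ((H.isEnv_obs k).const (H.bddMeas_obs k))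
    (W := fun ω => obs P Y h 0 ω * ∫ ω, |obs P Y h k ω| ∂P)
    ((H.bddMeas_obs 0).mul (BddMeas.const _)) ((H.measurable_obs le_rfl).mul_const _)
    fun ω => (abs_mul _ _).le
  have e : ∫ ω, (obs P Y h 0 ω * ∫ ω, |obs P Y h k ω| ∂P) * obs P Y h j ω ∂P =
      cov P Y h j * ∫ ω, |obs P Y h k ω| ∂P := by
    rw [cov, ← integral_mul_const]; congr 1; ext ω; ring
  rwa [e, abs_mul, abs_of_nonneg h0] at this

end Model

/-! ### Decoupling products of observables from functions of the past. -/

namespace Model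

variable {Ω : Type*} {mΩ : MeasurableSpace Ω} {P : Measure Ω} [IsProbabilityMeasure P]
  {Y : ℕ → Ω → ℝ} {ℱ : ℕ → MeasurableSpace Ω} {a : ℕ → ℝ} {M : ℝ} {B h : ℝ → ℝ}
  {Θ : Type*} [MeasurableSpace Θ] {θ : Ω → Θ} {ψ : Θ → ℝ → ℝ} {L : ℝ}

lemma measurable_eval (H : Model P Y ℱ a M B h) (hθ : Measurable[ℱ 0] θ)
    (hψ : Measurable (Function.uncurry ψ)) {u i : ℕ} (hu : u ≤ i) :
    Measurable[ℱ i] fun ω => ψ (θ ω) (psum P Y h u ω) :=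
  hψ.comp (Measurable.prodMk (hθ.mono (H.mix.mono (Nat.zero_le i)) le_rfl) (H.measurable_psum hu))

lemma bddMeas_eval (H : Model P Y ℱ a M B h) (hθ : Measurable[ℱ 0] θ)
    (hψ : Measurable (Function.uncurry ψ)) (h1 : ∀ t x, |ψ t x| ≤ 1) (u : ℕ) :
    BddMeas fun ω => ψ (θ ω) (psum P Y h u ω) :=
  ⟨(H.measurable_eval hθ hψ le_rfl).mono (H.mix.le u) le_rfl, 1, fun _ => h1 _ _⟩

/-- The increment is at most L|X_{t+1}| and is followed by gaps i and j. When j ≤ i the first gap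
decouples the centred pair from the increment. When j > i the gap inside the pair is used: the last
observable is decoupled from the two others, and the subtracted covariance is itself small at lag j.
Either way the larger of the gaps governs the bound. -/
lemma abs_integral_increment_le (H : Model P Y ℱ a M B h) (hθ : Measurable[ℱ 0] θ)
    (hψ : Measurable (Function.uncurry ψ)) (h1 : ∀ t x, |ψ t x| ≤ 1) (hL : 0 < L)
    (hlip : ∀ t x y, |ψ t (x + y) - ψ t x| ≤ L * |y|) {t i : ℕ} (hi : 1 ≤ i) (j : ℕ) :
    |∫ ω, (ψ (θ ω) (psum P Y h (t + 1) ω) - ψ (θ ω) (psum P Y h t ω)) *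
      centered P (fun ω => obs P Y h (t + 1 + i) ω * obs P Y h (t + 1 + i + j) ω) ω ∂P| ≤
      256 * L * partMoment B 3 (a (max i j)) := by
  set W : Ω → ℝ := fun ω =>
    L⁻¹ * (ψ (θ ω) (psum P Y h (t + 1) ω) - ψ (θ ω) (psum P Y h t ω)) with hW
  set X : Ω → ℝ := fun ω => obs P Y h (t + 1 + i) ω * obs P Y h (t + 1 + i + j) ω with hX
  have e : ∫ ω, (ψ (θ ω) (psum P Y h (t + 1) ω) - ψ (θ ω) (psum P Y h t ω)) *
      centered P X ω ∂P = L * ∫ ω, W ω * centered P X ω ∂P := by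
    rw [← integral_const_mul]; congr 1; ext ω; simp only [hW]; field_simp
  have hWm : Measurable[ℱ (t + 1)] W :=
    ((H.measurable_eval hθ hψ le_rfl).sub (H.measurable_eval hθ hψ (Nat.le_succ t))).const_mul _
  have hWb : BddMeas W := (BddMeas.const L⁻¹).mul
    ((H.bddMeas_eval hθ hψ h1 (t + 1)).sub (H.bddMeas_eval hθ hψ h1 t))
  have hWX : ∀ ω, |W ω| ≤ |obs P Y h (t + 1) ω| := fun ω => by
    simp only [hW]
    rw [abs_mul, abs_inv, abs_of_pos hL, inv_mul_le_iff₀ hL, psum_succ]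
    exact hlip _ _ _
  rw [e, abs_mul, abs_of_pos hL, mul_comm 256 L, mul_assoc]
  refine mul_le_mul_of_nonneg_left ?_ hL.le
  rcases le_or_gt j i with hji | hji
  · rw [max_eq_left hji]
    exact H.cov_pair_env hi (by omega) (by omega) (H.isEnv_obs (t + 1)) hWb hWm hWX
  · rw [max_eq_right hji.le]
    have hj : 1 ≤ j := by omega
    have bX : BddMeas X := (H.bddMeas_obs _).mul (H.bddMeas_obs _)
    have e2 : ∫ ω, W ω * centered P X ω ∂P =
        ∫ ω, (W ω * obs P Y h (t + 1 + i) ω) * obs P Y h (t + 1 + i + j) ω ∂P -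
          cov P Y h j * ∫ ω, W ω ∂P := by
      have e3 : ∀ ω, W ω * centered P X ω =
          (W ω * obs P Y h (t + 1 + i) ω) * obs P Y h (t + 1 + i + j) ω - cov P Y h j * W ω := by
        intro ω
        rw [centered, hX, H.integral_obs_mul]; ring
      simp_rw [e3]
      rw [integral_sub ((hWb.mul (H.bddMeas_obs _)).mul (H.bddMeas_obs _)).integrable
        ((BddMeas.const _).mul hWb).integrable, integral_const_mul]
    have b1 := H.cov_env_mul hj (i := t + 1 + i) (k := t + 1 + i + j) le_rfl
      (H.isEnv_obs (t + 1)) (H.isEnv_obs (t + 1 + i)) (hWb.mul (H.bddMeas_obs (t + 1 + i)))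
      ((hWm.mono (H.mix.mono (by omega)) le_rfl).mul (H.measurable_obs le_rfl)) fun ω => by
        rw [abs_mul]; exact mul_le_mul_of_nonneg_right (hWX ω) (abs_nonneg _)
    have b2 := H.abs_cov_mul_le hj (t + 1)
    have b3 : |∫ ω, W ω ∂P| ≤ ∫ ω, |obs P Y h (t + 1) ω| ∂P :=
      abs_integral_le_of_abs_le (H.bddMeas_obs _).abs.integrable hWX
    rw [e2]
    refine (abs_sub _ _).trans ?_
    rw [abs_mul (cov P Y h j)]
    have := mul_le_mul_of_nonneg_left b3 (abs_nonneg (cov P Y h j))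
    linarith

/-- The value at S_u is telescoped back m steps. Each increment costs a third partial moment. The
value left at S_{u-m} precedes the pair by m + 1 and is treated by the sup-norm bound; if time zero
is reached first, the function depends on the past at time zero only and the gap u + 1 is used. -/
lemma abs_integral_centered_le (H : Model P Y ℱ a M B h) (hθ : Measurable[ℱ 0] θ)
    (hψ : Measurable (Function.uncurry ψ)) (h1 : ∀ t x, |ψ t x| ≤ 1) (hL : 0 < L)
    (hlip : ∀ t x y, |ψ t (x + y) - ψ t x| ≤ L * |y|) (m u j : ℕ) :
    |∫ ω, ψ (θ ω) (psum P Y h u ω) *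
      centered P (fun ω => obs P Y h (u + 1) ω * obs P Y h (u + 1 + j) ω) ω ∂P| ≤
      256 * L * ∑ i ∈ Finset.range m, partMoment B 3 (a (max (i + 1) j)) +
        if m ≤ u then 32 * (M ^ 2 * a (m + 1)) else 96 * partMoment B 2 (a (u + 1)) := by
  have hm : ∀ m, |∫ ω, ψ (θ ω) (psum P Y h u ω) *
      centered P (fun ω => obs P Y h (u + 1) ω * obs P Y h (u + 1 + j) ω) ω ∂P| ≤
      256 * L * ∑ i ∈ Finset.range m, partMoment B 3 (a (max (i + 1) j)) +
      |∫ ω, ψ (θ ω) (psum P Y h (u - m) ω) *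
        centered P (fun ω => obs P Y h (u + 1) ω * obs P Y h (u + 1 + j) ω) ω ∂P| := by
    intro m
    induction m with
    | zero => simp
    | succ m ih =>
      refine ih.trans ?_
      rw [Finset.sum_range_succ, mul_add]
      have h0 := mul_nonneg (mul_nonneg (by norm_num : (0 : ℝ) ≤ 256) hL.le)
        (H.rate.partMoment_nonneg 3 (a (max (m + 1) j)))
      -- Once time zero is reached, truncated subtraction keeps the index at 0 and further steps
      -- change nothing.
      rcases Nat.eq_zero_or_pos (u - m) with hz | hz
      · rw [hz, show u - (m + 1) = 0 by omega]; linarith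
      · obtain ⟨t, ht⟩ : ∃ t, u - m = t + 1 := ⟨u - m - 1, by omega⟩
        have b := H.abs_integral_increment_le hθ hψ h1 hL hlip (t := t) (i := m + 1)
          (by omega) j
        rw [show t + 1 + (m + 1) = u + 1 by omega] at b
        rw [ht, show u - (m + 1) = t by omega]
        have bz : BddMeas (centered P fun ω => obs P Y h (u + 1) ω * obs P Y h (u + 1 + j) ω) :=
          ((H.bddMeas_obs _).mul (H.bddMeas_obs _)).centered
        simp_rw [sub_mul] at b
        rw [integral_sub ((H.bddMeas_eval hθ hψ h1 _).mul bz).integrable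
          ((H.bddMeas_eval hθ hψ h1 _).mul bz).integrable] at b
        have := (abs_sub_abs_le_abs_sub _ _).trans b
        linarith
  refine (hm m).trans (add_le_add le_rfl ?_)
  split_ifs with hmu
  · exact H.cov_pair_sup (i := u - m) (by omega) (by omega) (by omega)
      (H.measurable_eval hθ hψ le_rfl) fun _ => h1 _ _
  · rw [show u - m = 0 by omega]
    exact H.cov_pair (i := 0) (by omega) (by omega) (by omega)
      (H.measurable_eval hθ hψ le_rfl) fun _ => h1 _ _

/-- The Lindeberg step needs all covariances to multiply the same expectation, that of φ₂ at S_k.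
Moving the argument forward by d steps costs d first moments, each made third order by the
covariance in front. -/
lemma abs_cov_mul_integral_sub_le (H : Model P Y ℱ a M B h) (hθ : Measurable[ℱ 0] θ)
    (hψ : Measurable (Function.uncurry ψ)) (h1 : ∀ t x, |ψ t x| ≤ 1) (hL : 0 < L)
    (hlip : ∀ t x y, |ψ t (x + y) - ψ t x| ≤ L * |y|) {j : ℕ} (hj : 1 ≤ j) (u d : ℕ) :
    |cov P Y h j * (∫ ω, ψ (θ ω) (psum P Y h u ω) ∂P - ∫ ω, ψ (θ ω) (psum P Y h (u + d) ω) ∂P)| ≤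
      128 * L * (d * partMoment B 3 (a j)) := by
  induction d with
  | zero => simp
  | succ d ih =>
    have b1 : |∫ ω, ψ (θ ω) (psum P Y h (u + d) ω) ∂P -
        ∫ ω, ψ (θ ω) (psum P Y h (u + (d + 1)) ω) ∂P| ≤ ∫ ω, L * |obs P Y h (u + d + 1) ω| ∂P := by
      refine abs_integral_sub_le (H.bddMeas_eval hθ hψ h1 _) (H.bddMeas_eval hθ hψ h1 _)
        ((BddMeas.const L).mul (H.bddMeas_obs _).abs) fun ω => ?_
      rw [← add_assoc, psum_succ, abs_sub_comm]
      exact hlip _ _ _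
    rw [integral_const_mul] at b1
    have b2 := mul_le_mul_of_nonneg_left b1 (abs_nonneg (cov P Y h j))
    have b3 := mul_le_mul_of_nonneg_left (H.abs_cov_mul_le hj (u + d + 1)) hL.le
    rw [← abs_mul] at b2
    have e : cov P Y h j * (∫ ω, ψ (θ ω) (psum P Y h u ω) ∂P -
        ∫ ω, ψ (θ ω) (psum P Y h (u + (d + 1)) ω) ∂P) =
      cov P Y h j * (∫ ω, ψ (θ ω) (psum P Y h u ω) ∂P -
        ∫ ω, ψ (θ ω) (psum P Y h (u + d) ω) ∂P) +
      cov P Y h j * (∫ ω, ψ (θ ω) (psum P Y h (u + d) ω) ∂P -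
        ∫ ω, ψ (θ ω) (psum P Y h (u + (d + 1)) ω) ∂P) := by ring
    rw [e]
    refine (abs_add_le _ _).trans ?_
    push_cast
    linarith

/-- The sums `∑_{i ≤ m} β₃(max i j)`, where `β₃(p)` is the third partial moment at `a p`. -/
def rowSum (B : ℝ → ℝ) (a : ℕ → ℝ) (m j : ℕ) : ℝ :=
  ∑ i ∈ Finset.range (m + 1), partMoment B 3 (a (max i j))

lemma le_rowSum (H : Model P Y ℱ a M B h) {m j : ℕ} (hj : j ≤ m) :
    partMoment B 3 (a j) ≤ rowSum B a m j := by
  have := Finset.single_le_sum (f := fun i => partMoment B 3 (a (max i j)))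
    (fun i _ => H.rate.partMoment_nonneg 3 _) (Finset.mem_range.2 (Nat.lt_succ_of_le hj))
  simpa [rowSum] using this

/-- The first j terms of the row all equal the third partial moment at lag j, which pays for j
forward moves. -/
lemma mul_le_rowSum (H : Model P Y ℱ a M B h) {m j : ℕ} (hj : j ≤ m) :
    j * partMoment B 3 (a j) ≤ rowSum B a m j := by
  have : j * partMoment B 3 (a j) = ∑ i ∈ Finset.range j, partMoment B 3 (a (max i j)) := by
    rw [Finset.sum_congr rfl fun i hi => by rw [max_eq_right (Finset.mem_range.1 hi).le]]
    simp
  rw [this]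
  exact Finset.sum_le_sum_of_subset_of_nonneg (Finset.range_mono (by omega))
    fun i _ _ => H.rate.partMoment_nonneg 3 _

lemma sum_le_rowSum (H : Model P Y ℱ a M B h) (m j : ℕ) :
    ∑ i ∈ Finset.range m, partMoment B 3 (a (max (i + 1) j)) ≤ rowSum B a m j := by
  rw [rowSum, Finset.sum_range_succ']
  linarith [H.rate.partMoment_nonneg 3 (a (max 0 j))]

/-- The pair is centred at the cost of 256, and the argument of ψ is then moved from S_u to S_{u+j}
at the cost of 128. -/
lemma abs_integral_pair_sub_le (H : Model P Y ℱ a M B h) (hθ : Measurable[ℱ 0] θ)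
    (hψ : Measurable (Function.uncurry ψ)) (h1 : ∀ t x, |ψ t x| ≤ 1) (hL : 0 < L)
    (hlip : ∀ t x y, |ψ t (x + y) - ψ t x| ≤ L * |y|) {m u j : ℕ} (hj : j ≤ m) :
    |∫ ω, ψ (θ ω) (psum P Y h u ω) * (obs P Y h (u + 1) ω * obs P Y h (u + 1 + j) ω) ∂P -
      cov P Y h j * ∫ ω, ψ (θ ω) (psum P Y h (u + j) ω) ∂P| ≤
      384 * L * rowSum B a m j +
        if m ≤ u then 32 * (M ^ 2 * a (m + 1)) else 96 * partMoment B 2 (a (u + 1)) := by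
  have bψ := H.bddMeas_eval hθ hψ h1
  have e : ∫ ω, ψ (θ ω) (psum P Y h u ω) *
      centered P (fun ω => obs P Y h (u + 1) ω * obs P Y h (u + 1 + j) ω) ω ∂P =
      ∫ ω, ψ (θ ω) (psum P Y h u ω) * (obs P Y h (u + 1) ω * obs P Y h (u + 1 + j) ω) ∂P -
      cov P Y h j * ∫ ω, ψ (θ ω) (psum P Y h u ω) ∂P := by
    simp only [centered, H.integral_obs_mul, mul_sub]
    rw [integral_sub ((bψ u).mul ((H.bddMeas_obs _).mul (H.bddMeas_obs _))).integrable
      ((bψ u).mul (BddMeas.const _)).integrable, integral_mul_const, mul_comm (cov P Y h j)]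
  have b1 := H.abs_integral_centered_le hθ hψ h1 hL hlip m u j
  rw [e] at b1
  have b2 : |cov P Y h j * (∫ ω, ψ (θ ω) (psum P Y h u ω) ∂P -
      ∫ ω, ψ (θ ω) (psum P Y h (u + j) ω) ∂P)| ≤ 128 * L * (j * partMoment B 3 (a j)) := by
    rcases Nat.eq_zero_or_pos j with rfl | hj0
    · simp
    · exact H.abs_cov_mul_integral_sub_le hθ hψ h1 hL hlip hj0 u j
  have b3 := mul_le_mul_of_nonneg_left (H.mul_le_rowSum hj) hL.le
  have b4 := mul_le_mul_of_nonneg_left (H.sum_le_rowSum m j) hL.le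
  rw [abs_le] at b1 b2 ⊢
  constructor <;> linarith

end Model

lemma BddMeas.of_abs_sub_le {T : Type*} [MeasurableSpace T] {F G R : T → ℝ} (hF : Measurable F)
    (hG : BddMeas G) (hR : BddMeas R) (h : ∀ x, |F x - G x| ≤ R x) : BddMeas F := by
  obtain ⟨-, K, hK⟩ := hG
  obtain ⟨-, K', hK'⟩ := hR
  refine ⟨hF, K + K', fun x => ?_⟩
  have := abs_sub_abs_le_abs_sub (F x) (G x)
  linarith [h x, hK x, hK' x, le_abs_self (R x)]

/-! ### Taylor expansion and one Lindeberg step. -/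

namespace Model

variable {Ω : Type*} {mΩ : MeasurableSpace Ω} {P : Measure Ω} [IsProbabilityMeasure P]
  {Y : ℕ → Ω → ℝ} {ℱ : ℕ → MeasurableSpace Ω} {a : ℕ → ℝ} {M : ℝ} {B h : ℝ → ℝ}
  {Θ : Type*} [MeasurableSpace Θ] {θ : Ω → Θ} {φ φ₁ φ₂ : Θ → ℝ → ℝ} {L b : ℝ}

lemma bddMeas_eval_deriv (H : Model P Y ℱ a M B h) (hθ : Measurable[ℱ 0] θ)
    (hT : ∀ t, IsTest L b (φ t) (φ₁ t) (φ₂ t)) (h₁ : Measurable (Function.uncurry φ₁)) (u : ℕ) :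
    BddMeas fun ω => φ₁ (θ ω) (psum P Y h u ω) := by
  refine BddMeas.of_abs_sub_le ((H.measurable_eval hθ h₁ le_rfl).mono (H.mix.le u) le_rfl)
    (G := fun ω => φ₁ (θ ω) 0) ⟨?_, b, fun ω => (hT _).deriv_zero⟩ (H.bddMeas_psum u).abs
    fun ω => ?_
  · exact (h₁.comp (measurable_id.prodMk measurable_const)).comp (hθ.mono (H.mix.le 0) le_rfl)
  · simpa using (hT (θ ω)).lip_deriv 0 (psum P Y h u ω)

/-- The third order remainder is bounded through the third absolute moment. The square is written
with lag zero, so that the diagonal term has the same shape as the off-diagonal ones. -/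
lemma abs_integral_taylor_le (H : Model P Y ℱ a M B h) (hθ : Measurable[ℱ 0] θ)
    (hT : ∀ t, IsTest L b (φ t) (φ₁ t) (φ₂ t)) (h₀ : Measurable (Function.uncurry φ))
    (h₁ : Measurable (Function.uncurry φ₁)) (h₂ : Measurable (Function.uncurry φ₂)) (hL : 0 < L)
    (k : ℕ) :
    BddMeas (fun ω => φ (θ ω) (psum P Y h (k + 1) ω) - φ (θ ω) (psum P Y h k ω)) ∧
    |∫ ω, (φ (θ ω) (psum P Y h (k + 1) ω) - φ (θ ω) (psum P Y h k ω)) ∂P -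
      (∫ ω, φ₁ (θ ω) (psum P Y h k ω) * obs P Y h (k + 1) ω ∂P +
      (∫ ω, φ₂ (θ ω) (psum P Y h k ω) * (obs P Y h (k + 1) ω * obs P Y h (k + 1 + 0) ω) ∂P) / 2)| ≤
      24 * L * partMoment B 3 (a 0) := by
  have bX := H.bddMeas_obs (k + 1)
  have b1 := (H.bddMeas_eval_deriv hθ hT h₁ k).mul bX
  have b2 := (H.bddMeas_eval hθ h₂ (fun t x => (hT t).bound x) k).mul (bX.mul bX)
  have hle : ∀ ω, |φ (θ ω) (psum P Y h (k + 1) ω) - φ (θ ω) (psum P Y h k ω) -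
      (φ₁ (θ ω) (psum P Y h k ω) * obs P Y h (k + 1) ω +
      (φ₂ (θ ω) (psum P Y h k ω) * (obs P Y h (k + 1) ω * obs P Y h (k + 1) ω)) * 2⁻¹)| ≤
      L * |obs P Y h (k + 1) ω| ^ 3 := fun ω => by
    have := (hT (θ ω)).taylor (psum P Y h k ω) (obs P Y h (k + 1) ω)
    rw [← psum_succ] at this
    convert this using 2; ring
  have bF : BddMeas fun ω => φ (θ ω) (psum P Y h (k + 1) ω) - φ (θ ω) (psum P Y h k ω) :=
    BddMeas.of_abs_sub_le (((H.measurable_eval hθ h₀ le_rfl).mono (H.mix.le _) le_rfl).sub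
      ((H.measurable_eval hθ h₀ le_rfl).mono (H.mix.le _) le_rfl))
      (b1.add (b2.mul (BddMeas.const 2⁻¹))) ((BddMeas.const L).mul (bX.abs.pow 3)) hle
  refine ⟨bF, ?_⟩
  have := abs_integral_sub_le (P := P) bF (b1.add (b2.mul (BddMeas.const 2⁻¹)))
    ((BddMeas.const L).mul (bX.abs.pow 3)) hle
  rw [integral_add b1.integrable (b2.mul (BddMeas.const 2⁻¹)).integrable, integral_mul_const,
    integral_const_mul] at this
  rw [add_zero, div_eq_mul_inv]
  exact this.trans (by
    have := mul_le_mul_of_nonneg_left (H.integral_abs_obs_cube_le (k + 1)) hL.le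
    linarith)

/-- To first order the increment of φ₁ is φ₂(S_u) X_{u+1}, which pairs with the later observable to
give a covariance times the mean of φ₂. The remainder is at most L X_{u+1}², a product of two
envelopes, and is decoupled over the lag j + 1. -/
lemma abs_integral_increment_mul_sub_le (H : Model P Y ℱ a M B h) (hθ : Measurable[ℱ 0] θ)
    (hT : ∀ t, IsTest L b (φ t) (φ₁ t) (φ₂ t))
    (h₁ : Measurable (Function.uncurry φ₁)) (h₂ : Measurable (Function.uncurry φ₂)) (hL : 0 < L)
    {m j : ℕ} (hj : j < m) (u : ℕ) :
    |∫ ω, (φ₁ (θ ω) (psum P Y h (u + 1) ω) - φ₁ (θ ω) (psum P Y h u ω)) *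
        obs P Y h (u + 1 + (j + 1)) ω ∂P -
      cov P Y h (j + 1) * ∫ ω, φ₂ (θ ω) (psum P Y h (u + (j + 1)) ω) ∂P| ≤
      512 * L * rowSum B a m (j + 1) +
        if m ≤ u then 32 * (M ^ 2 * a (m + 1)) else 96 * partMoment B 2 (a (u + 1)) := by
  have hm1 := fun v => H.measurable_eval (u := v) hθ h₁ le_rfl
  have hm2 := H.measurable_eval (u := u) hθ h₂ le_rfl
  have b2 := H.bddMeas_eval hθ h₂ (fun t x => (hT t).bound x) u
  have b1 := H.bddMeas_eval_deriv hθ hT h₁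
  have bX := H.bddMeas_obs
  set r : Ω → ℝ := fun ω => L⁻¹ * (φ₁ (θ ω) (psum P Y h (u + 1) ω) -
    φ₁ (θ ω) (psum P Y h u ω) - φ₂ (θ ω) (psum P Y h u ω) * obs P Y h (u + 1) ω) with hr
  have br : BddMeas r := (BddMeas.const _).mul (((b1 _).sub (b1 _)).sub (b2.mul (bX _)))
  have mr : Measurable[ℱ (u + 1)] r :=
    (((hm1 (u + 1)).sub ((hm1 u).mono (H.mix.mono (Nat.le_succ u)) le_rfl)).sub
      ((hm2.mono (H.mix.mono (Nat.le_succ u)) le_rfl).mul (H.measurable_obs le_rfl))).const_mul _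
  have c1 := H.cov_env_mul (p := j + 1) (i := u + 1) (k := u + 1 + (j + 1)) (by omega) le_rfl
    (H.isEnv_obs (u + 1)) (H.isEnv_obs (u + 1)) br mr fun ω => by
      simp only [hr]
      rw [abs_mul, abs_inv, abs_of_pos hL, inv_mul_le_iff₀ hL, psum_succ, ← sq]
      exact (hT _).taylor_deriv _ _
  have e : ∫ ω, (φ₁ (θ ω) (psum P Y h (u + 1) ω) - φ₁ (θ ω) (psum P Y h u ω)) *
        obs P Y h (u + 1 + (j + 1)) ω ∂P =
      ∫ ω, φ₂ (θ ω) (psum P Y h u ω) *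
        (obs P Y h (u + 1) ω * obs P Y h (u + 1 + (j + 1)) ω) ∂P +
      L * ∫ ω, r ω * obs P Y h (u + 1 + (j + 1)) ω ∂P := by
    rw [← integral_const_mul, ← integral_add (b2.mul ((bX _).mul (bX _))).integrable
      ((BddMeas.const L).mul (br.mul (bX _))).integrable]
    congr 1; ext ω
    simp only [hr]; field_simp; ring
  have c2 := H.abs_integral_pair_sub_le hθ h₂ (fun t x => (hT t).bound x) hL
    (fun t => (hT t).lip) (m := m) (u := u) (j := j + 1) hj
  have c3 := mul_le_mul_of_nonneg_left c1 hL.le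
  have c4 := mul_le_mul_of_nonneg_left (H.le_rowSum (m := m) (j := j + 1) hj) hL.le
  rw [← abs_of_pos hL, ← abs_mul, abs_of_pos hL] at c3
  rw [e]
  rw [abs_le] at c2 c3 ⊢
  constructor <;> linarith

/-- The bound without sup-norm occurs only when k - j < m. As j ≤ m this forces k < 2m, so the
early-time correction is paid during at most 2m steps of the scheme. -/
lemma sum_level_le (H : Model P Y ℱ a M B h) (m k : ℕ) :
    ∑ j ∈ Finset.range (min k m + 1), (if m ≤ k - j then 32 * (M ^ 2 * a (m + 1)) else
      96 * partMoment B 2 (a (k - j + 1))) ≤ 32 * ((m + 1) * M ^ 2 * a (m + 1)) +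
      if k < 2 * m then 96 * ∑ u ∈ Finset.range m, partMoment B 2 (a (u + 1)) else 0 := by
  have h0 : 0 ≤ M ^ 2 * a (m + 1) := mul_nonneg (sq_nonneg _) (H.mix.nonneg _)
  set F : ℕ → ℝ := fun u => if u < m then 96 * partMoment B 2 (a (u + 1)) else 0 with hF
  have hF0 : ∀ u, 0 ≤ F u := fun u => by
    simp only [hF]; split_ifs
    · exact mul_nonneg (by norm_num) (H.rate.partMoment_nonneg 2 _)
    · exact le_rfl
  have hN : min k m + 1 ≤ m + 1 := by omega
  calc _ ≤ ∑ j ∈ Finset.range (min k m + 1), (32 * (M ^ 2 * a (m + 1)) + F (k - j)) := by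
        refine Finset.sum_le_sum fun j _ => ?_
        split_ifs with hm
        · linarith [hF0 (k - j)]
        · simp only [hF, if_pos (not_le.1 hm)]; linarith
    _ ≤ (m + 1) * (32 * (M ^ 2 * a (m + 1))) +
          ∑ j ∈ Finset.range (min k m + 1), F (k - j) := by
        rw [Finset.sum_add_distrib, Finset.sum_const, Finset.card_range, nsmul_eq_mul]
        refine add_le_add (mul_le_mul_of_nonneg_right ?_ (by linarith)) le_rfl
        exact_mod_cast hN
    _ ≤ _ := by
        refine add_le_add (le_of_eq (by ring)) ?_
        split_ifs with hk
        · calc ∑ j ∈ Finset.range (min k m + 1), F (k - j)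
              ≤ ∑ j ∈ Finset.range (k + 1), F (k + 1 - 1 - j) := by
                refine Finset.sum_le_sum_of_subset_of_nonneg (Finset.range_mono (by omega))
                  fun i _ _ => hF0 _
            _ = ∑ u ∈ Finset.range (k + 1), F u := Finset.sum_range_reflect _ _
            _ = ∑ u ∈ Finset.range (k + 1) with u < m, 96 * partMoment B 2 (a (u + 1)) := by
                rw [Finset.sum_filter]
            _ ≤ _ := by
                rw [Finset.mul_sum]
                refine Finset.sum_le_sum_of_subset_of_nonneg (fun i hi => ?_) fun i _ _ =>
                  mul_nonneg (by norm_num) (H.rate.partMoment_nonneg 2 _)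
                exact Finset.mem_range.2 (Finset.mem_filter.1 hi).2
        · refine (Finset.sum_eq_zero fun j hj => ?_).le
          have := Finset.mem_range.1 hj
          simp only [hF, if_neg (show ¬ k - j < m by omega)]

/-- One step of the Lindeberg scheme, for test functions depending on the past. -/
lemma lindeberg_step (H : Model P Y ℱ a M B h) (hθ : Measurable[ℱ 0] θ)
    (hT : ∀ t, IsTest L b (φ t) (φ₁ t) (φ₂ t)) (h₀ : Measurable (Function.uncurry φ))
    (h₁ : Measurable (Function.uncurry φ₁)) (h₂ : Measurable (Function.uncurry φ₂)) (hL : 0 < L)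
    (hb : 0 ≤ b) (s : ℝ) (m k : ℕ) :
    |∫ ω, (φ (θ ω) (psum P Y h (k + 1) ω) - φ (θ ω) (psum P Y h k ω)) ∂P -
      s / 2 * ∫ ω, φ₂ (θ ω) (psum P Y h k ω) ∂P| ≤
      600 * (L * ∑ j ∈ Finset.range (m + 1), rowSum B a m j) +
      16 * (b * partMoment B 1 (a (k + 1))) +
      16 * (M ^ 2 * ∑ j ∈ Finset.Ico m k, a (j + 1)) +
      32 * ((m + 1) * M ^ 2 * a (m + 1)) +
      (if k < 2 * m then 144 * ∑ u ∈ Finset.range m, partMoment B 2 (a (u + 1)) else 0) +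
      |cov P Y h 0 / 2 + ∑ j ∈ Finset.range m, cov P Y h (j + 1) - s / 2| := by
  have bX := H.bddMeas_obs
  have b1 := H.bddMeas_eval_deriv hθ hT h₁
  set e := ∫ ω, φ₂ (θ ω) (psum P Y h k ω) ∂P with he
  have he1 : |e| ≤ 1 := by
    have h0 : ‖e‖ ≤ 1 * P.real univ :=
      norm_integral_le_of_norm_le_const (ae_of_all _ fun ω => (hT (θ ω)).bound _)
    simpa using h0
  set G := ∑ j ∈ Finset.range (m + 1), rowSum B a m j with hG
  set V := ∑ u ∈ Finset.range m, partMoment B 2 (a (u + 1)) with hV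
  set N := min k m with hN
  set T : ℕ → ℝ := fun j => ∫ ω, (φ₁ (θ ω) (psum P Y h (k - j) ω) -
    φ₁ (θ ω) (psum P Y h (k - (j + 1)) ω)) * obs P Y h (k + 1) ω ∂P with hTd
  have hrow0 : ∀ j, 0 ≤ rowSum B a m j := fun j =>
    Finset.sum_nonneg fun i _ => H.rate.partMoment_nonneg 3 _
  have hV0 : 0 ≤ V := Finset.sum_nonneg fun i _ => H.rate.partMoment_nonneg 2 _
  -- expansion of the first order term
  have t1 : ∫ ω, φ₁ (θ ω) (psum P Y h k ω) * obs P Y h (k + 1) ω ∂P =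
      ∫ ω, φ₁ (θ ω) (psum P Y h 0 ω) * obs P Y h (k + 1) ω ∂P + ∑ j ∈ Finset.range k, T j := by
    simp only [hTd]
    rw [← integral_finsetSum _ fun j _ => (((b1 _).sub (b1 _)).mul (bX _)).integrable,
      ← integral_add ((b1 _).mul (bX _)).integrable
        (integrable_finsetSum _ fun j _ => (((b1 _).sub (b1 _)).mul (bX _)).integrable)]
    congr 1; ext ω
    rw [← Finset.sum_mul, Finset.sum_range_sub' (fun j => φ₁ (θ ω) (psum P Y h (k - j) ω)),
      Nat.sub_zero, Nat.sub_self]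
    ring
  have t2 : |∫ ω, φ₁ (θ ω) (psum P Y h 0 ω) * obs P Y h (k + 1) ω ∂P| ≤
      16 * b * partMoment B 1 (a (k + 1)) :=
    H.cov_bdd (i := 0) (by omega) (by omega) (H.measurable_eval hθ h₁ le_rfl) hb fun ω => by
      simpa [psum] using (hT (θ ω)).deriv_zero
  -- the two ranges of lags
  have small : ∀ j ∈ Finset.range N, |T j - cov P Y h (j + 1) * e| ≤
      512 * L * rowSum B a m (j + 1) + if m ≤ k - (j + 1) then 32 * (M ^ 2 * a (m + 1)) else
        96 * partMoment B 2 (a (k - (j + 1) + 1)) := by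
    intro j hj
    have hj' := Finset.mem_range.1 hj
    have := H.abs_integral_increment_mul_sub_le hθ hT h₁ h₂ hL (m := m) (j := j) (by omega)
      (k - (j + 1))
    rw [show k - (j + 1) + 1 + (j + 1) = k + 1 by omega,
      show k - (j + 1) + (j + 1) = k by omega] at this
    simp only [hTd]
    rwa [show k - j = k - (j + 1) + 1 by omega]
  -- For long lags no expansion is needed: an increment of φ₁ is at most |X| ≤ 2M because |φ₂| ≤ 1.
  have large : ∀ j ∈ Finset.Ico N k, |T j| ≤ 16 * (M ^ 2 * a (j + 1)) := by
    intro j hj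
    have hj' := Finset.mem_Ico.1 hj
    have := H.cov_bdd_sup (i := k - j) (p := j + 1) (k := k + 1) (by omega) (by omega)
      (W := fun ω => φ₁ (θ ω) (psum P Y h (k - j) ω) - φ₁ (θ ω) (psum P Y h (k - (j + 1)) ω))
      ((H.measurable_eval hθ h₁ le_rfl).sub (H.measurable_eval hθ h₁ (by omega)))
      (b := 2 * M) (by linarith [H.rate.bound_nonneg]) fun ω => by
        rw [show k - j = k - (j + 1) + 1 by omega, psum_succ]
        exact ((hT _).lip_deriv _ _).trans (H.abs_obs_le _ _)
    exact this.trans (le_of_eq (by ring))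
  obtain ⟨-, tay⟩ := H.abs_integral_taylor_le hθ hT h₀ h₁ h₂ hL k
  have diag := H.abs_integral_pair_sub_le hθ h₂ (fun t x => (hT t).bound x) hL
    (fun t => (hT t).lip) (m := m) (u := k) (j := 0) (Nat.zero_le m)
  rw [add_zero k, ← he] at diag
  set D := ∫ ω, φ₂ (θ ω) (psum P Y h k ω) *
    (obs P Y h (k + 1) ω * obs P Y h (k + 1 + 0) ω) ∂P with hD
  set lev : ℕ → ℝ := fun j => if m ≤ k - j then 32 * (M ^ 2 * a (m + 1)) else
      96 * partMoment B 2 (a (k - j + 1)) with hlev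
  have hlev0 : 0 ≤ lev 0 := by
    simp only [hlev]; split_ifs
    · exact mul_nonneg (by norm_num) (mul_nonneg (sq_nonneg _) (H.mix.nonneg _))
    · exact mul_nonneg (by norm_num) (H.rate.partMoment_nonneg 2 _)
  have s1 : |∑ j ∈ Finset.range N, T j - (∑ j ∈ Finset.range N, cov P Y h (j + 1)) * e| ≤
      ∑ j ∈ Finset.range N, (512 * L * rowSum B a m (j + 1) + lev (j + 1)) := by
    rw [Finset.sum_mul, ← Finset.sum_sub_distrib]
    exact (Finset.abs_sum_le_sum_abs _ _).trans (Finset.sum_le_sum small)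
  have s2 : |∑ j ∈ Finset.Ico N k, T j| ≤ 16 * (M ^ 2 * ∑ j ∈ Finset.Ico m k, a (j + 1)) := by
    rw [Finset.mul_sum, Finset.mul_sum]
    refine (Finset.abs_sum_le_sum_abs _ _).trans ((Finset.sum_le_sum large).trans (le_of_eq ?_))
    congr 1
    ext j; simp only [Finset.mem_Ico]; omega
  have s3 : ∑ j ∈ Finset.range N, T j + ∑ j ∈ Finset.Ico N k, T j = ∑ j ∈ Finset.range k, T j :=
    Finset.sum_range_add_sum_Ico _ (by omega)
  -- For k < m only k of the m covariances have appeared. The missing ones are charged to the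
  -- early-time term, which raises its constant from 96 to 144.
  have s4 : |(∑ j ∈ Finset.range m, cov P Y h (j + 1) -
      ∑ j ∈ Finset.range N, cov P Y h (j + 1)) * e| ≤ if k < 2 * m then 48 * V else 0 := by
    rw [abs_mul]
    refine (mul_le_of_le_one_right (abs_nonneg _) he1).trans ?_
    rcases le_or_gt m k with hmk | hmk
    · rw [show N = m by omega, sub_self, abs_zero]
      split_ifs <;> linarith
    · rw [if_pos (by omega), ← Finset.sum_range_add_sum_Ico _ (show N ≤ m by omega),
        add_sub_cancel_left, hV, Finset.mul_sum]
      refine (Finset.abs_sum_le_sum_abs _ _).trans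
        ((Finset.sum_le_sum fun j _ => H.abs_cov_le (j + 1)).trans ?_)
      exact Finset.sum_le_sum_of_subset_of_nonneg (fun j hj =>
        Finset.mem_range.2 (Finset.mem_Ico.1 hj).2) fun i _ _ =>
        mul_nonneg (by norm_num) (H.rate.partMoment_nonneg 2 _)
  have s5 : |(cov P Y h 0 / 2 + ∑ j ∈ Finset.range m, cov P Y h (j + 1) - s / 2) * e| ≤
      |cov P Y h 0 / 2 + ∑ j ∈ Finset.range m, cov P Y h (j + 1) - s / 2| := by
    rw [abs_mul]; exact mul_le_of_le_one_right (abs_nonneg _) he1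
  have g1 : rowSum B a m 0 + ∑ j ∈ Finset.range N, rowSum B a m (j + 1) ≤ G := by
    rw [hG, add_comm, ← Finset.sum_range_succ' (rowSum B a m)]
    exact Finset.sum_le_sum_of_subset_of_nonneg (Finset.range_mono (by omega))
      fun i _ _ => hrow0 _
  have g2 := H.sum_level_le m k
  rw [← hN, Finset.sum_range_succ', ← hV] at g2
  have g3 : partMoment B 3 (a 0) ≤ rowSum B a m 0 := H.le_rowSum (Nat.zero_le m)
  rw [Finset.sum_add_distrib, ← Finset.mul_sum] at s1
  have g4 := mul_le_mul_of_nonneg_left g1 hL.le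
  have g5 := mul_le_mul_of_nonneg_left g3 hL.le
  have g6 := mul_nonneg hL.le (hrow0 0)
  have g7 : 0 ≤ L * ∑ j ∈ Finset.range N, rowSum B a m (j + 1) :=
    mul_nonneg hL.le (Finset.sum_nonneg fun i _ => hrow0 _)
  have g8 : (if k < 2 * m then 96 * V else 0) + (if k < 2 * m then 48 * V else 0) =
      if k < 2 * m then 144 * V else 0 := by split_ifs <;> ring
  have diag' : |D - cov P Y h 0 * e| ≤ 384 * L * rowSum B a m 0 + lev 0 := diag
  have g2' : ∑ j ∈ Finset.range N, lev (j + 1) + lev 0 ≤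
      32 * ((m + 1) * M ^ 2 * a (m + 1)) + if k < 2 * m then 96 * V else 0 := g2
  rw [t1, ← s3] at tay
  rw [abs_le] at t2 s1 s2 s4 tay diag'
  have h5 := abs_le.1 s5
  rw [abs_le]
  constructor <;> nlinarith only [t2, s1, s2, s4, tay, diag', h5, g2', g4, g5, g6, g7, g8, hlev0]

end Model

/-! ### Summation of the Lindeberg steps. -/

lemma sum_inv_sqrt_le (n : ℕ) : ∑ i ∈ Finset.range n, (√((i : ℝ) + 1))⁻¹ ≤ 2 * √n := by
  induction n with
  | zero => simp
  | succ n ih =>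
    rw [Finset.sum_range_succ]
    have h1 : (0 : ℝ) < √((n : ℝ) + 1) := Real.sqrt_pos.2 (by positivity)
    have h2 : (√((n : ℝ) + 1)) ^ 2 = n + 1 := Real.sq_sqrt (by positivity)
    have h3 : (√(n : ℝ)) ^ 2 = n := Real.sq_sqrt (by positivity)
    have h4 : √(n : ℝ) * √((n : ℝ) + 1) ≤ n + 1 / 2 := by
      nlinarith [sq_nonneg (√(n : ℝ) - √((n : ℝ) + 1))]
    have h5 : (√((n : ℝ) + 1))⁻¹ ≤ 2 * √((n : ℝ) + 1) - 2 * √n := by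
      rw [inv_le_iff_one_le_mul₀ h1]
      nlinarith
    push_cast
    linarith

/-- The derivative at zero is at most √v and grows at unit rate at most. The bound gives quadratic
growth for integrability, and later the price of recentring a Gaussian. -/
lemma abs_smooth_prim_prim_sub_le {ε : ℝ → ℝ} (hm : Measurable ε) (hb : ∀ x, |ε x| ≤ 1) {v : ℝ≥0}
    (hv : v ≠ 0) (x : ℝ) :
    |smooth v (prim (prim ε)) x - smooth v (prim (prim ε)) 0| ≤ √v * |x| + x ^ 2 := by
  have hT := isTest_smooth hv hm hb
  have e := smooth_sub_eq_integral (continuous_prim hm hb).measurable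
    (continuous_prim_prim hm hb).measurable (abs_prim_le_quad hm hb)
    (abs_prim_prim_le_quad hm hb) (prim_prim_sub hm hb) v 0 x
  have e2 := intervalIntegral.norm_integral_le_of_norm_le_const (a := 0) (b := x)
    (f := smooth v (prim ε)) (C := √v + |x|) fun u hu => by
      have l1 := hT.lip_deriv 0 u
      rw [zero_add] at l1
      have l2 := hT.deriv_zero
      have l3 := abs_sub_left_of_mem_uIcc (uIoc_subset_uIcc hu)
      rw [sub_zero, sub_zero] at l3
      have l4 := abs_sub_abs_le_abs_sub (smooth v (prim ε) u) (smooth v (prim ε) 0)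
      rw [Real.norm_eq_abs]; linarith
  rw [← e, sub_zero, Real.norm_eq_abs] at e2
  nlinarith [sq_abs x]

namespace Model

variable {Ω : Type*} {mΩ : MeasurableSpace Ω} {P : Measure Ω} [IsProbabilityMeasure P]
  {Y : ℕ → Ω → ℝ} {ℱ : ℕ → MeasurableSpace Ω} {a : ℕ → ℝ} {M : ℝ} {B h : ℝ → ℝ}
  {Θ : Type*} [MeasurableSpace Θ] {θ : Ω → Θ} {ε : Θ → ℝ → ℝ}

/-- The error of the Lindeberg scheme with `n` steps, at lag cut `m` and variance `s`. -/
def lindErr (B : ℝ → ℝ) (a : ℕ → ℝ) (M : ℝ) (m n : ℕ) (s E : ℝ) : ℝ :=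
  2 * √n / √s * (600 * ∑ j ∈ Finset.range (m + 1), rowSum B a m j +
      ∫ z, |z| ^ 3 ∂gaussianReal 0 s.toNNReal) +
    16 * (√n * √s * ∑ k ∈ Finset.range n, partMoment B 1 (a (k + 1))) +
    n * (16 * (M ^ 2 * ∑ j ∈ Finset.Ico m n, a (j + 1)) + 32 * ((m + 1) * M ^ 2 * a (m + 1)) + E) +
    288 * (m * ∑ u ∈ Finset.range m, partMoment B 2 (a (u + 1)))

/-- The semigroup property writes smoothing by s + v as a Gaussian step of variance s applied to the
test function smoothed by v. Its second order term is s/2 times φ₂, exactly what `lindeberg_step`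
subtracts, and its remainder is the third Gaussian moment over √v. -/
lemma abs_integral_smooth_step_le (H : Model P Y ℱ a M B h) (hθ : Measurable[ℱ 0] θ)
    (hε : Measurable (Function.uncurry ε)) (hb : ∀ t x, |ε t x| ≤ 1) {s v : ℝ≥0} (hv : v ≠ 0)
    (m k : ℕ) :
    BddMeas (fun ω => smooth v (prim (prim (ε (θ ω)))) (psum P Y h (k + 1) ω) -
      smooth (s + v) (prim (prim (ε (θ ω)))) (psum P Y h k ω)) ∧
    |∫ ω, (smooth v (prim (prim (ε (θ ω)))) (psum P Y h (k + 1) ω) -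
      smooth (s + v) (prim (prim (ε (θ ω)))) (psum P Y h k ω)) ∂P| ≤
      (√v)⁻¹ * (600 * ∑ j ∈ Finset.range (m + 1), rowSum B a m j +
        ∫ z, |z| ^ 3 ∂gaussianReal 0 s) +
      16 * (√v * partMoment B 1 (a (k + 1))) +
      (16 * (M ^ 2 * ∑ j ∈ Finset.Ico m k, a (j + 1)) +
      32 * ((m + 1) * M ^ 2 * a (m + 1)) +
      |cov P Y h 0 / 2 + ∑ j ∈ Finset.range m, cov P Y h (j + 1) - s / 2|) +
      (if k < 2 * m then 144 * ∑ u ∈ Finset.range m, partMoment B 2 (a (u + 1)) else 0) := by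
  have hεm : ∀ t, Measurable (ε t) := fun t => hε.comp (measurable_const.prodMk measurable_id)
  have hT : ∀ t, IsTest (√v)⁻¹ (√v) (smooth v (prim (prim (ε t)))) (smooth v (prim (ε t)))
    (smooth v (ε t)) := fun t => isTest_smooth hv (hεm t) (hb t)
  have h1 := measurable_uncurry_prim hε
  have h0 := measurable_uncurry_prim h1
  have hv0 : (0 : ℝ) < v := by positivity
  have hL : 0 < (√(v : ℝ))⁻¹ := inv_pos.2 (Real.sqrt_pos.2 hv0)
  have step := H.lindeberg_step hθ hT (measurable_uncurry_smooth h0 v)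
    (measurable_uncurry_smooth h1 v) (measurable_uncurry_smooth hε v) hL (Real.sqrt_nonneg _) s m k
  obtain ⟨bF, -⟩ := H.abs_integral_taylor_le hθ hT (measurable_uncurry_smooth h0 v)
    (measurable_uncurry_smooth h1 v) (measurable_uncurry_smooth hε v) hL k
  have b2 := H.bddMeas_eval hθ (measurable_uncurry_smooth hε v) (fun t x => (hT t).bound x) k
  have hss : ∀ t y, smooth (s + v) (prim (prim (ε t))) y =
      smooth s (smooth v (prim (prim (ε t)))) y := fun t y =>
    (smooth_smooth (continuous_prim_prim (hεm t) (hb t)).measurable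
      (abs_prim_prim_le_quad (hεm t) (hb t)) s v y).symm
  have hint : ∀ t y, Integrable (fun z => smooth v (prim (prim (ε t))) (y + z))
      (gaussianReal 0 s) := by
    intro t y
    have hm : Measurable (smooth v (prim (prim (ε t)))) :=
      (measurable_uncurry_smooth h0 v).comp (measurable_const.prodMk measurable_id)
    have hv' := Real.sqrt_nonneg (v : ℝ)
    refine integrable_shift_gaussianReal (C := |smooth v (prim (prim (ε t))) 0| + √v + 1)
      hm (fun x => ?_) 0 s y
    have e2 := abs_smooth_prim_prim_sub_le (hεm t) (hb t) hv x
    have e3 := abs_sub_abs_le_abs_sub (smooth v (prim (prim (ε t))) x)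
      (smooth v (prim (prim (ε t))) 0)
    have e4 : |x| ≤ 1 + x ^ 2 := by nlinarith [sq_nonneg (|x| - 1), sq_abs x]
    have e5 := abs_nonneg (smooth v (prim (prim (ε t))) 0)
    nlinarith [sq_abs x, mul_nonneg e5 (sq_nonneg x), mul_le_mul_of_nonneg_left e4 hv']
  have hle : ∀ ω, |smooth (s + v) (prim (prim (ε (θ ω)))) (psum P Y h k ω) -
      smooth v (prim (prim (ε (θ ω)))) (psum P Y h k ω) -
      s / 2 * smooth v (ε (θ ω)) (psum P Y h k ω)| ≤
      (√v)⁻¹ * ∫ z, |z| ^ 3 ∂gaussianReal 0 s := fun ω => by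
    have := abs_smooth_sub_sub_le (hT (θ ω)) s (hint (θ ω) (psum P Y h k ω))
    rw [← hss] at this
    convert this using 2; ring
  have mG : ∀ w : ℝ≥0, Measurable fun ω => smooth w (prim (prim (ε (θ ω)))) (psum P Y h k ω) :=
    fun w => (H.measurable_eval hθ (measurable_uncurry_smooth h0 w) le_rfl).mono
      (H.mix.le k) le_rfl
  have bG : BddMeas fun ω => smooth (s + v) (prim (prim (ε (θ ω)))) (psum P Y h k ω) -
      smooth v (prim (prim (ε (θ ω)))) (psum P Y h k ω) :=
    BddMeas.of_abs_sub_le ((mG _).sub (mG _)) ((BddMeas.const _).mul b2) (BddMeas.const _) hle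
  have g1 := abs_integral_sub_le (P := P) bG ((BddMeas.const _).mul b2) (BddMeas.const _) hle
  rw [integral_const, probReal_univ, one_smul, integral_const_mul] at g1
  have e : ∀ ω, smooth v (prim (prim (ε (θ ω)))) (psum P Y h (k + 1) ω) -
      smooth (s + v) (prim (prim (ε (θ ω)))) (psum P Y h k ω) =
      (smooth v (prim (prim (ε (θ ω)))) (psum P Y h (k + 1) ω) -
        smooth v (prim (prim (ε (θ ω)))) (psum P Y h k ω)) -
      (smooth (s + v) (prim (prim (ε (θ ω)))) (psum P Y h k ω) -
        smooth v (prim (prim (ε (θ ω)))) (psum P Y h k ω)) := fun ω => by ring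
  simp_rw [e]
  refine ⟨bF.sub bG, ?_⟩
  rw [integral_sub bF.integrable bG.integrable]
  rw [_root_.abs_le] at step g1 ⊢
  constructor <;> linarith

lemma abs_integral_lindeberg_le (H : Model P Y ℱ a M B h) (hθ : Measurable[ℱ 0] θ)
    (hε : Measurable (Function.uncurry ε)) (hb : ∀ t x, |ε t x| ≤ 1) {s : ℝ≥0} (hs : s ≠ 0)
    (m n : ℕ) :
    BddMeas (fun ω => smooth s (prim (prim (ε (θ ω)))) (psum P Y h n ω) -
      smooth ((n + 1 : ℕ) * s) (prim (prim (ε (θ ω)))) 0) ∧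
    |∫ ω, (smooth s (prim (prim (ε (θ ω)))) (psum P Y h n ω) -
      smooth ((n + 1 : ℕ) * s) (prim (prim (ε (θ ω)))) 0) ∂P| ≤ lindErr B a M m n s
        |cov P Y h 0 / 2 + ∑ j ∈ Finset.range m, cov P Y h (j + 1) - s / 2| := by
  set G := 600 * ∑ j ∈ Finset.range (m + 1), rowSum B a m j + ∫ z, |z| ^ 3 ∂gaussianReal 0 s
  set V := ∑ u ∈ Finset.range m, partMoment B 2 (a (u + 1)) with hV
  set E := |cov P Y h 0 / 2 + ∑ j ∈ Finset.range m, cov P Y h (j + 1) - s / 2|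
  have hV0 : 0 ≤ V := Finset.sum_nonneg fun i _ => H.rate.partMoment_nonneg 2 _
  have hG0 : 0 ≤ G := add_nonneg (mul_nonneg (by norm_num) (Finset.sum_nonneg fun i _ =>
    Finset.sum_nonneg fun i _ => H.rate.partMoment_nonneg 3 _))
    (integral_nonneg fun _ => by positivity)
  -- The interpolation: at time k the variance is (n + 1 - k)s. It runs from variance (n + 1)s at
  -- the point 0 to variance s at S_n, so every step has a nonzero residual variance (n - k)s.
  set F : ℕ → Ω → ℝ := fun k ω =>
    smooth (((n + 1 - k : ℕ) : ℝ≥0) * s) (prim (prim (ε (θ ω)))) (psum P Y h k ω) with hF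
  have hstep : ∀ k ∈ Finset.range n, BddMeas (fun ω => F (k + 1) ω - F k ω) ∧
      |∫ ω, (F (k + 1) ω - F k ω) ∂P| ≤ (√(((n - k : ℕ) : ℝ) * s))⁻¹ * G +
      16 * (√(n * s) * partMoment B 1 (a (k + 1))) +
      (16 * (M ^ 2 * ∑ j ∈ Finset.Ico m n, a (j + 1)) +
      32 * ((m + 1) * M ^ 2 * a (m + 1)) + E) + (if k < 2 * m then 144 * V else 0) := by
    intro k hk
    have hk := Finset.mem_range.1 hk
    have hv : ((n - k : ℕ) : ℝ≥0) * s ≠ 0 :=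
      mul_ne_zero (Nat.cast_ne_zero.2 (by omega)) hs
    have := H.abs_integral_smooth_step_le hθ hε hb (s := s) hv m k
    have e1 : s + ((n - k : ℕ) : ℝ≥0) * s = ((n + 1 - k : ℕ) : ℝ≥0) * s := by
      rw [show n + 1 - k = (n - k) + 1 by omega]; push_cast; ring
    rw [e1] at this
    simp only [hF, show n + 1 - (k + 1) = n - k by omega]
    refine ⟨this.1, this.2.trans ?_⟩
    rw [NNReal.coe_mul, NNReal.coe_natCast]
    have hnk : ((n - k : ℕ) : ℝ) ≤ n := by exact_mod_cast Nat.sub_le n k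
    have m1 := H.rate.partMoment_nonneg 1 (a (k + 1))
    have m2 : ∑ j ∈ Finset.Ico m k, a (j + 1) ≤ ∑ j ∈ Finset.Ico m n, a (j + 1) :=
      Finset.sum_le_sum_of_subset_of_nonneg (Finset.Ico_subset_Ico le_rfl hk.le)
        fun j _ _ => H.mix.nonneg _
    gcongr
  have e : ∀ ω, smooth s (prim (prim (ε (θ ω)))) (psum P Y h n ω) -
      smooth ((n + 1 : ℕ) * s) (prim (prim (ε (θ ω)))) 0 =
      ∑ k ∈ Finset.range n, (F (k + 1) ω - F k ω) := fun ω => by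
    rw [Finset.sum_range_sub (fun k => F k ω)]
    simp [hF, psum]
  simp_rw [e]
  constructor
  · clear e
    have : ∀ N ≤ n, BddMeas fun ω => ∑ k ∈ Finset.range N, (F (k + 1) ω - F k ω) := by
      intro N
      induction N with
      | zero => intro _; simpa using BddMeas.const 0
      | succ N ih =>
        intro hN
        simp_rw [Finset.sum_range_succ]
        exact (ih (by omega)).add (hstep N (Finset.mem_range.2 (by omega))).1
    exact this n le_rfl
  · rw [integral_finsetSum _ fun k hk => (hstep k hk).1.integrable]
    refine (Finset.abs_sum_le_sum_abs _ _).trans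
      ((Finset.sum_le_sum fun k hk => (hstep k hk).2).trans ?_)
    rw [Finset.sum_add_distrib, Finset.sum_add_distrib, Finset.sum_add_distrib, ← Finset.sum_mul,
      ← Finset.mul_sum, ← Finset.mul_sum, Finset.sum_const, Finset.card_range, nsmul_eq_mul]
    unfold lindErr
    rw [Real.toNNReal_coe]
    refine add_le_add (add_le_add_three ?_ ?_ le_rfl) ?_
    · refine mul_le_mul_of_nonneg_right ?_ hG0
      have e2 : ∑ k ∈ Finset.range n, (√(((n - k : ℕ) : ℝ) * s))⁻¹ =
          (∑ i ∈ Finset.range n, (√((i : ℝ) + 1))⁻¹) * (√s)⁻¹ := by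
        rw [← Finset.sum_range_reflect, Finset.sum_mul]
        refine Finset.sum_congr rfl fun i hi => ?_
        have hi := Finset.mem_range.1 hi
        rw [show n - (n - 1 - i) = i + 1 by omega, Real.sqrt_mul (by positivity), mul_inv]
        push_cast; rfl
      rw [e2, div_eq_mul_inv]
      exact mul_le_mul_of_nonneg_right (sum_inv_sqrt_le n) (by positivity)
    · rw [Real.sqrt_mul (by positivity)]
    -- At most 2m steps carry the early-time term, whence 288 = 2 · 144.
    · rw [← Finset.sum_filter, Finset.sum_const, nsmul_eq_mul]
      have hc : (((Finset.range n).filter fun k => k < 2 * m).card : ℝ) ≤ 2 * m := by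
        have : ((Finset.range n).filter fun k => k < 2 * m).card ≤ (Finset.range (2 * m)).card :=
          Finset.card_le_card fun k hk => Finset.mem_range.2 (Finset.mem_filter.1 hk).2
        rw [Finset.card_range] at this
        exact_mod_cast this
      have := mul_le_mul_of_nonneg_right hc (mul_nonneg (by norm_num : (0 : ℝ) ≤ 144) hV0)
      linarith

end Model

/-! ### Gaussian perturbations of bounded laws -/

/-- All three quantile functions live on the same probability space (0,1), so (x - z)² ≤ 2(x - y)² +
2(y - z)² is integrated pointwise. -/
lemma W2sq_triangle (μ₁ μ₂ μ₃ : Measure ℝ) :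
    W2sq μ₁ μ₃ ≤ 2 * W2sq μ₁ μ₂ + 2 * W2sq μ₂ μ₃ := by
  obtain ⟨l₁, m₁, e₁⟩ := measurable_quantileFun_restrict μ₁
  obtain ⟨l₂, m₂, e₂⟩ := measurable_quantileFun_restrict μ₂
  obtain ⟨l₃, m₃, e₃⟩ := measurable_quantileFun_restrict μ₃
  have key : ∀ {μ ν : Measure ℝ} {l l' : ℝ → ℝ}, (∀ u ∈ Ioo (0 : ℝ) 1, quantileFun μ u = l u) →
      (∀ u ∈ Ioo (0 : ℝ) 1, quantileFun ν u = l' u) →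
      W2sq μ ν = ∫⁻ u in Ioo (0 : ℝ) 1, ENNReal.ofReal ((l u - l' u) ^ 2) := fun e e' =>
    setLIntegral_congr_fun measurableSet_Ioo fun u hu => by simp only [e u hu, e' u hu]
  rw [key e₁ e₃, key e₁ e₂, key e₂ e₃,
    ← lintegral_const_mul _ (by fun_prop), ← lintegral_const_mul _ (by fun_prop),
    ← lintegral_add_left (by fun_prop)]
  refine lintegral_mono fun u => ?_
  rw [← ENNReal.ofReal_ofNat, ← ENNReal.ofReal_mul (by norm_num), ← ENNReal.ofReal_mul (by norm_num),
    ← ENNReal.ofReal_add (by positivity) (by positivity)]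
  exact ENNReal.ofReal_le_ofReal (by nlinarith [sq_nonneg (l₁ u - l₂ u - (l₂ u - l₃ u))])

/-- The law of the sum of an independent variable of law `κ` and a centred Gaussian variable. -/
def gaussSum (κ : Measure ℝ) (v : ℝ≥0) : Measure ℝ :=
  (κ.prod (gaussianReal 0 v)).map fun p => p.1 + p.2

instance (κ : Measure ℝ) [IsProbabilityMeasure κ] (v : ℝ≥0) :
    IsProbabilityMeasure (gaussSum κ v) :=
  Measure.isProbabilityMeasure_map (by fun_prop)

lemma lintegral_sq_gaussianReal (v : ℝ≥0) :
    ∫⁻ z, ENNReal.ofReal (z ^ 2) ∂gaussianReal 0 v = v := by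
  rw [← ofReal_integral_eq_lintegral_ofReal (integrable_sq_gaussianReal 0 v)
    (ae_of_all _ fun z => sq_nonneg z), integral_sq_gaussianReal, ENNReal.ofReal_coe_nnreal]

/-- The obvious coupling, adding the independent Gaussian, has cost v. -/
lemma W2sq_gaussSum_le (κ : Measure ℝ) [IsProbabilityMeasure κ] (v : ℝ≥0) :
    W2sq κ (gaussSum κ v) ≤ v := by
  have h := W2sq_map_le (κ.prod (gaussianReal 0 v)) measurable_fst
    (by fun_prop : Measurable fun x : ℝ × ℝ => x.1 + x.2)
  have e : (κ.prod (gaussianReal 0 v)).map Prod.fst = κ := by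
    rw [Measure.map_fst_prod]; simp
  rw [e] at h
  refine h.trans (le_of_eq ?_)
  have e2 : ∀ x : ℝ × ℝ, ENNReal.ofReal ((x.1 - (x.1 + x.2)) ^ 2) =
      ENNReal.ofReal (x.2 ^ 2) := fun x => by
    congr 1; ring
  simp_rw [e2]
  rw [lintegral_prod _ (by fun_prop)]
  simp [lintegral_sq_gaussianReal]

/-- A Gaussian of variance v + w and mean c is coupled with its centred component of variance v; the
second moment of the other component is c² + w. -/
lemma W2sq_gaussianReal_le (c : ℝ) (v w : ℝ≥0) :
    W2sq (gaussianReal c (v + w)) (gaussianReal 0 v) ≤ ENNReal.ofReal (c ^ 2) + w := by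
  set π := (gaussianReal 0 v).prod (gaussianReal c w) with hπ
  have e1 : π.map (fun x : ℝ × ℝ => x.1 + x.2) = gaussianReal c (v + w) := by
    have := gaussianReal_conv_gaussianReal (m₁ := 0) (m₂ := c) (v₁ := v) (v₂ := w)
    rw [zero_add] at this
    exact this
  have e2 : π.map Prod.fst = gaussianReal 0 v := by
    rw [hπ, Measure.map_fst_prod]; simp
  have h := W2sq_map_le π (by fun_prop : Measurable fun x : ℝ × ℝ => x.1 + x.2) measurable_fst
  rw [e1, e2] at h
  refine h.trans (le_of_eq ?_)
  have e3 : ∀ x : ℝ × ℝ, ENNReal.ofReal (((x.1 + x.2) - x.1) ^ 2) =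
      ENNReal.ofReal (x.2 ^ 2) := fun x => by
    congr 1; ring
  simp_rw [e3]
  rw [hπ, lintegral_prod _ (by fun_prop)]
  simp only [lintegral_const, measure_univ, mul_one]
  have e4 : gaussianReal c w = (gaussianReal 0 w).map (c + ·) := by
    rw [gaussianReal_map_const_add, zero_add]
  rw [e4, lintegral_map (by fun_prop) (by fun_prop)]
  have i1 := integrable_id_gaussianReal 0 w
  have i2 := integrable_sq_gaussianReal 0 w
  have e5 : ∀ z : ℝ, (c + z) ^ 2 = c ^ 2 + 2 * c * z + z ^ 2 := fun z => by ring
  have hm : ∫ z, z ∂gaussianReal 0 w = 0 := integral_id_gaussianReal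
  simp_rw [e5]
  have i4 : Integrable (fun z => c ^ 2 + 2 * c * z) (gaussianReal 0 w) :=
    (integrable_const _).add (i1.const_mul _)
  have i3 : Integrable (fun z => c ^ 2 + 2 * c * z + z ^ 2) (gaussianReal 0 w) := i4.add i2
  rw [← ofReal_integral_eq_lintegral_ofReal i3
    (ae_of_all _ fun z => by simp only [Pi.zero_apply]; rw [← e5]; positivity),
    integral_add i4 i2, integral_add (integrable_const _) (i1.const_mul _), integral_const_mul, hm,
    integral_sq_gaussianReal]
  simp only [integral_const, probReal_univ, one_smul, mul_zero, add_zero]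
  rw [ENNReal.ofReal_add (sq_nonneg c) w.coe_nonneg, ENNReal.ofReal_coe_nnreal]

lemma integral_gaussSum {κ : Measure ℝ} [IsProbabilityMeasure κ] {K : ℝ} (hK : ∀ᵐ y ∂κ, |y| ≤ K)
    {g : ℝ → ℝ} (hg : Measurable g) {C : ℝ} (hb : ∀ x, |g x| ≤ C * (1 + x ^ 2)) (v : ℝ≥0) :
    Integrable g (gaussSum κ v) ∧ ∫ y, g y ∂gaussSum κ v = ∫ y, smooth v g y ∂κ := by
  have hC : 0 ≤ C := by have := (abs_nonneg _).trans (hb 0); simpa using this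
  have hm : Measurable fun p : ℝ × ℝ => p.1 + p.2 := by fun_prop
  have hi : Integrable (fun p : ℝ × ℝ => g (p.1 + p.2)) (κ.prod (gaussianReal 0 v)) := by
    refine Integrable.mono' (g := fun p : ℝ × ℝ => C * (1 + 2 * K ^ 2 + 2 * p.2 ^ 2)) ?_
      (hg.comp hm).aestronglyMeasurable ?_
    · exact ((integrable_const _).add (((integrable_sq_gaussianReal 0 v).comp_snd κ).const_mul
        2)).const_mul C
    · filter_upwards [Measure.quasiMeasurePreserving_fst.ae hK] with p hp
      refine (hb _).trans (mul_le_mul_of_nonneg_left ?_ hC)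
      have := sq_le_sq.2 (hp.trans (le_abs_self K))
      nlinarith [sq_nonneg (p.1 - p.2)]
  refine ⟨(integrable_map_measure hg.aestronglyMeasurable hm.aemeasurable).2 hi, ?_⟩
  rw [gaussSum, integral_map hm.aemeasurable hg.aestronglyMeasurable, integral_prod _ hi]
  rfl

/-- The sign of the difference of the stop-loss transforms. -/
def stopSign (μ ν : Measure ℝ) (x : ℝ) : ℝ := if stopLoss ν x ≤ stopLoss μ x then 1 else -1

lemma abs_stopSign_le (μ ν : Measure ℝ) (x : ℝ) : |stopSign μ ν x| ≤ 1 := by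
  unfold stopSign; split_ifs <;> simp

lemma stopSign_mul (μ ν : Measure ℝ) (x : ℝ) :
    stopSign μ ν x * (stopLoss μ x - stopLoss ν x) = |stopLoss μ x - stopLoss ν x| := by
  unfold stopSign
  split_ifs with h
  · rw [abs_of_nonneg (by linarith), one_mul]
  · rw [abs_of_neg (by linarith)]; ring

/-- The comparison Gaussian is given the mean c of κ, because the stop-loss pairing needs equal
means. Moving the evaluation point of the smoothed function from c to 0 then costs √w |c| + c².
Nonnegativity of the corrected integral is recorded so that it can later be integrated inside
`ENNReal.ofReal`. -/
lemma W2sq_gaussSum_gaussianReal_le {κ : Measure ℝ} [IsProbabilityMeasure κ] {K c : ℝ}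
    (hK : ∀ᵐ y ∂κ, |y| ≤ K) (hc : ∫ y, y ∂κ = c) {v w : ℝ≥0} (hw : w ≠ 0) {ε : ℝ → ℝ}
    (hε : ε = stopSign (gaussSum κ v) (gaussianReal c w)) (hm : Measurable ε) :
    0 ≤ ∫ y, (smooth v (prim (prim ε)) y - smooth w (prim (prim ε)) 0) ∂κ + (√w * |c| + c ^ 2) ∧
    W2sq (gaussSum κ v) (gaussianReal c w) ≤ 8 * ENNReal.ofReal
      (∫ y, (smooth v (prim (prim ε)) y - smooth w (prim (prim ε)) 0) ∂κ +
        (√w * |c| + c ^ 2)) := by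
  have hb : ∀ x, |ε x| ≤ 1 := fun x => by rw [hε]; exact abs_stopSign_le _ _ x
  have hK0 : 0 ≤ K := by
    obtain ⟨y, hy⟩ := hK.exists
    exact (abs_nonneg y).trans hy
  have q1 : ∀ x : ℝ, |x| ≤ 1 * (1 + x ^ 2) := fun x => by
    nlinarith [sq_nonneg (|x| - 1), sq_abs x]
  have q2 : ∀ x : ℝ, |x ^ 2| ≤ 1 * (1 + x ^ 2) := fun x => by
    rw [abs_of_nonneg (sq_nonneg x)]; linarith
  obtain ⟨i1, m1⟩ := integral_gaussSum hK measurable_id q1 v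
  obtain ⟨i2, -⟩ := integral_gaussSum hK (measurable_id.pow_const 2) q2 v
  have hf := (continuous_prim_prim hm hb).measurable
  obtain ⟨i3, m3⟩ := integral_gaussSum hK hf (abs_prim_prim_le_quad hm hb) v
  have es : ∀ y, smooth v id y = y := fun y => by
    have := integrable_id_gaussianReal 0 v
    have hz : ∫ z, z ∂gaussianReal 0 v = 0 := integral_id_gaussianReal
    simp only [smooth, id]
    rw [integral_add (integrable_const _) this, hz]; simp
  have hmean : ∫ y, y ∂gaussSum κ v = ∫ y, y ∂gaussianReal c w := by
    have hz : ∫ z, z ∂gaussianReal c w = c := integral_id_gaussianReal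
    rw [hz, ← hc]
    simp only [es] at m1
    exact m1
  obtain ⟨hi, he⟩ := integral_prim_prim_sub hm hb (gaussSum κ v) (gaussianReal c w) i1
    (integrable_id_gaussianReal c w) i2 (integrable_sq_gaussianReal c w) hmean
  have e4 : ∫ y, prim (prim ε) y ∂gaussianReal c w = smooth w (prim (prim ε)) c := by
    have : gaussianReal c w = (gaussianReal 0 w).map (c + ·) := by
      rw [gaussianReal_map_const_add, zero_add]
    rw [this, integral_map (by fun_prop) hf.aestronglyMeasurable]; rfl
  have habs : ∀ x, ε x * (stopLoss (gaussSum κ v) x - stopLoss (gaussianReal c w) x) =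
      |stopLoss (gaussSum κ v) x - stopLoss (gaussianReal c w) x| := fun x => by
    rw [hε]; exact stopSign_mul _ _ x
  simp_rw [habs] at hi he
  have i5 : Integrable (smooth v (prim (prim ε))) κ := by
    have hms : Measurable (smooth v (prim (prim ε))) :=
      (measurable_uncurry_smooth (α := Unit) (g := fun _ => prim (prim ε))
        (hf.comp measurable_snd) v).comp (measurable_const (a := ()) |>.prodMk measurable_id)
    refine Integrable.mono' (g := fun _ => 1 + 2 * K ^ 2 + 2 * v) (integrable_const _)
      hms.aestronglyMeasurable (hK.mono fun y hy => ?_)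
    have hK2 := sq_le_sq.2 (hy.trans (le_abs_self K))
    have j2 := integrable_sq_gaussianReal 0 v
    have := abs_integral_le_of_abs_le (P := gaussianReal 0 v)
      (X := fun z => prim (prim ε) (y + z)) (R := fun z => 1 + 2 * K ^ 2 + 2 * z ^ 2)
      ((integrable_const _).add (j2.const_mul 2)) fun z => by
        have := abs_prim_prim_le hm hb (y + z)
        nlinarith [sq_nonneg (y - z)]
    rw [integral_add (integrable_const _) (j2.const_mul 2), integral_const_mul,
      integral_sq_gaussianReal] at this
    simpa [smooth] using this
  rw [m3, e4] at he
  have e6 : ∫ y, (smooth v (prim (prim ε)) y - smooth w (prim (prim ε)) 0) ∂κ =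
      ∫ y, smooth v (prim (prim ε)) y ∂κ - smooth w (prim (prim ε)) 0 := by
    rw [integral_sub i5 (integrable_const _)]; simp
  have e7 := abs_smooth_prim_prim_sub_le hm hb hw c
  -- For ε the sign of the difference, the pairing with the second antiderivative is exactly the L¹
  -- distance of the transforms.
  have e8 : ∫ x, |stopLoss (gaussSum κ v) x - stopLoss (gaussianReal c w) x| ≤
      ∫ y, (smooth v (prim (prim ε)) y - smooth w (prim (prim ε)) 0) ∂κ +
        (√w * |c| + c ^ 2) := by
    rw [e6]
    linarith [(_root_.abs_le.1 e7).1]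
  have e9 : 0 ≤ ∫ x, |stopLoss (gaussSum κ v) x - stopLoss (gaussianReal c w) x| :=
    integral_nonneg fun _ => abs_nonneg _
  refine ⟨e9.trans e8, (W2sq_le_stopLoss _ _ i1 (integrable_id_gaussianReal c w)).trans ?_⟩
  refine mul_le_mul_right ?_ _
  rw [← ofReal_integral_eq_lintegral_ofReal hi (ae_of_all _ fun _ => abs_nonneg _)]
  exact ENNReal.ofReal_le_ofReal e8

/-! ### Conditional means -/

section CondMean

variable {Ω : Type*} {F mΩ : MeasurableSpace Ω} {P : Measure Ω} [IsProbabilityMeasure P]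
  {U W : Ω → ℝ}

lemma integral_mul_condExp (hF : F ≤ mΩ) (hU : BddMeas U) (hWF : Measurable[F] W) {b : ℝ}
    (hW : ∀ ω, |W ω| ≤ b) : ∫ ω, W ω * (P[U|F]) ω ∂P = ∫ ω, W ω * U ω ∂P := by
  have h := condExp_stronglyMeasurable_mul_of_bound hF hWF.stronglyMeasurable (hU.integrable (P := P))
    b (ae_of_all _ hW)
  calc ∫ ω, W ω * (P[U|F]) ω ∂P = ∫ ω, (P[W * U|F]) ω ∂P :=
        integral_congr_ae (h.mono fun ω hω => by rw [hω]; rfl)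
    _ = _ := integral_condExp hF

/-- Duality: the sign of the conditional expectation is an admissible test variable. -/
lemma integral_abs_condExp_le (hF : F ≤ mΩ) (hU : BddMeas U) {C : ℝ}
    (h : ∀ W, Measurable[F] W → (∀ ω, |W ω| ≤ 1) → |∫ ω, W ω * U ω ∂P| ≤ C) :
    ∫ ω, |(P[U|F]) ω| ∂P ≤ C := by
  have hA : Measurable[F] (P[U|F]) := stronglyMeasurable_condExp.measurable
  set W : Ω → ℝ := fun ω => if 0 ≤ (P[U|F]) ω then 1 else -1 with hW
  have hWm : Measurable[F] W :=
    Measurable.ite (measurableSet_le measurable_const hA) measurable_const measurable_const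
  have hWb : ∀ ω, |W ω| ≤ 1 := fun ω => by simp only [hW]; split_ifs <;> simp
  have e : ∫ ω, |(P[U|F]) ω| ∂P = ∫ ω, W ω * (P[U|F]) ω ∂P := by
    congr 1; ext ω
    simp only [hW]
    split_ifs with h0
    · rw [abs_of_nonneg h0, one_mul]
    · rw [abs_of_neg (not_le.1 h0)]; ring
  rw [e, integral_mul_condExp hF hU hWm hWb]
  exact (le_abs_self _).trans (h W hWm hWb)

/-- The conditional expectation itself is the test variable. It is bounded by K only almost
everywhere, so it is clipped to satisfy the bound everywhere. -/
lemma integral_condExp_sq_le (hF : F ≤ mΩ) (hU : BddMeas U) {K C : ℝ} (hK : 0 ≤ K)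
    (hUK : ∀ ω, |U ω| ≤ K)
    (h : ∀ W, Measurable[F] W → (∀ ω, |W ω| ≤ K) → |∫ ω, W ω * U ω ∂P| ≤ C) :
    ∫ ω, (P[U|F]) ω ^ 2 ∂P ≤ C := by
  have hA : Measurable[F] (P[U|F]) := stronglyMeasurable_condExp.measurable
  have hb : ∀ᵐ ω ∂P, |(P[U|F]) ω| ≤ K := ae_bdd_abs_condExp_of_ae_bdd_abs (ae_of_all _ hUK)
  have hW : Measurable[F] fun ω => clip K ((P[U|F]) ω) := (measurable_clip K).comp hA
  have e : ∫ ω, (P[U|F]) ω ^ 2 ∂P = ∫ ω, clip K ((P[U|F]) ω) * (P[U|F]) ω ∂P := by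
    refine integral_congr_ae (hb.mono fun ω hω => ?_)
    have := abs_sub_clip_le (c := K) (w := (P[U|F]) ω) le_rfl (by simpa using hω)
    have := sub_eq_zero.1 (abs_nonpos_iff.1 this)
    simp only [← this, sq]
  rw [e, integral_mul_condExp hF hU hW fun ω => abs_clip_le hK _]
  exact (le_abs_self _).trans (h _ hW fun ω => abs_clip_le hK _)

end CondMean

/-! ### Conditional means of partial sums. -/

namespace Model

variable {Ω : Type*} {F mΩ : MeasurableSpace Ω} {P : Measure Ω} [IsProbabilityMeasure P]
  {Y : ℕ → Ω → ℝ} {ℱ : ℕ → MeasurableSpace Ω} {a : ℕ → ℝ} {M : ℝ} {B h : ℝ → ℝ}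

lemma bddMeas_sum (H : Model P Y ℱ a M B h) (J : Finset ℕ) :
    BddMeas fun ω => ∑ k ∈ J, obs P Y h (k + 1) ω := by
  refine ⟨Finset.measurable_sum _ fun k _ => (H.bddMeas_obs (k + 1)).1, J.card * (2 * M),
    fun ω => ?_⟩
  refine (Finset.abs_sum_le_sum_abs _ _).trans ?_
  refine (Finset.sum_le_sum fun i _ => H.abs_obs_le (i + 1) ω).trans ?_
  simp

lemma abs_integral_mul_sum_le (H : Model P Y ℱ a M B h) (hF : F ≤ ℱ 0) {W : Ω → ℝ}
    (hW : Measurable[F] W) {b : ℝ} (hb : 0 ≤ b) (hWb : ∀ ω, |W ω| ≤ b) (J : Finset ℕ) :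
    |∫ ω, W ω * ∑ k ∈ J, obs P Y h (k + 1) ω ∂P| ≤
      16 * b * ∑ k ∈ J, partMoment B 1 (a (k + 1)) ∧
    |∫ ω, W ω * ∑ k ∈ J, obs P Y h (k + 1) ω ∂P| ≤ 8 * b * (M * ∑ k ∈ J, a (k + 1)) := by
  have hWm : BddMeas W := ⟨hW.mono (hF.trans (H.mix.le 0)) le_rfl, b, hWb⟩
  have hW0 : Measurable[ℱ 0] W := hW.mono hF le_rfl
  simp_rw [Finset.mul_sum]
  rw [integral_finsetSum _ fun k _ => (hWm.mul (H.bddMeas_obs (k + 1))).integrable]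
  constructor
  · exact (Finset.abs_sum_le_sum_abs _ _).trans (Finset.sum_le_sum fun k _ =>
      H.cov_bdd (i := 0) (by omega) (by omega) hW0 hb hWb)
  · exact (Finset.abs_sum_le_sum_abs _ _).trans (Finset.sum_le_sum fun k _ =>
      H.cov_bdd_sup (i := 0) (by omega) (by omega) hW0 hb hWb)

lemma integral_abs_condExp_psum_le (H : Model P Y ℱ a M B h) (hF : F ≤ ℱ 0) (n : ℕ) :
    ∫ ω, |(P[psum P Y h n|F]) ω| ∂P ≤ 16 * ∑ k ∈ Finset.range n, partMoment B 1 (a (k + 1)) := by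
  refine integral_abs_condExp_le (hF.trans (H.mix.le 0)) (H.bddMeas_psum n) fun W hW hWb => ?_
  have := (H.abs_integral_mul_sum_le hF hW zero_le_one hWb (Finset.range n)).1
  rwa [mul_one] at this

/-- The bound for the second moment of the conditional mean. -/
def meanErr (B : ℝ → ℝ) (a : ℕ → ℝ) (M : ℝ) (m n : ℕ) : ℝ :=
  64 * (m * M * ∑ k ∈ Finset.range n, partMoment B 1 (a (k + 1))) +
    32 * (n * M ^ 2 * ∑ k ∈ Finset.Ico m n, a (k + 1))

lemma integral_condExp_psum_sq_le (H : Model P Y ℱ a M B h) (hF : F ≤ ℱ 0) (m n : ℕ) :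
    Integrable (fun ω => (P[psum P Y h n|F]) ω ^ 2) P ∧
    ∫ ω, (P[psum P Y h n|F]) ω ^ 2 ∂P ≤ meanErr B a M m n := by
  have hM := H.rate.bound_nonneg
  have hF' := hF.trans (H.mix.le 0)
  -- The sum is split at the lag cut. The first part is bounded by 2mM and uses first partial
  -- moments; the tail is bounded by 2nM and uses the sup-norm covariance bound.
  set U₁ : Ω → ℝ := fun ω => ∑ k ∈ Finset.range (min m n), obs P Y h (k + 1) ω with hU₁
  set U₂ : Ω → ℝ := fun ω => ∑ k ∈ Finset.Ico (min m n) n, obs P Y h (k + 1) ω with hU₂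
  have b₁ : BddMeas U₁ := H.bddMeas_sum _
  have b₂ : BddMeas U₂ := H.bddMeas_sum _
  have hU : psum P Y h n = U₁ + U₂ := by
    ext ω; exact (Finset.sum_range_add_sum_Ico _ (min_le_right m n)).symm
  have hc : P[psum P Y h n|F] =ᵐ[P] P[U₁|F] + P[U₂|F] := by
    rw [hU]; exact condExp_add b₁.integrable b₂.integrable F
  have hcard : ∀ (J : Finset ℕ) (N : ℕ), J.card ≤ N → ∀ ω,
      |∑ k ∈ J, obs P Y h (k + 1) ω| ≤ N * (2 * M) := fun J N hJ ω => by
    refine (Finset.abs_sum_le_sum_abs _ _).trans ?_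
    refine (Finset.sum_le_sum fun i _ => H.abs_obs_le (i + 1) ω).trans ?_
    rw [Finset.sum_const, nsmul_eq_mul]
    have : (J.card : ℝ) ≤ N := by exact_mod_cast hJ
    exact mul_le_mul_of_nonneg_right this (by linarith)
  have hpos : ∀ N : ℕ, 0 ≤ (N : ℝ) * (2 * M) := fun N => by positivity
  have s₁ := integral_condExp_sq_le (P := P) hF' b₁ (hpos m)
    (hcard _ m (by simp)) fun W hW hWb => (H.abs_integral_mul_sum_le hF hW (hpos m) hWb _).1
  have s₂ := integral_condExp_sq_le (P := P) hF' b₂ (hpos n)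
    (hcard _ n (by simp)) fun W hW hWb => (H.abs_integral_mul_sum_le hF hW (hpos n) hWb _).2
  have hsq : ∀ U : Ω → ℝ, BddMeas U → Integrable (fun ω => (P[U|F]) ω ^ 2) P := by
    rintro U ⟨hUm, K, hK⟩
    have hb : ∀ᵐ ω ∂P, |(P[U|F]) ω| ≤ K := ae_bdd_abs_condExp_of_ae_bdd_abs (ae_of_all _ hK)
    refine Integrable.of_bound ((stronglyMeasurable_condExp.mono hF').measurable.pow_const
      2).aestronglyMeasurable (K ^ 2) (hb.mono fun ω hω => ?_)
    rw [norm_pow]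
    exact pow_le_pow_left₀ (norm_nonneg _) hω 2
  refine ⟨hsq _ (H.bddMeas_psum n), ?_⟩
  have h2 : ∫ ω, (P[psum P Y h n|F]) ω ^ 2 ∂P ≤
      ∫ ω, (2 * (P[U₁|F]) ω ^ 2 + 2 * (P[U₂|F]) ω ^ 2) ∂P := by
    refine integral_mono_ae (hsq _ (H.bddMeas_psum n))
      (((hsq _ b₁).const_mul 2).add ((hsq _ b₂).const_mul 2)) (hc.mono fun ω hω => ?_)
    simp only [hω, Pi.add_apply]
    nlinarith [sq_nonneg ((P[U₁|F]) ω - (P[U₂|F]) ω)]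
  rw [integral_add ((hsq _ b₁).const_mul 2) ((hsq _ b₂).const_mul 2), integral_const_mul,
    integral_const_mul] at h2
  have hI : Finset.Ico (min m n) n = Finset.Ico m n := by
    ext j; simp only [Finset.mem_Ico]; omega
  rw [hI] at s₂
  have h3 : ∑ k ∈ Finset.range (min m n), partMoment B 1 (a (k + 1)) ≤
      ∑ k ∈ Finset.range n, partMoment B 1 (a (k + 1)) :=
    Finset.sum_le_sum_of_subset_of_nonneg (Finset.range_mono (min_le_right _ _))
      fun k _ _ => H.rate.partMoment_nonneg 1 _
  have h4 := mul_le_mul_of_nonneg_left h3 (hpos m)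
  unfold meanErr
  nlinarith

end Model

/-! ### Disintegration -/

section Kernels

variable {Θ : Type*} [MeasurableSpace Θ]

lemma measurable_uncurry_stopLoss (η : Kernel Θ ℝ) [IsSFiniteKernel η] :
    Measurable (Function.uncurry fun t x => stopLoss (η t) x) := by
  have : Measurable (Function.uncurry fun (p : Θ × ℝ) (y : ℝ) => max (y - p.2) 0) := by
    unfold Function.uncurry; fun_prop
  exact (this.stronglyMeasurable.integral_kernel_prod_right
    (κ := η.comap Prod.fst measurable_fst)).measurable

/-- The kernel of Gaussian perturbations of the laws of a kernel. -/
def gaussSumKernel (κ : Kernel Θ ℝ) (v : ℝ≥0) : Kernel Θ ℝ :=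
  (κ ×ₖ Kernel.const Θ (gaussianReal 0 v)).map fun p => p.1 + p.2

instance (κ : Kernel Θ ℝ) [IsMarkovKernel κ] (v : ℝ≥0) : IsMarkovKernel (gaussSumKernel κ v) :=
  Kernel.IsMarkovKernel.map _ (by fun_prop)

lemma gaussSumKernel_apply (κ : Kernel Θ ℝ) [IsMarkovKernel κ] (v : ℝ≥0) (t : Θ) :
    gaussSumKernel κ v t = gaussSum (κ t) v := by
  rw [gaussSumKernel, Kernel.map_apply _ (by fun_prop), Kernel.prod_apply, Kernel.const_apply]
  rfl

lemma gaussSum_dirac (c : ℝ) (v : ℝ≥0) : gaussSum (Measure.dirac c) v = gaussianReal c v := by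
  rw [gaussSum, Measure.dirac_prod, Measure.map_map (by fun_prop) (by fun_prop)]
  have : (fun p : ℝ × ℝ => p.1 + p.2) ∘ Prod.mk c = (c + ·) := rfl
  rw [this, gaussianReal_map_const_add, zero_add]

/-- Joint measurability in the conditioning parameter makes the optimal sign an admissible random
test function. The Gaussian laws with random mean are realised as Gaussian perturbations of Dirac
kernels. -/
lemma measurable_uncurry_stopSign (κ : Kernel Θ ℝ) [IsMarkovKernel κ] (v w : ℝ≥0) {c : Θ → ℝ}
    (hc : Measurable c) :
    Measurable (Function.uncurry fun t => stopSign (gaussSum (κ t) v) (gaussianReal (c t) w)) := by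
  have h1 := measurable_uncurry_stopLoss (gaussSumKernel κ v)
  have h2 := measurable_uncurry_stopLoss (gaussSumKernel (Kernel.deterministic c hc) w)
  simp only [gaussSumKernel_apply, Kernel.deterministic_apply, gaussSum_dirac] at h1 h2
  exact Measurable.ite (measurableSet_le h2 h1) measurable_const measurable_const

end Kernels

/-! ### The expected conditional transport cost. -/

namespace Model

variable {Ω : Type*} {mΩ : MeasurableSpace Ω} {P : Measure Ω} [IsProbabilityMeasure P]
  {Y : ℕ → Ω → ℝ} {ℱ : ℕ → MeasurableSpace Ω} {a : ℕ → ℝ} {M : ℝ} {B h : ℝ → ℝ}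
  {Θ : Type*} [MeasurableSpace Θ] {θ : Ω → Θ}

set_option maxHeartbeats 400000 in
/-- The conditional transport cost of a variable close to a partial sum of a mixing sequence. -/
theorem lintegral_W2sq_condDistrib_le (H : Model P Y ℱ a M B h) (hθ : Measurable[ℱ 0] θ)
    {T : Ω → ℝ} (hT : Measurable T) {s : ℝ≥0} (hs : s ≠ 0) (m n : ℕ) :
    ∫⁻ ω, W2sq (condDistrib T θ P (θ ω)) (gaussianReal 0 (n * s)) ∂P ≤
      4 * ∫⁻ ω, ENNReal.ofReal ((T ω - psum P Y h n ω) ^ 2) ∂P + 32 * ENNReal.ofReal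
        (lindErr B a M m n s
          |cov P Y h 0 / 2 + ∑ j ∈ Finset.range m, cov P Y h (j + 1) - s / 2| +
        (16 * (√((n + 1 : ℕ) * s) * ∑ k ∈ Finset.range n, partMoment B 1 (a (k + 1))) +
        meanErr B a M m n)) + (4 * ENNReal.ofReal (meanErr B a M m n) + 8 * s) := by
  have hθm : Measurable θ := hθ.mono (H.mix.le 0) le_rfl
  have hθF : (inferInstance : MeasurableSpace Θ).comap θ ≤ ℱ 0 := hθ.comap_le
  set S := psum P Y h n with hS
  have bS : BddMeas S := H.bddMeas_psum n
  obtain ⟨hSm, K, hK⟩ := id bS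
  set w : ℝ≥0 := (n + 1 : ℕ) * s with hw
  have hw0 : w ≠ 0 := mul_ne_zero (by positivity) hs
  -- The joint conditional law of the variable and the partial sum couples their conditional laws,
  -- so the cost of replacing one by the other averages to their mean square distance.
  set ρ := condDistrib (fun ω => (T ω, S ω)) θ P with hρ
  set κ := ρ.map Prod.snd with hκ
  have : IsMarkovKernel κ := Kernel.IsMarkovKernel.map _ measurable_snd
  have hTS : Measurable fun ω => (T ω, S ω) := hT.prodMk hSm
  have e1 : condDistrib T θ P =ᵐ[P.map θ] ρ.map Prod.fst :=
    condDistrib_comp θ hTS.aemeasurable measurable_fst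
  have e2 : condDistrib S θ P =ᵐ[P.map θ] κ :=
    condDistrib_comp θ hTS.aemeasurable measurable_snd
  have hcomp : P.map (fun ω => (θ ω, S ω)) = P.map θ ⊗ₘ κ :=
    (condDistrib_ae_eq_iff_measure_eq_compProd θ hSm.aemeasurable κ).1 e2
  have hcomp' : P.map θ ⊗ₘ ρ = P.map fun ω => (θ ω, (T ω, S ω)) :=
    compProd_map_condDistrib hTS.aemeasurable
  have hprob : IsProbabilityMeasure (P.map θ) := Measure.isProbabilityMeasure_map hθm.aemeasurable
  set c : Θ → ℝ := fun t => ∫ y, y ∂κ t with hc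
  have hcm : Measurable c :=
    (StronglyMeasurable.integral_kernel_prod_right (κ := κ) (f := fun _ y => y)
      measurable_snd.stronglyMeasurable).measurable
  have hKκ : ∀ᵐ t ∂P.map θ, ∀ᵐ y ∂κ t, |y| ≤ K := by
    refine Measure.ae_ae_of_ae_compProd (p := fun q : Θ × ℝ => |q.2| ≤ K) ?_
    rw [← hcomp, ae_map_iff (hθm.prodMk hSm).aemeasurable
      (measurableSet_le (by fun_prop) measurable_const)]
    exact ae_of_all _ hK
  have hcA : (fun ω => c (θ ω)) =ᵐ[P] P[S|(inferInstance : MeasurableSpace Θ).comap θ] := by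
    refine EventuallyEq.symm ((condExp_ae_eq_integral_condDistrib hθm hSm.aemeasurable
      (f := id) stronglyMeasurable_id bS.integrable).trans ?_)
    filter_upwards [ae_of_ae_map hθm.aemeasurable e2] with ω hω
    rw [hω]; rfl
  obtain ⟨isq, msq⟩ := H.integral_condExp_psum_sq_le hθF m n
  have mabs := H.integral_abs_condExp_psum_le hθF n
  have ec2 : (fun ω => c (θ ω) ^ 2) =ᵐ[P]
      fun ω => (P[S|(inferInstance : MeasurableSpace Θ).comap θ]) ω ^ 2 :=
    hcA.mono fun ω hω => by simp only [hω]
  have ec1 : (fun ω => |c (θ ω)|) =ᵐ[P]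
      fun ω => |(P[S|(inferInstance : MeasurableSpace Θ).comap θ]) ω| :=
    hcA.mono fun ω hω => by simp only [hω]
  have ic2 : Integrable (fun ω => c (θ ω) ^ 2) P := isq.congr ec2.symm
  have ic1 : Integrable (fun ω => |c (θ ω)|) P := integrable_condExp.abs.congr ec1.symm
  rw [← integral_congr_ae ec2] at msq
  rw [← integral_congr_ae ec1] at mabs
  -- The sign that is optimal for the conditional law at t. It depends on the past only, so the
  -- Lindeberg bound for parametrised test functions applies to it.
  obtain ⟨ε, hε⟩ : ∃ ε : Θ → ℝ → ℝ,
    ε = fun t => stopSign (gaussSum (κ t) s) (gaussianReal (c t) w) := ⟨_, rfl⟩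
  have hεm : Measurable (Function.uncurry ε) := by
    rw [hε]; exact measurable_uncurry_stopSign κ s w hcm
  have hεb : ∀ t x, |ε t x| ≤ 1 := fun t x => by rw [hε]; exact abs_stopSign_le _ _ x
  set D : Θ × ℝ → ℝ := fun q =>
    smooth s (prim (prim (ε q.1))) q.2 - smooth w (prim (prim (ε q.1))) 0 with hD
  have hff := measurable_uncurry_prim (measurable_uncurry_prim hεm)
  have hDm : Measurable D := (measurable_uncurry_smooth hff s).sub
    ((measurable_uncurry_smooth hff w).comp (measurable_fst.prodMk measurable_const))
  obtain ⟨bD, lind⟩ := H.abs_integral_lindeberg_le hθ hεm hεb hs m n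
  have hDi : Integrable D (P.map θ ⊗ₘ κ) := by
    rw [← hcomp]
    exact (integrable_map_measure hDm.aestronglyMeasurable
      (hθm.prodMk hSm).aemeasurable).2 bD.integrable
  set I : Θ → ℝ := fun t => ∫ y, D (t, y) ∂κ t with hI
  have hIm : Measurable I :=
    (hDm.stronglyMeasurable.integral_kernel_prod_right' (κ := κ)).measurable
  have hIi : Integrable I (P.map θ) :=
    ((Measure.integrable_compProd_iff hDm.aestronglyMeasurable).1 hDi).2.mono'
      hIm.aestronglyMeasurable (ae_of_all _ fun t => norm_integral_le_integral_norm _)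
  have iI : Integrable (fun ω => I (θ ω)) P :=
    (integrable_map_measure hIm.aestronglyMeasurable hθm.aemeasurable).1 hIi
  -- The disintegration identity: averaging the conditional integrals of the random test function
  -- gives its expectation at the actual partial sum, which the Lindeberg bound controls.
  have mI : ∫ ω, I (θ ω) ∂P = ∫ ω, D (θ ω, S ω) ∂P := by
    rw [← integral_map hθm.aemeasurable hIm.aestronglyMeasurable, hI,
      ← Measure.integral_compProd hDi, ← hcomp,
      integral_map (hθm.prodMk hSm).aemeasurable hDm.aestronglyMeasurable]
  set J : Θ → ℝ := fun t => I t + (√w * |c t| + c t ^ 2) with hJ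
  have hJm : Measurable J := hIm.add ((hcm.abs.const_mul _).add (hcm.pow_const 2))
  have ic : Integrable (fun ω => √w * |c (θ ω)| + c (θ ω) ^ 2) P := (ic1.const_mul _).add ic2
  have iJ : Integrable (fun ω => J (θ ω)) P := iI.add ic
  have third : ∀ᵐ t ∂P.map θ, 0 ≤ J t ∧
      W2sq (gaussSum (κ t) s) (gaussianReal (c t) w) ≤ 8 * ENNReal.ofReal (J t) := by
    filter_upwards [hKκ] with t ht
    have hmt : Measurable (ε t) := hεm.comp (measurable_const.prodMk measurable_id)
    exact W2sq_gaussSum_gaussianReal_le ht rfl hw0 (by rw [hε]) hmt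
  set g : Θ → ℝ≥0∞ := fun t => ∫⁻ z, ENNReal.ofReal ((z.1 - z.2) ^ 2) ∂ρ t with hg
  have hgm : Measurable g := Measurable.lintegral_kernel (by fun_prop)
  have eg : ∫⁻ ω, g (θ ω) ∂P = ∫⁻ ω, ENNReal.ofReal ((T ω - S ω) ^ 2) ∂P := by
    rw [← lintegral_map hgm hθm, hg, ← Measure.lintegral_compProd (μ := P.map θ) (κ := ρ)
      (f := fun q : Θ × (ℝ × ℝ) => ENNReal.ofReal ((q.2.1 - q.2.2) ^ 2)) (by fun_prop), hcomp',
      lintegral_map (by fun_prop) (hθm.prodMk hTS)]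
  have pw : ∀ᵐ ω ∂P, W2sq (condDistrib T θ P (θ ω)) (gaussianReal 0 (n * s)) ≤
      4 * g (θ ω) + 32 * ENNReal.ofReal (J (θ ω)) +
        (4 * ENNReal.ofReal (c (θ ω) ^ 2) + 8 * s) := by
    filter_upwards [ae_of_ae_map hθm.aemeasurable e1, ae_of_ae_map hθm.aemeasurable third]
      with ω h1 h3
    rw [h1, Kernel.map_apply _ measurable_fst]
    have w1 : W2sq ((ρ (θ ω)).map Prod.fst) (κ (θ ω)) ≤ g (θ ω) := by
      rw [hκ, Kernel.map_apply _ measurable_snd]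
      exact W2sq_map_le _ measurable_fst measurable_snd
    have w2 := W2sq_gaussSum_le (κ (θ ω)) s
    have w4 := W2sq_gaussianReal_le (c (θ ω)) (n * s) s
    have hws : (n : ℝ≥0) * s + s = w := by rw [hw]; push_cast; ring
    rw [hws] at w4
    -- Four legs: the law of T, the law of S, its Gaussian perturbation, the Gaussian with the
    -- conditional mean and variance (n + 1)s, the centred Gaussian of variance ns. Each leg is
    -- weighted by 4, and the stop-loss factor 8 makes 32.
    calc _ ≤ 2 * (2 * g (θ ω) + 2 * s) + 2 * (2 * (8 * ENNReal.ofReal (J (θ ω))) +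
          2 * (ENNReal.ofReal (c (θ ω) ^ 2) + s)) := by
          refine (W2sq_triangle _ (gaussSum (κ (θ ω)) s) _).trans (add_le_add
            (mul_le_mul_right ?_ _) (mul_le_mul_right ?_ _))
          · refine (W2sq_triangle _ (κ (θ ω)) _).trans ?_
            gcongr
          · refine (W2sq_triangle _ (gaussianReal (c (θ ω)) w) _).trans ?_
            gcongr
            exact h3.2
      _ = _ := by ring
  have lJ : ∫⁻ ω, ENNReal.ofReal (J (θ ω)) ∂P = ENNReal.ofReal (∫ ω, J (θ ω) ∂P) :=
    (ofReal_integral_eq_lintegral_ofReal iJ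
      ((ae_of_ae_map hθm.aemeasurable third).mono fun ω h => h.1)).symm
  have lc : ∫⁻ ω, ENNReal.ofReal (c (θ ω) ^ 2) ∂P = ENNReal.ofReal (∫ ω, c (θ ω) ^ 2 ∂P) :=
    (ofReal_integral_eq_lintegral_ofReal ic2 (ae_of_all _ fun ω => sq_nonneg _)).symm
  have vJ : ∫ ω, J (θ ω) ∂P = ∫ ω, D (θ ω, S ω) ∂P +
      (√w * ∫ ω, |c (θ ω)| ∂P + ∫ ω, c (θ ω) ^ 2 ∂P) := by
    simp only [hJ]
    rw [integral_add iI ic, integral_add (ic1.const_mul _) ic2,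
      integral_const_mul, mI]
  refine (lintegral_mono_ae pw).trans ?_
  have m1 : Measurable fun ω => g (θ ω) := hgm.comp hθm
  have m2 : Measurable fun ω => ENNReal.ofReal (J (θ ω)) := (hJm.comp hθm).ennreal_ofReal
  have m3 : Measurable fun ω => ENNReal.ofReal (c (θ ω) ^ 2) :=
    ((hcm.comp hθm).pow_const 2).ennreal_ofReal
  have m4 : Measurable fun ω => 4 * g (θ ω) + 32 * ENNReal.ofReal (J (θ ω)) :=
    (m1.const_mul 4).add (m2.const_mul 32)
  rw [lintegral_add_left m4,
    lintegral_add_left (m1.const_mul 4), lintegral_add_left (m3.const_mul 4),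
    lintegral_const_mul _ m1, lintegral_const_mul _ m2, lintegral_const_mul _ m3, eg, lJ, lc, vJ,
    lintegral_const, measure_univ, mul_one]
  have hwr : (w : ℝ) = (n + 1 : ℕ) * s := by rw [hw, NNReal.coe_mul, NNReal.coe_natCast]
  have hmean := mul_le_mul_of_nonneg_left mabs (Real.sqrt_nonneg (w : ℝ))
  rw [← hwr]
  refine add_le_add (add_le_add le_rfl (mul_le_mul_right (ENNReal.ofReal_le_ofReal ?_) _))
    (add_le_add (mul_le_mul_right (ENNReal.ofReal_le_ofReal msq) _) le_rfl)
  exact add_le_add ((le_abs_self _).trans lind) (add_le_add (by linarith) msq)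

end Model

/-! ### Stationary sequences as mixing settings -/

/-- A bounded variable measurable for F pairs with V as it does with E(V | F), and the pairing with
the centred conditional expectation is at most its L¹ norm. This is how the coefficients yield the
mixing inequalities. -/
lemma ofReal_abs_integral_mul_centered_le {Ω : Type*} {F mΩ : MeasurableSpace Ω} {P : Measure Ω}
    [IsProbabilityMeasure P] (hF : F ≤ mΩ) {W V : Ω → ℝ}
    (hW : Measurable[F] W) (hWb : ∀ ω, |W ω| ≤ 1) (hV : BddMeas V) :
    ENNReal.ofReal |∫ ω, W ω * centered P V ω ∂P| ≤
      eLpNorm (centered P (condExp F P V)) 1 P := by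
  have hWm : BddMeas W := ⟨hW.mono hF le_rfl, 1, hWb⟩
  have i1 : Integrable (fun ω => W ω * V ω) P := (hWm.mul hV).integrable
  have e1 : ∫ ω, W ω * V ω ∂P = ∫ ω, W ω * (condExp F P V) ω ∂P := by
    rw [← integral_condExp hF (f := fun ω => W ω * V ω)]
    refine integral_congr_ae ?_
    exact condExp_mul_of_stronglyMeasurable_left hW.stronglyMeasurable i1 hV.integrable
  have i2 : Integrable (fun ω => W ω * (condExp F P V) ω) P :=
    integrable_condExp.bdd_mul (c := 1) hWm.1.aestronglyMeasurable (ae_of_all _ hWb)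
  have e2 : ∫ ω, W ω * centered P V ω ∂P = ∫ ω, W ω * centered P (condExp F P V) ω ∂P := by
    simp only [centered, mul_sub, integral_condExp hF]
    rw [integral_sub i1 (hWm.integrable.mul_const _), integral_sub i2 (hWm.integrable.mul_const _),
      e1]
  rw [e2, ← Real.norm_eq_abs, ofReal_norm, eLpNorm_one_eq_lintegral_enorm]
  refine (enorm_integral_le_lintegral_enorm _).trans (lintegral_mono fun ω => ?_)
  rw [enorm_mul]
  refine mul_le_of_le_one_left zero_le ?_
  rw [← ofReal_norm, ENNReal.ofReal_le_one]
  exact hWb ω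

section Coefficients

variable {Ω : Type*} {mΩ : MeasurableSpace Ω} {P : Measure Ω} [IsProbabilityMeasure P]

/-- The indicator of a half-line evaluated along a random variable. -/
def halfInd (X : Ω → ℝ) (x : ℝ) (ω : Ω) : ℝ := (Iic x).indicator (fun _ => (1 : ℝ)) (X ω)

lemma bddMeas_halfInd {X : Ω → ℝ} (hX : Measurable X) (x : ℝ) : BddMeas (halfInd X x) :=
  (bddMeas_indicator measurableSet_Iic).comp hX

lemma abs_centered_halfInd_le {X : Ω → ℝ} (hX : Measurable X) (x : ℝ) (ω : Ω) :
    |centered P (halfInd X x) ω| ≤ 1 := by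
  have hb := (bddMeas_halfInd hX x).integrable (P := P)
  have h01 : ∀ ω, 0 ≤ halfInd X x ω ∧ halfInd X x ω ≤ 1 := fun ω => by
    unfold halfInd indicator; split_ifs <;> norm_num
  have h0 : 0 ≤ ∫ ω, halfInd X x ω ∂P := integral_nonneg fun ω => (h01 ω).1
  have h1 : ∫ ω, halfInd X x ω ∂P ≤ 1 := by
    simpa using integral_mono hb (integrable_const (1 : ℝ)) fun ω => (h01 ω).2
  unfold centered
  rw [abs_le]
  constructor <;> linarith [(h01 ω).1, (h01 ω).2]

/-- The dependence coefficients of `Y`, truncated at `1`. -/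
def mixRate (P : Measure Ω) (Y δ : ℤ → Ω → ℝ) (p : ℕ) : ℝ := (min (alphaSeq P Y δ 2 p) 1).toReal

/-- Truncating the coefficients at 1 is harmless, since the quantities they bound are trivially at
most 2. -/
lemma abs_le_two_mul_mixRate {Y δ : ℤ → Ω → ℝ} {p : ℕ} {z : ℝ} (h2 : |z| ≤ 2)
    (h : ENNReal.ofReal |z| ≤ alphaSeq P Y δ 2 p) : |z| ≤ 2 * mixRate P Y δ p := by
  unfold mixRate
  rcases le_total (alphaSeq P Y δ 2 p) 1 with h1 | h1
  · rw [min_eq_left h1]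
    have := (ENNReal.ofReal_le_iff_le_toReal (h1.trans_lt ENNReal.one_lt_top).ne).1 h
    linarith [abs_nonneg z]
  · rw [min_eq_right h1]; simpa using h2

lemma alphaSeq_anti (P : Measure Ω) [IsProbabilityMeasure P] (Y δ : ℤ → Ω → ℝ) {m n : ℕ}
    (hm : 1 ≤ m) (hmn : m ≤ n) : alphaSeq P Y δ 2 n ≤ alphaSeq P Y δ 2 m := by
  unfold alphaSeq
  rw [if_neg (by omega), if_neg (by omega)]
  refine iSup_mono fun l => iSup_mono fun hl => iSup_mono fun i => iSup_le fun hi => ?_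
  exact le_iSup (α := ℝ≥0∞) (f := fun _ : Monotone i ∧ ∀ j, (m : ℤ) ≤ i j => _)
    ⟨hi.1, fun j => by have := hi.2 j; omega⟩

lemma mixRate_le_one (P : Measure Ω) (Y δ : ℤ → Ω → ℝ) (p : ℕ) : mixRate P Y δ p ≤ 1 := by
  unfold mixRate
  exact ENNReal.toReal_mono ENNReal.one_ne_top (min_le_right _ _)

lemma mixRate_zero (P : Measure Ω) (Y δ : ℤ → Ω → ℝ) : mixRate P Y δ 0 = 1 := by
  simp [mixRate, alphaSeq]

/-- At lag zero the coefficient is 1 by convention, and the truncation at 1 makes the sequence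
nonincreasing from there on. -/
lemma antitone_mixRate (P : Measure Ω) [IsProbabilityMeasure P] (Y δ : ℤ → Ω → ℝ) :
    Antitone (mixRate P Y δ) := fun m n hmn => by
  rcases Nat.eq_zero_or_pos m with rfl | hm
  · rw [mixRate_zero]; exact mixRate_le_one P Y δ n
  · exact ENNReal.toReal_mono (ne_top_of_le_ne_top ENNReal.one_ne_top (min_le_right _ _))
      (min_le_min_right _ (alphaSeq_anti P Y δ hm hmn))

lemma alphaCoef_le_alphaSeq (P : Measure Ω) (Y δ : ℤ → Ω → ℝ) {p l : ℕ} (hp : 1 ≤ p)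
    (hl : 1 ≤ l ∧ l ≤ 2) {i : Fin l → ℤ} (hi : Monotone i) (h : ∀ j, (p : ℤ) ≤ i j) :
    alphaCoef P (past Y δ 0) (fun j => Y (i j)) ≤ alphaSeq P Y δ 2 p := by
  unfold alphaSeq
  rw [if_neg (by omega)]
  exact le_iSup_of_le l (le_iSup_of_le hl (le_iSup_of_le i
    (le_iSup (α := ℝ≥0∞) (f := fun _ : Monotone i ∧ ∀ j, (p : ℤ) ≤ i j => _) ⟨hi, h⟩)))

end Coefficients

namespace StationarySetup

variable {Ω : Type*} {mΩ : MeasurableSpace Ω} {P : Measure Ω} [IsProbabilityMeasure P]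
  {Y δ : ℤ → Ω → ℝ}

lemma past_le (hS : StationarySetup P Y δ) (i : ℤ) : past Y δ i ≤ mΩ :=
  iSup₂_le fun k _ => ((hS.measurable_Y k).prodMk (hS.measurable_δ k)).comap_le

lemma past_mono : Monotone (past Y δ) := fun _ _ hij =>
  biSup_mono fun _ hk => le_trans hk hij

lemma measurable_past {k i : ℤ} (hk : k ≤ i) :
    Measurable[past Y δ i] fun ω => (Y k ω, δ k ω) :=
  Measurable.mono (comap_measurable _) (le_iSup₂_of_le k hk le_rfl) le_rfl

/-- The past is generated by the sequence read backwards from time i, indexed by naturals. Variables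
measurable for it therefore factor through a sequence space that does not depend on i. -/
lemma past_le_comap (i : ℤ) : past Y δ i ≤
    MeasurableSpace.comap (fun ω (n : ℕ) => (Y (i - n) ω, δ (i - n) ω)) inferInstance := by
  refine iSup₂_le fun k hk => ?_
  have hk : k ≤ i := hk
  have e : (fun ω => (Y k ω, δ k ω)) =
      (fun z : ℕ → ℝ × ℝ => z (i - k).toNat) ∘ fun ω (n : ℕ) => (Y (i - n) ω, δ (i - n) ω) := by
    funext ω
    have : i - ((i - k).toNat : ℤ) = k := by omega
    simp only [Function.comp_apply, this]
  rw [e, ← MeasurableSpace.comap_comp]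
  exact MeasurableSpace.comap_mono (measurable_pi_apply _).comap_le

/-- By independence the joint law is the product of the law of Y, invariant by stationarity, and of
an infinite product of uniform laws, invariant because its factors are equal. -/
lemma identDistrib_shift (hS : StationarySetup P Y δ) (i : ℤ) :
    IdentDistrib (fun ω (j : ℤ) => (Y (j + i) ω, δ (j + i) ω)) (fun ω (j : ℤ) => (Y j ω, δ j ω))
      P P := by
  have mY : ∀ i : ℤ, Measurable fun ω (j : ℤ) => Y (j + i) ω := fun i =>
    measurable_pi_lambda _ fun j => hS.measurable_Y _
  have mδ : ∀ i : ℤ, Measurable fun ω (j : ℤ) => δ (j + i) ω := fun i =>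
    measurable_pi_lambda _ fun j => hS.measurable_δ _
  have e0 : ∀ i : ℤ, P.map (fun ω => ((fun j : ℤ => Y (j + i) ω), fun j : ℤ => δ (j + i) ω)) =
      (P.map fun ω (j : ℤ) => Y j ω).prod
        (Measure.infinitePi fun _ : ℤ => volume.restrict (Icc (0 : ℝ) 1)) := fun i => by
    have hi : IndepFun (fun ω (j : ℤ) => Y (j + i) ω) (fun ω (j : ℤ) => δ (j + i) ω) P :=
      hS.indep_Y_δ.comp (φ := fun (y : ℤ → ℝ) j => y (j + i)) (ψ := fun (y : ℤ → ℝ) j => y (j + i))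
        (measurable_pi_lambda _ fun j => measurable_pi_apply _)
        (measurable_pi_lambda _ fun j => measurable_pi_apply _)
    rw [(indepFun_iff_map_prod_eq_prod_map_map (mY i).aemeasurable (mδ i).aemeasurable).1 hi,
      hS.stationary i]
    congr 1
    have := (hS.indep_δ.precomp (g := fun j : ℤ => j + i) (add_left_injective i))
    rw [this.map_fun_eq_infinitePi_map₀' fun j => (hS.measurable_δ _).aemeasurable]
    simp only [hS.uniform_δ]
  have h : IdentDistrib (fun ω => ((fun j : ℤ => Y (j + i) ω), fun j : ℤ => δ (j + i) ω))
      (fun ω => ((fun j : ℤ => Y (j + 0) ω), fun j : ℤ => δ (j + 0) ω)) P P :=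
    ⟨((mY i).prodMk (mδ i)).aemeasurable, ((mY 0).prodMk (mδ 0)).aemeasurable,
      (e0 i).trans (e0 0).symm⟩
  simpa [Function.comp_def] using h.comp
    (u := fun z : (ℤ → ℝ) × (ℤ → ℝ) => fun j => (z.1 j, z.2 j))
    (measurable_pi_lambda _ fun j => ((measurable_pi_apply j).comp measurable_fst).prodMk
      ((measurable_pi_apply j).comp measurable_snd))

/-- The coefficients refer to F₀ only. A variable measurable at time i is a function of the past
read backwards; the same function of the past of time 0 has the same joint law with the shifted
process, so mixing inequalities transfer to all times. -/
lemma exists_identDistrib (hS : StationarySetup P Y δ) (i : ℤ) {W : Ω → ℝ}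
    (hW : Measurable[past Y δ i] W) (hWb : ∀ ω, |W ω| ≤ 1) :
    ∃ W' : Ω → ℝ, Measurable[past Y δ 0] W' ∧ (∀ ω, |W' ω| ≤ 1) ∧
      IdentDistrib (fun ω => (W ω, fun j : ℤ => Y (j + i) ω))
        (fun ω => (W' ω, fun j : ℤ => Y j ω)) P P := by
  obtain ⟨w, hw, hWw⟩ := (hW.mono (past_le_comap i) le_rfl).exists_eq_measurable_comp
  have hm : Measurable[past Y δ 0] fun ω (n : ℕ) => (Y (-(n : ℤ)) ω, δ (-(n : ℤ)) ω) :=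
    @measurable_pi_lambda _ _ _ (past Y δ 0) _ _ fun n => measurable_past (by omega)
  -- The factor is clipped because it need not be bounded by 1 off the range of the original
  -- process.
  have e : ∀ ω, W ω = clip 1 (w fun n => (Y (i - n) ω, δ (i - n) ω)) := fun ω => by
    have h1 : W ω = w fun n => (Y (i - n) ω, δ (i - n) ω) := congrFun hWw ω
    have h2 := abs_le.1 (hWb ω)
    rw [← h1, clip, min_eq_left h2.2, max_eq_right h2.1]
  refine ⟨fun ω => clip 1 (w fun n => (Y (-(n : ℤ)) ω, δ (-(n : ℤ)) ω)),
    @Measurable.comp _ _ _ (past Y δ 0) _ _ (fun z => clip 1 (w z)) _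
    ((measurable_clip 1).comp hw) hm, fun ω => abs_clip_le zero_le_one _, ?_⟩
  have := (hS.identDistrib_shift i).comp
    (u := fun z : ℤ → ℝ × ℝ => (clip 1 (w fun n => z (-(n : ℤ))), fun j => (z j).1))
    (((measurable_clip 1).comp (hw.comp (measurable_pi_lambda _ fun n =>
      measurable_pi_apply _))).prodMk (measurable_pi_lambda _ fun j =>
        measurable_fst.comp (measurable_pi_apply j)))
  simpa [Function.comp_def, e, neg_add_eq_sub] using this

lemma abs_integral_mul_centered_halfInd_le (hS : StationarySetup P Y δ) {p : ℕ} (hp : 1 ≤ p)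
    {k : ℤ} (hk : (p : ℤ) ≤ k) {W : Ω → ℝ} (hW : Measurable[past Y δ 0] W)
    (hWb : ∀ ω, |W ω| ≤ 1) (x : ℝ) :
    |∫ ω, W ω * centered P (halfInd (Y k) x) ω ∂P| ≤ 2 * mixRate P Y δ p := by
  have hV := (bddMeas_halfInd (hS.measurable_Y k) x).centered (P := P)
  have hcc : centered P (centered P (halfInd (Y k) x)) = centered P (halfInd (Y k) x) := by
    funext ω
    rw [centered, integral_centered (P := P) (bddMeas_halfInd (hS.measurable_Y k) x).integrable,
      sub_zero]
  have hWm : BddMeas W := ⟨hW.mono (hS.past_le 0) le_rfl, 1, hWb⟩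
  refine abs_le_two_mul_mixRate ?_ ?_
  · refine (abs_integral_le_of_abs_le (integrable_const (1 : ℝ)) fun ω => ?_).trans (by simp)
    rw [abs_mul]
    exact mul_le_one₀ (hWb ω) (abs_nonneg _) (abs_centered_halfInd_le (hS.measurable_Y k) x ω)
  · have h1 := ofReal_abs_integral_mul_centered_le (P := P) (hS.past_le 0) hW hWb hV
    rw [hcc] at h1
    refine h1.trans (le_trans ?_ (alphaCoef_le_alphaSeq P Y δ hp (l := 1) (by norm_num)
      (i := fun _ => k) monotone_const fun _ => hk))
    refine le_iSup_of_le (fun _ => x) (le_of_eq ?_)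
    simp only [Finset.univ_unique, Finset.prod_singleton]
    rfl

lemma abs_integral_mul_centered_pair_le (hS : StationarySetup P Y δ) {p : ℕ} (hp : 1 ≤ p)
    {k l : ℤ} (hk : (p : ℤ) ≤ k) (hl : (p : ℤ) ≤ l) {W : Ω → ℝ} (hW : Measurable[past Y δ 0] W)
    (hWb : ∀ ω, |W ω| ≤ 1) (x z : ℝ) :
    |∫ ω, W ω * centered P (fun ω => centered P (halfInd (Y k) x) ω *
      centered P (halfInd (Y l) z) ω) ω ∂P| ≤ 2 * mixRate P Y δ p := by
  -- The coefficients are defined with nondecreasing indices.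
  wlog hkl : k ≤ l generalizing k l x z
  · have := this hl hk z x (le_of_not_ge hkl)
    simpa only [mul_comm] using this
  have hV := ((bddMeas_halfInd (hS.measurable_Y k) x).centered (P := P)).mul
    ((bddMeas_halfInd (hS.measurable_Y l) z).centered (P := P))
  have hVb : ∀ ω, |centered P (halfInd (Y k) x) ω * centered P (halfInd (Y l) z) ω| ≤ 1 :=
    fun ω => by
      rw [abs_mul]
      exact mul_le_one₀ (abs_centered_halfInd_le (hS.measurable_Y k) x ω) (abs_nonneg _)
        (abs_centered_halfInd_le (hS.measurable_Y l) z ω)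
  refine abs_le_two_mul_mixRate ?_ ?_
  · refine (abs_integral_le_of_abs_le (integrable_const (2 : ℝ)) fun ω => ?_).trans (by simp)
    rw [abs_mul]
    have := abs_centered_le (P := P) hVb ω
    nlinarith [hWb ω, abs_nonneg (W ω), abs_nonneg (centered P (fun ω =>
      centered P (halfInd (Y k) x) ω * centered P (halfInd (Y l) z) ω) ω)]
  · refine (ofReal_abs_integral_mul_centered_le (P := P) (hS.past_le 0) hW hWb hV).trans (le_trans ?_
      (alphaCoef_le_alphaSeq P Y δ hp (l := 2) (by norm_num) (i := ![k, l]) ?_ ?_))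
    · refine le_iSup_of_le ![x, z] (le_of_eq ?_)
      simp only [Fin.prod_univ_two]
      rfl
    · intro i j hij
      fin_cases i <;> fin_cases j <;> simp_all
    · intro j
      fin_cases j <;> simp_all

lemma integral_mul_centered_eq {W W' V V' : Ω → ℝ}
    (h : IdentDistrib (fun ω => (W ω, V ω)) (fun ω => (W' ω, V' ω)) P P) :
    ∫ ω, W ω * centered P V ω ∂P = ∫ ω, W' ω * centered P V' ω ∂P := by
  have e : ∫ ω, V ω ∂P = ∫ ω, V' ω ∂P := (h.comp measurable_snd).integral_eq
  have := (h.comp (u := fun q : ℝ × ℝ => q.1 * (q.2 - ∫ ω, V' ω ∂P)) (by fun_prop)).integral_eq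
  simpa only [centered, e, Function.comp_def] using this

/-- The positive half of a stationary sequence, with the filtration of the past, is a mixing
setting. -/
theorem mixSetting (hS : StationarySetup P Y δ) :
    MixSetting P (fun k : ℕ => Y k) (fun k : ℕ => past Y δ k) (mixRate P Y δ) where
  le i := hS.past_le i
  mono i j hij := past_mono (by exact_mod_cast hij)
  meas i := (measurable_fst (α := ℝ) (β := ℝ)).comp (measurable_past le_rfl)
  nonneg p := ENNReal.toReal_nonneg
  le_one p := mixRate_le_one P Y δ p
  pair i j k := by
    have := (hS.identDistrib_shift i).comp (u := fun z : ℤ → ℝ × ℝ => ((z j).1, (z k).1))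
      (((measurable_pi_apply _).fst).prodMk (measurable_pi_apply _).fst)
    have h2 := this.map_eq
    simp only [Function.comp_def] at h2
    push_cast
    simpa only [add_comm (i : ℤ)] using h2
  mix1 i p k hp hk W hW hWb x := by
    obtain ⟨W', hW', hWb', h⟩ := hS.exists_identDistrib i hW hWb
    have h1 := h.comp (u := fun z : ℝ × (ℤ → ℝ) =>
      (z.1, (Iic x).indicator (fun _ => (1 : ℝ)) (z.2 ((k : ℤ) - i))))
      (measurable_fst.prodMk ((measurable_const.indicator measurableSet_Iic).comp
        ((measurable_pi_apply _).comp measurable_snd)))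
    simp only [Function.comp_def, sub_add_cancel] at h1
    rw [integral_mul_centered_eq h1]
    exact hS.abs_integral_mul_centered_halfInd_le hp (by omega) hW' hWb' x
  mix2 i p k l hp hk hl W hW hWb x z := by
    obtain ⟨W', hW', hWb', h⟩ := hS.exists_identDistrib i hW hWb
    have mi : ∀ (x : ℝ) (k : ℤ), Measurable fun z : ℝ × (ℤ → ℝ) =>
        (Iic x).indicator (fun _ => (1 : ℝ)) (z.2 k) := fun x k =>
      (measurable_const.indicator measurableSet_Iic).comp
        ((measurable_pi_apply _).comp measurable_snd)
    have e : ∀ (x : ℝ) (k : ℤ), ∫ ω, halfInd (Y k) x ω ∂P = ∫ ω, halfInd (Y (k - i)) x ω ∂P :=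
      fun x k => by
        have := (h.comp (mi x (k - i))).integral_eq
        simp only [Function.comp_def, sub_add_cancel] at this
        exact this
    have h1 := h.comp (u := fun q : ℝ × (ℤ → ℝ) =>
      (q.1, ((Iic x).indicator (fun _ => (1 : ℝ)) (q.2 ((k : ℤ) - i)) - ∫ ω, halfInd (Y k) x ω ∂P) *
        ((Iic z).indicator (fun _ => (1 : ℝ)) (q.2 ((l : ℤ) - i)) - ∫ ω, halfInd (Y l) z ω ∂P)))
      (measurable_fst.prodMk (((mi x _).sub_const _).mul ((mi z _).sub_const _)))
    simp only [Function.comp_def, sub_add_cancel] at h1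
    have h2 := integral_mul_centered_eq h1
    rw [e x k, e z l] at h2
    have h3 := hS.abs_integral_mul_centered_pair_le hp (k := (k : ℤ) - i) (l := (l : ℤ) - i)
      (by omega) (by omega) hW' hWb' x z
    refine le_trans (le_of_eq ?_) h3
    refine (congrArg abs (Eq.trans ?_ h2)).trans rfl
    rw [← e x k, ← e z l]
    rfl

end StationarySetup

/-! ### Observables with tails controlled by a quantile function -/

/-- Nonincreasing functions that are finite on the positive half-line. -/
structure IsTail (Q : ℝ → ℝ≥0∞) : Prop where
  anti : Antitone Q
  fin : ∀ u, 0 < u → Q u < ∞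

lemma upperQuantile_antitone {Ω : Type*} {mΩ : MeasurableSpace Ω} (P : Measure Ω) (X : Ω → ℝ) :
    Antitone (upperQuantile P X) := fun _ _ h =>
  iInf_mono fun _ => iInf_mono' fun h' => ⟨h'.trans (ENNReal.ofReal_le_ofReal h), le_rfl⟩

/-- The infimum in the quantile is attained: the event is the increasing union of the events at
levels q + 1/(n + 1), each strictly above the infimum. -/
lemma measure_lt_toReal_upperQuantile_le {Ω : Type*} {mΩ : MeasurableSpace Ω} {P : Measure Ω}
    {X : Ω → ℝ} {u q : ℝ} (h : upperQuantile P X u ≤ ENNReal.ofReal q) (hq : 0 ≤ q) :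
    P {ω | q < X ω} ≤ ENNReal.ofReal u := by
  have key : ∀ n : ℕ, P {ω | q + 1 / ((n : ℝ) + 1) < X ω} ≤ ENNReal.ofReal u := fun n => by
    have hn : (0 : ℝ) < 1 / ((n : ℝ) + 1) := by positivity
    have h1 : upperQuantile P X u < ENNReal.ofReal (q + 1 / ((n : ℝ) + 1)) :=
      h.trans_lt ((ENNReal.ofReal_lt_ofReal_iff (by linarith)).2 (by linarith))
    obtain ⟨t, ht⟩ := iInf_lt_iff.1 h1
    obtain ⟨ht1, ht2⟩ := iInf_lt_iff.1 ht
    refine (measure_mono fun ω hω => ?_).trans ht1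
    have h3 : (t : ℝ) < q + 1 / ((n : ℝ) + 1) := by
      rw [← ENNReal.ofReal_coe_nnreal] at ht2
      exact (ENNReal.ofReal_lt_ofReal_iff (by linarith)).1 ht2
    exact h3.trans hω
  have e : {ω | q < X ω} = ⋃ n : ℕ, {ω | q + 1 / ((n : ℝ) + 1) < X ω} := by
    ext ω
    simp only [mem_iUnion]
    refine ⟨fun hω => ?_, fun ⟨n, hn⟩ => ?_⟩
    · obtain ⟨n, hn⟩ := exists_nat_one_div_lt (sub_pos.2 (show q < X ω from hω))
      exact ⟨n, show q + _ < X ω by linarith⟩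
    · have hn' : q + 1 / ((n : ℝ) + 1) < X ω := hn
      have : (0 : ℝ) < 1 / ((n : ℝ) + 1) := by positivity
      show q < X ω
      linarith
  rw [e, Monotone.measure_iUnion]
  · exact iSup_le key
  · intro i j hij ω hω
    have hω' : q + 1 / ((i : ℝ) + 1) < X ω := hω
    have := one_div_le_one_div_of_le (by positivity : (0 : ℝ) < i + 1)
      (by exact_mod_cast Nat.succ_le_succ hij : (i : ℝ) + 1 ≤ j + 1)
    show q + 1 / ((j : ℝ) + 1) < X ω
    linarith

lemma isPieceMono_of_mem {Q : ℝ → ℝ≥0∞} {μ : Measure ℝ} {g : ℝ → ℝ} (hg : g ∈ MonClass Q μ) :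
    IsPieceMono g := by
  obtain ⟨⟨I, -, h1, h2, h3⟩, -⟩ := hg
  exact ⟨I, h1, h2, h3⟩

/-- Comparison level by level. If w is the mass where φ(|g|) exceeds s, then every u < w satisfies
φ(Q(u)) ≥ s, for otherwise the quantile bound would give w ≤ u. -/
lemma lintegral_comp_le_of_mem {Q : ℝ → ℝ≥0∞} (hQ : IsTail Q) {μ : Measure ℝ}
    [IsProbabilityMeasure μ] {g : ℝ → ℝ} (hg : g ∈ MonClass Q μ) {φ : ℝ → ℝ}
    (hφ : Monotone φ) (h0 : ∀ x, 0 ≤ φ x) :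
    ∫⁻ x, ENNReal.ofReal (φ |g x|) ∂μ ≤
      ∫⁻ u in Ioo (0 : ℝ) 1, ENNReal.ofReal (φ (Q u).toReal) := by
  have hQm : AEMeasurable (fun u => φ (Q u).toReal) (volume.restrict (Ioo (0 : ℝ) 1)) :=
    hφ.measurable.comp_aemeasurable hQ.anti.measurable.ennreal_toReal.aemeasurable
  rw [lintegral_eq_lintegral_meas_lt _ (ae_of_all _ fun x => h0 _)
    (hφ.measurable.comp (isPieceMono_of_mem hg).measurable.abs).aemeasurable,
    lintegral_eq_lintegral_meas_le _ (ae_of_all _ fun x => h0 _) hQm]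
  refine lintegral_mono fun s => ?_
  have hw : μ {x | s < φ |g x|} ≠ ∞ := measure_ne_top _ _
  obtain ⟨w, hww⟩ : ∃ w, w = (μ {x | s < φ |g x|}).toReal := ⟨_, rfl⟩
  have hw1 : w ≤ 1 := hww ▸ ENNReal.toReal_mono ENNReal.one_ne_top prob_le_one
  calc μ {x | s < φ |g x|} = volume (Ioo 0 w) := by
        rw [Real.volume_Ioo, sub_zero, hww, ENNReal.ofReal_toReal hw]
    _ = (volume.restrict (Ioo (0 : ℝ) 1)) (Ioo 0 w) := by
        rw [Measure.restrict_apply measurableSet_Ioo,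
          inter_eq_left.2 (Ioo_subset_Ioo_right hw1)]
    _ ≤ _ := by
        refine measure_mono fun u hu => ?_
        show s ≤ φ (Q u).toReal
        by_contra hlt
        have hfin := (hQ.fin u hu.1).ne
        have h1 := measure_lt_toReal_upperQuantile_le (P := μ) (X := fun x => |g x|) (u := u)
          (q := (Q u).toReal) ((hg.2 u ⟨hu.1.le, hu.2.le.trans hw1⟩).trans
            (ENNReal.ofReal_toReal hfin).ge) ENNReal.toReal_nonneg
        have h2 : μ {x | s < φ |g x|} ≤ ENNReal.ofReal u := by
          refine (measure_mono fun x hx => ?_).trans h1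
          show (Q u).toReal < |g x|
          by_contra h
          exact hlt ((le_of_lt hx).trans (hφ (not_lt.1 h)))
        have h3 := ENNReal.toReal_mono ENNReal.ofReal_ne_top h2
        rw [← hww, ENNReal.toReal_ofReal hu.1.le] at h3
        exact absurd hu.2 (not_lt.2 h3)

/-- The part of a real number between the levels `M` and `K`. -/
def band (M K y : ℝ) : ℝ := clip K y - clip M y

/-- The part of the tail function `Q` between the levels `M` and `K`. -/
def bandRate (Q : ℝ → ℝ≥0∞) (M K u : ℝ) : ℝ := min (Q u).toReal K - min (Q u).toReal M

/-- The combination `∑ a_l ψ(g_l)`. -/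
def comb {L : ℕ} (a : Fin L → ℝ) (ψ : ℝ → ℝ) (g : Fin L → ℝ → ℝ) (x : ℝ) : ℝ :=
  ∑ l, a l * ψ (g l x)

section Band

variable {M K : ℝ}

lemma band_zero_left (K y : ℝ) : band 0 K y = clip K y := by
  have : clip 0 y = 0 := by
    unfold clip
    rcases le_total y 0 with h | h
    · rw [min_eq_left h]; simpa using h
    · rw [min_eq_right h]; simp
  rw [band, this, sub_zero]

lemma abs_band (h0 : 0 ≤ M) (hMK : M ≤ K) (y : ℝ) : |band M K y| = min |y| K - min |y| M := by
  unfold band clip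
  rcases le_total 0 y with h | h
  · have e : ∀ c, 0 ≤ c → max (-c) (min y c) = min y c := fun c hc =>
      max_eq_right (by rw [le_min_iff]; constructor <;> linarith)
    rw [abs_of_nonneg h, e K (h0.trans hMK), e M h0, abs_of_nonneg]
    exact sub_nonneg.2 (min_le_min_left _ hMK)
  · have e : ∀ c, 0 ≤ c → max (-c) (min y c) = -min (-y) c := fun c hc => by
      rw [min_eq_left (by linarith : y ≤ c), ← neg_neg y, max_neg_neg, neg_neg, min_comm]
    rw [abs_of_nonpos h, e K (h0.trans hMK), e M h0, abs_of_nonpos]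
    · ring
    · have := min_le_min_left (-y) hMK
      linarith

lemma monotone_min_sub_min (hMK : M ≤ K) : Monotone fun t : ℝ => min t K - min t M := by
  intro s t h
  simp only
  rcases le_total s M with h1 | h1
  · rw [min_eq_left h1, min_eq_left (h1.trans hMK), sub_self]
    exact sub_nonneg.2 (min_le_min_left _ hMK)
  · rw [min_eq_right h1, min_eq_right (h1.trans h)]
    exact sub_le_sub_right (min_le_min_right _ h) _

lemma min_sub_min_nonneg (hMK : M ≤ K) (t : ℝ) : 0 ≤ min t K - min t M :=
  sub_nonneg.2 (min_le_min_left _ hMK)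

lemma monotone_band (h0 : 0 ≤ M) (hMK : M ≤ K) : Monotone (band M K) := by
  have e : ∀ y, band M K y = (min (max y 0) K - min (max y 0) M) -
      (min (max (-y) 0) K - min (max (-y) 0) M) := fun y => by
    have hz : min 0 K - min 0 M = 0 := by
      rw [min_eq_left h0, min_eq_left (h0.trans hMK), sub_self]
    unfold band clip
    rcases le_total 0 y with h | h
    · have e : ∀ c, 0 ≤ c → max (-c) (min y c) = min y c := fun c hc =>
        max_eq_right (by rw [le_min_iff]; constructor <;> linarith)
      rw [e K (h0.trans hMK), e M h0, max_eq_left h, max_eq_right (by linarith : -y ≤ 0), hz,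
        sub_zero]
    · have e : ∀ c, 0 ≤ c → max (-c) (min y c) = -min (-y) c := fun c hc => by
        rw [min_eq_left (by linarith : y ≤ c), ← neg_neg y, max_neg_neg, neg_neg, min_comm]
      rw [e K (h0.trans hMK), e M h0, max_eq_right h, max_eq_left (by linarith : 0 ≤ -y), hz]
      ring
  intro x y hxy
  rw [e x, e y]
  exact sub_le_sub (monotone_min_sub_min hMK (max_le_max_right _ hxy))
    (monotone_min_sub_min hMK (max_le_max_right _ (neg_le_neg hxy)))

lemma band_zero_right (h0 : 0 ≤ M) (hMK : M ≤ K) : band M K 0 = 0 := by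
  rw [band, clip_zero h0, clip_zero (h0.trans hMK), sub_zero]

lemma isRate_bandRate {Q : ℝ → ℝ≥0∞} (hQ : IsTail Q) (h0 : 0 ≤ M) (hMK : M ≤ K) :
    IsRate K (bandRate Q M K) where
  anti u hu w hw huw := monotone_min_sub_min hMK
    (ENNReal.toReal_mono (hQ.fin u hu.1).ne (hQ.anti huw))
  nonneg u := min_sub_min_nonneg hMK _
  le u := by
    have : 0 ≤ min (Q u).toReal M := le_min ENNReal.toReal_nonneg h0
    have := min_le_right (Q u).toReal K
    unfold bandRate
    linarith

/-- Jensen for weights of total mass at most one: the missing mass is placed at the value zero, on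
an extra index. -/
lemma pow_sum_mul_le {L : ℕ} {w z : Fin L → ℝ} (hw : ∀ l, 0 ≤ w l) (hw1 : ∑ l, w l ≤ 1)
    (hz : ∀ l, 0 ≤ z l) {j : ℕ} (hj : 1 ≤ j) : (∑ l, w l * z l) ^ j ≤ ∑ l, w l * z l ^ j := by
  have := Real.pow_arith_mean_le_arith_mean_pow (Finset.univ : Finset (Option (Fin L)))
    (fun o => o.elim (1 - ∑ l, w l) w) (fun o => o.elim 0 z)
    (fun o _ => by cases o <;> simp [hw1, hw]) (by simp [Fintype.sum_option])
    (fun o _ => by cases o <;> simp [hz]) j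
  simpa [Fintype.sum_option, show j ≠ 0 by omega] using this

lemma bddMeas_comb {L : ℕ} {a : Fin L → ℝ} {g : Fin L → ℝ → ℝ} (ha : ∑ l, |a l| ≤ 1)
    {ψ : ℝ → ℝ} {c : ℝ} (hc : 0 ≤ c) (hψm : Measurable ψ) (hψ : ∀ y, |ψ y| ≤ c)
    (hg : ∀ l, Measurable (g l)) : Measurable (comb a ψ g) ∧ ∀ x, |comb a ψ g x| ≤ c := by
  refine ⟨Finset.measurable_fun_sum _ fun l _ => (hψm.comp (hg l)).const_mul _, fun x => ?_⟩
  refine (Finset.abs_sum_le_sum_abs _ _).trans ?_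
  calc ∑ l, |a l * ψ (g l x)| ≤ ∑ l, |a l| * c := Finset.sum_le_sum fun l _ => by
        rw [abs_mul]; exact mul_le_mul_of_nonneg_left (hψ _) (abs_nonneg _)
    _ ≤ c := by rw [← Finset.sum_mul]; exact mul_le_of_le_one_left hc ha

lemma abs_band_le (h0 : 0 ≤ M) (hMK : M ≤ K) (y : ℝ) : |band M K y| ≤ K := by
  rw [abs_band h0 hMK]
  have : 0 ≤ min |y| M := le_min (abs_nonneg _) h0
  linarith [min_le_right |y| K]

variable {Q : ℝ → ℝ≥0∞} {μ : Measure ℝ} [IsProbabilityMeasure μ] {L : ℕ} {a : Fin L → ℝ}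
  {g : Fin L → ℝ → ℝ}

/-- Clipping each piece at q keeps it monotonic with the same support interval, since bands and
clips are monotone and fix zero. The remainder is a subconvex combination of excesses over q, whose
moments are bounded by Jensen and by the tail comparison with Q. -/
lemma ctrl_comb_band (hQ : IsTail Q) (ha : ∑ l, |a l| ≤ 1) (hg : ∀ l, g l ∈ MonClass Q μ)
    (h0 : 0 ≤ M) (hMK : M ≤ K) : Ctrl μ (bandRate Q M K) (comb a (band M K) g) := by
  have hK := h0.trans hMK
  have hbm := (monotone_band h0 hMK).measurable
  have hgm : ∀ l, Measurable (g l) := fun l => (isPieceMono_of_mem (hg l)).measurable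
  have hcb := bddMeas_comb ha hK hbm (abs_band_le h0 hMK) hgm
  refine ⟨⟨hcb.1, K, hcb.2⟩, fun q hq => ⟨fun x => ∑ l, a l * clip q (band M K (g l x)),
    fun x => ∑ l, |a l| * max (|band M K (g l x)| - q) 0, ⟨L, a,
      fun l x => clip q (band M K (g l x)), ha, fun l => ⟨?_, fun x => abs_clip_le hq _⟩, rfl⟩,
    ?_, fun x => Finset.sum_nonneg fun l _ => mul_nonneg (abs_nonneg _) (le_max_right _ _),
    fun x => ?_, fun j hj => ?_⟩⟩
  · exact ((isPieceMono_of_mem (hg l)).comp (monotone_band h0 hMK) (band_zero_right h0 hMK)).comp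
      (monotone_clip q) (clip_zero hq)
  · have hb : ∀ y, |max (|band M K y| - q) 0| ≤ K := fun y => by
      rw [abs_of_nonneg (le_max_right _ _)]
      exact max_le (by linarith [abs_band_le h0 hMK y]) hK
    have := bddMeas_comb (a := fun l => |a l|) (ψ := fun y => max (|band M K y| - q) 0) (c := K)
      (by simpa using ha) hK ((hbm.abs.sub_const q).max measurable_const) hb hgm
    exact ⟨this.1, K, this.2⟩
  · have e : comb a (band M K) g x - ∑ l, a l * clip q (band M K (g l x)) =
        ∑ l, a l * (band M K (g l x) - clip q (band M K (g l x))) := by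
      rw [comb, ← Finset.sum_sub_distrib]
      exact Finset.sum_congr rfl fun l _ => by ring
    rw [e]
    refine (Finset.abs_sum_le_sum_abs _ _).trans (Finset.sum_le_sum fun l _ => ?_)
    rw [abs_mul]
    refine mul_le_mul_of_nonneg_left (abs_sub_clip_le (le_max_right _ _) ?_) (abs_nonneg _)
    linarith [le_max_left (|band M K (g l x)| - q) 0]
  · have hj1 : 1 ≤ j := (Finset.mem_Icc.1 hj).1
    set φ : ℝ → ℝ := fun t => max (min t K - min t M - q) 0 ^ j with hφ
    have hφm : Monotone φ := fun s t h => pow_le_pow_left₀ (le_max_right _ _)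
      (max_le_max_right _ (sub_le_sub_right (monotone_min_sub_min hMK h) _)) j
    have hφ0 : ∀ t, 0 ≤ φ t := fun t => pow_nonneg (le_max_right _ _) _
    have hφb : ∀ t, 0 ≤ t → φ t ≤ K ^ j := fun t ht => by
      refine pow_le_pow_left₀ (le_max_right _ _) (max_le ?_ hK) j
      have : 0 ≤ min t M := le_min ht h0
      linarith [min_le_right t K]
    have hi : ∀ l, Integrable (fun x => φ |g l x|) μ := fun l =>
      Integrable.of_bound (hφm.measurable.comp (hgm l).abs).aestronglyMeasurable (K ^ j)
        (ae_of_all _ fun x => by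
          rw [Real.norm_of_nonneg (hφ0 _)]; exact hφb _ (abs_nonneg _))
    have hiQ : IntegrableOn (fun u => φ (Q u).toReal) (Ioo (0 : ℝ) 1) :=
      Integrable.of_bound (hφm.measurable.comp
        hQ.anti.measurable.ennreal_toReal).aestronglyMeasurable (K ^ j)
        (ae_of_all _ fun x => by
          rw [Real.norm_of_nonneg (hφ0 _)]; exact hφb _ ENNReal.toReal_nonneg)
    have hl : ∀ l, ∫ x, φ |g l x| ∂μ ≤ tailMoment (bandRate Q M K) q j := fun l => by
      have e : tailMoment (bandRate Q M K) q j = ∫ u in Ioo (0 : ℝ) 1, φ (Q u).toReal := rfl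
      rw [e, integral_eq_lintegral_of_nonneg_ae (ae_of_all _ fun x => hφ0 _)
        (hi l).aestronglyMeasurable, integral_eq_lintegral_of_nonneg_ae
        (ae_of_all _ fun x => hφ0 _) hiQ.aestronglyMeasurable]
      refine ENNReal.toReal_mono ?_ (lintegral_comp_le_of_mem hQ (hg l) hφm hφ0)
      exact hiQ.lintegral_lt_top.ne
    calc ∫ x, (∑ l, |a l| * max (|band M K (g l x)| - q) 0) ^ j ∂μ
        ≤ ∫ x, ∑ l, |a l| * φ |g l x| ∂μ := by
          refine integral_mono_of_nonneg (ae_of_all _ fun x => pow_nonneg (Finset.sum_nonneg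
            fun l _ => mul_nonneg (abs_nonneg _) (le_max_right _ _)) _)
            (integrable_finsetSum _ fun l _ => (hi l).const_mul _) (ae_of_all _ fun x => ?_)
          refine (pow_sum_mul_le (fun l => abs_nonneg _) ha (fun l => le_max_right _ _) hj1).trans
            (le_of_eq ?_)
          simp only [hφ, abs_band h0 hMK]
      _ = ∑ l, |a l| * ∫ x, φ |g l x| ∂μ := by
          rw [integral_finsetSum _ fun l _ => (hi l).const_mul _]
          simp only [integral_const_mul]
      _ ≤ ∑ l, |a l| * tailMoment (bandRate Q M K) q j := Finset.sum_le_sum fun l _ =>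
          mul_le_mul_of_nonneg_left (hl l) (abs_nonneg _)
      _ ≤ _ := by
          rw [← Finset.sum_mul]
          exact mul_le_of_le_one_left (tailMoment_nonneg _ _ _) ha

end Band

/-- The bounded model given by a band of a combination of monotonic functions. -/
theorem StationarySetup.model {Ω : Type*} {mΩ : MeasurableSpace Ω} {P : Measure Ω}
    [IsProbabilityMeasure P] {Y δ : ℤ → Ω → ℝ} (hS : StationarySetup P Y δ) {Q : ℝ → ℝ≥0∞}
    (hQ : IsTail Q) {L : ℕ} {a : Fin L → ℝ} {g : Fin L → ℝ → ℝ} (ha : ∑ l, |a l| ≤ 1)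
    (hg : ∀ l, g l ∈ MonClass Q (P.map (Y 0))) {M K : ℝ} (h0 : 0 ≤ M) (hMK : M ≤ K) :
    Model P (fun k : ℕ => Y k) (fun k : ℕ => past Y δ k) (mixRate P Y δ) K (bandRate Q M K)
      (comb a (band M K) g) where
  mix := hS.mixSetting
  ctrl := by
    have := Measure.isProbabilityMeasure_map (μ := P) (hS.measurable_Y 0).aemeasurable
    exact ctrl_comb_band hQ ha hg h0 hMK
  rate := isRate_bandRate hQ h0 hMK
  bound := (bddMeas_comb ha (h0.trans hMK) (monotone_band h0 hMK).measurable (abs_band_le h0 hMK)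
    fun l => (isPieceMono_of_mem (hg l)).measurable).2
  zero := mixRate_zero P Y δ

/-! ### Square integrability and approximation in the class -/

lemma abs_clip_sub_clip_le (c x y : ℝ) : |clip c x - clip c y| ≤ |x - y| := by
  unfold clip
  refine (abs_max_sub_max_le_max _ _ _ _).trans (max_le (by simp) ?_)
  exact (abs_min_sub_min_le_max _ _ _ _).trans (max_le le_rfl (by simp))

lemma comb_band_zero {L : ℕ} (a : Fin L → ℝ) (K : ℝ) (g : Fin L → ℝ → ℝ) (x : ℝ) :
    comb a (band 0 K) g x = ∑ l, a l * clip K (g l x) := by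
  simp only [comb, band_zero_left]

section Approximation

variable {Q : ℝ → ℝ≥0∞} {μ : Measure ℝ} [IsProbabilityMeasure μ] {f : ℝ → ℝ}

/-- The part of the second moment of `Q` above the level `K`. -/
def upperMoment (Q : ℝ → ℝ≥0∞) (K : ℝ) : ℝ≥0∞ :=
  ∫⁻ u in Ioo (0 : ℝ) 1, ENNReal.ofReal (if K < (Q u).toReal then (Q u).toReal ^ 2 else 0)

lemma upperMoment_le (Q : ℝ → ℝ≥0∞) (K : ℝ) :
    upperMoment Q K ≤ ∫⁻ u in Ioo (0 : ℝ) 1, Q u ^ 2 := by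
  refine lintegral_mono fun u => ?_
  by_cases h : K < (Q u).toReal
  · simp only [h, if_true]
    rw [ENNReal.ofReal_pow ENNReal.toReal_nonneg]
    exact pow_le_pow_left₀ zero_le ENNReal.ofReal_toReal_le 2
  · simp [h]

lemma tendsto_upperMoment (hQ : IsTail Q) (hQ2 : ∫⁻ u in Ioo (0 : ℝ) 1, Q u ^ 2 < ∞) :
    Tendsto (fun n : ℕ => upperMoment Q n) atTop (𝓝 0) := by
  have hm : Measurable fun u => (Q u).toReal := hQ.anti.measurable.ennreal_toReal
  have := tendsto_lintegral_filter_of_dominated_convergence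
    (μ := volume.restrict (Ioo (0 : ℝ) 1)) (l := atTop)
    (F := fun (n : ℕ) u => ENNReal.ofReal (if (n : ℝ) < (Q u).toReal then (Q u).toReal ^ 2 else 0))
    (f := fun _ => 0) (fun u => Q u ^ 2)
    (Eventually.of_forall fun n => (Measurable.ite (measurableSet_lt measurable_const hm)
      (hm.pow_const 2) measurable_const).ennreal_ofReal)
    (Eventually.of_forall fun n => ae_of_all _ fun u => ?_) hQ2.ne
    (ae_of_all _ fun u => ?_)
  · simpa [upperMoment] using this
  · by_cases h : (n : ℝ) < (Q u).toReal
    · simp only [h, if_true]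
      rw [ENNReal.ofReal_pow ENNReal.toReal_nonneg]
      exact pow_le_pow_left₀ zero_le ENNReal.ofReal_toReal_le 2
    · simp [h]
  · refine tendsto_const_nhds.congr' ?_
    filter_upwards [eventually_ge_atTop ⌈(Q u).toReal⌉₊] with n hn
    rw [if_neg (not_lt.2 (Nat.ceil_le.1 hn)), ENNReal.ofReal_zero]

/-- Membership in the class gives approximation in L¹ only. After clipping, the difference is at
most 2K, so its square is at most 2K times the L¹ error; clipping the approximant itself costs the
excess of its pieces over K, charged to the upper second moment. -/
lemma exists_comb_clip_near (hQ : IsTail Q) (hf : f ∈ FClass Q μ) (hfm : Measurable f) {K : ℝ}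
    (hK : 0 ≤ K) {ε : ℝ} (hε : 0 < ε) : ∃ (L : ℕ) (a : Fin L → ℝ) (g : Fin L → ℝ → ℝ),
      ∑ l, |a l| ≤ 1 ∧ (∀ l, g l ∈ MonClass Q μ) ∧
      ∫⁻ x, ENNReal.ofReal ((clip K (f x) - comb a (band 0 K) g x) ^ 2) ∂μ ≤
        ENNReal.ofReal ε + 2 * upperMoment Q K := by
  -- The tolerance is divided by 2K + 1 because the L¹ error will be multiplied by 2K; the 1 covers
  -- K = 0.
  obtain ⟨_, ⟨L, a, g, ha, hg, rfl⟩, hh⟩ := hf.2 (ENNReal.ofReal (ε / (2 * K + 1)))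
    (ENNReal.ofReal_pos.2 (by positivity))
  have hgm : ∀ l, Measurable (g l) := fun l => (isPieceMono_of_mem (hg l)).measurable
  have hcb := bddMeas_comb ha hK (monotone_band le_rfl hK).measurable (abs_band_le le_rfl hK) hgm
  refine ⟨L, a, g, ha, hg, ?_⟩
  have hφ : Monotone fun t : ℝ => max (t - K) 0 := fun s t h =>
    max_le_max_right _ (sub_le_sub_right h _)
  have htail : ∀ l, ENNReal.ofReal (2 * K) * ∫⁻ x, ENNReal.ofReal (max (|g l x| - K) 0) ∂μ ≤
      2 * upperMoment Q K := fun l => by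
    refine (mul_le_mul_right (lintegral_comp_le_of_mem hQ (hg l) hφ fun _ => le_max_right _ _) _).trans ?_
    rw [upperMoment, ← lintegral_const_mul' _ _ ENNReal.ofReal_ne_top,
      ← lintegral_const_mul' _ _ (by norm_num)]
    refine lintegral_mono fun u => ?_
    have h0 : 0 ≤ (Q u).toReal := ENNReal.toReal_nonneg
    rw [show (2 : ℝ≥0∞) = ENNReal.ofReal 2 by norm_num, ← ENNReal.ofReal_mul (by positivity),
      ← ENNReal.ofReal_mul (by norm_num)]
    refine ENNReal.ofReal_le_ofReal ?_
    split_ifs with h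
    · rw [max_eq_left (by linarith)]; nlinarith
    · rw [max_eq_right (by linarith)]; simp
  have key : ∀ x, (clip K (f x) - comb a (band 0 K) g x) ^ 2 ≤
      2 * K * (|f x - ∑ l, a l * g l x| + ∑ l, |a l| * max (|g l x| - K) 0) := fun x => by
    obtain ⟨y, hy⟩ : ∃ y, y = comb a (band 0 K) g x := ⟨_, rfl⟩
    have hyK : |y| ≤ K := hy ▸ hcb.2 x
    have h1 : |clip K (f x) - y| ≤ 2 * K := by
      have := abs_clip_le hK (f x)
      exact (abs_sub _ _).trans (by linarith)
    have hyc : clip K y = y := by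
      have := abs_le.1 hyK
      rw [clip, min_eq_left this.2, max_eq_right this.1]
    have h2 : |clip K (f x) - y| ≤ |f x - y| := by
      have := abs_clip_sub_clip_le K (f x) y
      rwa [hyc] at this
    have h3 : |∑ l, a l * g l x - y| ≤ ∑ l, |a l| * max (|g l x| - K) 0 := by
      rw [hy, comb_band_zero, ← Finset.sum_sub_distrib]
      refine (Finset.abs_sum_le_sum_abs _ _).trans (Finset.sum_le_sum fun l _ => ?_)
      rw [← mul_sub, abs_mul]
      refine mul_le_mul_of_nonneg_left (abs_sub_clip_le (le_max_right _ _) ?_) (abs_nonneg _)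
      linarith [le_max_left (|g l x| - K) 0]
    have h4 : |f x - y| ≤ |f x - ∑ l, a l * g l x| + |∑ l, a l * g l x - y| := abs_sub_le _ _ _
    rw [← hy, ← sq_abs, sq]
    exact mul_le_mul h1 (h2.trans (by linarith)) (abs_nonneg _) (by linarith)
  have m1 : Measurable fun x => ENNReal.ofReal |f x - ∑ l, a l * g l x| :=
    (hfm.sub (Finset.measurable_fun_sum _ fun l _ => (hgm l).const_mul _)).abs.ennreal_ofReal
  have m2 : ∀ l, Measurable fun x => ENNReal.ofReal |a l| * ENNReal.ofReal (max (|g l x| - K) 0) :=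
    fun l => (((hgm l).abs.sub_const K).max measurable_const).ennreal_ofReal.const_mul _
  calc _ ≤ ∫⁻ x, ENNReal.ofReal (2 * K) * (ENNReal.ofReal |f x - ∑ l, a l * g l x| +
        ∑ l, ENNReal.ofReal |a l| * ENNReal.ofReal (max (|g l x| - K) 0)) ∂μ := by
        refine lintegral_mono fun x => (ENNReal.ofReal_le_ofReal (key x)).trans (le_of_eq ?_)
        have h5 : ∀ l, 0 ≤ |a l| * max (|g l x| - K) 0 := fun l =>
          mul_nonneg (abs_nonneg _) (le_max_right _ _)
        rw [ENNReal.ofReal_mul (by positivity), ENNReal.ofReal_add (abs_nonneg _)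
          (Finset.sum_nonneg fun l _ => h5 l), ENNReal.ofReal_sum_of_nonneg fun l _ => h5 l]
        simp only [ENNReal.ofReal_mul (abs_nonneg _)]
    _ = ENNReal.ofReal (2 * K) * ∫⁻ x, ENNReal.ofReal |f x - ∑ l, a l * g l x| ∂μ +
        ∑ l, ENNReal.ofReal |a l| *
          (ENNReal.ofReal (2 * K) * ∫⁻ x, ENNReal.ofReal (max (|g l x| - K) 0) ∂μ) := by
        rw [lintegral_const_mul' _ _ ENNReal.ofReal_ne_top, lintegral_add_left m1,
          lintegral_finsetSum _ fun l _ => m2 l, mul_add, Finset.mul_sum]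
        congr 1
        refine Finset.sum_congr rfl fun l _ => ?_
        rw [lintegral_const_mul' _ _ ENNReal.ofReal_ne_top]; ring
    _ ≤ ENNReal.ofReal ε + ∑ l, ENNReal.ofReal |a l| * (2 * upperMoment Q K) := by
        refine add_le_add ?_ (Finset.sum_le_sum fun l _ => mul_le_mul_right (htail l) _)
        have e : ∫⁻ x, ENNReal.ofReal |f x - ∑ l, a l * g l x| ∂μ ≤
            ENNReal.ofReal (ε / (2 * K + 1)) := by
          refine le_trans (le_of_eq ?_) hh.le
          simp only [← Real.norm_eq_abs, ofReal_norm]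
        refine (mul_le_mul_right e _).trans ?_
        rw [← ENNReal.ofReal_mul (by positivity)]
        refine ENNReal.ofReal_le_ofReal ?_
        rw [mul_div_assoc', div_le_iff₀ (by positivity)]
        nlinarith
    _ ≤ _ := by
        rw [← Finset.sum_mul, ← ENNReal.ofReal_sum_of_nonneg fun l _ => abs_nonneg _]
        refine add_le_add le_rfl (mul_le_of_le_one_left zero_le ?_)
        simpa using ENNReal.ofReal_le_ofReal ha

lemma lintegral_comb_band_sq_le (hQ : IsTail Q) {L : ℕ} {a : Fin L → ℝ} {g : Fin L → ℝ → ℝ}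
    (ha : ∑ l, |a l| ≤ 1) (hg : ∀ l, g l ∈ MonClass Q μ) {K : ℝ} (hK : 0 ≤ K) :
    ∫⁻ x, ENNReal.ofReal (comb a (band 0 K) g x ^ 2) ∂μ ≤ ∫⁻ u in Ioo (0 : ℝ) 1, Q u ^ 2 := by
  have hgm : ∀ l, Measurable (g l) := fun l => (isPieceMono_of_mem (hg l)).measurable
  have hφ : Monotone fun t : ℝ => max t 0 ^ 2 := fun s t h =>
    pow_le_pow_left₀ (le_max_right _ _) (max_le_max_right _ h) 2
  have hl : ∀ l, ∫⁻ x, ENNReal.ofReal (max |g l x| 0 ^ 2) ∂μ ≤ ∫⁻ u in Ioo (0 : ℝ) 1, Q u ^ 2 :=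
    fun l => by
      refine (lintegral_comp_le_of_mem hQ (hg l) hφ fun _ => by positivity).trans
        (lintegral_mono fun u => ?_)
      rw [max_eq_left ENNReal.toReal_nonneg, ENNReal.ofReal_pow ENNReal.toReal_nonneg]
      exact pow_le_pow_left₀ zero_le ENNReal.ofReal_toReal_le 2
  calc _ ≤ ∫⁻ x, ∑ l, ENNReal.ofReal |a l| * ENNReal.ofReal (max |g l x| 0 ^ 2) ∂μ := by
        refine lintegral_mono fun x => ?_
        have h1 : comb a (band 0 K) g x ^ 2 ≤ ∑ l, |a l| * max |g l x| 0 ^ 2 := by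
          refine le_trans ?_ (pow_sum_mul_le (fun l => abs_nonneg (a l)) ha
            (fun l => le_max_right |g l x| 0) one_le_two)
          refine sq_le_sq' (abs_le.1 ?_).1 (abs_le.1 ?_).2 <;>
          · rw [comb_band_zero]
            refine (Finset.abs_sum_le_sum_abs _ _).trans (Finset.sum_le_sum fun l _ => ?_)
            rw [abs_mul]
            exact mul_le_mul_of_nonneg_left ((abs_clip_le_abs hK _).trans (le_max_left _ _))
              (abs_nonneg _)
        refine (ENNReal.ofReal_le_ofReal h1).trans (le_of_eq ?_)
        rw [ENNReal.ofReal_sum_of_nonneg fun l _ => by positivity]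
        simp only [ENNReal.ofReal_mul (abs_nonneg _)]
    _ = ∑ l, ENNReal.ofReal |a l| * ∫⁻ x, ENNReal.ofReal (max |g l x| 0 ^ 2) ∂μ := by
        rw [lintegral_finsetSum _ fun l _ => (((hgm l).abs.max
          measurable_const).pow_const 2).ennreal_ofReal.const_mul _]
        simp only [lintegral_const_mul' _ _ ENNReal.ofReal_ne_top]
    _ ≤ ∑ l, ENNReal.ofReal |a l| * ∫⁻ u in Ioo (0 : ℝ) 1, Q u ^ 2 :=
        Finset.sum_le_sum fun l _ => mul_le_mul_right (hl l) _
    _ ≤ _ := by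
        rw [← Finset.sum_mul, ← ENNReal.ofReal_sum_of_nonneg fun l _ => abs_nonneg _]
        exact mul_le_of_le_one_left zero_le (by simpa using ENNReal.ofReal_le_ofReal ha)

lemma ofReal_sq_le_two_mul_add (x y : ℝ) :
    ENNReal.ofReal (x ^ 2) ≤ 2 * ENNReal.ofReal ((x - y) ^ 2) + 2 * ENNReal.ofReal (y ^ 2) := by
  rw [show (2 : ℝ≥0∞) = ENNReal.ofReal 2 by norm_num, ← ENNReal.ofReal_mul (by norm_num),
    ← ENNReal.ofReal_mul (by norm_num), ← ENNReal.ofReal_add (by positivity) (by positivity)]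
  exact ENNReal.ofReal_le_ofReal (by nlinarith [sq_nonneg (x - 2 * y)])

lemma clip_eventually_eq (y : ℝ) : ∀ᶠ n : ℕ in atTop, clip n y = y := by
  filter_upwards [eventually_ge_atTop ⌈|y|⌉₊] with n hn
  have := abs_le.1 (Nat.ceil_le.1 hn)
  rw [clip, min_eq_left this.2, max_eq_right this.1]

/-- Fatou along the clips: each is close in mean square to a clipped combination, whose second
moment is at most that of Q, and the resulting bound does not depend on the clip. -/
lemma memLp_two_of_mem_FClass (hQ : IsTail Q) (hQ2 : ∫⁻ u in Ioo (0 : ℝ) 1, Q u ^ 2 < ∞)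
    (hf : f ∈ FClass Q μ) (hfm : Measurable f) : MemLp f 2 μ := by
  rw [memLp_two_iff_integrable_sq hfm.aestronglyMeasurable]
  refine ⟨(hfm.pow_const 2).aestronglyMeasurable, ?_⟩
  rw [hasFiniteIntegral_iff_ofReal (ae_of_all _ fun _ => sq_nonneg _)]
  set q := ∫⁻ u in Ioo (0 : ℝ) 1, Q u ^ 2 with hq
  have hb : ∀ n : ℕ, ∫⁻ x, ENNReal.ofReal (clip n (f x) ^ 2) ∂μ ≤ 2 * (1 + 2 * q) + 2 * q :=
    fun n => by
      obtain ⟨L, a, g, ha, hg, h⟩ := exists_comb_clip_near hQ hf hfm (Nat.cast_nonneg n) one_pos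
      have hgm : ∀ l, Measurable (g l) := fun l => (isPieceMono_of_mem (hg l)).measurable
      have hcm := (bddMeas_comb ha (Nat.cast_nonneg n)
        (monotone_band le_rfl (Nat.cast_nonneg (α := ℝ) n)).measurable
        (abs_band_le le_rfl (Nat.cast_nonneg (α := ℝ) n)) hgm).1
      refine (lintegral_mono fun x => ofReal_sq_le_two_mul_add _ (comb a (band 0 n) g x)).trans ?_
      rw [lintegral_add_right _ ((hcm.pow_const 2).ennreal_ofReal.const_mul 2),
        lintegral_const_mul' _ _ (by norm_num), lintegral_const_mul' _ _ (by norm_num)]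
      refine add_le_add (mul_le_mul_right (h.trans ?_) _) (mul_le_mul_right
        (lintegral_comb_band_sq_le hQ ha hg (Nat.cast_nonneg n)) _)
      rw [ENNReal.ofReal_one]
      exact add_le_add le_rfl (mul_le_mul_right (upperMoment_le Q n) _)
  have hlim : ∫⁻ x, ENNReal.ofReal (f x ^ 2) ∂μ =
      ∫⁻ x, liminf (fun n : ℕ => ENNReal.ofReal (clip n (f x) ^ 2)) atTop ∂μ := by
    refine lintegral_congr fun x => (Tendsto.liminf_eq (tendsto_const_nhds.congr' ?_)).symm
    filter_upwards [clip_eventually_eq (f x)] with n hn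
    rw [hn]
  rw [hlim]
  refine (lintegral_liminf_le (u := (atTop : Filter ℕ))
    (f := fun (n : ℕ) x => ENNReal.ofReal (clip n (f x) ^ 2)) fun n =>
      (((measurable_clip n).comp hfm).pow_const 2).ennreal_ofReal).trans_lt ?_
  refine (liminf_le_of_le (a := 2 * (1 + 2 * q) + 2 * q) (by isBoundedDefault)
    fun b hbb => ?_).trans_lt ?_
  · obtain ⟨n, hn⟩ := hbb.exists
    exact hn.trans (hb n)
  · have : q ≠ ∞ := hQ2.ne
    exact ENNReal.add_lt_top.2 ⟨ENNReal.mul_lt_top (by norm_num) (ENNReal.add_lt_top.2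
      ⟨by norm_num, ENNReal.mul_lt_top (by norm_num) hQ2⟩), ENNReal.mul_lt_top (by norm_num) hQ2⟩

/-- Functions of the class are approximated in mean square by truncated combinations. -/
theorem exists_comb_near (hQ : IsTail Q) (hQ2 : ∫⁻ u in Ioo (0 : ℝ) 1, Q u ^ 2 < ∞)
    (hf : f ∈ FClass Q μ) (hfm : Measurable f) (K₀ : ℝ) {ε : ℝ} (hε : 0 < ε) :
    ∃ (K : ℝ) (L : ℕ) (a : Fin L → ℝ) (g : Fin L → ℝ → ℝ), 0 ≤ K ∧ K₀ ≤ K ∧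
      ∑ l, |a l| ≤ 1 ∧ (∀ l, g l ∈ MonClass Q μ) ∧
      ∫ x, (f x - comb a (band 0 K) g x) ^ 2 ∂μ ≤ ε := by
  have hL := memLp_two_of_mem_FClass hQ hQ2 hf hfm
  have hi : Integrable (fun x => f x ^ 2) μ :=
    (memLp_two_iff_integrable_sq hfm.aestronglyMeasurable).1 hL
  have t1 : Tendsto (fun n : ℕ => ∫⁻ x, ENNReal.ofReal ((f x - clip n (f x)) ^ 2) ∂μ) atTop
      (𝓝 0) := by
    have := tendsto_lintegral_filter_of_dominated_convergence (μ := μ) (l := atTop)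
      (F := fun (n : ℕ) x => ENNReal.ofReal ((f x - clip n (f x)) ^ 2)) (f := fun _ => 0)
      (fun x => ENNReal.ofReal (f x ^ 2))
      (Eventually.of_forall fun n =>
        ((hfm.sub ((measurable_clip n).comp hfm)).pow_const 2).ennreal_ofReal)
      (Eventually.of_forall fun n => ae_of_all _ fun x => ENNReal.ofReal_le_ofReal ?_)
      hi.lintegral_lt_top.ne (ae_of_all _ fun x => ?_)
    · simpa using this
    · exact sq_le_sq.2 (abs_sub_clip_le (abs_nonneg _) (by
        have : (0 : ℝ) ≤ n := Nat.cast_nonneg n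
        linarith))
    · refine tendsto_const_nhds.congr' ?_
      filter_upwards [clip_eventually_eq (f x)] with n hn
      rw [hn]; simp
  have hε8 : 0 < ENNReal.ofReal (ε / 8) := ENNReal.ofReal_pos.2 (by positivity)
  obtain ⟨n, h1, h2, h3⟩ := ((t1.eventually_le_const hε8).and
    (((tendsto_upperMoment hQ hQ2).eventually_le_const hε8).and
      (eventually_ge_atTop ⌈K₀⌉₊))).exists
  obtain ⟨L, a, g, ha, hg, h⟩ := exists_comb_clip_near hQ hf hfm (Nat.cast_nonneg n)
    (show 0 < ε / 8 by positivity)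
  refine ⟨n, L, a, g, Nat.cast_nonneg n, Nat.ceil_le.1 h3, ha, hg, ?_⟩
  have hgm : ∀ l, Measurable (g l) := fun l => (isPieceMono_of_mem (hg l)).measurable
  have hcm := (bddMeas_comb ha (Nat.cast_nonneg n)
    (monotone_band le_rfl (Nat.cast_nonneg (α := ℝ) n)).measurable
    (abs_band_le le_rfl (Nat.cast_nonneg (α := ℝ) n)) hgm).1
  have hdm : Measurable fun x => (f x - comb a (band 0 n) g x) ^ 2 := (hfm.sub hcm).pow_const 2
  rw [integral_eq_lintegral_of_nonneg_ae (ae_of_all _ fun _ => sq_nonneg _)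
    hdm.aestronglyMeasurable]
  refine ENNReal.toReal_le_of_le_ofReal hε.le ?_
  refine (lintegral_mono fun x => ofReal_sq_le_two_mul_add _
    (clip n (f x) - comb a (band 0 n) g x)).trans ?_
  have hem : Measurable fun x => 2 * ENNReal.ofReal ((clip n (f x) - comb a (band 0 n) g x) ^ 2) :=
    ((((measurable_clip n).comp hfm).sub hcm).pow_const 2).ennreal_ofReal.const_mul 2
  rw [lintegral_add_right _ hem,
    lintegral_const_mul' _ _ (by norm_num), lintegral_const_mul' _ _ (by norm_num)]
  simp only [sub_sub_sub_cancel_right]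
  refine (add_le_add (mul_le_mul_right h1 2) (mul_le_mul_right (h.trans
    (add_le_add le_rfl (mul_le_mul_right h2 2))) 2)).trans (le_of_eq ?_)
  rw [show (2 : ℝ≥0∞) = ENNReal.ofReal 2 by norm_num]
  have : (0 : ℝ) ≤ ε / 8 := by positivity
  simp only [← ENNReal.ofReal_mul (show (0 : ℝ) ≤ 2 by norm_num)]
  rw [← ENNReal.ofReal_add (by positivity) (by positivity), ← ENNReal.ofReal_mul (by norm_num),
    ← ENNReal.ofReal_add (by positivity) (by positivity)]
  congr 1; ring

end Approximation

/-! ### Thresholds and truncated moments -/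

section Threshold

variable {Ω : Type*} {mΩ : MeasurableSpace Ω} {P : Measure Ω} [IsProbabilityMeasure P]
  {Y δ : ℤ → Ω → ℝ} {Q : ℝ → ℝ≥0∞}

lemma alphaInv_antitone (P : Measure Ω) (Y δ : ℤ → Ω → ℝ) : Antitone (alphaInv P Y δ) :=
  fun _ _ h => iInf_mono fun _ => iInf_mono' fun h' => ⟨h'.trans (ENNReal.ofReal_le_ofReal h), le_rfl⟩

lemma Rfun_antitone (hQ : Antitone Q) : Antitone (Rfun P Y δ Q) := fun _ _ h =>
  mul_le_mul' (alphaInv_antitone P Y δ h) (max_le_max_right _ (hQ h))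

lemma mixRate_le_of_alphaSeq_le {q : ℕ} {u : ℝ} (hu : 0 ≤ u)
    (h : alphaSeq P Y δ 2 q ≤ ENNReal.ofReal u) : mixRate P Y δ q ≤ u :=
  ENNReal.toReal_le_of_le_ofReal hu ((min_le_left _ _).trans h)

lemma natCast_le_alphaInv {p : ℕ} {u : ℝ} (hu : 0 ≤ u) (h : u < mixRate P Y δ p) :
    ((p + 1 : ℕ) : ℝ≥0∞) ≤ alphaInv P Y δ u := by
  refine le_iInf₂ fun q hq => ?_
  have : p < q := by
    by_contra hlt
    exact absurd h (not_lt.2 ((antitone_mixRate P Y δ (not_lt.1 hlt)).trans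
      (mixRate_le_of_alphaSeq_le hu hq)))
  exact_mod_cast this

lemma one_le_alphaInv {u : ℝ} (h0 : 0 ≤ u) (h1 : u < 1) : 1 ≤ alphaInv P Y δ u := by
  have := natCast_le_alphaInv (P := P) (Y := Y) (δ := δ) (p := 0) h0 (by rwa [mixRate_zero])
  simpa using this

lemma exists_alphaInv_eq {u : ℝ} (h : alphaInv P Y δ u < ∞) :
    ∃ k : ℕ, alphaInv P Y δ u = k ∧ alphaSeq P Y δ 2 k ≤ ENNReal.ofReal u := by
  classical
  have hex : ∃ k, alphaSeq P Y δ 2 k ≤ ENNReal.ofReal u := by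
    by_contra hne
    push Not at hne
    have : alphaInv P Y δ u = ∞ := by
      refine iInf_eq_top.2 fun q => iInf_eq_top.2 fun hq => absurd hq (hne q).not_ge
    exact h.ne this
  refine ⟨Nat.find hex, le_antisymm (iInf₂_le (Nat.find hex) (Nat.find_spec hex)) ?_, Nat.find_spec hex⟩
  exact le_iInf₂ fun q hq => by exact_mod_cast Nat.find_min' hex hq

/-- The number of indices whose mixing rate exceeds `u`. -/
def rateCount (a : ℕ → ℝ) {ι : Type*} (s : Finset ι) (e : ι → ℕ) (u : ℝ) : ℝ≥0∞ :=
  ∑ i ∈ s, if u < a (e i) then 1 else 0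

/-- Lags with rate above u lie below every q with α(q) ≤ u, and injectivity bounds their number by
q. This is how α⁻¹ arises from sums over lags. -/
lemma rateCount_le_alphaInv {ι : Type*} {s : Finset ι} {e : ι → ℕ} (he : InjOn e s) {u : ℝ}
    (hu : 0 ≤ u) : rateCount (mixRate P Y δ) s e u ≤ alphaInv P Y δ u := by
  classical
  refine le_iInf₂ fun q hq => ?_
  unfold rateCount
  rw [Finset.sum_boole]
  have : (s.filter fun i => u < mixRate P Y δ (e i)).card ≤ (Finset.range q).card := by
    refine Finset.card_le_card_of_injOn e (fun i hi => ?_) (he.mono fun i hi =>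
      (Finset.mem_filter.1 hi).1)
    rw [Finset.coe_filter] at hi
    have hi2 : u < mixRate P Y δ (e i) := hi.2
    rw [Finset.coe_range]
    by_contra hlt
    exact absurd hi2 (not_lt.2 ((antitone_mixRate P Y δ (not_lt.1 hlt)).trans
      (mixRate_le_of_alphaSeq_le hu hq)))
  rw [Finset.card_range] at this
  exact_mod_cast this

lemma rateCount_le_card (a : ℕ → ℝ) {ι : Type*} (s : Finset ι) (e : ι → ℕ) (u : ℝ) :
    rateCount a s e u ≤ s.card := by
  unfold rateCount
  rw [Finset.sum_boole]
  exact_mod_cast Finset.card_filter_le _ _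

lemma rateCount_eq_zero {a : ℕ → ℝ} {ι : Type*} {s : Finset ι} {e : ι → ℕ} {u : ℝ}
    (h : ∀ i ∈ s, a (e i) ≤ u) : rateCount a s e u = 0 :=
  Finset.sum_eq_zero fun i hi => if_neg (not_lt.2 (h i hi))

/-- The rate at the larger lag exceeds u only if both rates do, so a double sum over max(i, j)
produces the square of the count. -/
lemma rateCount_max_le {a : ℕ → ℝ} (ha : Antitone a) (m : ℕ) (u : ℝ) :
    rateCount a (Finset.range m ×ˢ Finset.range m) (fun z => max z.2 z.1) u ≤
      rateCount a (Finset.range m) id u * rateCount a (Finset.range m) id u := by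
  unfold rateCount
  rw [Finset.sum_mul_sum, Finset.sum_product]
  refine Finset.sum_le_sum fun i _ => Finset.sum_le_sum fun j _ => ?_
  by_cases h : u < a (max j i)
  · have h1 : u < a (id i) := h.trans_le (ha (le_max_right j i))
    have h2 : u < a (id j) := h.trans_le (ha (le_max_left j i))
    rw [if_pos h1, if_pos h2, if_pos h, one_mul]
  · rw [if_neg h]; exact zero_le

/-- Tonelli: a sum of integrals up to the rates is one integral weighted by the number of rates
exceeding u. -/
lemma sum_lintegral_Ioo_eq {a : ℕ → ℝ} (ha : ∀ p, a p ≤ 1) {ι : Type*} (s : Finset ι)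
    (e : ι → ℕ) {φ : ℝ → ℝ≥0∞} (hφ : Measurable φ) :
    ∑ i ∈ s, ∫⁻ u in Ioo (0 : ℝ) (a (e i)), φ u =
      ∫⁻ u in Ioo (0 : ℝ) 1, rateCount a s e u * φ u := by
  have h1 : ∀ i, ∫⁻ u in Ioo (0 : ℝ) (a (e i)), φ u =
      ∫⁻ u in Ioo (0 : ℝ) 1, (if u < a (e i) then 1 else 0) * φ u := fun i => by
    have e1 : ∀ u, (if u < a (e i) then (1 : ℝ≥0∞) else 0) * φ u =
        (Iio (a (e i))).indicator φ u := fun u => by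
      by_cases h : u < a (e i) <;> simp [h]
    simp only [e1]
    rw [lintegral_indicator measurableSet_Iio, Measure.restrict_restrict measurableSet_Iio]
    congr 2
    ext u
    simp only [mem_inter_iff, mem_Ioo, mem_Iio]
    exact ⟨fun h => ⟨h.2, h.1, h.2.trans_le (ha _)⟩, fun h => ⟨h.2.1, h.1⟩⟩
  have hm : ∀ i, Measurable fun u => (if u < a (e i) then (1 : ℝ≥0∞) else 0) * φ u := fun i =>
    (Measurable.ite measurableSet_Iio measurable_const measurable_const).mul hφ
  simp only [h1, rateCount, Finset.sum_mul]
  rw [lintegral_finsetSum _ fun i _ => hm i]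

lemma IsRate.ofReal_partMoment {M : ℝ} {B : ℝ → ℝ} (hB : IsRate M B) (r : ℕ) {t : ℝ} (ht : t ≤ 1) :
    ENNReal.ofReal (partMoment B r t) = ∫⁻ u in Ioo (0 : ℝ) t, ENNReal.ofReal (B u ^ r) :=
  ofReal_integral_eq_lintegral_ofReal ((hB.integrableOn_pow r).mono_set (Ioo_subset_Ioo_right ht))
    (ae_of_all _ fun u => pow_nonneg (hB.nonneg u) r)

lemma measurable_bandRate (hQ : IsTail Q) (M K : ℝ) : Measurable (bandRate Q M K) :=
  (hQ.anti.measurable.ennreal_toReal.min measurable_const).sub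
    (hQ.anti.measurable.ennreal_toReal.min measurable_const)

lemma ofReal_sum_partMoment (hQ : IsTail Q) {M K : ℝ} (h0 : 0 ≤ M) (hMK : M ≤ K) (r : ℕ)
    {ι : Type*} (s : Finset ι) (e : ι → ℕ) :
    ENNReal.ofReal (∑ i ∈ s, partMoment (bandRate Q M K) r (mixRate P Y δ (e i))) =
      ∫⁻ u in Ioo (0 : ℝ) 1, rateCount (mixRate P Y δ) s e u *
        ENNReal.ofReal (bandRate Q M K u ^ r) := by
  have hB := isRate_bandRate hQ h0 hMK
  rw [ENNReal.ofReal_sum_of_nonneg fun i _ => hB.partMoment_nonneg r _,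
    ← sum_lintegral_Ioo_eq (mixRate_le_one P Y δ) s e
      ((measurable_bandRate hQ M K).pow_const r).ennreal_ofReal]
  exact Finset.sum_congr rfl fun i _ => hB.ofReal_partMoment r (mixRate_le_one P Y δ _)

/-- The integrand of the truncated moment of order three. -/
def truncKernel (P : Measure Ω) (Y δ : ℤ → Ω → ℝ) (Q : ℝ → ℝ≥0∞) (lam u : ℝ) : ℝ≥0∞ :=
  Q u * Rfun P Y δ Q u * min (Rfun P Y δ Q u) (ENNReal.ofReal lam)

/-- A lag `q`, a truncation level `M` and a probability `v` at which the function `R` crosses the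
level `lam`. -/
structure IsThreshold (P : Measure Ω) (Y δ : ℤ → Ω → ℝ) (Q : ℝ → ℝ≥0∞) (lam : ℝ) (q : ℕ)
    (M v : ℝ) : Prop where
  one_le : 1 ≤ q
  nonneg : 0 ≤ M
  mul_le : q * M ≤ lam
  below : ∀ u ∈ Ioo (0 : ℝ) 1, u < v → ENNReal.ofReal M ≤ Q u ∧ (q : ℝ≥0∞) ≤ alphaInv P Y δ u ∧
    ENNReal.ofReal lam ≤ Rfun P Y δ Q u
  above : ∀ u ∈ Ioo (0 : ℝ) 1, v < u → Q u ≤ ENNReal.ofReal M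
  rate : ∀ p, q ≤ p → mixRate P Y δ p ≤ v

/-- The crossing point v is the infimum of {R ≤ lam}; q and M are the suprema of α⁻¹ and Q on (v,
1). The product of suprema is at most lam because both functions are nonincreasing: the point at
which q is attained and any other point can be replaced by the smaller of the two. -/
lemma exists_isThreshold (hQ : IsTail Q) {lam : ℝ} (hl : 1 ≤ lam) :
    ∃ q M v, IsThreshold P Y δ Q lam q M v := by
  have hl0 : 0 ≤ lam := zero_le_one.trans hl
  by_cases hne : ∃ u ∈ Ioo (0 : ℝ) 1, Rfun P Y δ Q u ≤ ENNReal.ofReal lam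
  · obtain ⟨w, hw, hRw⟩ := hne
    set S := {u | u ∈ Ioo (0 : ℝ) 1 ∧ Rfun P Y δ Q u ≤ ENNReal.ofReal lam} with hS
    have hSb : BddBelow S := ⟨0, fun u hu => hu.1.1.le⟩
    have hwS : w ∈ S := ⟨hw, hRw⟩
    set v := sInf S with hv
    have hv0 : 0 ≤ v := le_csInf ⟨w, hwS⟩ fun u hu => hu.1.1.le
    have hv1 : v < 1 := (csInf_le hSb hwS).trans_lt hw.2
    have hup : ∀ u, v < u → Rfun P Y δ Q u ≤ ENNReal.ofReal lam := fun u hu => by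
      obtain ⟨s, hs, hsu⟩ := exists_lt_of_csInf_lt ⟨w, hwS⟩ hu
      exact (Rfun_antitone hQ.anti hsu.le).trans hs.2
    have hlow : ∀ u ∈ Ioo (0 : ℝ) 1, u < v → ENNReal.ofReal lam ≤ Rfun P Y δ Q u :=
      fun u hu huv => by
        by_contra h
        exact absurd (csInf_le hSb ⟨hu, (not_le.1 h).le⟩) (not_le.2 huv)
    have hAR : ∀ u, alphaInv P Y δ u ≤ Rfun P Y δ Q u := fun u =>
      le_mul_of_one_le_right zero_le (le_max_right _ _)
    have hAQR : ∀ u, alphaInv P Y δ u * Q u ≤ Rfun P Y δ Q u := fun u =>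
      mul_le_mul_right (le_max_left _ _) _
    set N := {k : ℕ | ∃ u ∈ Ioo v 1, (k : ℝ≥0∞) ≤ alphaInv P Y δ u} with hN
    have hNb : BddAbove N := ⟨⌊lam⌋₊, fun k ⟨u, hu, hk⟩ => by
      have h1 : ENNReal.ofReal k ≤ ENNReal.ofReal lam := by
        rw [ENNReal.ofReal_natCast]
        exact hk.trans ((hAR u).trans (hup u hu.1))
      exact Nat.le_floor ((ENNReal.ofReal_le_ofReal_iff hl0).1 h1)⟩
    obtain ⟨z, hz⟩ := exists_between hv1
    have hN1 : 1 ∈ N := ⟨z, hz, by simpa using one_le_alphaInv (hv0.trans hz.1.le) hz.2⟩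
    set q := sSup N with hq
    -- A bounded nonempty set of naturals attains its supremum.
    obtain ⟨u₀, hu₀, hqu⟩ : q ∈ N := Nat.sSup_mem ⟨1, hN1⟩ hNb
    have hq1 : 1 ≤ q := le_csSup hNb hN1
    have hq0 : (0 : ℝ) < q := by exact_mod_cast hq1
    have hqQ : ∀ u ∈ Ioo v 1, (Q u).toReal ≤ lam / q := fun u hu => by
      have hu1 : min u u₀ ∈ Ioo v 1 := ⟨lt_min hu.1 hu₀.1, (min_le_left _ _).trans_lt hu.2⟩
      have h1 : (q : ℝ≥0∞) * Q u ≤ ENNReal.ofReal lam :=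
        (mul_le_mul' (hqu.trans (alphaInv_antitone P Y δ (min_le_right _ _)))
          (hQ.anti (min_le_left _ _))).trans ((hAQR _).trans (hup _ hu1.1))
      have h2 := ENNReal.toReal_le_of_le_ofReal hl0 h1
      rw [ENNReal.toReal_mul, ENNReal.toReal_natCast] at h2
      rw [le_div_iff₀ hq0]; linarith
    set T := (fun u => (Q u).toReal) '' Ioo v 1 with hT
    have hTb : BddAbove T := ⟨lam / q, by rintro _ ⟨u, hu, rfl⟩; exact hqQ u hu⟩
    have hTn : T.Nonempty := ⟨_, mem_image_of_mem _ hz⟩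
    refine ⟨q, sSup T, v, hq1, Real.sSup_nonneg (by
      rintro _ ⟨u, -, rfl⟩; exact ENNReal.toReal_nonneg), ?_, fun u hu huv =>
        ⟨?_, hqu.trans (alphaInv_antitone P Y δ (huv.trans hu₀.1).le), hlow u hu huv⟩,
      fun u hu huv => ?_, fun p hp => ?_⟩
    · have : sSup T ≤ lam / q := csSup_le hTn (by rintro _ ⟨u, hu, rfl⟩; exact hqQ u hu)
      rw [le_div_iff₀ hq0] at this; linarith
    · refine ENNReal.ofReal_le_of_le_toReal (csSup_le hTn ?_)
      rintro _ ⟨s, hs, rfl⟩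
      exact ENNReal.toReal_mono (hQ.fin u hu.1).ne (hQ.anti (huv.trans hs.1).le)
    · rw [← ENNReal.ofReal_toReal (hQ.fin u hu.1).ne]
      exact ENNReal.ofReal_le_ofReal (le_csSup hTb (mem_image_of_mem _ ⟨huv, hu.2⟩))
    -- For s just above v the minimal lag with rate at most s is at most q; letting s decrease to v
    -- gives the rate bound at v itself.
    · refine (antitone_mixRate P Y δ hp).trans (le_of_forall_gt_imp_ge_of_dense fun u hu => ?_)
      obtain ⟨s, hs1, hs2⟩ := exists_between (lt_min hu hv1)
      have hs : s ∈ Ioo v 1 := ⟨hs1, hs2.trans_le (min_le_right _ _)⟩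
      have hsu : s ≤ u := (hs2.trans_le (min_le_left _ _)).le
      obtain ⟨k, hk, hks⟩ := exists_alphaInv_eq (P := P) (Y := Y) (δ := δ) (u := s)
        (((hAR s).trans (hup s hs.1)).trans_lt ENNReal.ofReal_lt_top)
      have hkq : k ≤ q := le_csSup hNb ⟨s, hs, hk.ge⟩
      exact (antitone_mixRate P Y δ hkq).trans
        ((mixRate_le_of_alphaSeq_le (hv0.trans hs.1.le) hks).trans hsu)
  · push Not at hne
    -- If R exceeds lam throughout, nothing is retained: the level is zero, the lag is 1 and v = 1.
    exact ⟨1, 0, 1, le_rfl, le_rfl, by simpa using hl0, fun u hu _ => ⟨by simp,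
      by simpa using one_le_alphaInv hu.1.le hu.2, (hne u hu).le⟩,
      fun u hu h => absurd hu.2 h.not_gt, fun p _ => mixRate_le_one P Y δ p⟩

end Threshold

/-! ### Covariances of square integrable observables -/

namespace MixSetting

variable {Ω : Type*} {mΩ : MeasurableSpace Ω} {P : Measure Ω} [IsProbabilityMeasure P]
  {Y : ℕ → Ω → ℝ} {ℱ : ℕ → MeasurableSpace Ω} {a : ℕ → ℝ} {φ χ : ℝ → ℝ}

lemma memLp_comp (hS : MixSetting P Y ℱ a) (hφ : MemLp φ 2 (P.map (Y 0))) (k : ℕ) :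
    MemLp (fun ω => φ (Y k ω)) 2 P := by
  rw [← hS.map_eq k] at hφ
  exact (memLp_map_measure_iff hφ.1 (hS.measurable k).aemeasurable).1 hφ

lemma memLp_obs (hS : MixSetting P Y ℱ a) (hφ : MemLp φ 2 (P.map (Y 0))) (k : ℕ) :
    MemLp (obs P Y φ k) 2 P :=
  (hS.memLp_comp hφ k).sub (memLp_const _)

lemma integrable_obs_mul (hS : MixSetting P Y ℱ a) (hφ : MemLp φ 2 (P.map (Y 0)))
    (hχ : MemLp χ 2 (P.map (Y 0))) (k l : ℕ) :
    Integrable (fun ω => obs P Y φ k ω * obs P Y χ l ω) P :=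
  (hS.memLp_obs hφ k).integrable_mul (hS.memLp_obs hχ l)

lemma integrable_obs_sq (hS : MixSetting P Y ℱ a) (hφ : MemLp φ 2 (P.map (Y 0))) (k : ℕ) :
    Integrable (fun ω => obs P Y φ k ω ^ 2) P := (hS.memLp_obs hφ k).integrable_sq

lemma integral_obs_sq_le (hS : MixSetting P Y ℱ a) (hφm : Measurable φ)
    (hφ : MemLp φ 2 (P.map (Y 0))) (k : ℕ) :
    ∫ ω, obs P Y φ k ω ^ 2 ∂P ≤ ∫ x, φ x ^ 2 ∂(P.map (Y 0)) := by
  have hX := hS.memLp_comp hφ k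
  have h1 := variance_le_expectation_sq (μ := P) (X := fun ω => φ (Y k ω)) hX.1
  rw [variance_eq_integral hX.1.aemeasurable] at h1
  rw [← hS.integral_comp (hφm.pow_const 2) k]
  exact h1

lemma obs_sub (hS : MixSetting P Y ℱ a) (hφ : MemLp φ 2 (P.map (Y 0)))
    (hχ : MemLp χ 2 (P.map (Y 0))) (k : ℕ) (ω : Ω) :
    obs P Y (fun x => φ x - χ x) k ω = obs P Y φ k ω - obs P Y χ k ω := by
  simp only [obs, centered]
  rw [integral_sub ((hS.memLp_comp hφ k).integrable one_le_two)
    ((hS.memLp_comp hχ k).integrable one_le_two)]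
  ring

/-- The difference of products is linear in D = obs φ - obs χ, and Young's inequality with parameter
t separates the small factor from the bounded one. -/
lemma abs_cov_sub_cov_le (hS : MixSetting P Y ℱ a) (hφm : Measurable φ)
    (hφ : MemLp φ 2 (P.map (Y 0))) (hχm : Measurable χ) (hχ : MemLp χ 2 (P.map (Y 0)))
    {t : ℝ} (ht : 0 < t) (j : ℕ) :
    |cov P Y φ j - cov P Y χ j| ≤ (∫ x, (φ x - χ x) ^ 2 ∂(P.map (Y 0))) / t +
      t * (∫ x, φ x ^ 2 ∂(P.map (Y 0)) + ∫ x, χ x ^ 2 ∂(P.map (Y 0))) := by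
  have hd : MemLp (fun x => φ x - χ x) 2 (P.map (Y 0)) := hφ.sub hχ
  obtain ⟨D, hD⟩ : ∃ D, D = obs P Y (fun x => φ x - χ x) := ⟨_, rfl⟩
  have hDe : ∀ k ω, D k ω = obs P Y φ k ω - obs P Y χ k ω := fun k ω => by
    rw [hD]; exact hS.obs_sub hφ hχ k ω
  have hD2 : ∀ k, ∫ ω, D k ω ^ 2 ∂P ≤ ∫ x, (φ x - χ x) ^ 2 ∂(P.map (Y 0)) := fun k => by
    rw [hD]; exact hS.integral_obs_sq_le (hφm.sub hχm) hd k
  have iD : ∀ k, Integrable (fun ω => D k ω ^ 2) P := fun k => by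
    rw [hD]; exact hS.integrable_obs_sq hd k
  have i1 := hS.integrable_obs_sq hφ j
  have i2 := hS.integrable_obs_sq hχ 0
  have h1 := hS.integral_obs_sq_le hφm hφ j
  have h2 := hS.integral_obs_sq_le hχm hχ 0
  have young : ∀ x y : ℝ, |x * y| ≤ 2⁻¹ * t⁻¹ * x ^ 2 + 2⁻¹ * t * y ^ 2 := fun x y => by
    rw [abs_mul]
    have e : 2⁻¹ * t⁻¹ * x ^ 2 + 2⁻¹ * t * y ^ 2 - |x| * |y| =
        2⁻¹ * t⁻¹ * (|x| - t * |y|) ^ 2 := by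
      rw [← sq_abs x, ← sq_abs y]; field_simp; ring
    have : 0 ≤ 2⁻¹ * t⁻¹ * (|x| - t * |y|) ^ 2 := by positivity
    linarith
  have ij1 : Integrable (fun ω => 2⁻¹ * t⁻¹ * D 0 ω ^ 2 + 2⁻¹ * t * obs P Y φ j ω ^ 2) P :=
    ((iD 0).const_mul _).add (i1.const_mul _)
  have ij2 : Integrable (fun ω => 2⁻¹ * t⁻¹ * D j ω ^ 2 + 2⁻¹ * t * obs P Y χ 0 ω ^ 2) P :=
    ((iD j).const_mul _).add (i2.const_mul _)
  have e : cov P Y φ j - cov P Y χ j =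
      ∫ ω, (D 0 ω * obs P Y φ j ω + D j ω * obs P Y χ 0 ω) ∂P := by
    rw [cov, cov, ← integral_sub (hS.integrable_obs_mul hφ hφ 0 j) (hS.integrable_obs_mul hχ hχ 0 j)]
    refine integral_congr_ae (ae_of_all _ fun ω => ?_)
    simp only [hDe]; ring
  rw [e]
  have ij : Integrable (fun ω => 2⁻¹ * t⁻¹ * D 0 ω ^ 2 + 2⁻¹ * t * obs P Y φ j ω ^ 2 +
      (2⁻¹ * t⁻¹ * D j ω ^ 2 + 2⁻¹ * t * obs P Y χ 0 ω ^ 2)) P := ij1.add ij2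
  refine (abs_integral_le_of_abs_le ij fun ω =>
    (abs_add_le _ _).trans (add_le_add (young _ _) (young _ _))).trans ?_
  rw [integral_add ij1 ij2, integral_add ((iD 0).const_mul _) (i1.const_mul _),
    integral_add ((iD j).const_mul _) (i2.const_mul _)]
  simp only [integral_const_mul]
  rw [div_eq_inv_mul]
  have t0 : 0 < t⁻¹ := inv_pos.2 ht
  have := mul_le_mul_of_nonneg_left (hD2 0) t0.le
  have := mul_le_mul_of_nonneg_left (hD2 j) t0.le
  have := mul_le_mul_of_nonneg_left h1 ht.le
  have := mul_le_mul_of_nonneg_left h2 ht.le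
  have : 0 ≤ t * ∫ x, φ x ^ 2 ∂(P.map (Y 0)) :=
    mul_nonneg ht.le (integral_nonneg fun _ => sq_nonneg _)
  have : 0 ≤ t * ∫ x, χ x ^ 2 ∂(P.map (Y 0)) :=
    mul_nonneg ht.le (integral_nonneg fun _ => sq_nonneg _)
  linarith

/-- Covariances are continuous in mean square, uniformly in the lag. -/
lemma exists_abs_cov_sub_cov_le (hS : MixSetting P Y ℱ a) (hφm : Measurable φ)
    (hφ : MemLp φ 2 (P.map (Y 0))) {η : ℝ} (hη : 0 < η) : ∃ ε > 0, ∀ χ : ℝ → ℝ, Measurable χ →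
      MemLp χ 2 (P.map (Y 0)) → ∫ x, (φ x - χ x) ^ 2 ∂(P.map (Y 0)) ≤ ε →
      ∀ j, |cov P Y φ j - cov P Y χ j| ≤ η := by
  obtain ⟨V, hV⟩ : ∃ V, V = ∫ x, φ x ^ 2 ∂(P.map (Y 0)) := ⟨_, rfl⟩
  have hV0 : 0 ≤ V := hV ▸ integral_nonneg fun _ => sq_nonneg _
  obtain ⟨t, ht⟩ : ∃ t, t = η / (2 * (3 * V + 2)) := ⟨_, rfl⟩
  have ht0 : 0 < t := by rw [ht]; positivity
  refine ⟨min 1 (η / 2 * t), lt_min one_pos (by positivity), fun χ hχm hχ h j => ?_⟩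
  have h2 : ∫ x, χ x ^ 2 ∂(P.map (Y 0)) ≤ 2 * V + 2 := by
    have i1 : Integrable (fun x => (φ x - χ x) ^ 2) (P.map (Y 0)) := (hφ.sub hχ).integrable_sq
    have i2 := hφ.integrable_sq
    have : ∫ x, χ x ^ 2 ∂(P.map (Y 0)) ≤ ∫ x, (2 * φ x ^ 2 + 2 * (φ x - χ x) ^ 2) ∂(P.map (Y 0)) :=
      integral_mono hχ.integrable_sq ((i2.const_mul 2).add (i1.const_mul 2)) fun x => by
        simp only; nlinarith [sq_nonneg (2 * φ x - χ x)]
    rw [integral_add (i2.const_mul 2) (i1.const_mul 2), integral_const_mul, integral_const_mul] at this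
    have := h.trans (min_le_left _ _)
    linarith
  have h1 := hS.abs_cov_sub_cov_le hφm hφ hχm hχ ht0 j
  have h3 : (∫ x, (φ x - χ x) ^ 2 ∂(P.map (Y 0))) / t ≤ η / 2 := by
    rw [div_le_iff₀ ht0]; exact h.trans (min_le_right _ _)
  have h4 : t * (∫ x, φ x ^ 2 ∂(P.map (Y 0)) + ∫ x, χ x ^ 2 ∂(P.map (Y 0))) ≤ η / 2 := by
    rw [← hV]
    calc _ ≤ t * (3 * V + 2) := mul_le_mul_of_nonneg_left (by linarith) ht0.le
      _ = η / 2 := by rw [ht]; field_simp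
  linarith

/-- Adding one summand increases the second moment by a partial sum of the covariance series, so
E(S_n²)/n is a Cesàro mean of these partial sums. -/
lemma integral_psum_sq (hS : MixSetting P Y ℱ a) (hφm : Measurable φ)
    (hφ : MemLp φ 2 (P.map (Y 0))) (n : ℕ) :
    MemLp (psum P Y φ n) 2 P ∧ ∫ ω, psum P Y φ n ω ^ 2 ∂P =
      ∑ N ∈ Finset.range n, (cov P Y φ 0 + 2 * ∑ j ∈ Finset.range N, cov P Y φ (j + 1)) := by
  have hL : ∀ n, MemLp (psum P Y φ n) 2 P := fun n =>
    memLp_finsetSum _ fun i _ => hS.memLp_obs hφ (i + 1)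
  refine ⟨hL n, ?_⟩
  induction n with
  | zero => simp [psum]
  | succ n ih =>
    rw [Finset.sum_range_succ, ← ih]
    have e : ∀ ω, psum P Y φ (n + 1) ω ^ 2 = psum P Y φ n ω ^ 2 +
        (2 * ∑ i ∈ Finset.range n, obs P Y φ (i + 1) ω * obs P Y φ (n + 1) ω +
          obs P Y φ (n + 1) ω * obs P Y φ (n + 1) ω) := fun ω => by
      rw [← Finset.sum_mul, psum, Finset.sum_range_succ, ← psum]; ring_nf
    have i2 : ∀ i ∈ Finset.range n,
        Integrable (fun ω => obs P Y φ (i + 1) ω * obs P Y φ (n + 1) ω) P := fun i _ =>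
      hS.integrable_obs_mul hφ hφ (i + 1) (n + 1)
    have i3 := hS.integrable_obs_mul hφ hφ (n + 1) (n + 1)
    have i4 : Integrable (fun ω => 2 * ∑ i ∈ Finset.range n,
        obs P Y φ (i + 1) ω * obs P Y φ (n + 1) ω) P := (integrable_finsetSum _ i2).const_mul 2
    have i5 : Integrable (fun ω => 2 * ∑ i ∈ Finset.range n,
        obs P Y φ (i + 1) ω * obs P Y φ (n + 1) ω + obs P Y φ (n + 1) ω * obs P Y φ (n + 1) ω) P :=
      i4.add i3
    simp only [e]
    rw [integral_add (hL n).integrable_sq i5, integral_add i4 i3, integral_const_mul,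
      integral_finsetSum _ i2]
    have e3 : ∫ ω, obs P Y φ (n + 1) ω * obs P Y φ (n + 1) ω ∂P = cov P Y φ 0 :=
      hS.integral_obs_mul hφm (n + 1) 0
    have e4 : ∑ i ∈ Finset.range n, ∫ ω, obs P Y φ (i + 1) ω * obs P Y φ (n + 1) ω ∂P =
        ∑ j ∈ Finset.range n, cov P Y φ (j + 1) := by
      rw [← Finset.sum_range_reflect]
      refine Finset.sum_congr rfl fun j hj => ?_
      have hj := Finset.mem_range.1 hj
      rw [← hS.integral_obs_mul hφm (n - 1 - j + 1) (j + 1)]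
      congr 3
      ext ω
      rw [show n - 1 - j + 1 + (j + 1) = n + 1 by omega]
    rw [e3, e4]; ring

/-- Nonnegativity of the limit is inherited from the Cesàro means, which are normalised second
moments. -/
lemma limit_variance (hS : MixSetting P Y ℱ a) (hφm : Measurable φ)
    (hφ : MemLp φ 2 (P.map (Y 0))) (hs : Summable fun j => cov P Y φ (j + 1)) :
    Tendsto (fun N => cov P Y φ 0 + 2 * ∑ j ∈ Finset.range N, cov P Y φ (j + 1)) atTop
      (𝓝 (cov P Y φ 0 + 2 * ∑' j, cov P Y φ (j + 1))) ∧
    0 ≤ cov P Y φ 0 + 2 * ∑' j, cov P Y φ (j + 1) := by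
  have ht : Tendsto (fun N => cov P Y φ 0 + 2 * ∑ j ∈ Finset.range N, cov P Y φ (j + 1)) atTop
      (𝓝 (cov P Y φ 0 + 2 * ∑' j, cov P Y φ (j + 1))) :=
    (hs.hasSum.tendsto_sum_nat.const_mul 2).const_add _
  refine ⟨ht, ge_of_tendsto' ht.cesaro fun n => ?_⟩
  rw [← (hS.integral_psum_sq hφm hφ n).2]
  exact mul_nonneg (by positivity) (integral_nonneg fun _ => sq_nonneg _)

end MixSetting

namespace Model

variable {Ω : Type*} {mΩ : MeasurableSpace Ω} {P : Measure Ω} [IsProbabilityMeasure P]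
  {Y : ℕ → Ω → ℝ} {ℱ : ℕ → MeasurableSpace Ω} {a : ℕ → ℝ} {M : ℝ} {B h : ℝ → ℝ}

lemma memLp (H : Model P Y ℱ a M B h) : MemLp h 2 (P.map (Y 0)) := by
  have := Measure.isProbabilityMeasure_map (μ := P) (H.mix.measurable 0).aemeasurable
  exact MemLp.of_bound H.ctrl.bdd.1.aestronglyMeasurable M (ae_of_all _ H.bound)

lemma integral_abs_obs_le (H : Model P Y ℱ a M B h) (k : ℕ) :
    ∫ ω, |obs P Y h k ω| ∂P ≤ 2 * partMoment B 1 (a 0) := by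
  obtain ⟨ρ, hρ, hle⟩ := H.isEnv_obs k 0 le_rfl
  have h1 := hρ.moment 1 (by simp)
  rw [H.tailMoment_zero] at h1
  simp only [pow_one] at h1
  exact (integral_mono (H.bddMeas_obs k).abs.integrable hρ.bdd.integrable fun ω => by
    simpa using hle ω).trans h1

lemma integral_psum_sq_le (H : Model P Y ℱ a M B h) (n : ℕ) :
    ∫ ω, psum P Y h n ω ^ 2 ∂P ≤ n * (96 * ∑ j ∈ Finset.range (n + 1), partMoment B 2 (a j)) := by
  rw [(H.mix.integral_psum_sq H.ctrl.bdd.1 H.memLp n).2]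
  calc _ ≤ ∑ N ∈ Finset.range n, 96 * ∑ j ∈ Finset.range (n + 1), partMoment B 2 (a j) := by
        refine Finset.sum_le_sum fun N hN => ?_
        have hN := Finset.mem_range.1 hN
        have h0 := (le_abs_self _).trans (H.abs_cov_le 0)
        have p0 : 0 ≤ partMoment B 2 (a 0) := H.rate.partMoment_nonneg 2 _
        have h1 : ∑ j ∈ Finset.range N, cov P Y h (j + 1) ≤
            ∑ j ∈ Finset.range N, 48 * partMoment B 2 (a (j + 1)) :=
          Finset.sum_le_sum fun j _ => (le_abs_self _).trans (H.abs_cov_le (j + 1))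
        have h2 : ∑ j ∈ Finset.range N, 48 * partMoment B 2 (a (j + 1)) ≤
            ∑ j ∈ Finset.range n, 48 * partMoment B 2 (a (j + 1)) :=
          Finset.sum_le_sum_of_subset_of_nonneg (Finset.range_mono hN.le) fun j _ _ =>
            mul_nonneg (by norm_num) (H.rate.partMoment_nonneg 2 _)
        rw [Finset.sum_range_succ', mul_add, Finset.mul_sum]
        simp only [← Finset.mul_sum] at h1 h2 ⊢
        linarith
    _ = _ := by rw [Finset.sum_const, Finset.card_range, nsmul_eq_mul]

end Model

/-! ### Comparison with the truncated moment of order three -/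

section Comparison

variable {Ω : Type*} {mΩ : MeasurableSpace Ω} {P : Measure Ω} [IsProbabilityMeasure P]
  {Y δ : ℤ → Ω → ℝ} {Q : ℝ → ℝ≥0∞} {lam M v u : ℝ} {q m : ℕ}

lemma one_le_Rfun (hu : u ∈ Ioo (0 : ℝ) 1) : 1 ≤ Rfun P Y δ Q u :=
  one_le_mul (one_le_alphaInv hu.1.le hu.2) (le_max_right _ _)

lemma alphaInv_mul_le_Rfun (u : ℝ) : alphaInv P Y δ u * Q u ≤ Rfun P Y δ Q u :=
  mul_le_mul_right (le_max_left _ _) _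

lemma alphaInv_le_Rfun (u : ℝ) : alphaInv P Y δ u ≤ Rfun P Y δ Q u :=
  le_mul_of_one_le_right zero_le (le_max_right _ _)

lemma mul_Rfun_le_truncKernel (hl : 1 ≤ lam) (hu : u ∈ Ioo (0 : ℝ) 1) :
    Q u * Rfun P Y δ Q u ≤ truncKernel P Y δ Q lam u :=
  le_mul_of_one_le_right zero_le (le_min (one_le_Rfun hu) (by
    simpa using ENNReal.ofReal_le_ofReal hl))

lemma alphaInv_mul_le_truncKernel (hl : 1 ≤ lam) (hu : u ∈ Ioo (0 : ℝ) 1) :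
    alphaInv P Y δ u * Q u ≤ truncKernel P Y δ Q lam u := by
  refine le_trans ?_ (mul_Rfun_le_truncKernel hl hu)
  rw [mul_comm]
  exact mul_le_mul_right (alphaInv_le_Rfun u) _

lemma alphaInv_mul_sq_le_mul_Rfun (u : ℝ) :
    alphaInv P Y δ u * Q u ^ 2 ≤ Q u * Rfun P Y δ Q u := by
  calc alphaInv P Y δ u * Q u ^ 2 = Q u * (alphaInv P Y δ u * Q u) := by ring
    _ ≤ _ := mul_le_mul_right (alphaInv_mul_le_Rfun u) _

/-- To the left of v the function R exceeds lam, so the truncated factor in the kernel is lam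
itself. -/
lemma IsThreshold.mul_le_truncKernel (T : IsThreshold P Y δ Q lam q M v)
    (hu : u ∈ Ioo (0 : ℝ) 1) (huv : u < v) :
    ENNReal.ofReal lam * (alphaInv P Y δ u * Q u ^ 2) ≤ truncKernel P Y δ Q lam u := by
  rw [mul_comm, truncKernel, min_eq_right (T.below u hu huv).2.2]
  exact mul_le_mul_left (alphaInv_mul_sq_le_mul_Rfun u) _

/-- Integrands need only be compared off the crossing point, where the threshold says nothing and
which has measure zero. -/
lemma le_toReal_Mtrunc (hfin : Mtrunc P Y δ Q lam ≠ ∞) {x : ℝ} {F : ℝ → ℝ≥0∞} (v : ℝ)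
    (hF : ∀ u ∈ Ioo (0 : ℝ) 1, u ≠ v → F u ≤ truncKernel P Y δ Q lam u)
    (hx : ENNReal.ofReal x ≤ ∫⁻ u in Ioo (0 : ℝ) 1, F u) : x ≤ (Mtrunc P Y δ Q lam).toReal := by
  refine (ENNReal.ofReal_le_iff_le_toReal hfin).1 (hx.trans (lintegral_mono_ae ?_))
  filter_upwards [ae_restrict_mem measurableSet_Ioo, Measure.ae_ne _ v] with u hu huv
  exact hF u hu huv

lemma ofReal_bandRate_le {K : ℝ} (hM : 0 ≤ M) (u : ℝ) :
    ENNReal.ofReal (bandRate Q M K u) ≤ Q u := by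
  refine (ENNReal.ofReal_le_ofReal ?_).trans ENNReal.ofReal_toReal_le
  have : 0 ≤ min (Q u).toReal M := le_min ENNReal.toReal_nonneg hM
  unfold bandRate
  linarith [min_le_left (Q u).toReal K]

lemma bandRate_nonneg {K : ℝ} (hMK : M ≤ K) (u : ℝ) : 0 ≤ bandRate Q M K u :=
  min_sub_min_nonneg hMK _

namespace IsThreshold

/-- With c lags counted at u, the integrand is c²B³ = B · (cB) · (cB). One factor cB is at most α⁻¹Q
≤ R; the other is also at most (m + 1)M ≤ lam because there are m + 1 lags and B ≤ M. This is
exactly the kernel of the truncated moment. -/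
lemma sum_rowSum_le (T : IsThreshold P Y δ Q lam (m + 1) M v) (hQ : IsTail Q)
    (hfin : Mtrunc P Y δ Q lam ≠ ∞) :
    ∑ j ∈ Finset.range (m + 1), Model.rowSum (bandRate Q 0 M) (mixRate P Y δ) m j ≤
      (Mtrunc P Y δ Q lam).toReal := by
  have e : ∑ j ∈ Finset.range (m + 1), Model.rowSum (bandRate Q 0 M) (mixRate P Y δ) m j =
      ∑ z ∈ Finset.range (m + 1) ×ˢ Finset.range (m + 1),
        partMoment (bandRate Q 0 M) 3 (mixRate P Y δ (max z.2 z.1)) := by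
    rw [Finset.sum_product]; rfl
  rw [e]
  refine le_toReal_Mtrunc hfin v ?_ (ofReal_sum_partMoment hQ le_rfl T.nonneg 3 _
    (fun z : ℕ × ℕ => max z.2 z.1)).le
  intro u hu _
  obtain ⟨c, hc⟩ : ∃ c, c = rateCount (mixRate P Y δ) (Finset.range (m + 1)) id u := ⟨_, rfl⟩
  have hcA : c ≤ alphaInv P Y δ u := hc ▸ rateCount_le_alphaInv (injOn_id _) hu.1.le
  have hcq : c ≤ ((m + 1 : ℕ) : ℝ≥0∞) := by
    rw [hc]
    exact (rateCount_le_card _ _ _ _).trans (by rw [Finset.card_range])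
  have hB := ofReal_bandRate_le (Q := Q) (K := M) le_rfl u
  have hBM : ENNReal.ofReal (bandRate Q 0 M u) ≤ ENNReal.ofReal M :=
    ENNReal.ofReal_le_ofReal ((isRate_bandRate hQ le_rfl T.nonneg).le u)
  have h1 : c * ENNReal.ofReal (bandRate Q 0 M u) ≤ Rfun P Y δ Q u :=
    (mul_le_mul' hcA hB).trans (alphaInv_mul_le_Rfun u)
  have h2 : c * ENNReal.ofReal (bandRate Q 0 M u) ≤ ENNReal.ofReal lam := by
    refine (mul_le_mul' hcq hBM).trans ?_
    rw [← ENNReal.ofReal_natCast, ← ENNReal.ofReal_mul (Nat.cast_nonneg _)]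
    exact ENNReal.ofReal_le_ofReal T.mul_le
  calc _ ≤ c * c * ENNReal.ofReal (bandRate Q 0 M u ^ 3) :=
        mul_le_mul_left (hc ▸ rateCount_max_le (antitone_mixRate P Y δ) (m + 1) u) _
    _ = ENNReal.ofReal (bandRate Q 0 M u) * (c * ENNReal.ofReal (bandRate Q 0 M u)) *
        (c * ENNReal.ofReal (bandRate Q 0 M u)) := by
        rw [ENNReal.ofReal_pow (bandRate_nonneg T.nonneg u)]; ring
    _ ≤ _ := mul_le_mul' (mul_le_mul' hB h1) (le_min h1 h2)

lemma sum_partMoment_one_le (T : IsThreshold P Y δ Q lam (m + 1) M v) (hQ : IsTail Q)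
    (hl : 1 ≤ lam) (hfin : Mtrunc P Y δ Q lam ≠ ∞) (n : ℕ) :
    ∑ k ∈ Finset.range n, partMoment (bandRate Q 0 M) 1 (mixRate P Y δ (k + 1)) ≤
      (Mtrunc P Y δ Q lam).toReal := by
  refine le_toReal_Mtrunc hfin v ?_ (ofReal_sum_partMoment hQ le_rfl T.nonneg 1 _
    (fun k : ℕ => k + 1)).le
  intro u hu _
  rw [pow_one]
  exact (mul_le_mul' (rateCount_le_alphaInv (add_left_injective 1).injOn hu.1.le)
    (ofReal_bandRate_le le_rfl u)).trans (alphaInv_mul_le_truncKernel hl hu)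

/-- The pattern common to the truncation errors: they vanish to the right of v and are at most α⁻¹Q²
to the left, where an extra factor lam is available. -/
lemma le_truncKernel (T : IsThreshold P Y δ Q lam q M v) (hu : u ∈ Ioo (0 : ℝ) 1) (huv : u ≠ v)
    {F : ℝ≥0∞} (h1 : u < v → F ≤ alphaInv P Y δ u * Q u ^ 2) (h2 : v < u → F = 0) :
    ENNReal.ofReal lam * F ≤ truncKernel P Y δ Q lam u := by
  rcases huv.lt_or_gt with h | h
  · exact (mul_le_mul_right (h1 h) _).trans (T.mul_le_truncKernel hu h)
  · rw [h2 h, mul_zero]; exact zero_le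

lemma ofReal_sum_mixRate (hQ : IsTail Q) {ι : Type*} (s : Finset ι) (e : ι → ℕ) :
    ENNReal.ofReal (∑ i ∈ s, mixRate P Y δ (e i)) =
      ∫⁻ u in Ioo (0 : ℝ) 1, rateCount (mixRate P Y δ) s e u := by
  have := ofReal_sum_partMoment (P := P) (Y := Y) (δ := δ) hQ (le_refl (0 : ℝ)) le_rfl 0 s e
  have e2 : ∀ p, partMoment (bandRate Q 0 0) 0 (mixRate P Y δ p) = mixRate P Y δ p := fun p => by
    simp [partMoment, Real.volume_real_Ioo_of_le (show 0 ≤ mixRate P Y δ p from ENNReal.toReal_nonneg)]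
  simpa only [e2, pow_zero, ENNReal.ofReal_one, mul_one] using this

lemma sum_mixRate_le (T : IsThreshold P Y δ Q lam (m + 1) M v) (hQ : IsTail Q)
    (hl : 1 ≤ lam) (hfin : Mtrunc P Y δ Q lam ≠ ∞) (n : ℕ) :
    lam * (M ^ 2 * ∑ k ∈ Finset.Ico m n, mixRate P Y δ (k + 1)) ≤
      (Mtrunc P Y δ Q lam).toReal := by
  refine le_toReal_Mtrunc (F := fun u => ENNReal.ofReal lam * (ENNReal.ofReal (M ^ 2) *
    rateCount (mixRate P Y δ) (Finset.Ico m n) (fun k => k + 1) u)) hfin v ?_ (le_of_eq ?_)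
  · intro u hu huv
    refine T.le_truncKernel hu huv (fun h => ?_) fun h => ?_
    · rw [mul_comm, ENNReal.ofReal_pow T.nonneg]
      exact mul_le_mul' (rateCount_le_alphaInv (add_left_injective 1).injOn hu.1.le)
        (pow_le_pow_left₀ zero_le (T.below u hu h).1 2)
    · rw [rateCount_eq_zero fun k hk => (T.rate _ (by
        have := Finset.mem_Ico.1 hk; omega)).trans h.le, mul_zero]
  · rw [ENNReal.ofReal_mul (by linarith), ENNReal.ofReal_mul (sq_nonneg _), ofReal_sum_mixRate hQ,
      lintegral_const_mul' _ _ ENNReal.ofReal_ne_top, lintegral_const_mul' _ _ ENNReal.ofReal_ne_top]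

/-- To the left of v both α⁻¹ ≥ m + 1 and Q ≥ M, so (m + 1)M² is dominated there by α⁻¹Q². -/
lemma mul_mixRate_le (T : IsThreshold P Y δ Q lam (m + 1) M v) (hQ : IsTail Q)
    (hl : 1 ≤ lam) (hfin : Mtrunc P Y δ Q lam ≠ ∞) :
    lam * ((m + 1) * M ^ 2 * mixRate P Y δ (m + 1)) ≤ (Mtrunc P Y δ Q lam).toReal := by
  refine le_toReal_Mtrunc (F := fun u => ENNReal.ofReal lam * (((m + 1 : ℕ) : ℝ≥0∞) *
    ENNReal.ofReal (M ^ 2) * rateCount (mixRate P Y δ) {m + 1} id u)) hfin v ?_ (le_of_eq ?_)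
  · intro u hu huv
    refine T.le_truncKernel hu huv (fun h => ?_) fun h => ?_
    · rw [ENNReal.ofReal_pow T.nonneg]
      refine (mul_le_of_le_one_right zero_le ?_).trans (mul_le_mul' (T.below u hu h).2.1
        (pow_le_pow_left₀ zero_le (T.below u hu h).1 2))
      exact (rateCount_le_card _ _ _ _).trans (by simp)
    · rw [rateCount_eq_zero fun k hk => (T.rate _ (by simp_all)).trans h.le, mul_zero]
  · have := ofReal_sum_mixRate (P := P) (Y := Y) (δ := δ) hQ {m + 1} id
    rw [Finset.sum_singleton] at this
    rw [ENNReal.ofReal_mul (by linarith), ENNReal.ofReal_mul (by positivity),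
      ENNReal.ofReal_mul (by positivity), lintegral_const_mul' _ _ ENNReal.ofReal_ne_top,
      lintegral_const_mul' _ _ (ENNReal.mul_ne_top (ENNReal.natCast_ne_top _) ENNReal.ofReal_ne_top),
      ← this, ← ENNReal.ofReal_natCast]
    push_cast; rfl

/-- One of the two factors B is combined with m and bounded by lam. What remains is α⁻¹Q, which the
kernel dominates since R ≥ 1 and lam ≥ 1. -/
lemma mul_sum_partMoment_two_le (T : IsThreshold P Y δ Q lam (m + 1) M v) (hQ : IsTail Q)
    (hl : 1 ≤ lam) (hfin : Mtrunc P Y δ Q lam ≠ ∞) :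
    m * ∑ k ∈ Finset.range m, partMoment (bandRate Q 0 M) 2 (mixRate P Y δ (k + 1)) ≤
      lam * (Mtrunc P Y δ Q lam).toReal := by
  have hl0 : 0 < lam := by linarith
  rw [mul_comm lam, ← div_le_iff₀ hl0]
  refine le_toReal_Mtrunc (F := fun u => ENNReal.ofReal lam⁻¹ * ((m : ℝ≥0∞) *
    (rateCount (mixRate P Y δ) (Finset.range m) (fun k => k + 1) u *
      ENNReal.ofReal (bandRate Q 0 M u ^ 2)))) hfin v ?_ (le_of_eq ?_)
  · intro u hu _
    have hB := ofReal_bandRate_le (Q := Q) (K := M) le_rfl u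
    have hmB : (m : ℝ≥0∞) * ENNReal.ofReal (bandRate Q 0 M u) ≤ ENNReal.ofReal lam := by
      rw [← ENNReal.ofReal_natCast, ← ENNReal.ofReal_mul (Nat.cast_nonneg _)]
      refine ENNReal.ofReal_le_ofReal (le_trans ?_ T.mul_le)
      have h1 := (isRate_bandRate hQ le_rfl T.nonneg).le u
      have h2 := T.nonneg
      push_cast
      nlinarith [(Nat.cast_nonneg m : (0 : ℝ) ≤ m)]
    calc _ = ENNReal.ofReal lam⁻¹ * ((m : ℝ≥0∞) * ENNReal.ofReal (bandRate Q 0 M u)) *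
          (rateCount (mixRate P Y δ) (Finset.range m) (fun k => k + 1) u *
            ENNReal.ofReal (bandRate Q 0 M u)) := by
          rw [ENNReal.ofReal_pow (bandRate_nonneg T.nonneg u)]; ring
      _ ≤ ENNReal.ofReal lam⁻¹ * ENNReal.ofReal lam * (alphaInv P Y δ u * Q u) :=
          mul_le_mul' (mul_le_mul_right hmB _)
            (mul_le_mul' (rateCount_le_alphaInv (add_left_injective 1).injOn hu.1.le) hB)
      _ ≤ _ := by
          rw [← ENNReal.ofReal_mul (by positivity), inv_mul_cancel₀ hl0.ne', ENNReal.ofReal_one,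
            one_mul]
          exact alphaInv_mul_le_truncKernel hl hu
  · rw [lintegral_const_mul' _ _ ENNReal.ofReal_ne_top,
      lintegral_const_mul' _ _ (ENNReal.natCast_ne_top _),
      ← ofReal_sum_partMoment hQ le_rfl T.nonneg 2, div_eq_inv_mul,
      ENNReal.ofReal_mul (by positivity), ENNReal.ofReal_mul (Nat.cast_nonneg _),
      ENNReal.ofReal_natCast]

lemma upperIntegrand_eq_zero (T : IsThreshold P Y δ Q lam q M v) (hu : u ∈ Ioo (0 : ℝ) 1)
    (h : v < u) : (Q u).toReal ≤ M :=
  ENNReal.toReal_le_of_le_ofReal T.nonneg (T.above u hu h)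

lemma mul_upperMoment_le (T : IsThreshold P Y δ Q lam (m + 1) M v)
    (hQ2 : ∫⁻ u in Ioo (0 : ℝ) 1, Q u ^ 2 < ∞)
    (hl : 1 ≤ lam) (hfin : Mtrunc P Y δ Q lam ≠ ∞) :
    lam * ((m + 1) * (upperMoment Q M).toReal) ≤ (Mtrunc P Y δ Q lam).toReal := by
  refine le_toReal_Mtrunc (F := fun u => ENNReal.ofReal lam * (((m + 1 : ℕ) : ℝ≥0∞) *
    ENNReal.ofReal (if M < (Q u).toReal then (Q u).toReal ^ 2 else 0))) hfin v ?_ (le_of_eq ?_)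
  · intro u hu huv
    refine T.le_truncKernel hu huv (fun h => mul_le_mul' (T.below u hu h).2.1 ?_) fun h => ?_
    · split_ifs
      · rw [ENNReal.ofReal_pow ENNReal.toReal_nonneg]
        exact pow_le_pow_left₀ zero_le ENNReal.ofReal_toReal_le 2
      · simp
    · rw [if_neg (not_lt.2 (T.upperIntegrand_eq_zero hu h)), ENNReal.ofReal_zero, mul_zero]
  · rw [lintegral_const_mul' _ _ ENNReal.ofReal_ne_top,
      lintegral_const_mul' _ _ (ENNReal.natCast_ne_top _), ← upperMoment,
      ENNReal.ofReal_mul (by linarith), ENNReal.ofReal_mul (by positivity),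
      ENNReal.ofReal_toReal ((upperMoment_le Q M).trans_lt hQ2).ne, ← ENNReal.ofReal_natCast]
    push_cast; rfl

lemma mul_sum_bandRate_le (T : IsThreshold P Y δ Q lam q M v) (hQ : IsTail Q) {K : ℝ}
    (hMK : M ≤ K) (hl : 1 ≤ lam) (hfin : Mtrunc P Y δ Q lam ≠ ∞) (N : ℕ) :
    lam * ∑ j ∈ Finset.range N, partMoment (bandRate Q M K) 2 (mixRate P Y δ j) ≤
      (Mtrunc P Y δ Q lam).toReal := by
  refine le_toReal_Mtrunc (F := fun u => ENNReal.ofReal lam *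
    (rateCount (mixRate P Y δ) (Finset.range N) id u *
      ENNReal.ofReal (bandRate Q M K u ^ 2))) hfin v ?_ (le_of_eq ?_)
  · intro u hu huv
    refine T.le_truncKernel hu huv (fun h => ?_) fun h => ?_
    · rw [ENNReal.ofReal_pow (bandRate_nonneg hMK u)]
      exact mul_le_mul' (rateCount_le_alphaInv (injOn_id _) hu.1.le)
        (pow_le_pow_left₀ zero_le (ofReal_bandRate_le T.nonneg u) 2)
    · have := T.upperIntegrand_eq_zero hu h
      simp [bandRate, min_eq_left this, min_eq_left (this.trans hMK)]
  · rw [lintegral_const_mul' _ _ ENNReal.ofReal_ne_top, ENNReal.ofReal_mul (by linarith),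
      ← ofReal_sum_partMoment hQ T.nonneg hMK 2]
    rfl

end IsThreshold

/-- The part of the second moment of `Q` near the origin. -/
def lowMoment (Q : ℝ → ℝ≥0∞) (t : ℝ) : ℝ := (∫⁻ u in Ioo (0 : ℝ) t, Q u ^ 2).toReal

lemma lowMoment_nonneg (Q : ℝ → ℝ≥0∞) (t : ℝ) : 0 ≤ lowMoment Q t := ENNReal.toReal_nonneg

lemma ofReal_sum_lowMoment_le (hQ : IsTail Q) {ι : Type*} (s : Finset ι) (e : ι → ℕ) :
    ENNReal.ofReal (∑ i ∈ s, lowMoment Q (mixRate P Y δ (e i))) ≤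
      ∫⁻ u in Ioo (0 : ℝ) 1, rateCount (mixRate P Y δ) s e u * Q u ^ 2 := by
  rw [ENNReal.ofReal_sum_of_nonneg fun i _ => lowMoment_nonneg Q _,
    ← sum_lintegral_Ioo_eq (mixRate_le_one P Y δ) s e (hQ.anti.measurable.pow_const 2)]
  exact Finset.sum_le_sum fun i _ => ENNReal.ofReal_toReal_le

lemma IsThreshold.mul_sum_lowMoment_le (T : IsThreshold P Y δ Q lam q M v) (hQ : IsTail Q)
    (hl : 1 ≤ lam) (hfin : Mtrunc P Y δ Q lam ≠ ∞) (N : ℕ) :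
    lam * ∑ j ∈ Finset.range N, lowMoment Q (mixRate P Y δ (j + q)) ≤
      (Mtrunc P Y δ Q lam).toReal := by
  refine le_toReal_Mtrunc (F := fun u => ENNReal.ofReal lam *
    (rateCount (mixRate P Y δ) (Finset.range N) (fun j => j + q) u * Q u ^ 2)) hfin v ?_ ?_
  · intro u hu huv
    refine T.le_truncKernel hu huv (fun h => ?_) fun h => ?_
    · exact mul_le_mul_left (rateCount_le_alphaInv (add_left_injective q).injOn hu.1.le) _
    · rw [rateCount_eq_zero fun k hk => (T.rate _ (by omega)).trans h.le, zero_mul]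
  · rw [lintegral_const_mul' _ _ ENNReal.ofReal_ne_top, ENNReal.ofReal_mul (by linarith)]
    exact mul_le_mul_right (ofReal_sum_lowMoment_le hQ _ _) _

lemma sum_lowMoment_le_Mtrunc (hQ : IsTail Q) (hl : 1 ≤ lam) (hfin : Mtrunc P Y δ Q lam ≠ ∞)
    (N : ℕ) : ∑ j ∈ Finset.range N, lowMoment Q (mixRate P Y δ j) ≤
      (Mtrunc P Y δ Q lam).toReal := by
  refine le_toReal_Mtrunc hfin 0 ?_ (ofReal_sum_lowMoment_le hQ _ id)
  exact fun u hu _ => (mul_le_mul_left (rateCount_le_alphaInv (injOn_id _) hu.1.le) _).trans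
    ((alphaInv_mul_sq_le_mul_Rfun u).trans (mul_Rfun_le_truncKernel hl hu))

lemma Mtrunc_le (P : Measure Ω) (Y δ : ℤ → Ω → ℝ) (Q : ℝ → ℝ≥0∞) (lam : ℝ) :
    Mtrunc P Y δ Q lam ≤ ENNReal.ofReal lam * Mmoment P Y δ Q 2 := by
  rw [Mtrunc, Mmoment, ← lintegral_const_mul' _ _ ENNReal.ofReal_ne_top]
  refine lintegral_mono fun u => ?_
  calc _ ≤ Q u * Rfun P Y δ Q u * ENNReal.ofReal lam := mul_le_mul_right (min_le_right _ _) _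
    _ = _ := by
      rw [show (2 : ℝ) - 1 = 1 by norm_num, ENNReal.rpow_one]; ring

/-- On (0,1) the inverse rate is at least 1, since the coefficient at lag zero is 1. The moment
hypothesis therefore contains square integrability of Q. -/
lemma lintegral_sq_le_Mmoment (P : Measure Ω) [IsProbabilityMeasure P] (Y δ : ℤ → Ω → ℝ)
    (Q : ℝ → ℝ≥0∞) : ∫⁻ u in Ioo (0 : ℝ) 1, Q u ^ 2 ≤ Mmoment P Y δ Q 2 := by
  refine setLIntegral_mono' measurableSet_Ioo fun u hu => ?_
  rw [show (2 : ℝ) - 1 = 1 by norm_num, ENNReal.rpow_one, mul_comm]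
  refine le_trans ?_ (alphaInv_mul_sq_le_mul_Rfun u)
  exact le_mul_of_one_le_left zero_le (one_le_alphaInv hu.1.le hu.2)

end Comparison

/-! ### Covariances of functions of the class -/

section ClassCov

variable {Ω : Type*} {mΩ : MeasurableSpace Ω} {P : Measure Ω} [IsProbabilityMeasure P]
  {Y δ : ℤ → Ω → ℝ} {Q : ℝ → ℝ≥0∞} {f : ℝ → ℝ}

lemma partMoment_bandRate_le_lowMoment (hQ : IsTail Q)
    (hQ2 : ∫⁻ u in Ioo (0 : ℝ) 1, Q u ^ 2 < ∞) {K t : ℝ} (hK : 0 ≤ K) (ht : t ≤ 1) :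
    partMoment (bandRate Q 0 K) 2 t ≤ lowMoment Q t := by
  have h1 : ∫⁻ u in Ioo (0 : ℝ) t, Q u ^ 2 < ∞ :=
    (lintegral_mono_set (Ioo_subset_Ioo_right ht)).trans_lt hQ2
  refine (ENNReal.ofReal_le_iff_le_toReal h1.ne).1 ?_
  rw [(isRate_bandRate hQ le_rfl hK).ofReal_partMoment 2 ht]
  refine lintegral_mono fun u => ?_
  rw [ENNReal.ofReal_pow (bandRate_nonneg hK u)]
  exact pow_le_pow_left₀ zero_le (ofReal_bandRate_le le_rfl u) 2

/-- The bound holds for clipped combinations with a constant free of the clip, and covariances are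
continuous in mean square. -/
lemma StationarySetup.abs_cov_le (hS : StationarySetup P Y δ) (hQ : IsTail Q)
    (hQ2 : ∫⁻ u in Ioo (0 : ℝ) 1, Q u ^ 2 < ∞) (hf : f ∈ FClass Q (P.map (Y 0)))
    (hfm : Measurable f) (j : ℕ) :
    |cov P (fun k : ℕ => Y k) f j| ≤ 48 * lowMoment Q (mixRate P Y δ j) := by
  have := Measure.isProbabilityMeasure_map (μ := P) (hS.measurable_Y 0).aemeasurable
  have hf2 := memLp_two_of_mem_FClass hQ hQ2 hf hfm
  refine le_of_forall_pos_le_add fun η hη => ?_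
  obtain ⟨ε, hε, h⟩ := hS.mixSetting.exists_abs_cov_sub_cov_le hfm hf2 hη
  obtain ⟨K, L, a, g, hK, -, ha, hg, hd⟩ := exists_comb_near hQ hQ2 hf hfm 0 hε
  have H := hS.model hQ ha hg le_rfl hK
  have h1 := h _ H.ctrl.bdd.1 H.memLp hd j
  have h2 := H.abs_cov_le j
  have h3 := partMoment_bandRate_le_lowMoment hQ hQ2 hK (mixRate_le_one P Y δ j)
  have h4 := abs_sub_abs_le_abs_sub (cov P (fun k : ℕ => Y k) f j)
    (cov P (fun k : ℕ => Y k) (comb a (band 0 K) g) j)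
  linarith

lemma upperMoment_bounds (hQ : IsTail Q) (hQ2 : ∫⁻ u in Ioo (0 : ℝ) 1, Q u ^ 2 < ∞) {M K : ℝ}
    (h0 : 0 ≤ M) (hMK : M ≤ K) :
    M * partMoment (bandRate Q M K) 1 1 ≤ (upperMoment Q M).toReal ∧
      partMoment (bandRate Q M K) 2 1 ≤ (upperMoment Q M).toReal := by
  have hfin := ((upperMoment_le Q M).trans_lt hQ2).ne
  have hB := isRate_bandRate hQ h0 hMK
  have hb : ∀ u, (bandRate Q M K u = 0 ∧ ¬ M < (Q u).toReal) ∨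
      (M < (Q u).toReal ∧ bandRate Q M K u ≤ (Q u).toReal) := fun u => by
    by_cases h : M < (Q u).toReal
    · refine Or.inr ⟨h, ?_⟩
      unfold bandRate
      rw [min_eq_right h.le]
      linarith [min_le_left (Q u).toReal K]
    · have h' := not_lt.1 h
      exact Or.inl ⟨by rw [bandRate, min_eq_left h', min_eq_left (h'.trans hMK), sub_self], h⟩
  constructor
  · refine (ENNReal.ofReal_le_iff_le_toReal hfin).1 ?_
    rw [ENNReal.ofReal_mul h0, hB.ofReal_partMoment 1 le_rfl,
      ← lintegral_const_mul' _ _ ENNReal.ofReal_ne_top]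
    refine lintegral_mono fun u => ?_
    simp only
    rw [← ENNReal.ofReal_mul h0, pow_one]
    refine ENNReal.ofReal_le_ofReal ?_
    rcases hb u with ⟨h1, h2⟩ | ⟨h1, h2⟩
    · rw [h1, if_neg h2, mul_zero]
    · rw [if_pos h1, sq]
      exact mul_le_mul h1.le h2 (hB.nonneg u) ENNReal.toReal_nonneg
  · refine (ENNReal.ofReal_le_iff_le_toReal hfin).1 ?_
    rw [hB.ofReal_partMoment 2 le_rfl]
    refine lintegral_mono fun u => ENNReal.ofReal_le_ofReal ?_
    rcases hb u with ⟨h1, h2⟩ | ⟨h1, h2⟩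
    · rw [h1, if_neg h2, zero_pow two_ne_zero]
    · rw [if_pos h1]
      exact pow_le_pow_left₀ (hB.nonneg u) h2 2

lemma comb_band_add {L : ℕ} (a : Fin L → ℝ) (M K : ℝ) (g : Fin L → ℝ → ℝ) (x : ℝ) :
    comb a (band M K) g x = comb a (band 0 K) g x - comb a (band 0 M) g x := by
  rw [comb_band_zero, comb_band_zero, ← Finset.sum_sub_distrib]
  exact Finset.sum_congr rfl fun l _ => by unfold band; ring

/-- Write D for the band between M and K. The cross terms cost 2M E|D| each and the product of bands
costs second moments; both are controlled by the part of Q above M, with 12 = 8 + 4. -/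
lemma StationarySetup.abs_cov_band_sub_le (hS : StationarySetup P Y δ) (hQ : IsTail Q)
    (hQ2 : ∫⁻ u in Ioo (0 : ℝ) 1, Q u ^ 2 < ∞) {L : ℕ} {a : Fin L → ℝ} {g : Fin L → ℝ → ℝ}
    (ha : ∑ l, |a l| ≤ 1) (hg : ∀ l, g l ∈ MonClass Q (P.map (Y 0))) {M K : ℝ} (h0 : 0 ≤ M)
    (hMK : M ≤ K) (j : ℕ) :
    |cov P (fun k : ℕ => Y k) (comb a (band 0 K) g) j -
      cov P (fun k : ℕ => Y k) (comb a (band 0 M) g) j| ≤ 12 * (upperMoment Q M).toReal := by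
  have HK := hS.model hQ ha hg le_rfl (h0.trans hMK)
  have HM := hS.model hQ ha hg le_rfl h0
  have HD := hS.model hQ ha hg h0 hMK
  obtain ⟨u1, u2⟩ := upperMoment_bounds hQ hQ2 h0 hMK
  obtain ⟨D, hD⟩ : ∃ D, D = obs P (fun k : ℕ => Y k) (comb a (band M K) g) := ⟨_, rfl⟩
  obtain ⟨Z, hZ⟩ : ∃ Z, Z = obs P (fun k : ℕ => Y k) (comb a (band 0 M) g) := ⟨_, rfl⟩
  have hX : ∀ k ω, obs P (fun k : ℕ => Y k) (comb a (band 0 K) g) k ω = Z k ω + D k ω :=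
    fun k ω => by
      have := hS.mixSetting.obs_sub HK.memLp HM.memLp k ω
      simp only [← comb_band_add] at this
      rw [hZ, hD]
      linarith [show obs P (fun k : ℕ => Y k) (comb a (band M K) g) k ω = _ from this]
  have bD : ∀ k, BddMeas (D k) := fun k => hD ▸ HD.bddMeas_obs k
  have bZ : ∀ k, BddMeas (Z k) := fun k => hZ ▸ HM.bddMeas_obs k
  have zb : ∀ k ω, |Z k ω| ≤ 2 * M := fun k ω => by rw [hZ]; exact HM.abs_obs_le k ω
  have d1 : ∀ k, ∫ ω, |D k ω| ∂P ≤ 2 * partMoment (bandRate Q M K) 1 1 := fun k => by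
    have := HD.integral_abs_obs_le k
    rwa [HD.zero, ← hD] at this
  have d2 : ∀ k, ∫ ω, D k ω ^ 2 ∂P ≤ 4 * partMoment (bandRate Q M K) 2 1 := fun k => by
    have := HD.integral_obs_sq_le k
    rwa [HD.zero, ← hD] at this
  have i0 := (bD 0).abs.integrable (P := P)
  have ij := (bD j).abs.integrable (P := P)
  have s0 := ((bD 0).pow 2).integrable (P := P)
  have sj := ((bD j).pow 2).integrable (P := P)
  have e : cov P (fun k : ℕ => Y k) (comb a (band 0 K) g) j -
      cov P (fun k : ℕ => Y k) (comb a (band 0 M) g) j =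
      ∫ ω, (D 0 ω * Z j ω + Z 0 ω * D j ω + D 0 ω * D j ω) ∂P := by
    rw [cov, cov, ← integral_sub ((HK.bddMeas_obs 0).mul (HK.bddMeas_obs j)).integrable
      ((HM.bddMeas_obs 0).mul (HM.bddMeas_obs j)).integrable]
    refine integral_congr_ae (ae_of_all _ fun ω => ?_)
    simp only [hX, ← hZ]; ring
  have j1 : Integrable (fun ω => 2 * M * |D 0 ω| + 2 * M * |D j ω|) P :=
    (i0.const_mul _).add (ij.const_mul _)
  have j2 : Integrable (fun ω => 2⁻¹ * D 0 ω ^ 2 + 2⁻¹ * D j ω ^ 2) P :=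
    (s0.const_mul _).add (sj.const_mul _)
  have j3 : Integrable (fun ω => 2 * M * |D 0 ω| + 2 * M * |D j ω| +
      (2⁻¹ * D 0 ω ^ 2 + 2⁻¹ * D j ω ^ 2)) P := j1.add j2
  rw [e]
  refine (abs_integral_le_of_abs_le j3 fun ω => ?_).trans ?_
  · refine (abs_add_three _ _ _).trans ?_
    rw [abs_mul, abs_mul, abs_mul]
    have a1 := mul_le_mul_of_nonneg_left (zb j ω) (abs_nonneg (D 0 ω))
    have a2 := mul_le_mul_of_nonneg_left (zb 0 ω) (abs_nonneg (D j ω))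
    have a3 : |D 0 ω| * |D j ω| ≤ 2⁻¹ * D 0 ω ^ 2 + 2⁻¹ * D j ω ^ 2 := by
      rw [← sq_abs (D 0 ω), ← sq_abs (D j ω)]
      nlinarith [sq_nonneg (|D 0 ω| - |D j ω|)]
    nlinarith
  · rw [integral_add j1 j2, integral_add (i0.const_mul _) (ij.const_mul _),
      integral_add (s0.const_mul _) (sj.const_mul _)]
    simp only [integral_const_mul]
    have := mul_le_mul_of_nonneg_left (d1 0) h0
    have := mul_le_mul_of_nonneg_left (d1 j) h0
    linarith [d2 0, d2 j]

lemma StationarySetup.summable_cov (hS : StationarySetup P Y δ) (hQ : IsTail Q)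
    (hM : Mmoment P Y δ Q 2 < ∞) (hf : f ∈ FClass Q (P.map (Y 0))) (hfm : Measurable f) :
    Summable fun j => |cov P (fun k : ℕ => Y k) f j| := by
  have hQ2 := (lintegral_sq_le_Mmoment P Y δ Q).trans_lt hM
  have hfin : Mtrunc P Y δ Q 1 ≠ ∞ :=
    ((Mtrunc_le P Y δ Q 1).trans_lt (ENNReal.mul_lt_top ENNReal.ofReal_lt_top hM)).ne
  refine summable_of_sum_range_le (c := 48 * (Mtrunc P Y δ Q 1).toReal) (fun _ => abs_nonneg _)
    fun N => ?_
  refine (Finset.sum_le_sum fun j _ => hS.abs_cov_le hQ hQ2 hf hfm j).trans ?_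
  rw [← Finset.mul_sum]
  exact mul_le_mul_of_nonneg_left (sum_lowMoment_le_Mtrunc hQ le_rfl hfin N) (by norm_num)

/-- The limit of the normalized variances of the partial sums. -/
def limitVariance (P : Measure Ω) (Y : ℤ → Ω → ℝ) (f : ℝ → ℝ) : ℝ :=
  cov P (fun k : ℕ => Y k) f 0 + 2 * ∑' j, cov P (fun k : ℕ => Y k) f (j + 1)

/-- Converts errors of order σ² into the truncated moment; in particular the cost of the initial
Gaussian perturbation is absorbed in this way. -/
lemma StationarySetup.limitVariance_le (hS : StationarySetup P Y δ) (hQ : IsTail Q)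
    (hM : Mmoment P Y δ Q 2 < ∞) (hf : f ∈ FClass Q (P.map (Y 0))) (hfm : Measurable f)
    {lam : ℝ} (hl : 1 ≤ lam) (hfin : Mtrunc P Y δ Q lam ≠ ∞) :
    limitVariance P Y f ≤ 96 * (Mtrunc P Y δ Q lam).toReal := by
  have hQ2 := (lintegral_sq_le_Mmoment P Y δ Q).trans_lt hM
  have hs := (summable_nat_add_iff 1).2 (hS.summable_cov hQ hM hf hfm).of_abs
  refine le_of_tendsto' (hS.mixSetting.limit_variance hfm
    (by
      have := Measure.isProbabilityMeasure_map (μ := P) (hS.measurable_Y 0).aemeasurable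
      exact memLp_two_of_mem_FClass hQ hQ2 hf hfm) hs).1 fun N => ?_
  have h1 := sum_lowMoment_le_Mtrunc (P := P) (Y := Y) (δ := δ) hQ hl hfin (N + 1)
  rw [Finset.sum_range_succ'] at h1
  have h2 := fun j => (le_abs_self _).trans (hS.abs_cov_le hQ hQ2 hf hfm j)
  have h3 := Finset.sum_le_sum (s := Finset.range N) fun j _ => h2 (j + 1)
  rw [← Finset.mul_sum] at h3
  have h4 := h2 0
  have h5 := lowMoment_nonneg Q (mixRate P Y δ 0)
  linarith

/-- The truncated covariance series of a band is close to the limit variance. -/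
lemma StationarySetup.abs_covSum_sub_le (hS : StationarySetup P Y δ) (hQ : IsTail Q)
    (hM2 : Mmoment P Y δ Q 2 < ∞) (hf : f ∈ FClass Q (P.map (Y 0))) (hfm : Measurable f)
    {lam : ℝ} (hl : 1 ≤ lam) (hfin : Mtrunc P Y δ Q lam ≠ ∞) {m : ℕ} {M v : ℝ}
    (T : IsThreshold P Y δ Q lam (m + 1) M v) {h : ℝ → ℝ} {η : ℝ}
    (hh : ∀ j, |cov P (fun k : ℕ => Y k) f j - cov P (fun k : ℕ => Y k) h j| ≤
      η + 12 * (upperMoment Q M).toReal) :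
    lam * |cov P (fun k : ℕ => Y k) h 0 / 2 +
      ∑ j ∈ Finset.range m, cov P (fun k : ℕ => Y k) h (j + 1) - limitVariance P Y f / 2| ≤
      lam * ((m + 1) * η) + 60 * (Mtrunc P Y δ Q lam).toReal := by
  have hQ2 := (lintegral_sq_le_Mmoment P Y δ Q).trans_lt hM2
  have hsa := hS.summable_cov hQ hM2 hf hfm
  obtain ⟨c, hc⟩ : ∃ c, c = cov P (fun k : ℕ => Y k) f := ⟨_, rfl⟩
  obtain ⟨d, hd⟩ : ∃ d, d = cov P (fun k : ℕ => Y k) h := ⟨_, rfl⟩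
  obtain ⟨U, hU⟩ : ∃ U, U = (upperMoment Q M).toReal := ⟨_, rfl⟩
  have hl0 : 0 < lam := by linarith
  have h1 := T.mul_upperMoment_le hQ2 hl hfin
  -- The neglected tail of the covariance series starts at the threshold lag, where rates are at
  -- most v, so its integrand lives to the left of v.
  have h2 : lam * ∑' j, |c (j + (m + 1))| ≤ 48 * (Mtrunc P Y δ Q lam).toReal := by
    rw [mul_comm, ← le_div_iff₀ hl0]
    refine Real.tsum_le_of_sum_range_le (fun _ => abs_nonneg _) fun N => ?_
    rw [le_div_iff₀ hl0, mul_comm]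
    have h3 := T.mul_sum_lowMoment_le hQ hl hfin N
    have h4 := Finset.sum_le_sum (s := Finset.range N) fun j _ =>
      hS.abs_cov_le hQ hQ2 hf hfm (j + (m + 1))
    rw [← Finset.mul_sum, ← hc] at h4
    have h5 := mul_le_mul_of_nonneg_left h4 hl0.le
    linarith
  rw [← hc] at hsa
  have hs1 : Summable fun j => c (j + 1) := (summable_nat_add_iff 1).2 hsa.of_abs
  have e : limitVariance P Y f / 2 = c 0 / 2 + ∑ j ∈ Finset.range m, c (j + 1) +
      ∑' j, c (j + (m + 1)) := by
    have h3 := hs1.sum_add_tsum_nat_add m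
    have h4 : ∑' j, c (j + m + 1) = ∑' j, c (j + (m + 1)) := rfl
    rw [limitVariance, ← hc, ← h3, ← h4]
    ring
  have h6 : |∑' j, c (j + (m + 1))| ≤ ∑' j, |c (j + (m + 1))| := by
    have := norm_tsum_le_tsum_norm (f := fun j => c (j + (m + 1)))
      ((summable_nat_add_iff (m + 1)).2 hsa)
    simpa only [Real.norm_eq_abs] using this
  rw [← hc, ← hd, ← hU] at hh
  have h7 : |∑ j ∈ Finset.range m, (d (j + 1) - c (j + 1))| ≤ m * (η + 12 * U) := by
    refine (Finset.abs_sum_le_sum_abs _ _).trans ?_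
    refine (Finset.sum_le_sum fun j _ => (abs_sub_comm _ _).trans_le (hh (j + 1))).trans ?_
    rw [Finset.sum_const, Finset.card_range, nsmul_eq_mul]
  have h8 : |(d 0 - c 0) / 2| ≤ η + 12 * U := by
    rw [abs_div, abs_sub_comm, abs_two]
    have := hh 0
    have := abs_nonneg (c 0 - d 0)
    linarith
  rw [← hd, e]
  have e2 : d 0 / 2 + ∑ j ∈ Finset.range m, d (j + 1) - (c 0 / 2 +
      ∑ j ∈ Finset.range m, c (j + 1) + ∑' j, c (j + (m + 1))) =
      (d 0 - c 0) / 2 + ∑ j ∈ Finset.range m, (d (j + 1) - c (j + 1)) -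
        ∑' j, c (j + (m + 1)) := by
    rw [Finset.sum_sub_distrib]; ring
  rw [e2]
  have h9 := (abs_sub ((d 0 - c 0) / 2 + ∑ j ∈ Finset.range m, (d (j + 1) - c (j + 1)))
    (∑' j, c (j + (m + 1)))).trans (add_le_add ((abs_add_le _ _).trans (add_le_add h8 h7)) h6)
  have h10 := mul_le_mul_of_nonneg_left h9 hl0.le
  rw [← hU] at h1
  nlinarith

end ClassCov

/-! ### The rate of convergence -/

section Rate

variable {Ω : Type*} {mΩ : MeasurableSpace Ω} {P : Measure Ω} [IsProbabilityMeasure P]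

namespace MixSetting

variable {Y : ℕ → Ω → ℝ} {ℱ : ℕ → MeasurableSpace Ω} {a : ℕ → ℝ} {φ χ : ℝ → ℝ}

lemma psum_sub (hS : MixSetting P Y ℱ a) (hφ : MemLp φ 2 (P.map (Y 0)))
    (hχ : MemLp χ 2 (P.map (Y 0))) (n : ℕ) (ω : Ω) :
    psum P Y (fun x => φ x - χ x) n ω = psum P Y φ n ω - psum P Y χ n ω := by
  simp only [psum, hS.obs_sub hφ hχ, Finset.sum_sub_distrib]

/-- Cauchy-Schwarz without using mixing. The factor n² is harmless, as the approximation error it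
multiplies can be chosen after n. -/
lemma integral_psum_sq_le_sq_mul (hS : MixSetting P Y ℱ a) (hφm : Measurable φ)
    (hφ : MemLp φ 2 (P.map (Y 0))) (n : ℕ) :
    ∫ ω, psum P Y φ n ω ^ 2 ∂P ≤ n * (n * ∫ x, φ x ^ 2 ∂(P.map (Y 0))) := by
  have hi : ∀ i ∈ Finset.range n, Integrable (fun ω => obs P Y φ (i + 1) ω ^ 2) P := fun i _ =>
    hS.integrable_obs_sq hφ (i + 1)
  calc ∫ ω, psum P Y φ n ω ^ 2 ∂P
      ≤ ∫ ω, (n : ℝ) * ∑ i ∈ Finset.range n, obs P Y φ (i + 1) ω ^ 2 ∂P := by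
        refine integral_mono (hS.integral_psum_sq hφm hφ n).1.integrable_sq
          ((integrable_finsetSum _ hi).const_mul _) fun ω => ?_
        have := sq_sum_le_card_mul_sum_sq (s := Finset.range n) (f := fun i => obs P Y φ (i + 1) ω)
        rwa [Finset.card_range] at this
    _ = n * ∑ i ∈ Finset.range n, ∫ ω, obs P Y φ (i + 1) ω ^ 2 ∂P := by
        rw [integral_const_mul, integral_finsetSum _ hi]
    _ ≤ _ := by
        refine mul_le_mul_of_nonneg_left ?_ (Nat.cast_nonneg n)
        refine (Finset.sum_le_sum fun i _ => hS.integral_obs_sq_le hφm hφ (i + 1)).trans ?_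
        rw [Finset.sum_const, Finset.card_range, nsmul_eq_mul]

end MixSetting

variable {Y δ : ℤ → Ω → ℝ} {Q : ℝ → ℝ≥0∞} {f : ℝ → ℝ}

/-- The third absolute moment of the centred normal law of variance `s`. -/
def gaussCube (s : ℝ) : ℝ := ∫ z, |z| ^ 3 ∂gaussianReal 0 s.toNNReal

lemma gaussCube_nonneg (s : ℝ) : 0 ≤ gaussCube s :=
  integral_nonneg fun _ => pow_nonneg (abs_nonneg _) 3

/-- The constant in the rate of convergence, a function of the limit variance. -/
def rateConst (s : ℝ) : ℝ :=
  2736 + 32 * ((1200 + 192 * (gaussCube s / s)) / √s + 48 * √s + 600)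

lemma rateConst_pos {s : ℝ} (hs : 0 < s) : 0 < rateConst s := by
  have := gaussCube_nonneg s
  unfold rateConst
  positivity

lemma partialSum_eq_psum (n : ℕ) : partialSum P Y f n = psum P (fun k : ℕ => Y k) f n := by
  funext ω
  rw [partialSum, psum, Finset.range_eq_Ico]
  exact (Finset.sum_Ico_add' (fun i : ℕ => Xseq P Y f i ω) 0 n 1).symm

/-- The difference consists of an approximation error, arbitrarily small in mean square, and the
partial sum of the band between M and K. The latter is a model in its own right, and its variance is
at most n times a sum supported to the left of v; with n = lam² one factor lam is consumed. -/
lemma StationarySetup.lintegral_trunc_le (hS : StationarySetup P Y δ) (hQ : IsTail Q)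
    (hM2 : Mmoment P Y δ Q 2 < ∞) (hf : f ∈ FClass Q (P.map (Y 0))) (hfm : Measurable f)
    {lam : ℝ} (hl : 1 ≤ lam) (hfin : Mtrunc P Y δ Q lam ≠ ∞) {q n : ℕ} {M v : ℝ}
    (hn : lam ^ 2 = n) (T : IsThreshold P Y δ Q lam q M v) {K ε : ℝ} (hMK : M ≤ K)
    {L : ℕ} {a : Fin L → ℝ} {g : Fin L → ℝ → ℝ} (ha : ∑ l, |a l| ≤ 1)
    (hg : ∀ l, g l ∈ MonClass Q (P.map (Y 0)))
    (hd : ∫ x, (f x - comb a (band 0 K) g x) ^ 2 ∂(P.map (Y 0)) ≤ ε) :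
    ∫⁻ ω, ENNReal.ofReal ((psum P (fun k : ℕ => Y k) f n ω -
      psum P (fun k : ℕ => Y k) (comb a (band 0 M) g) n ω) ^ 2) ∂P ≤
      ENNReal.ofReal (2 * (n * (n * ε)) + 192 * (lam * (Mtrunc P Y δ Q lam).toReal)) := by
  have := Measure.isProbabilityMeasure_map (μ := P) (hS.measurable_Y 0).aemeasurable
  have hQ2 := (lintegral_sq_le_Mmoment P Y δ Q).trans_lt hM2
  have hf2 := memLp_two_of_mem_FClass hQ hQ2 hf hfm
  have hX := hS.mixSetting
  have HK := hS.model hQ ha hg le_rfl (T.nonneg.trans hMK)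
  have HM := hS.model hQ ha hg le_rfl T.nonneg
  have HD := hS.model hQ ha hg T.nonneg hMK
  have hRm : Measurable fun x => f x - comb a (band 0 K) g x := hfm.sub HK.ctrl.bdd.1
  have hR : MemLp (fun x => f x - comb a (band 0 K) g x) 2 (P.map (Y 0)) := hf2.sub HK.memLp
  obtain ⟨A, hA⟩ : ∃ A, A = psum P (fun k : ℕ => Y k) (fun x => f x - comb a (band 0 K) g x) n :=
    ⟨_, rfl⟩
  obtain ⟨D, hD⟩ : ∃ D, D = psum P (fun k : ℕ => Y k) (comb a (band M K) g) n := ⟨_, rfl⟩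
  have e : ∀ ω, psum P (fun k : ℕ => Y k) f n ω -
      psum P (fun k : ℕ => Y k) (comb a (band 0 M) g) n ω = A ω + D ω := fun ω => by
    have h1 := hX.psum_sub hf2 HK.memLp n ω
    have h2 := hX.psum_sub HK.memLp HM.memLp n ω
    simp only [← comb_band_add] at h2
    rw [hA, hD, h1, show psum P (fun k : ℕ => Y k) (comb a (band M K) g) n ω = _ from h2]
    ring
  have iA : Integrable (fun ω => A ω ^ 2) P := hA ▸ (hX.integral_psum_sq hRm hR n).1.integrable_sq
  have iD : Integrable (fun ω => D ω ^ 2) P := hD ▸ ((HD.bddMeas_psum n).pow 2).integrable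
  have bA : ∫ ω, A ω ^ 2 ∂P ≤ n * (n * ε) := by
    rw [hA]
    refine (hX.integral_psum_sq_le_sq_mul hRm hR n).trans ?_
    gcongr
    exact hd
  have bD : ∫ ω, D ω ^ 2 ∂P ≤ 96 * (lam * (Mtrunc P Y δ Q lam).toReal) := by
    rw [hD]
    refine (HD.integral_psum_sq_le n).trans ?_
    have h1 := T.mul_sum_bandRate_le hQ hMK hl hfin (n + 1)
    rw [← hn]
    have := mul_le_mul_of_nonneg_left h1 (show 0 ≤ 96 * lam by linarith)
    linarith
  calc _ ≤ ∫⁻ ω, ENNReal.ofReal (2 * A ω ^ 2 + 2 * D ω ^ 2) ∂P := by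
        refine lintegral_mono fun ω => ENNReal.ofReal_le_ofReal ?_
        rw [e]; nlinarith [sq_nonneg (A ω - D ω)]
    _ = ENNReal.ofReal (∫ ω, (2 * A ω ^ 2 + 2 * D ω ^ 2) ∂P) :=
        (ofReal_integral_eq_lintegral_ofReal ((iA.const_mul 2).add (iD.const_mul 2))
          (ae_of_all _ fun ω => add_nonneg (by positivity) (by positivity))).symm
    _ ≤ _ := by
        rw [integral_add (iA.const_mul 2) (iD.const_mul 2), integral_const_mul, integral_const_mul]
        exact ENNReal.ofReal_le_ofReal (by linarith)

/-- The first part uses mM ≤ lam, the second n = lam² with one factor lam absorbed by the sum of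
rates beyond the cut. -/
lemma meanErr_le {lam : ℝ} (hl : 1 ≤ lam) (hQ : IsTail Q) (hfin : Mtrunc P Y δ Q lam ≠ ∞)
    {m n : ℕ} {M v : ℝ} (hn : lam ^ 2 = n) (T : IsThreshold P Y δ Q lam (m + 1) M v) :
    Model.meanErr (bandRate Q 0 M) (mixRate P Y δ) M m n ≤
      96 * (lam * (Mtrunc P Y δ Q lam).toReal) := by
  have h1 := T.sum_partMoment_one_le hQ hl hfin n
  have h2 := T.sum_mixRate_le hQ hl hfin n
  have h3 : 0 ≤ ∑ k ∈ Finset.range n, partMoment (bandRate Q 0 M) 1 (mixRate P Y δ (k + 1)) :=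
    Finset.sum_nonneg fun k _ => (isRate_bandRate hQ le_rfl T.nonneg).partMoment_nonneg _ _
  have h4 : m * M ≤ lam := by
    have := T.mul_le
    push_cast at this
    linarith [T.nonneg]
  have h5 := mul_le_mul h4 h1 h3 (by linarith)
  have h6 := mul_le_mul_of_nonneg_left h2 (show 0 ≤ lam by linarith)
  unfold Model.meanErr
  rw [← hn]
  nlinarith

/-- The Gaussian third moment is not proportional to the truncated moment. It is written as
(moment/s) · s and s is bounded by 96 times the truncated moment, so the ratio enters the constant.
-/
lemma lindErr_le {lam : ℝ} (hl : 1 ≤ lam) (hQ : IsTail Q) (hfin : Mtrunc P Y δ Q lam ≠ ∞)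
    {m n : ℕ} {M v : ℝ} (hn : lam ^ 2 = n) (T : IsThreshold P Y δ Q lam (m + 1) M v)
    {s E : ℝ} (hs : 0 < s) (hsk : s ≤ 96 * (Mtrunc P Y δ Q lam).toReal)
    (hE : lam * E ≤ 156 * (Mtrunc P Y δ Q lam).toReal) :
    Model.lindErr (bandRate Q 0 M) (mixRate P Y δ) M m n s E ≤
      ((1200 + 192 * (gaussCube s / s)) / √s + 16 * √s + 492) *
        (lam * (Mtrunc P Y δ Q lam).toReal) := by
  obtain ⟨k3, hk⟩ : ∃ k, k = (Mtrunc P Y δ Q lam).toReal := ⟨_, rfl⟩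
  have hl0 : 0 < lam := by linarith
  have hsq : √(n : ℝ) = lam := by rw [← hn, Real.sqrt_sq hl0.le]
  have h0 := T.sum_rowSum_le hQ hfin
  have h1 := T.sum_partMoment_one_le hQ hl hfin n
  have h2 := T.sum_mixRate_le hQ hl hfin n
  have h3 := T.mul_mixRate_le hQ hl hfin
  have h4 := T.mul_sum_partMoment_two_le hQ hl hfin
  rw [← hk] at hsk hE h0 h1 h2 h3 h4 ⊢
  have hκ := Real.sqrt_pos.2 hs
  have hG := gaussCube_nonneg s
  have g1 : gaussCube s ≤ 96 * (gaussCube s / s) * k3 := by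
    have := mul_le_mul_of_nonneg_left hsk (div_nonneg hG hs.le)
    rw [div_mul_cancel₀ _ hs.ne'] at this
    linarith
  have b1 : 2 * lam / √s * (600 * ∑ j ∈ Finset.range (m + 1),
      Model.rowSum (bandRate Q 0 M) (mixRate P Y δ) m j + gaussCube s) ≤
      (1200 + 192 * (gaussCube s / s)) / √s * (lam * k3) := by
    calc _ ≤ 2 * lam / √s * (600 * k3 + 96 * (gaussCube s / s) * k3) := by gcongr
      _ = _ := by ring
  have b2 := mul_le_mul_of_nonneg_left h1 (show 0 ≤ lam * √s by positivity)
  have b3 := mul_le_mul_of_nonneg_left h2 hl0.le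
  have b4 := mul_le_mul_of_nonneg_left h3 hl0.le
  have b5 := mul_le_mul_of_nonneg_left hE hl0.le
  unfold Model.lindErr
  rw [hsq, ← hn, ← gaussCube]
  linarith

/-- The rate of convergence for measurable functions of the class. -/
theorem StationarySetup.lintegral_W2sq_le (hS : StationarySetup P Y δ) (hQ : IsTail Q)
    (hM2 : Mmoment P Y δ Q 2 < ∞) (hf : f ∈ FClass Q (P.map (Y 0))) (hfm : Measurable f)
    (hs : 0 < limitVariance P Y f) {n : ℕ} (hn : 0 < n) :
    ∫⁻ ω, W2sq (condLaw P (past Y δ 0) (partialSum P Y f n) ω)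
      (gaussianReal 0 (Real.toNNReal (n * limitVariance P Y f))) ∂P ≤
      ENNReal.ofReal (rateConst (limitVariance P Y f) * √n) * Mtrunc P Y δ Q √n := by
  have := Measure.isProbabilityMeasure_map (μ := P) (hS.measurable_Y 0).aemeasurable
  have hn1 : (1 : ℝ) ≤ n := by exact_mod_cast hn
  obtain ⟨lam, hlam⟩ : ∃ lam, lam = √(n : ℝ) := ⟨_, rfl⟩
  have hl : 1 ≤ lam := hlam ▸ Real.one_le_sqrt.2 hn1
  have hln : lam ^ 2 = n := by rw [hlam, Real.sq_sqrt (by linarith)]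
  have hl0 : 0 < lam := by linarith
  have hfin : Mtrunc P Y δ Q lam ≠ ∞ :=
    ((Mtrunc_le P Y δ Q lam).trans_lt (ENNReal.mul_lt_top ENNReal.ofReal_lt_top hM2)).ne
  have hQ2 := (lintegral_sq_le_Mmoment P Y δ Q).trans_lt hM2
  have hf2 := memLp_two_of_mem_FClass hQ hQ2 hf hfm
  have hsk := hS.limitVariance_le hQ hM2 hf hfm hl hfin
  obtain ⟨s, hse⟩ : ∃ s, s = limitVariance P Y f := ⟨_, rfl⟩
  obtain ⟨k3, hk⟩ : ∃ k, k = (Mtrunc P Y δ Q lam).toReal := ⟨_, rfl⟩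
  obtain ⟨q, M, v, T⟩ := exists_isThreshold (P := P) (Y := Y) (δ := δ) hQ hl
  obtain ⟨m, rfl⟩ : ∃ m, q = m + 1 := ⟨q - 1, by have := T.one_le; omega⟩
  rw [← hse] at hs hsk
  -- The m + 1 covariances involved then err by s/n in total, and lam · s/n ≤ s. Together with the
  -- 60 of the covariance series this gives 156 = 96 + 60.
  have hη : 0 < s / (n * (m + 1)) := by positivity
  obtain ⟨ε, hε, hcov⟩ := hS.mixSetting.exists_abs_cov_sub_cov_le hfm hf2 hη
  -- The mean square error meets two demands: closeness of covariances, and at most s/n², so that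
  -- the crude n² bound for partial sums leaves only s.
  obtain ⟨K, L, a, g, -, hMK, ha, hg, hd⟩ := exists_comb_near hQ hQ2 hf hfm M
    (lt_min hε (show 0 < s / n ^ 2 by positivity))
  have HK := hS.model hQ ha hg le_rfl (T.nonneg.trans hMK)
  have HM := hS.model hQ ha hg le_rfl T.nonneg
  have hE := hS.abs_covSum_sub_le hQ hM2 hf hfm hl hfin T (h := comb a (band 0 M) g)
    (η := s / (n * (m + 1))) fun j => (abs_sub_le _ _ _).trans (add_le_add
      (hcov _ HK.ctrl.bdd.1 HK.memLp (hd.trans (min_le_left _ _)) j)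
      (hS.abs_cov_band_sub_le hQ hQ2 ha hg T.nonneg hMK j))
  have htr := hS.lintegral_trunc_le hQ hM2 hf hfm hl hfin hln T hMK ha hg
    (hd.trans (min_le_right _ _))
  have hs0 : s.toNNReal ≠ 0 := (Real.toNNReal_pos.2 hs).ne'
  have hTm : Measurable (partialSum P Y f n) := by
    rw [partialSum_eq_psum]
    exact Finset.measurable_fun_sum _ fun i _ => (hfm.comp (hS.measurable_Y _)).sub_const _
  -- The conditioning variable is the identity from Ω to Ω with the past σ-algebra, which is how the
  -- conditional law is defined.
  have main := @Model.lintegral_W2sq_condDistrib_le Ω mΩ P _ _ _ _ _ _ _ Ω (past Y δ 0) id HM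
    measurable_id _ hTm _ hs0 m n
  have hmean := meanErr_le hl hQ hfin hln T
  rw [← hse] at hE
  rw [← hk] at hsk hE htr hmean
  have hk0 : 0 ≤ k3 := hk ▸ ENNReal.toReal_nonneg
  have hsc : (s.toNNReal : ℝ) = s := Real.coe_toNNReal s hs.le
  rw [hsc] at main
  obtain ⟨E, hEE⟩ : ∃ E, E = |cov P (fun k : ℕ => Y k) (comb a (band 0 M) g) 0 / 2 +
    ∑ j ∈ Finset.range m, cov P (fun k : ℕ => Y k) (comb a (band 0 M) g) (j + 1) - s / 2| :=
    ⟨_, rfl⟩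
  rw [← hEE] at hE main
  have hm0 : (0 : ℝ) < m + 1 := by positivity
  have hE2 : lam * E ≤ 156 * k3 := by
    refine hE.trans ?_
    have : lam * ((m + 1) * (s / (n * (m + 1)))) ≤ s := by
      have e1 : lam * ((m + 1) * (s / (n * (m + 1)))) = lam * s / n := by field_simp
      rw [e1, div_le_iff₀ (by linarith), ← hln]
      nlinarith [mul_nonneg (mul_nonneg hs.le hl0.le) (sub_nonneg.2 hl)]
    linarith
  have hlind := lindErr_le hl hQ hfin hln T hs (hk ▸ hsk) (hk ▸ hE2)
  rw [← hk] at hlind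
  have h1 := T.sum_partMoment_one_le hQ hl hfin n
  rw [← hk] at h1
  have hlk : k3 ≤ lam * k3 := le_mul_of_one_le_left hk0 hl
  have hκ := Real.sqrt_pos.2 hs
  have hroot : √((n + 1 : ℕ) * s) ≤ 2 * (lam * √s) := by
    refine Real.sqrt_le_iff.2 ⟨by positivity, ?_⟩
    rw [mul_pow, mul_pow, hln, Real.sq_sqrt hs.le]
    push_cast
    nlinarith
  have hβ := mul_le_mul hroot h1 (Finset.sum_nonneg fun k _ =>
    HM.rate.partMoment_nonneg _ _) (by positivity)
  have htr2 : 2 * ((n : ℝ) * (n * (s / n ^ 2))) + 192 * (lam * k3) ≤ 384 * (lam * k3) := by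
    have : (n : ℝ) * (n * (s / n ^ 2)) = s := by field_simp
    rw [this]; linarith
  have eM : Mtrunc P Y δ Q lam = ENNReal.ofReal k3 := by rw [hk, ENNReal.ofReal_toReal hfin]
  have eg : Real.toNNReal (n * s) = n * s.toNNReal := by
    rw [Real.toNNReal_mul (Nat.cast_nonneg n), Real.toNNReal_natCast]
  rw [← hse, ← hlam, eM, eg]
  refine main.trans ?_
  rw [partialSum_eq_psum]
  have hlk0 : 0 ≤ lam * k3 := by positivity
  have hG := gaussCube_nonneg s
  -- The plain terms add up to 4 · 384 + 4 · 96 + 8 · 96 = 2688, and inside the factor 32 the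
  -- Lindeberg, first moment and mean errors give 48√s and 588; `rateConst` leaves a little room.
  calc _ ≤ 4 * ENNReal.ofReal (384 * (lam * k3)) + 32 * ENNReal.ofReal
        (((1200 + 192 * (gaussCube s / s)) / √s + 16 * √s + 492) * (lam * k3) +
          (16 * (2 * (lam * √s) * k3) + 96 * (lam * k3))) +
        (4 * ENNReal.ofReal (96 * (lam * k3)) + 8 * ENNReal.ofReal (96 * (lam * k3))) := by
        refine add_le_add (add_le_add (mul_le_mul_right (htr.trans
          (ENNReal.ofReal_le_ofReal htr2)) 4) (mul_le_mul_right (ENNReal.ofReal_le_ofReal ?_) 32))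
          (add_le_add (mul_le_mul_right (ENNReal.ofReal_le_ofReal hmean) 4)
            (mul_le_mul_right (ENNReal.ofReal_le_ofReal (hsk.trans ?_)) 8))
        · linarith
        · linarith
    _ = ENNReal.ofReal (4 * (384 * (lam * k3)) + 32 *
        (((1200 + 192 * (gaussCube s / s)) / √s + 16 * √s + 492) * (lam * k3) +
          (16 * (2 * (lam * √s) * k3) + 96 * (lam * k3))) +
        (4 * (96 * (lam * k3)) + 8 * (96 * (lam * k3)))) := by
        rw [show (4 : ℝ≥0∞) = ENNReal.ofReal 4 by norm_num,
          show (32 : ℝ≥0∞) = ENNReal.ofReal 32 by norm_num,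
          show (8 : ℝ≥0∞) = ENNReal.ofReal 8 by norm_num,
          ← ENNReal.ofReal_mul (by norm_num), ← ENNReal.ofReal_mul (by norm_num),
          ← ENNReal.ofReal_mul (by norm_num), ← ENNReal.ofReal_mul (by norm_num),
          ← ENNReal.ofReal_add (by positivity) (by positivity),
          ← ENNReal.ofReal_add (by positivity) (by positivity),
          ← ENNReal.ofReal_add (by positivity) (by positivity)]
    _ ≤ _ := by
        have := rateConst_pos hs
        rw [← ENNReal.ofReal_mul (by positivity)]
        refine ENNReal.ofReal_le_ofReal ?_
        unfold rateConst
        linarith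

end Rate

/-! ### Reduction to measurable functions and globally monotone quantile functions -/

section Reduction

variable {Q Q' : ℝ → ℝ≥0∞}

/-- By monotonicity w · Q(w) is at most the integral of Q over (0, w), which forces finiteness at
every positive point. -/
lemma isTail_upperQuantile {ν : Measure ℝ}
    (h : ∫⁻ u in Ioo (0 : ℝ) 1, upperQuantile ν id u < ∞) : IsTail (upperQuantile ν id) := by
  refine ⟨upperQuantile_antitone ν id, fun u hu => ?_⟩
  obtain ⟨w, hw⟩ : ∃ w, w = min u (1 / 2) := ⟨_, rfl⟩
  have hw0 : 0 < w := hw ▸ lt_min hu (by norm_num)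
  have hw1 : w ≤ 1 := hw ▸ (min_le_right _ _).trans (by norm_num)
  refine (upperQuantile_antitone ν id (hw ▸ min_le_left u (1 / 2))).trans_lt ?_
  have h1 : upperQuantile ν id w * ENNReal.ofReal w < ∞ := by
    refine lt_of_le_of_lt ?_ h
    calc upperQuantile ν id w * ENNReal.ofReal w = ∫⁻ _ in Ioo (0 : ℝ) w, upperQuantile ν id w := by
          rw [setLIntegral_const, Real.volume_Ioo, sub_zero]
      _ ≤ ∫⁻ u in Ioo (0 : ℝ) w, upperQuantile ν id u :=
          setLIntegral_mono' measurableSet_Ioo fun u hu => upperQuantile_antitone ν id hu.2.le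
      _ ≤ _ := lintegral_mono_set (Ioo_subset_Ioo_right hw1)
  exact (ENNReal.lt_top_of_mul_ne_top_left h1.ne (ENNReal.ofReal_pos.2 hw0).ne')

lemma FClass_congr (h : ∀ u ∈ Icc (0 : ℝ) 1, Q u = Q' u) (μ : Measure ℝ) :
    FClass Q μ = FClass Q' μ := by
  have h1 : MonClass Q μ = MonClass Q' μ := by
    ext g
    exact and_congr_right fun _ => forall₂_congr fun u hu => by rw [h u hu]
  simp only [FClass, MonCombinations, h1]

lemma mem_FClass_of_ae_eq {μ : Measure ℝ} {f f' : ℝ → ℝ} (hf : f ∈ FClass Q μ) (h : f =ᵐ[μ] f') :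
    f' ∈ FClass Q μ := by
  refine ⟨hf.1.congr h, fun ε hε => ?_⟩
  obtain ⟨g, hg, hlt⟩ := hf.2 ε hε
  refine ⟨g, hg, lt_of_eq_of_lt (lintegral_congr_ae ?_) hlt⟩
  filter_upwards [h] with x hx
  rw [hx]

variable {Ω : Type*} {mΩ : MeasurableSpace Ω} {P : Measure Ω} {Y δ : ℤ → Ω → ℝ}

lemma Rfun_congr (h : ∀ u ∈ Icc (0 : ℝ) 1, Q u = Q' u) {u : ℝ} (hu : u ∈ Ioo (0 : ℝ) 1) :
    Rfun P Y δ Q u = Rfun P Y δ Q' u := by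
  unfold Rfun
  rw [h u (Ioo_subset_Icc_self hu)]

lemma Mmoment_congr (h : ∀ u ∈ Icc (0 : ℝ) 1, Q u = Q' u) (p : ℝ) :
    Mmoment P Y δ Q p = Mmoment P Y δ Q' p :=
  setLIntegral_congr_fun measurableSet_Ioo fun u hu => by
    simp only [Rfun_congr h hu, h u (Ioo_subset_Icc_self hu)]

lemma Mtrunc_congr (h : ∀ u ∈ Icc (0 : ℝ) 1, Q u = Q' u) (lam : ℝ) :
    Mtrunc P Y δ Q lam = Mtrunc P Y δ Q' lam :=
  setLIntegral_congr_fun measurableSet_Ioo fun u hu => by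
    simp only [Rfun_congr h hu, h u (Ioo_subset_Icc_self hu)]

variable [IsProbabilityMeasure P]

/-- All Y_k have the law of Y_0, so an equality almost everywhere for that law holds along the whole
sequence. -/
lemma StationarySetup.Xseq_ae_eq (hS : StationarySetup P Y δ) {f f' : ℝ → ℝ}
    (h : f =ᵐ[P.map (Y 0)] f') (k : ℕ) : Xseq P Y f k =ᵐ[P] Xseq P Y f' k := by
  have h1 : (fun ω => f (Y k ω)) =ᵐ[P] fun ω => f' (Y k ω) := by
    have e : P.map (Y k) = P.map (Y 0) := hS.mixSetting.map_eq k
    rw [← e] at h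
    exact ae_of_ae_map (hS.measurable_Y k).aemeasurable h
  have h2 := integral_congr_ae h1
  filter_upwards [h1] with ω hω
  simp only [Xseq, centered, hω, h2]

lemma covPartialSum_eq (f : ℝ → ℝ) (N : ℕ) : covPartialSum P Y f N =
    cov P (fun k : ℕ => Y k) f 0 + 2 * ∑ j ∈ Finset.range N, cov P (fun k : ℕ => Y k) f (j + 1) := by
  rw [covPartialSum, Finset.range_eq_Ico,
    Finset.sum_Ico_add' (fun j : ℕ => cov P (fun k : ℕ => Y k) f j) 0 N 1]
  simp only [sq]
  rfl

lemma StationarySetup.covPartialSum_congr (hS : StationarySetup P Y δ) {f f' : ℝ → ℝ}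
    (h : f =ᵐ[P.map (Y 0)] f') : covPartialSum P Y f = covPartialSum P Y f' := by
  funext N
  have h0 := hS.Xseq_ae_eq h 0
  have e : ∀ k : ℕ, ∫ ω, Xseq P Y f 0 ω * Xseq P Y f k ω ∂P =
      ∫ ω, Xseq P Y f' 0 ω * Xseq P Y f' k ω ∂P := fun k => by
    refine integral_congr_ae ?_
    filter_upwards [h0, hS.Xseq_ae_eq h k] with ω h1 h2
    rw [show Xseq P Y f 0 ω = Xseq P Y f' 0 ω from h1, h2]
  have e0 : ∫ ω, Xseq P Y f 0 ω ^ 2 ∂P = ∫ ω, Xseq P Y f' 0 ω ^ 2 ∂P := by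
    simp only [sq]
    exact e 0
  simp only [covPartialSum, e, e0]

lemma StationarySetup.condLaw_congr (hS : StationarySetup P Y δ) {f f' : ℝ → ℝ}
    (h : f =ᵐ[P.map (Y 0)] f') (F : MeasurableSpace Ω) (n : ℕ) :
    condLaw P F (partialSum P Y f n) = condLaw P F (partialSum P Y f' n) := by
  have : partialSum P Y f n =ᵐ[P] partialSum P Y f' n := by
    have h1 : ∀ᵐ ω ∂P, ∀ k : ℕ, Xseq P Y f k ω = Xseq P Y f' k ω :=
      ae_all_iff.2 fun k => hS.Xseq_ae_eq h k
    filter_upwards [h1] with ω hω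
    simp only [partialSum, hω]
  funext ω
  rw [condLaw, condLaw, condDistrib_congr_left this]

end Reduction

end WeakDep

end

theorem mainTheorem4 :
    ∃ C : ℝ → ℝ, (∀ s : ℝ, 0 < s → 0 < C s) ∧
      ∀ (Ω : Type*) (mΩ : MeasurableSpace Ω) (P : Measure Ω) (_ : IsProbabilityMeasure P)
        (Y δ : ℤ → Ω → ℝ) (Q : ℝ → ℝ≥0∞) (f : ℝ → ℝ),
        WeakDep.StationarySetup P Y δ →
        WeakDep.IsIntegrableQuantile Q →
        f ∈ WeakDep.FClass Q (P.map (Y 0)) →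
        WeakDep.Mmoment P Y δ Q 2 < ∞ →
        (∀ k : ℕ, Integrable
          (fun ω => WeakDep.Xseq P Y f 0 ω * WeakDep.Xseq P Y f (k : ℤ) ω) P) ∧
        ∃ σ2 : ℝ, 0 ≤ σ2 ∧
          Tendsto (WeakDep.covPartialSum P Y f) atTop (𝓝 σ2) ∧
          (0 < σ2 → ∀ n : ℕ, 0 < n →
            ∫⁻ ω, WeakDep.W2sq
                (WeakDep.condLaw P (WeakDep.past Y δ 0) (WeakDep.partialSum P Y f n) ω)
                (gaussianReal 0 (Real.toNNReal (n * σ2))) ∂P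
              ≤ ENNReal.ofReal (C σ2 * Real.sqrt n)
                  * WeakDep.Mtrunc P Y δ Q (Real.sqrt n)) := by

  refine ⟨WeakDep.rateConst, fun s => WeakDep.rateConst_pos, ?_⟩
  intro Ω mΩ P hP Y δ Q f hS hQ hf hM
  obtain ⟨⟨ν, -, -, hQν⟩, hint⟩ := hQ
  -- Q is prescribed on [0,1] only. It is replaced by the quantile function of ν, which is
  -- nonincreasing on the whole line and agrees with Q there.
  have hint' : ∫⁻ u in Ioo (0 : ℝ) 1, WeakDep.upperQuantile ν id u < ∞ := by
    rwa [← setLIntegral_congr_fun measurableSet_Ioo fun u hu => hQν u (Ioo_subset_Icc_self hu)]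
  have hT := WeakDep.isTail_upperQuantile hint'
  rw [WeakDep.FClass_congr hQν] at hf
  rw [WeakDep.Mmoment_congr hQν] at hM
  -- An element of the class is only almost everywhere measurable for the law of Y_0. A measurable
  -- representative changes neither the covariances nor the conditional laws.
  obtain ⟨f', hf'm, hff'⟩ : ∃ f', Measurable f' ∧ f =ᵐ[P.map (Y 0)] f' :=
    ⟨_, hf.1.1.stronglyMeasurable_mk.measurable, hf.1.1.ae_eq_mk⟩
  have hf' := WeakDep.mem_FClass_of_ae_eq hf hff'
  have hμ := Measure.isProbabilityMeasure_map (μ := P) (hS.measurable_Y 0).aemeasurable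
  have hQ2 := (WeakDep.lintegral_sq_le_Mmoment P Y δ _).trans_lt hM
  have hf2 := WeakDep.memLp_two_of_mem_FClass hT hQ2 hf' hf'm
  have hlim := hS.mixSetting.limit_variance hf'm hf2
    ((summable_nat_add_iff 1).2 (hS.summable_cov hT hM hf' hf'm).of_abs)
  refine ⟨fun k => ?_, WeakDep.limitVariance P Y f', hlim.2, ?_, fun hs n hn => ?_⟩
  · refine (hS.mixSetting.integrable_obs_mul hf2 hf2 0 k).congr ?_
    filter_upwards [hS.Xseq_ae_eq hff' 0, hS.Xseq_ae_eq hff' k] with ω h0 hk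
    rw [hk, show WeakDep.Xseq P Y f 0 ω = WeakDep.Xseq P Y f' 0 ω from h0]
    rfl
  · rw [hS.covPartialSum_congr hff']
    exact hlim.1.congr fun N => (WeakDep.covPartialSum_eq f' N).symm
  · rw [hS.condLaw_congr hff', WeakDep.Mtrunc_congr hQν]
    exact hS.lintegral_W2sq_le hT hM hf' hf'm hs hn
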